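/- Let $k$ be a field of characteristic zero. For a finite-dimensional vector space $V$, let $\operatorname{Det}(V)=\Lambda^{\dim V}V$, and $\operatorname{Det}(S)=\operatorname{Det}(k^S)$ for a finite set $S$. **Twisted modular $\operatorname{Det}$-operads.** A modular operad $\mathcal P$ twisted by the cocycle $G\mapsto\operatorname{Det}(H_1(G))$ has complexes $\mathcal P((I,b))$ ($I$ a finite set, $b\ge 0$), functorial under bijections of $I$; its compositions are generated by those along graphs with one edge: $\mathcal P((I\sqcup\{f\},b))\otimes\mathcal P((J\sqcup\{f'\},b'))\to\mathcal P((I\sqcup J,b+b'))$, and the loop composition $\mu(e_{ff'}\otimes-):\mathcal P((I\sqcup\{f,f'\},b))\to\mathcal P((I,b+1))$, where $e_{ff'}$ is the generator of $\operatorname{Det}(H_1)$ given by the loop oriented from $f$ to $f'$. A morphism is a family of degree $0$ linear maps $\mathcal P((I,b))\to\mathcal Q((I,b))$ that commutes with bijections, with these compositions and with the differentials. **The operad $\mathbb S[t]$.** $\mathbb S[t]((I,b))$ is spanned by the elements $(\sigma,a)t^g$, where $\sigma$ is a permutation of $I$ with $i_\sigma$ cycles, $a\in\operatorname{Det}(\{\text{cycles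 of }\sigma\})$, $2g+i_\sigma-1=b$ and $2b+|I|>2$. It is concentrated in degree $-b$, with zero differential; bijections act by conjugation. Let $\pi$ denote the erasing of $f,f'$ from the cycles of a permutation, and read a composition as $0$ whenever a cycle becomes empty. Ordering the cycles so that those containing $f$ and $f'$ come first, the compositions are: * two vertices, with $f\in\sigma_1$ and $f'\in\rho_1$: $(\sigma,\sigma_1\wedge A)t^g\otimes(\rho,\rho_1\wedge B)t^{h}\mapsto(\pi(\sigma\rho(ff')),\ \pi(\sigma_1\rho_1(ff'))\wedge A\wedge B)\,t^{g+h}$; * loop, with $f\in\sigma_1$ and $f'\in\sigma_2$ in different cycles: $(\sigma,\sigma_1\wedge\sigma_2\wedge A)t^g\mapsto(\pi(\sigma(ff')),\ \pi(\sigma_1\sigma_2(ff'))\wedge A)\,t^{g+1}$; * loop, with $f,f'\in\sigma_1$: $(\sigma,\sigma_1\wedge A)t^g\mapsto(\pi(\sigma(ff')),\ \pi\sigma_1^f\wedge\pi\sigma_1^{f'}\wedge A)\,t^g$, where $\sigma_1^f,\sigma_1^{f'}$ are the cycles of $\sigma_1(ff')$ through $f$ and $f'$. **Ribbon graphs.**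 A ribbon graph $G$ with legs marked by $I$ is a non-empty finite set of flags with a permutation $s$ (whose cycles, all of length $n(v)\ge3$, are the vertices $v$) and an involution $\iota$ (whose $2$-cycles are the edges, and whose fixed points are the legs, identified with $I$), such that $G$ is connected. Put $b(G)=\dim H_1(G)$. The punctures of $G$ are the cycles of $s\iota$, $\nu$ is their number, and the genus $\gamma$ is given by $2\gamma+\nu=b(G)+1$. A leg is adjacent to the puncture to which its flag belongs; $\sigma_G$ is the permutation of the legs obtained by erasing from the cycles of $s\iota$ the flags that are not legs. **The operad $\chi_0^{-1}\mathcal F\mathcal Ass$**, the twist of the Feynman transform of the cyclic operad $\mathcal Ass$. Its component $((I,b))$ consists of the linear combinations of pairs $(G,\hat\alpha)$, modulo isomorphisms of $G$, where $G$ is a ribbon graph with legs marked by $I$, $b(G)=b$ and $\hat\alpha\in\operatorname{Det}(H_1(G))\otimes\bigotimes_v\operatorname{Det}(\{v\}\sqcup \operatorname{Leg}(v))$, where $\operatorname{Leg}(v)$ is the set of flags at $v$. (The last factors are the lines $\operatorname{Det}(\operatorname{Leg}(v))[-3]$ up to an even shift.) Equivalently, $\hat\alpha\in\operatorname{Det}(H_1(G)\oplus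 k^{\mathrm{Flag}(G)}\oplus k^{\mathrm{Vert}(G)})$. The degree is $\sum_v(n(v)-3)-b$. The loop composition glues the legs $f,f'$ to an edge and maps $\hat\alpha$ to $\tilde e\wedge\hat\alpha$, where $\tilde e\in H_1$ is any class in which the new edge, oriented from $f$ to $f'$, has coefficient $1$. The two-vertex composition glues $f$ and $f'$ to an edge and multiplies $\hat\alpha$ and $\hat\alpha'$. The differential is the sum over all graphs $\tilde G$ in which a vertex of $G$ is replaced by two vertices $v',v''$ joined by a new edge with flags $e'$ at $v'$ and $e''$ at $v''$, of $(\tilde G,\ v'\wedge e'\wedge e''\wedge\hat\alpha)$; here $H_1(\tilde G)= H_1(G)$, and a function on $\mathrm{Vert}(G)$ is pulled back to $\mathrm{Vert}(\tilde G)$. **The canonical orientations.** Let $G$ be trivalent, with at least one leg adjacent to every puncture. Let $C_1,\dots,C_\nu$ be the punctures, $\bar C_j$ the set of legs adjacent to $C_j$ (so that the $\bar C_j$ are the cycles of $\sigma_G$), and $[C_j]=\sum_{f\in C_j}f\in H_1(G)$ the boundary classes, where a flag $f$ of an edge stands for this edge oriented away from the vertex of $f$, and a leg for $0$. The exact sequence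 $0\to k\to k^{\{C_1,\dots,C_\nu\}}\to H_1(G)\to H_1(\Sigma)\to0$, where $\Sigma$ is the closed surface of genus $\gamma$ of $G$, gives the isomorphism $\operatorname{Det}(H_1(G))\simeq\operatorname{Det}(\{\text{cycles of }\sigma_G\})[2\gamma-1]$ under which $$\alpha_G=[C_1]\wedge\dots\wedge[C_{\nu-1}]\wedge\textstyle\bigwedge_{i=1}^{\gamma}(a_i\wedge b_i)\quad\text{corresponds to}\quad\alpha_{\sigma_G}=\bar C_1\wedge\dots\wedge\bar C_\nu ,$$ where $a_i,b_i\in H_1(G)$ satisfy $a_i\cdot b_j=\delta_{ij}$ and $a_i\cdot a_j=b_i\cdot b_j=0$ for the intersection form of the surface, $x\cdot y=\frac12\sum_v\sum_{i<j}(x_{v,i}y_{v,j}-x_{v,j}y_{v,i})$; here $x_{v,1},\dots,x_{v,n(v)}$ are the coefficients of $x$ at the flags of $v$ in their cyclic order, oriented away from $v$. Let $\hat\alpha_G^{can}$ be the product of $\alpha_G$ and of the elements $v\wedge f\wedge s(f)\wedge s^2(f)$ for all the vertices $v$, where $f$ is any flag of $v$. **Proposition.** There is one and only one morphism of twisted modular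 $\operatorname{Det}$-operads $\varphi:\chi_0^{-1}\mathcal F\mathcal Ass\to\mathbb S[t]$ such that * $\varphi(G,\hat\alpha_G^{can})=(\sigma_G,\alpha_{\sigma_G})\,t^{\gamma}$ for every trivalent ribbon graph $G$ for which there is at least one leg adjacent to every puncture, and for all choices in the definition of $\hat\alpha_G^{can}$ and $\alpha_{\sigma_G}$; * $\varphi(G,\hat\alpha)=0$ for all other ribbon graphs $G$ and all $\hat\alpha$. That is, these formulas give a well defined map $\varphi$, and it is a morphism of twisted modular $\operatorname{Det}$-operads. -/

import Mathlib

noncomputable section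

namespace RibbonOperad

open Equiv Module
open scoped Classical

universe u v w

/-! ### Cycles of permutations and erasing elements from cycles -/

section Permutations

variable {X I : Type}

/-- The underlying set of the cycle of the permutation `τ` through `x` (fixed points are cycles
of length one). -/
def cyc (τ : Perm X) (x : X) : Set X := {y | τ.SameCycle x y}

/-- `L` is an enumeration, without repetition, of all the cycles of `τ`. -/
def IsCycleList (τ : Perm X) (L : List (Set X)) : Prop :=
  L.Nodup ∧ ∀ C, C ∈ L ↔ ∃ x, C = cyc τ x

theorem mem_cyc_self (τ : Perm X) (x : X) : x ∈ cyc τ x := Perm.SameCycle.refl _ _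

theorem cyc_eq_iff {τ : Perm X} {x y : X} : cyc τ x = cyc τ y ↔ τ.SameCycle x y := by
  constructor
  · intro h
    have : y ∈ cyc τ x := h ▸ mem_cyc_self τ y
    exact this
  · intro h
    ext z
    exact ⟨fun hz => h.symm.trans hz, fun hz => h.trans hz⟩

theorem exists_return [Finite X] (l : I ↪ X) (τ : Perm X) (i : I) :
    ∃ n : ℕ, ∃ j, (τ ^ (n + 1)) (l i) = l j := by
  refine ⟨orderOf τ - 1, i, ?_⟩
  rw [Nat.sub_add_cancel (orderOf_pos τ), pow_orderOf_eq_one]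
  rfl

/-- One less than the first positive time at which the `τ`-orbit of `l i` returns to the range
of `l`. -/
def returnTime [Finite X] (l : I ↪ X) (τ : Perm X) (i : I) : ℕ := Nat.find (exists_return l τ i)

/-- The first element of the range of `l` met by the `τ`-orbit of `l i` after `l i`. -/
def returnMap [Finite X] (l : I ↪ X) (τ : Perm X) (i : I) : I :=
  Classical.choose (Nat.find_spec (exists_return l τ i))

theorem returnMap_spec [Finite X] (l : I ↪ X) (τ : Perm X) (i : I) :
    (τ ^ (returnTime l τ i + 1)) (l i) = l (returnMap l τ i) :=
  Classical.choose_spec (Nat.find_spec (exists_return l τ i))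

theorem returnTime_le [Finite X] {l : I ↪ X} {τ : Perm X} {i j : I} {n : ℕ}
    (h : (τ ^ (n + 1)) (l i) = l j) : returnTime l τ i ≤ n :=
  Nat.find_min' _ ⟨j, h⟩

theorem returnMap_injective [Finite X] (l : I ↪ X) (τ : Perm X) :
    Function.Injective (returnMap l τ) := by
  have key : ∀ i j, returnTime l τ i ≤ returnTime l τ j →
      returnMap l τ i = returnMap l τ j → i = j := by
    intro i j hle h
    have hi := returnMap_spec l τ i
    have hj := returnMap_spec l τ j
    obtain ⟨d, hd⟩ := Nat.exists_eq_add_of_le hle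
    rw [← h, ← hi, hd, show returnTime l τ i + d + 1 = (returnTime l τ i + 1) + d by ring,
      pow_add, Perm.mul_apply] at hj
    have hj' := (τ ^ (returnTime l τ i + 1)).injective hj
    cases d with
    | zero => exact (l.injective (by simpa using hj')).symm
    | succ d =>
      have := returnTime_le hj'
      omega
  intro i j h
  rcases le_total (returnTime l τ i) (returnTime l τ j) with hle | hle
  · exact key i j hle h
  · exact (key j i hle h.symm).symm

/-- The permutation of `I` obtained from the permutation `τ` of `X` by erasing from its cycles all
the elements that do not belong to (the image under `l` of) `I`. -/
def erase [Finite X] (l : I ↪ X) (τ : Perm X) : Perm I :=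
  haveI : Finite I := Finite.of_injective l l.injective
  Equiv.ofBijective (returnMap l τ) (Finite.injective_iff_bijective.1 (returnMap_injective l τ))

theorem apply_erase [Finite X] (l : I ↪ X) (τ : Perm X) (i : I) :
    (τ ^ (returnTime l τ i + 1)) (l i) = l (erase l τ i) :=
  returnMap_spec l τ i

theorem sameCycle_erase [Finite X] (l : I ↪ X) (τ : Perm X) (i j : I) :
    (erase l τ).SameCycle i j ↔ τ.SameCycle (l i) (l j) := by
  have : Finite I := Finite.of_injective l l.injective
  have step : ∀ i, τ.SameCycle (l i) (l (erase l τ i)) := by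
    intro i
    rw [← apply_erase]
    exact (Perm.SameCycle.refl τ (l i)).pow_right
  constructor
  · intro h
    obtain ⟨n, rfl⟩ := h.exists_nat_pow_eq
    clear h
    induction n with
    | zero => exact Perm.SameCycle.refl _ _
    | succ n ih =>
      rw [pow_succ', Perm.mul_apply]
      exact ih.trans (step _)
  · intro h
    obtain ⟨n, hn⟩ := h.exists_nat_pow_eq
    clear h
    induction n using Nat.strong_induction_on generalizing i with
    | _ n ih =>
      cases n with
      | zero =>
        have : i = j := l.injective (by simpa using hn)
        rw [this]
      | succ n =>
        have hle := returnTime_le hn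
        obtain ⟨d, hd⟩ := Nat.exists_eq_add_of_le hle
        have h2 : (τ ^ d) (l (erase l τ i)) = l j := by
          rw [← apply_erase, ← Perm.mul_apply, ← pow_add, ← hn]
          congr 2
          omega
        have := ih d (by omega) (erase l τ i) h2
        exact Perm.sameCycle_apply_left.1 this

theorem cyc_erase [Finite X] (l : I ↪ X) (τ : Perm X) (i : I) :
    cyc (erase l τ) i = l ⁻¹' cyc τ (l i) := by
  ext j
  exact sameCycle_erase l τ i j

/-- Erasing elements from cycles, none of which gets empty, erases them from the list of
cycles. -/
theorem IsCycleList.erase [Finite X] {l : I ↪ X} {τ : Perm X} {L : List (Set X)}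
    (h : IsCycleList τ L) (hL : ∀ C ∈ L, (l ⁻¹' C).Nonempty) :
    IsCycleList (erase l τ) (L.map (l ⁻¹' ·)) := by
  have hc : ∀ C ∈ L, ∃ i, C = cyc τ (l i) := by
    intro C hC
    obtain ⟨i, hi⟩ := hL C hC
    obtain ⟨x, rfl⟩ := (h.2 C).1 hC
    exact ⟨i, cyc_eq_iff.2 hi⟩
  constructor
  · refine List.Nodup.map_on ?_ h.1
    intro C hC D hD hCD
    obtain ⟨i, rfl⟩ := hc C hC
    obtain ⟨j, rfl⟩ := hc D hD
    have : i ∈ l ⁻¹' cyc τ (l j) := hCD ▸ mem_cyc_self τ (l i)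
    exact (cyc_eq_iff.2 this).symm
  · intro C
    rw [List.mem_map]
    constructor
    · rintro ⟨D, hD, rfl⟩
      obtain ⟨i, rfl⟩ := hc D hD
      exact ⟨i, (cyc_erase l τ i).symm⟩
    · rintro ⟨i, rfl⟩
      exact ⟨cyc τ (l i), (h.2 _).2 ⟨_, rfl⟩, (cyc_erase l τ i).symm⟩

theorem sameCycle_mul_swap_of_not [Finite X] [DecidableEq X] {σ : Perm X} {a b y : X}
    (ha : ¬ σ.SameCycle y a) (hb : ¬ σ.SameCycle y b) (z : X) :
    (σ * swap a b).SameCycle y z ↔ σ.SameCycle y z := by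
  have key : ∀ n : ℕ, ((σ * swap a b) ^ n) y = (σ ^ n) y := by
    intro n
    induction n with
    | zero => rfl
    | succ n ih =>
      rw [pow_succ', Perm.mul_apply, ih, pow_succ' σ, Perm.mul_apply, Perm.mul_apply,
        swap_apply_of_ne_of_ne]
      · intro h
        exact ha (h ▸ (Perm.SameCycle.refl σ y).pow_right)
      · intro h
        exact hb (h ▸ (Perm.SameCycle.refl σ y).pow_right)
  constructor
  · intro h
    obtain ⟨n, rfl⟩ := h.exists_nat_pow_eq
    rw [key]
    exact (Perm.SameCycle.refl σ y).pow_right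
  · intro h
    obtain ⟨n, rfl⟩ := h.exists_nat_pow_eq
    rw [← key]
    exact (Perm.SameCycle.refl _ y).pow_right

theorem cyc_mul_swap_of_not [Finite X] [DecidableEq X] {σ : Perm X} {a b y : X}
    (ha : ¬ σ.SameCycle y a) (hb : ¬ σ.SameCycle y b) : cyc (σ * swap a b) y = cyc σ y :=
  Set.ext fun z => sameCycle_mul_swap_of_not ha hb z

theorem sameCycle_mul_swap_or [Finite X] [DecidableEq X] {σ : Perm X} {a b y : X}
    (h : σ.SameCycle y a ∨ σ.SameCycle y b) :
    (σ * swap a b).SameCycle y a ∨ (σ * swap a b).SameCycle y b := by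
  by_contra hn
  rw [not_or] at hn
  have e : σ * swap a b * swap a b = σ := by rw [mul_assoc, swap_mul_self, mul_one]
  have h1 := sameCycle_mul_swap_of_not hn.1 hn.2 a
  have h2 := sameCycle_mul_swap_of_not hn.1 hn.2 b
  rw [e] at h1 h2
  rcases h with h | h
  · exact hn.1 (h1.1 h)
  · exact hn.2 (h2.1 h)

theorem sameCycle_mul_swap_of_not_sameCycle [Finite X] [DecidableEq X] {σ : Perm X} {a b : X}
    (h : ¬ σ.SameCycle a b) : (σ * swap a b).SameCycle a b := by
  by_contra hn
  have key : ∀ n : ℕ, (∀ m < n, (σ ^ (m + 1)) b ≠ b) →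
      (σ * swap a b).SameCycle a ((σ ^ (n + 1)) b) := by
    intro n
    induction n with
    | zero =>
      intro _
      have : (σ * swap a b) a = (σ ^ (0 + 1)) b := by simp
      rw [← this]
      exact (Perm.SameCycle.refl _ a).apply_right
    | succ n ih =>
      intro hm
      have h1 := ih fun m hmn => hm m (by omega)
      have : (σ * swap a b) ((σ ^ (n + 1)) b) = (σ ^ (n + 1 + 1)) b := by
        rw [Perm.mul_apply, swap_apply_of_ne_of_ne, pow_succ' σ (n + 1), Perm.mul_apply]
        · intro h2
          exact h (h2 ▸ ((Perm.SameCycle.refl σ b).pow_right (n := n + 1)).symm)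
        · exact hm n (by omega)
      rw [← this]
      exact h1.apply_right
  have hex : ∃ n, (σ ^ (n + 1)) b = b := ⟨orderOf σ - 1, by
    rw [Nat.sub_add_cancel (orderOf_pos σ), pow_orderOf_eq_one]; rfl⟩
  have h1 := key (Nat.find hex) fun m hm => Nat.find_min hex hm
  rw [Nat.find_spec hex] at h1
  exact hn h1

theorem not_sameCycle_mul_swap_of_sameCycle [Finite X] [DecidableEq X] {σ : Perm X} {a b : X} (hab : a ≠ b)
    (h : σ.SameCycle a b) : ¬ (σ * swap a b).SameCycle a b := by
  have hex : ∃ n, (σ ^ (n + 1)) b = a := by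
    obtain ⟨n, hn0, -, hn⟩ := h.symm.exists_pow_eq''
    exact ⟨n - 1, by rw [Nat.sub_add_cancel hn0]; exact hn⟩
  set n := Nat.find hex with hndef
  have hn : (σ ^ (n + 1)) b = a := Nat.find_spec hex
  have hmin : ∀ m < n, (σ ^ (m + 1)) b ≠ a := fun m hm => Nat.find_min hex hm
  have hb : ∀ m ≤ n, (σ ^ (m + 1)) b ≠ b := by
    intro m hm hmb
    rcases Nat.lt_or_eq_of_le hm with hlt | rfl
    · obtain ⟨d, hd⟩ := Nat.exists_eq_add_of_lt hlt
      refine hmin d (by omega) ?_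
      rw [← hn, hd, show m + d + 1 + 1 = (d + 1) + (m + 1) by ring, pow_add σ (d + 1) (m + 1),
        Perm.mul_apply, hmb]
    · exact hab (hn.symm.trans hmb)
  have key : ∀ j : ℕ, ∃ m ≤ n, ((σ * swap a b) ^ j) a = (σ ^ (m + 1)) b := by
    intro j
    induction j with
    | zero => exact ⟨n, le_rfl, hn.symm⟩
    | succ j ih =>
      obtain ⟨m, hm, e⟩ := ih
      rw [pow_succ', Perm.mul_apply, e]
      rcases Nat.lt_or_eq_of_le hm with hlt | rfl
      · refine ⟨m + 1, hlt, ?_⟩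
        rw [Perm.mul_apply, swap_apply_of_ne_of_ne (hmin m hlt) (hb m hm), pow_succ' σ (m + 1),
          Perm.mul_apply]
      · refine ⟨0, Nat.zero_le _, ?_⟩
        rw [hn]
        simp
  intro hs
  obtain ⟨j, hj⟩ := hs.exists_nat_pow_eq
  obtain ⟨m, hm, e⟩ := key j
  exact hb m hm (e.symm.trans hj)

/-- Dissecting a cycle: the list of cycles of `σ * swap a b` when `a` and `b` belong to one cycle
of `σ`. -/
theorem IsCycleList.dissect [Finite X] [DecidableEq X] {σ : Perm X} {a b : X} (hab : a ≠ b)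
    (h : σ.SameCycle a b) {L : List (Set X)} (hL : IsCycleList σ (cyc σ a :: L)) :
    IsCycleList (σ * swap a b) (cyc (σ * swap a b) a :: cyc (σ * swap a b) b :: L) := by
  have hnd := List.nodup_cons.1 hL.1
  have hC : ∀ C ∈ L, ∃ y, ¬ σ.SameCycle y a ∧ ¬ σ.SameCycle y b ∧ C = cyc σ y := by
    intro C hC
    obtain ⟨y, rfl⟩ := (hL.2 C).1 (List.mem_cons_of_mem _ hC)
    have hya : ¬ σ.SameCycle y a := fun hy => hnd.1 (cyc_eq_iff.2 hy ▸ hC)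
    exact ⟨y, hya, fun hy => hya (hy.trans h.symm), rfl⟩
  have hC' : ∀ C ∈ L, ∃ y, ¬ σ.SameCycle y a ∧ ¬ σ.SameCycle y b ∧ C = cyc (σ * swap a b) y := by
    intro C hCL
    obtain ⟨y, h1, h2, rfl⟩ := hC C hCL
    exact ⟨y, h1, h2, (cyc_mul_swap_of_not h1 h2).symm⟩
  have hn : ∀ x, (σ.SameCycle x a ∨ σ.SameCycle x b) → cyc (σ * swap a b) x ∉ L := by
    intro x hx hxL
    obtain ⟨y, h1, h2, e⟩ := hC' _ hxL
    have hs := cyc_eq_iff.1 e.symm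
    rw [sameCycle_mul_swap_of_not h1 h2] at hs
    exact hx.elim (fun hx => h1 (hs.trans hx)) (fun hx => h2 (hs.trans hx))
  refine ⟨?_, ?_⟩
  · rw [List.nodup_cons, List.nodup_cons, List.mem_cons, not_or]
    exact ⟨⟨fun e => not_sameCycle_mul_swap_of_sameCycle hab h (cyc_eq_iff.1 e),
      hn a (Or.inl (Perm.SameCycle.refl _ _))⟩, hn b (Or.inr (Perm.SameCycle.refl _ _)), hnd.2⟩
  · intro C
    rw [List.mem_cons, List.mem_cons]
    constructor
    · rintro (rfl | rfl | hCL)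
      · exact ⟨_, rfl⟩
      · exact ⟨_, rfl⟩
      · obtain ⟨y, -, -, e⟩ := hC' C hCL
        exact ⟨y, e⟩
    · rintro ⟨x, rfl⟩
      by_cases hx : σ.SameCycle x a
      · rcases sameCycle_mul_swap_or (b := b) (Or.inl hx) with h1 | h1
        · exact Or.inl (cyc_eq_iff.2 h1)
        · exact Or.inr (Or.inl (cyc_eq_iff.2 h1))
      · have hxb : ¬ σ.SameCycle x b := fun hy => hx (hy.trans h.symm)
        rw [cyc_mul_swap_of_not hx hxb]
        rcases List.mem_cons.1 ((hL.2 _).2 ⟨x, rfl⟩) with e | e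
        · exact absurd (cyc_eq_iff.1 e) hx
        · exact Or.inr (Or.inr e)

/-- Sewing cycles: the list of cycles of `σ * swap a b` when `a` and `b` belong to different
cycles of `σ`. -/
theorem IsCycleList.sew [Finite X] [DecidableEq X] {σ : Perm X} {a b : X}
    (h : ¬ σ.SameCycle a b) {L : List (Set X)} (hL : IsCycleList σ (cyc σ a :: cyc σ b :: L)) :
    IsCycleList (σ * swap a b) (cyc (σ * swap a b) a :: L) := by
  have hnd := List.nodup_cons.1 hL.1
  have hnd2 := List.nodup_cons.1 hnd.2
  have hs := sameCycle_mul_swap_of_not_sameCycle h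
  have hC' : ∀ C ∈ L, ∃ y, ¬ σ.SameCycle y a ∧ ¬ σ.SameCycle y b ∧ C = cyc (σ * swap a b) y := by
    intro C hCL
    obtain ⟨y, rfl⟩ := (hL.2 C).1 (List.mem_cons_of_mem _ (List.mem_cons_of_mem _ hCL))
    have hya : ¬ σ.SameCycle y a := fun hy =>
      hnd.1 (List.mem_cons_of_mem _ (cyc_eq_iff.2 hy ▸ hCL))
    have hyb : ¬ σ.SameCycle y b := fun hy => hnd2.1 (cyc_eq_iff.2 hy ▸ hCL)
    exact ⟨y, hya, hyb, (cyc_mul_swap_of_not hya hyb).symm⟩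
  refine ⟨?_, ?_⟩
  · rw [List.nodup_cons]
    refine ⟨fun ha => ?_, hnd2.2⟩
    obtain ⟨y, h1, h2, e⟩ := hC' _ ha
    have hs := cyc_eq_iff.1 e.symm
    rw [sameCycle_mul_swap_of_not h1 h2] at hs
    exact h1 hs
  · intro C
    rw [List.mem_cons]
    constructor
    · rintro (rfl | hCL)
      · exact ⟨_, rfl⟩
      · obtain ⟨y, -, -, e⟩ := hC' C hCL
        exact ⟨y, e⟩
    · rintro ⟨x, rfl⟩
      by_cases hx : σ.SameCycle x a ∨ σ.SameCycle x b
      · left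
        rcases sameCycle_mul_swap_or hx with h1 | h1
        · exact cyc_eq_iff.2 h1
        · exact cyc_eq_iff.2 (h1.trans hs.symm)
      · right
        rw [not_or] at hx
        rw [cyc_mul_swap_of_not hx.1 hx.2]
        have := (hL.2 _).2 ⟨x, rfl⟩
        rw [List.mem_cons, List.mem_cons] at this
        rcases this with e | e | e
        · exact absurd (cyc_eq_iff.1 e) hx.1
        · exact absurd (cyc_eq_iff.1 e) hx.2
        · exact e

theorem IsCycleList.perm {τ : Perm X} {L L' : List (Set X)} (h : IsCycleList τ L)
    (hp : L.Perm L') : IsCycleList τ L' :=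
  ⟨hp.nodup_iff.1 h.1, fun C => by rw [← hp.mem_iff]; exact h.2 C⟩

end Permutations
/-! ### The modular operad `S[t]` -/

section SymmetricGroups

/-- The restriction of a bilinear map to submodules. -/
def restrict₂ {k : Type u} [Field k] {M N P : Type*} [AddCommGroup M] [AddCommGroup N]
    [AddCommGroup P] [Module k M] [Module k N] [Module k P] (B : M →ₗ[k] N →ₗ[k] P)
    (p : Submodule k M) (q : Submodule k N) (r : Submodule k P)
    (h : ∀ x ∈ p, ∀ y ∈ q, B x y ∈ r) : p →ₗ[k] q →ₗ[k] r :=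
  LinearMap.mk₂ k (fun x y => ⟨B x y, h x x.2 y y.2⟩)
    (fun x x' y => Subtype.ext (by simp)) (fun c x y => Subtype.ext (by simp))
    (fun x y y' => Subtype.ext (by simp)) (fun c x y => Subtype.ext (by simp))

variable (k : Type u) [Field k] {X I J : Type}

/-- The exterior algebra on the vector space with basis the subsets of `X`; it contains
`Det (Cycle σ)` for all permutations `σ` of `X`, a cycle being represented by its underlying set. -/
abbrev Blocks (X : Type) := ExteriorAlgebra k (Set X →₀ k)

/-- The generator of the exterior algebra given by a subset. -/
def block (C : Set X) : Blocks k X := ExteriorAlgebra.ι k (Finsupp.single C 1)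

/-- The element `σ_1 ∧ ... ∧ σ_i` defined by a list of cycles. -/
def wedge (L : List (Set X)) : Blocks k X := (L.map (block k)).prod

/-- The space of finite linear combinations of symbols `(σ, a) t ^ g`, where `σ` is a permutation
and `a` an element of the exterior algebra. -/
abbrev Ambient (X : Type) := (Perm X × ℕ) →₀ Blocks k X

/-- The component `S[t]((I, b))`: the span of the elements `(σ, σ_1 ∧ ... ∧ σ_i) t ^ g`, where
`σ_1, ..., σ_i` are the cycles of `σ` and `b = 2 g + i - 1`. It is zero if `2 b + |I| - 2 ≤ 0`. -/
def SComp (I : Type) (b : ℕ) : Submodule k (Ambient k I) :=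
  Submodule.span k {x | ∃ (σ : Perm I) (L : List (Set I)) (g : ℕ), IsCycleList σ L ∧
    2 * g + L.length = b + 1 ∧ 2 < 2 * b + Nat.card I ∧ x = Finsupp.single (σ, g) (wedge k L)}

/-- The contraction `σ_k ∧ rest ↦ rest` with a cycle `σ_k`. -/
def contr (C : Set X) : Blocks k X →ₗ[k] Blocks k X :=
  CliffordAlgebra.contractLeft (Q := (0 : QuadraticForm k (Set X →₀ k))) (Finsupp.lapply C)

/-- The map of exterior algebras induced by a map between the sets of blocks. -/
def mapBlocks (q : Set X → Set I) : Blocks k X →ₗ[k] Blocks k I :=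
  (ExteriorAlgebra.map (Finsupp.lmapDomain k k q)).toLinearMap

variable {k}

theorem wedge_cons (C : Set X) (L : List (Set X)) : wedge k (C :: L) = block k C * wedge k L := by
  simp [wedge]

theorem wedge_append (L M : List (Set X)) : wedge k (L ++ M) = wedge k L * wedge k M := by
  simp [wedge]

theorem wedge_perm {L M : List (Set X)} (h : L.Perm M) :
    wedge k L = wedge k M ∨ wedge k L = - wedge k M := by
  induction h with
  | nil => exact Or.inl rfl
  | cons C _ ih =>
    rw [wedge_cons, wedge_cons]
    rcases ih with e | e <;> rw [e]
    · exact Or.inl rfl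
    · exact Or.inr (mul_neg _ _)
  | swap C D L =>
    right
    rw [wedge_cons, wedge_cons, wedge_cons, wedge_cons, ← mul_assoc, ← mul_assoc, ← neg_mul]
    congr 1
    exact eq_neg_of_add_eq_zero_left (ExteriorAlgebra.ι_add_mul_swap _ _)
  | trans _ _ h1 h2 =>
    rcases h1 with e1 | e1 <;> rcases h2 with e2 | e2 <;> rw [e1, e2]
    · exact Or.inl rfl
    · exact Or.inr rfl
    · exact Or.inr rfl
    · exact Or.inl (neg_neg _)

theorem contr_wedge_of_notMem {C : Set X} {L : List (Set X)} (h : C ∉ L) :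
    contr k C (wedge k L) = 0 := by
  induction L with
  | nil => exact CliffordAlgebra.contractLeft_one _ _
  | cons D L ih =>
    rw [List.mem_cons, not_or] at h
    rw [wedge_cons, contr, block]
    refine (CliffordAlgebra.contractLeft_ι_mul _ _ _).trans ?_
    have h2 := ih h.2
    rw [contr] at h2
    rw [h2, Finsupp.lapply_apply, Finsupp.single_eq_of_ne h.1, zero_smul, mul_zero, sub_zero]

theorem contr_wedge_cons {C : Set X} {L : List (Set X)} (h : C ∉ L) :
    contr k C (wedge k (C :: L)) = wedge k L := by
  rw [wedge_cons, contr, block]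
  refine (CliffordAlgebra.contractLeft_ι_mul _ _ _).trans ?_
  have h2 := contr_wedge_of_notMem (k := k) h
  rw [contr] at h2
  rw [h2, Finsupp.lapply_apply, Finsupp.single_eq_same, one_smul, mul_zero, sub_zero]

theorem mapBlocks_wedge (q : Set X → Set I) (L : List (Set X)) :
    mapBlocks k q (wedge k L) = wedge k (L.map q) := by
  induction L with
  | nil => exact map_one (ExteriorAlgebra.map (Finsupp.lmapDomain k k q))
  | cons D L ih =>
    rw [wedge_cons, List.map_cons, wedge_cons, ← ih]
    refine (map_mul (ExteriorAlgebra.map (Finsupp.lmapDomain k k q)) _ _).trans ?_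
    congr 1
    refine (ExteriorAlgebra.map_apply_ι _ _).trans ?_
    rw [Finsupp.lmapDomain_apply, Finsupp.mapDomain_single]
    rfl

/-- An element spanning the component, starting with the cycles `C` at choice. -/
theorem single_perm_mem {S : Submodule k (Ambient k I)} {T : Ambient k X →ₗ[k] Ambient k I}
    {σ : Perm X} {g : ℕ} {L M : List (Set X)} (h : L.Perm M)
    (hM : T (Finsupp.single (σ, g) (wedge k M)) ∈ S) :
    T (Finsupp.single (σ, g) (wedge k L)) ∈ S := by
  rcases wedge_perm (k := k) h with e | e <;> rw [e]
  · exact hM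
  · rw [Finsupp.single_neg, map_neg]
    exact S.neg_mem hM

theorem single_mem_SComp {σ : Perm I} {L : List (Set I)} {g b : ℕ} (hL : IsCycleList σ L)
    (hb : 2 * g + L.length = b + 1) (hs : 2 < 2 * b + Nat.card I) :
    Finsupp.single (σ, g) (wedge k L) ∈ SComp k I b :=
  Submodule.subset_span ⟨σ, L, g, hL, hb, hs, rfl⟩

variable (k)

/-! Relabelling of the legs. -/

/-- The action of a bijection `e` on symbols `(σ, a) t ^ g`. -/
def sMapAux (e : I ≃ J) : Ambient k I →ₗ[k] Ambient k J :=
  Finsupp.lsum k fun x : Perm I × ℕ =>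
    (Finsupp.lsingle (R := k) (e.permCongr x.1, x.2)).comp (mapBlocks k (e '' ·))

theorem sMapAux_single (e : I ≃ J) (σ : Perm I) (g : ℕ) (L : List (Set I)) :
    sMapAux k e (Finsupp.single (σ, g) (wedge k L)) =
      Finsupp.single (e.permCongr σ, g) (wedge k (L.map (e '' ·))) := by
  simp [sMapAux, mapBlocks_wedge]

theorem sameCycle_permCongr (e : I ≃ J) (σ : Perm I) (x y : I) :
    (e.permCongr σ).SameCycle (e x) (e y) ↔ σ.SameCycle x y := by
  have : ∀ n : ℤ, ((e.permCongr σ) ^ n) (e x) = e ((σ ^ n) x) := by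
    intro n
    have h : (e.permCongr σ) ^ n = e.permCongr (σ ^ n) :=
      (map_zpow e.permCongrHom σ n).symm
    rw [h]
    simp
  simp [Perm.SameCycle, this]

theorem cyc_permCongr (e : I ≃ J) (σ : Perm I) (x : I) :
    cyc (e.permCongr σ) (e x) = e '' cyc σ x := by
  ext y
  obtain ⟨y, rfl⟩ := e.surjective y
  rw [e.injective.mem_set_image]
  exact sameCycle_permCongr e σ x y

theorem IsCycleList.permCongr (e : I ≃ J) {σ : Perm I} {L : List (Set I)} (h : IsCycleList σ L) :
    IsCycleList (e.permCongr σ) (L.map (e '' ·)) := by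
  constructor
  · exact h.1.map (Set.image_injective.2 e.injective)
  · intro C
    rw [List.mem_map]
    constructor
    · rintro ⟨D, hD, rfl⟩
      obtain ⟨x, rfl⟩ := (h.2 D).1 hD
      exact ⟨e x, (cyc_permCongr e σ x).symm⟩
    · rintro ⟨y, rfl⟩
      obtain ⟨x, rfl⟩ := e.surjective y
      exact ⟨_, (h.2 _).2 ⟨x, rfl⟩, (cyc_permCongr e σ x).symm⟩

theorem sMapAux_mem (e : I ≃ J) (b : ℕ) : ∀ x ∈ SComp k I b, sMapAux k e x ∈ SComp k J b := by
  intro x hx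
  refine Submodule.span_le (p := (SComp k J b).comap (sMapAux k e)).2 ?_ hx
  rintro _ ⟨σ, L, g, hL, hb, hs, rfl⟩
  change sMapAux k e _ ∈ SComp k J b
  rw [sMapAux_single]
  refine single_mem_SComp (hL.permCongr e) (by simpa using hb) ?_
  rwa [← Nat.card_congr e]

/-- The action of bijections on `S[t]`: conjugation of permutations. -/
def sMap (e : I ≃ J) (b : ℕ) : SComp k I b →ₗ[k] SComp k J b :=
  (sMapAux k e).restrict (sMapAux_mem k e b)

/-! Composition along the graph with one vertex and one loop. -/

/-- The inclusion of `I` in `I ⊔ {f, f'}`, where `f = some none` and `f' = none`. -/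
def inclTwo (I : Type) : I ↪ Option (Option I) := ⟨fun i => some (some i), fun i j h => by simpa using h⟩

/-- The value of the loop composition `μ (e_{f f'} ⊗ -)` on `(σ, a) t ^ g`, for
`f = some none`, `f' = none`:
* if `f` and `f'` are in the same cycle, it is the dissection
  `σ_k ∧ rest ↦ (π σ_k^f) ∧ (π σ_k^f') ∧ rest`, or zero if one of the two cycles disappears;
* otherwise it is the sewing `σ_k ∧ σ_l ∧ rest ↦ π (σ_k σ_l (f f')) ∧ rest`, times `t`, or zero if
  the cycle disappears. -/
def sLoopTerm [Finite I] (σ : Perm (Option (Option I))) (g : ℕ) :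
    Blocks k (Option (Option I)) →ₗ[k] Ambient k I :=
  let f : Option (Option I) := some none
  let f' : Option (Option I) := none
  let τ := σ * swap f f'
  let A : Set I := inclTwo I ⁻¹' cyc τ f
  let A' : Set I := inclTwo I ⁻¹' cyc τ f'
  if σ.SameCycle f f' then
    if A.Nonempty ∧ A'.Nonempty then
      (Finsupp.lsingle (R := k) (erase (inclTwo I) τ, g)).comp
        ((LinearMap.mulLeft k (block k A * block k A')).comp
          ((mapBlocks k (inclTwo I ⁻¹' ·)).comp (contr k (cyc σ f))))
    else 0
  else
    if A.Nonempty then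
      (Finsupp.lsingle (R := k) (erase (inclTwo I) τ, g + 1)).comp
        ((LinearMap.mulLeft k (block k A)).comp
          ((mapBlocks k (inclTwo I ⁻¹' ·)).comp
            ((contr k (cyc σ f')).comp (contr k (cyc σ f)))))
    else 0

/-- The loop composition on linear combinations of symbols. -/
def sLoopAux (I : Type) [Finite I] : Ambient k (Option (Option I)) →ₗ[k] Ambient k I :=
  Finsupp.lsum k fun x : Perm (Option (Option I)) × ℕ => sLoopTerm k x.1 x.2

theorem nonempty_preimage_inclTwo {σ : Perm (Option (Option I))} {y : Option (Option I)}
    (h1 : ¬ σ.SameCycle y (some none)) (h2 : ¬ σ.SameCycle y none) :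
    (inclTwo I ⁻¹' cyc σ y).Nonempty := by
  match y with
  | none => exact absurd (Perm.SameCycle.refl _ _) h2
  | some none => exact absurd (Perm.SameCycle.refl _ _) h1
  | some (some i) => exact ⟨i, mem_cyc_self σ _⟩

theorem exists_perm_cons {L : List (Set X)} {C : Set X} (h : C ∈ L) : ∃ M, L.Perm (C :: M) :=
  ⟨L.erase C, List.perm_cons_erase h⟩

theorem sLoopAux_mem [Finite I] (b : ℕ) :
    ∀ x ∈ SComp k (Option (Option I)) b, sLoopAux k I x ∈ SComp k I (b + 1) := by
  intro x hx
  refine Submodule.span_le (p := (SComp k I (b + 1)).comap (sLoopAux k I)).2 ?_ hx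
  rintro _ ⟨σ, L, g, hL, hb, hs, rfl⟩
  change sLoopAux k I _ ∈ SComp k I (b + 1)
  have hs' : 2 < 2 * (b + 1) + Nat.card I := by
    simp only [Finite.card_option] at hs
    omega
  have hne : (some none : Option (Option I)) ≠ none := by simp
  have ht : ∀ a, sLoopAux k I (Finsupp.single (σ, g) a) = sLoopTerm k σ g a := by
    intro a
    simp [sLoopAux]
  obtain ⟨M, hM⟩ := exists_perm_cons ((hL.2 _).2 ⟨some none, rfl⟩)
  have hLM := hL.perm hM
  have hMlen : L.length = M.length + 1 := by simpa using hM.length_eq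
  have hnd := List.nodup_cons.1 hLM.1
  by_cases hc : σ.SameCycle (some none) none
  · refine single_perm_mem hM ?_
    rw [ht]
    simp only [sLoopTerm, if_pos hc]
    split_ifs with hA
    · simp only [LinearMap.comp_apply, contr_wedge_cons hnd.1, mapBlocks_wedge,
        LinearMap.mulLeft_apply, Finsupp.lsingle_apply, mul_assoc, ← wedge_cons]
      refine single_mem_SComp ?_ (by simp; omega) hs'
      have hd := hLM.dissect hne hc
      have := hd.erase (l := inclTwo I) ?_
      · simpa using this
      · intro C hC
        rcases List.mem_cons.1 hC with rfl | hC
        · exact hA.1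
        rcases List.mem_cons.1 hC with rfl | hC
        · exact hA.2
        obtain ⟨y, rfl⟩ := (hLM.2 C).1 (List.mem_cons_of_mem _ hC)
        have hy : ¬ σ.SameCycle y (some none) := fun h => hnd.1 (cyc_eq_iff.2 h ▸ hC)
        exact nonempty_preimage_inclTwo hy fun h => hy (h.trans hc.symm)
    · exact Submodule.zero_mem _
  · have hmem : cyc σ none ∈ M := by
      have := (hLM.2 _).2 ⟨none, rfl⟩
      rcases List.mem_cons.1 this with e | e
      · exact absurd (cyc_eq_iff.1 e.symm) hc
      · exact e
    obtain ⟨N, hN⟩ := exists_perm_cons hmem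
    have hMN : L.Perm (cyc σ (some none) :: cyc σ none :: N) := hM.trans (hN.cons _)
    have hLN := hL.perm hMN
    have hNlen : M.length = N.length + 1 := by simpa using hN.length_eq
    have hnd := List.nodup_cons.1 hLN.1
    have hnd2 := List.nodup_cons.1 hnd.2
    refine single_perm_mem hMN ?_
    rw [ht]
    simp only [sLoopTerm, if_neg hc]
    split_ifs with hA
    · simp only [LinearMap.comp_apply, contr_wedge_cons hnd.1, contr_wedge_cons hnd2.1,
        mapBlocks_wedge, LinearMap.mulLeft_apply, Finsupp.lsingle_apply, ← wedge_cons]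
      refine single_mem_SComp ?_ (by simp; omega) hs'
      have hd := hLN.sew hc
      have := hd.erase (l := inclTwo I) ?_
      · simpa using this
      · intro C hC
        rcases List.mem_cons.1 hC with rfl | hC
        · exact hA
        obtain ⟨y, rfl⟩ := (hLN.2 C).1 (List.mem_cons_of_mem _ (List.mem_cons_of_mem _ hC))
        have hy : ¬ σ.SameCycle y (some none) := fun h =>
          hnd.1 (List.mem_cons_of_mem _ (cyc_eq_iff.2 h ▸ hC))
        exact nonempty_preimage_inclTwo hy fun h => hnd2.1 (cyc_eq_iff.2 h ▸ hC)
    · exact Submodule.zero_mem _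

/-- The loop composition `μ (e_{f f'} ⊗ -) : S[t]((I ⊔ {f, f'}, b)) → S[t]((I, b + 1))`. -/
def sLoop (I : Type) [Finite I] (b : ℕ) : SComp k (Option (Option I)) b →ₗ[k] SComp k I (b + 1) :=
  (sLoopAux k I).restrict (sLoopAux_mem k b)

/-! Composition along the graph with two vertices and one edge. -/

/-- The inclusion of `I ⊔ J` in `(I ⊔ {f}) ⊔ (J ⊔ {f'})`, where `f = inl none`, `f' = inr none`. -/
def inclSum (I J : Type) : I ⊕ J ↪ Option I ⊕ Option J :=
  ⟨Sum.map some some, Sum.map_injective.2 ⟨Option.some_injective _, Option.some_injective _⟩⟩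

/-- The composition along the edge `f f'` of `(σ, a) t ^ g` and `(ρ, a') t ^ g'`, where `f = none`
and `f' = none` are in the cycles `σ_k` and `ρ_l`:
`σ_k ∧ rest`, `ρ_l ∧ rest' ↦ π (σ_k ρ_l (f f')) ∧ rest ∧ rest'`, or zero if the cycle
disappears. -/
def sCompTerm [Finite I] [Finite J] (σ : Perm (Option I)) (g : ℕ) (ρ : Perm (Option J)) (g' : ℕ) :
    Blocks k (Option I) →ₗ[k] Blocks k (Option J) →ₗ[k] Ambient k (I ⊕ J) :=
  let f : Option I ⊕ Option J := Sum.inl none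
  let f' : Option I ⊕ Option J := Sum.inr none
  let τ := Perm.sumCongr σ ρ * swap f f'
  let A : Set (I ⊕ J) := inclSum I J ⁻¹' cyc τ f
  if A.Nonempty then
    LinearMap.compr₂
      (LinearMap.compl₁₂ (LinearMap.mul k (Blocks k (I ⊕ J)))
        ((mapBlocks k fun C => inclSum I J ⁻¹' (Sum.inl '' C)).comp (contr k (cyc σ none)))
        ((mapBlocks k fun C => inclSum I J ⁻¹' (Sum.inr '' C)).comp (contr k (cyc ρ none))))
      ((Finsupp.lsingle (R := k) (erase (inclSum I J) τ, g + g')).comp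
        (LinearMap.mulLeft k (block k A)))
  else 0

/-- The composition along an edge on linear combinations of symbols. -/
def sCompAux (I J : Type) [Finite I] [Finite J] :
    Ambient k (Option I) →ₗ[k] Ambient k (Option J) →ₗ[k] Ambient k (I ⊕ J) :=
  Finsupp.lsum k fun x : Perm (Option I) × ℕ =>
    LinearMap.flip (Finsupp.lsum k fun y : Perm (Option J) × ℕ =>
      (sCompTerm k x.1 x.2 y.1 y.2).flip)

theorem sCompAux_single [Finite I] [Finite J] (σ : Perm (Option I)) (g : ℕ)
    (ρ : Perm (Option J)) (g' : ℕ) (a : Blocks k (Option I)) (a' : Blocks k (Option J)) :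
    sCompAux k I J (Finsupp.single (σ, g) a) (Finsupp.single (ρ, g') a') =
      sCompTerm k σ g ρ g' a a' := by
  simp [sCompAux]

theorem sameCycle_sumCongr_inl (σ : Perm X) (ρ : Perm I) (x : X) (z : X ⊕ I) :
    (Perm.sumCongr σ ρ).SameCycle (Sum.inl x) z ↔ ∃ y, σ.SameCycle x y ∧ z = Sum.inl y := by
  have h : ∀ n : ℤ, (Perm.sumCongr σ ρ) ^ n = Perm.sumCongr (σ ^ n) (ρ ^ n) := fun n =>
    (map_zpow (Perm.sumCongrHom X I) (σ, ρ) n).symm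
  simp only [Perm.SameCycle, h, Perm.sumCongr_apply, Sum.map_inl]
  constructor
  · rintro ⟨n, rfl⟩
    exact ⟨_, ⟨n, rfl⟩, rfl⟩
  · rintro ⟨_, ⟨n, rfl⟩, rfl⟩
    exact ⟨n, rfl⟩

theorem sameCycle_sumCongr_inr (σ : Perm X) (ρ : Perm I) (x : I) (z : X ⊕ I) :
    (Perm.sumCongr σ ρ).SameCycle (Sum.inr x) z ↔ ∃ y, ρ.SameCycle x y ∧ z = Sum.inr y := by
  have h : ∀ n : ℤ, (Perm.sumCongr σ ρ) ^ n = Perm.sumCongr (σ ^ n) (ρ ^ n) := fun n =>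
    (map_zpow (Perm.sumCongrHom X I) (σ, ρ) n).symm
  simp only [Perm.SameCycle, h, Perm.sumCongr_apply, Sum.map_inr]
  constructor
  · rintro ⟨n, rfl⟩
    exact ⟨_, ⟨n, rfl⟩, rfl⟩
  · rintro ⟨_, ⟨n, rfl⟩, rfl⟩
    exact ⟨n, rfl⟩

theorem cyc_sumCongr_inl (σ : Perm X) (ρ : Perm I) (x : X) :
    cyc (Perm.sumCongr σ ρ) (Sum.inl x) = Sum.inl '' cyc σ x := by
  ext z
  rw [cyc, Set.mem_ofPred_eq, sameCycle_sumCongr_inl]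
  exact ⟨fun ⟨y, h, e⟩ => ⟨y, h, e.symm⟩, fun ⟨y, h, e⟩ => ⟨y, h, e.symm⟩⟩

theorem cyc_sumCongr_inr (σ : Perm X) (ρ : Perm I) (x : I) :
    cyc (Perm.sumCongr σ ρ) (Sum.inr x) = Sum.inr '' cyc ρ x := by
  ext z
  rw [cyc, Set.mem_ofPred_eq, sameCycle_sumCongr_inr]
  exact ⟨fun ⟨y, h, e⟩ => ⟨y, h, e.symm⟩, fun ⟨y, h, e⟩ => ⟨y, h, e.symm⟩⟩

theorem IsCycleList.sumCongr {σ : Perm X} {ρ : Perm I} {L : List (Set X)} {M : List (Set I)}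
    (hL : IsCycleList σ L) (hM : IsCycleList ρ M) :
    IsCycleList (Perm.sumCongr σ ρ) (L.map (Sum.inl '' ·) ++ M.map (Sum.inr '' ·)) := by
  constructor
  · refine List.nodup_append.2 ⟨hL.1.map (Set.image_injective.2 Sum.inl_injective),
      hM.1.map (Set.image_injective.2 Sum.inr_injective), ?_⟩
    intro C hC D hD hCD
    rw [List.mem_map] at hC hD
    obtain ⟨C, hC, rfl⟩ := hC
    obtain ⟨D, hD, rfl⟩ := hD
    obtain ⟨x, rfl⟩ := (hL.2 C).1 hC
    have : Sum.inl x ∈ Sum.inr '' D := hCD ▸ Set.mem_image_of_mem _ (mem_cyc_self σ x)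
    simp at this
  · intro C
    rw [List.mem_append, List.mem_map, List.mem_map]
    constructor
    · rintro (⟨D, hD, rfl⟩ | ⟨D, hD, rfl⟩)
      · obtain ⟨x, rfl⟩ := (hL.2 D).1 hD
        exact ⟨Sum.inl x, (cyc_sumCongr_inl σ ρ x).symm⟩
      · obtain ⟨x, rfl⟩ := (hM.2 D).1 hD
        exact ⟨Sum.inr x, (cyc_sumCongr_inr σ ρ x).symm⟩
    · rintro ⟨x | x, rfl⟩
      · exact Or.inl ⟨_, (hL.2 _).2 ⟨x, rfl⟩, (cyc_sumCongr_inl σ ρ x).symm⟩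
      · exact Or.inr ⟨_, (hM.2 _).2 ⟨x, rfl⟩, (cyc_sumCongr_inr σ ρ x).symm⟩

theorem nonempty_of_notMem_none {σ : Perm (Option I)} {C : Set (Option I)} {M : List (Set (Option I))}
    (h : IsCycleList σ (cyc σ none :: M)) (hC : C ∈ M) : ∃ i, some i ∈ C := by
  obtain ⟨y, rfl⟩ := (h.2 C).1 (List.mem_cons_of_mem _ hC)
  match y with
  | none => exact absurd hC (List.nodup_cons.1 h.1).1
  | some i => exact ⟨i, mem_cyc_self σ _⟩

theorem sCompAux_mem [Finite I] [Finite J] (b b' : ℕ) :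
    ∀ x ∈ SComp k (Option I) b, ∀ y ∈ SComp k (Option J) b',
      sCompAux k I J x y ∈ SComp k (I ⊕ J) (b + b') := by
  intro x hx y hy
  refine Submodule.span_le
    (p := (SComp k (I ⊕ J) (b + b')).comap ((sCompAux k I J).flip y)).2 ?_ hx
  rintro _ ⟨σ, L, g, hL, hb, hs, rfl⟩
  change sCompAux k I J _ y ∈ SComp k (I ⊕ J) (b + b')
  refine Submodule.span_le (p := (SComp k (I ⊕ J) (b + b')).comap
    (sCompAux k I J (Finsupp.single (σ, g) (wedge k L)))).2 ?_ hy
  rintro _ ⟨ρ, M, g', hM, hb', hs', rfl⟩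
  change sCompAux k I J _ _ ∈ SComp k (I ⊕ J) (b + b')
  obtain ⟨L', hL'⟩ := exists_perm_cons ((hL.2 _).2 ⟨none, rfl⟩)
  obtain ⟨M', hM'⟩ := exists_perm_cons ((hM.2 _).2 ⟨none, rfl⟩)
  have hLL := hL.perm hL'
  have hMM := hM.perm hM'
  have hLlen : L.length = L'.length + 1 := by simpa using hL'.length_eq
  have hMlen : M.length = M'.length + 1 := by simpa using hM'.length_eq
  have hndL := List.nodup_cons.1 hLL.1
  have hndM := List.nodup_cons.1 hMM.1
  refine single_perm_mem hM' ?_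
  refine single_perm_mem (T := (sCompAux k I J).flip _) hL' ?_
  rw [LinearMap.flip_apply, sCompAux_single]
  simp only [sCompTerm]
  split_ifs with hA
  · simp only [LinearMap.compr₂_apply, LinearMap.compl₁₂_apply, LinearMap.comp_apply,
      contr_wedge_cons hndL.1, contr_wedge_cons hndM.1, mapBlocks_wedge, LinearMap.mul_apply',
      LinearMap.mulLeft_apply, Finsupp.lsingle_apply, ← wedge_append, ← wedge_cons]
    refine single_mem_SComp ?_ (by simp; omega) ?_
    · have h1 := hLL.sumCongr hMM
      have h2 : IsCycleList (Perm.sumCongr σ ρ)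
          (cyc (Perm.sumCongr σ ρ) (Sum.inl none) :: cyc (Perm.sumCongr σ ρ) (Sum.inr none) ::
            (L'.map (Sum.inl '' ·) ++ M'.map (Sum.inr '' ·))) := by
        refine h1.perm ?_
        rw [cyc_sumCongr_inl, cyc_sumCongr_inr]
        simp only [List.map_cons, List.cons_append]
        exact List.Perm.cons _ List.perm_middle
      have hn : ¬ (Perm.sumCongr σ ρ).SameCycle (Sum.inl none) (Sum.inr none) := by
        rw [sameCycle_sumCongr_inl]
        simp
      have h3 := (h2.sew hn).erase (l := inclSum I J) ?_
      · simpa [List.map_append, Function.comp_def] using h3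
      · intro C hC
        rcases List.mem_cons.1 hC with rfl | hC
        · exact hA
        rw [List.mem_append, List.mem_map, List.mem_map] at hC
        rcases hC with ⟨D, hD, rfl⟩ | ⟨D, hD, rfl⟩
        · obtain ⟨i, hi⟩ := nonempty_of_notMem_none hLL hD
          exact ⟨Sum.inl i, ⟨some i, hi, rfl⟩⟩
        · obtain ⟨i, hi⟩ := nonempty_of_notMem_none hMM hD
          exact ⟨Sum.inr i, ⟨some i, hi, rfl⟩⟩
    · simp only [Finite.card_option] at hs hs'
      rw [Nat.card_sum]
      omega
  · exact Submodule.zero_mem _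

/-- The composition `S[t]((I ⊔ {f}, b)) ⊗ S[t]((J ⊔ {f'}, b')) → S[t]((I ⊔ J, b + b'))`. -/
def sComp (I J : Type) [Finite I] [Finite J] (b b' : ℕ) :
    SComp k (Option I) b →ₗ[k] SComp k (Option J) b' →ₗ[k] SComp k (I ⊕ J) (b + b') :=
  restrict₂ (sCompAux k I J) _ _ _ (sCompAux_mem k b b')

end SymmetricGroups

/-! ### Top exterior powers -/

section Determinants

variable {k : Type u} [Field k] {U V W : Type u} [AddCommGroup U] [AddCommGroup V] [AddCommGroup W]
  [Module k U] [Module k V] [Module k W]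

/-- The determinant line `Det V`, the top exterior power of a vector space. -/
def Det (k : Type u) (V : Type u) [Field k] [AddCommGroup V] [Module k V] : Type u :=
  ⋀[k]^(finrank k V) V

instance : AddCommGroup (Det k V) := inferInstanceAs (AddCommGroup (⋀[k]^(finrank k V) V))

instance : Module k (Det k V) := inferInstanceAs (Module k (⋀[k]^(finrank k V) V))

/-- The inclusion of the determinant line in the exterior algebra. -/
def Det.val : Det k V →ₗ[k] ExteriorAlgebra k V := (⋀[k]^(finrank k V) V).subtype

theorem Det.val_injective : Function.Injective (Det.val (k := k) (V := V)) :=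
  Subtype.val_injective

theorem Det.val_mem (x : Det k V) : x.val ∈ ⋀[k]^(finrank k V) V := x.2

theorem map_mem_power (f : V →ₗ[k] W) {n : ℕ} {x : ExteriorAlgebra k V} (hx : x ∈ ⋀[k]^n V) :
    ExteriorAlgebra.map f x ∈ ⋀[k]^n W := by
  have h1 : ExteriorAlgebra.map f x ∈
      ((LinearMap.range (ExteriorAlgebra.ι k (M := V))) ^ n).map
        (ExteriorAlgebra.map f).toLinearMap := ⟨x, hx, rfl⟩
  rw [Submodule.map_pow] at h1
  have h2 : (LinearMap.range (ExteriorAlgebra.ι k (M := V))).map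
      (ExteriorAlgebra.map f).toLinearMap ≤ LinearMap.range (ExteriorAlgebra.ι k (M := W)) := by
    rw [← LinearMap.range_comp]
    rintro _ ⟨v, rfl⟩
    exact ⟨f v, (ExteriorAlgebra.map_apply_ι f v).symm⟩
  have h3 := pow_le_pow_left' h2 n
  exact h3 h1

theorem mul_mem_power {m n : ℕ} {x y : ExteriorAlgebra k V} (hx : x ∈ ⋀[k]^m V)
    (hy : y ∈ ⋀[k]^n V) : x * y ∈ ⋀[k]^(m + n) V := by
  rw [ExteriorAlgebra.exteriorPower, pow_add]
  exact Submodule.mul_mem_mul hx hy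

theorem one_mem_power : (1 : ExteriorAlgebra k V) ∈ ⋀[k]^0 V := by
  rw [ExteriorAlgebra.exteriorPower, pow_zero]
  exact Submodule.one_le.1 le_rfl

theorem ι_mem_power (v : V) : ExteriorAlgebra.ι k v ∈ ⋀[k]^1 V := by
  rw [ExteriorAlgebra.exteriorPower, pow_one]
  exact ⟨v, rfl⟩

/-- The map `x ↦ t ∧ f x` of determinant lines defined by a linear map `f : V → W` and an element
`t` of the `r`-th exterior power of `W`, where `dim W = dim V + r`. -/
def detMap (f : V →ₗ[k] W) (r : ℕ) (t : ExteriorAlgebra k W) (ht : t ∈ ⋀[k]^r W)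
    (h : finrank k W = r + finrank k V) : Det k V →ₗ[k] Det k W :=
  LinearMap.restrict (p := ⋀[k]^(finrank k V) V) (q := ⋀[k]^(finrank k W) W)
    ((LinearMap.mulLeft k t).comp (ExteriorAlgebra.map f).toLinearMap) fun x hx => by
    change t * ExteriorAlgebra.map f x ∈ ⋀[k]^(finrank k W) W
    rw [h]
    exact mul_mem_power ht (map_mem_power f hx)

theorem coe_detMap (f : V →ₗ[k] W) (r : ℕ) (t : ExteriorAlgebra k W) (ht : t ∈ ⋀[k]^r W)
    (h : finrank k W = r + finrank k V) (x : Det k V) :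
    (detMap f r t ht h x).val = t * ExteriorAlgebra.map f x.val := rfl

/-- The product `Det U ⊗ Det V → Det W` defined by linear maps `f : U → W`, `g : V → W`. -/
def detMul (f : U →ₗ[k] W) (g : V →ₗ[k] W) (h : finrank k W = finrank k U + finrank k V) :
    Det k U →ₗ[k] Det k V →ₗ[k] Det k W :=
  restrict₂ (LinearMap.compl₁₂ (LinearMap.mul k (ExteriorAlgebra k W))
      (ExteriorAlgebra.map f).toLinearMap (ExteriorAlgebra.map g).toLinearMap)
      (⋀[k]^(finrank k U) U) (⋀[k]^(finrank k V) V) (⋀[k]^(finrank k W) W)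
    fun x hx y hy => by
      change ExteriorAlgebra.map f x * ExteriorAlgebra.map g y ∈ ⋀[k]^(finrank k W) W
      rw [h]
      exact mul_mem_power (map_mem_power f hx) (map_mem_power g hy)

theorem coe_detMul (f : U →ₗ[k] W) (g : V →ₗ[k] W) (h : finrank k W = finrank k U + finrank k V)
    (x : Det k U) (y : Det k V) : (detMul f g h x y).val =
      ExteriorAlgebra.map f x.val * ExteriorAlgebra.map g y.val := rfl

theorem ι_mul_det [FiniteDimensional k V] (v : V) (x : Det k V) :
    ExteriorAlgebra.ι k v * x.val = 0 := by
  have h1 : ExteriorAlgebra.ι k v * x.val ∈ ⋀[k]^(1 + finrank k V) V :=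
    mul_mem_power (ι_mem_power v) x.val_mem
  have h2 : finrank k (⋀[k]^(1 + finrank k V) V) = 0 := by
    rw [exteriorPower.finrank_eq]
    exact Nat.choose_eq_zero_of_lt (by omega)
  have h3 : ⋀[k]^(1 + finrank k V) V = ⊥ := Submodule.finrank_eq_zero.1 h2
  rw [h3] at h1
  exact (Submodule.mem_bot k).1 h1

end Determinants

/-! ### Ribbon graphs -/

/-- A connected ribbon graph with all vertices of valence at least three and with the set of legs
identified with `I`. The vertices are the cycles of the permutation `rot`, which gives the cyclic
order on the flags of every vertex; the edges and the legs are the orbits of the involution `opp`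
with two and with one element. -/
structure RibbonGraph (I : Type) where
  /-- the set of flags -/
  Flag : Type
  [fintype : Fintype Flag]
  /-- the next flag in the cyclic order at the same vertex -/
  rot : Perm Flag
  /-- the other half of the edge containing the flag, or the flag itself if it is a leg -/
  opp : Perm Flag
  /-- the marking of the legs -/
  leg : I ↪ Flag
  opp_opp : ∀ x, opp (opp x) = x
  opp_eq_self_iff : ∀ x, opp x = x ↔ x ∈ Set.range leg
  nonempty : Nonempty Flag
  connected : ∀ S : Set Flag, S.Nonempty → (∀ x ∈ S, rot x ∈ S ∧ opp x ∈ S) → S = Set.univ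
  stable : ∀ x, rot x ≠ x ∧ rot (rot x) ≠ x

namespace RibbonGraph

attribute [instance] RibbonGraph.fintype

variable (k : Type u) [Field k] {I J : Type}

/-- The first homology of the graph: `x f` is the coefficient of the edge of the flag `f`, oriented
away from the vertex of `f`. The second condition says that the boundary vanishes, in the form that
it pairs to zero with all functions on the set of vertices. -/
def H1 (G : RibbonGraph I) : Submodule k (G.Flag → k) where
  carrier := {x | (∀ f, x (G.opp f) = - x f) ∧
    ∀ u : G.Flag → k, (∀ f, u (G.rot f) = u f) → ∑ f, u f * x f = 0}
  zero_mem' := by simp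
  add_mem' {x y} hx hy := by
    refine ⟨fun f => ?_, fun u hu => ?_⟩
    · simp only [Pi.add_apply, hx.1, hy.1]
      ring
    · simp only [Pi.add_apply, mul_add, Finset.sum_add_distrib, hx.2 u hu, hy.2 u hu, add_zero]
  smul_mem' c x hx := by
    refine ⟨fun f => ?_, fun u hu => ?_⟩
    · simp only [Pi.smul_apply, smul_eq_mul, hx.1]
      ring
    · simp only [Pi.smul_apply, smul_eq_mul, mul_left_comm _ c, ← Finset.mul_sum, hx.2 u hu,
        mul_zero]

/-- The first Betti number `b(G) = dim H_1(G)`. -/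
def betti (G : RibbonGraph I) : ℕ := finrank k (G.H1 k)

/-- The space `k ^ Vert(G)` of functions on the set of vertices, considered as functions of a flag
that depend only on its vertex. -/
def VertFun (G : RibbonGraph I) : Submodule k (G.Flag → k) where
  carrier := {u | ∀ f, u (G.rot f) = u f}
  zero_mem' := by simp
  add_mem' {x y} hx hy := fun f => by simp only [Pi.add_apply, hx f, hy f]
  smul_mem' c x hx := fun f => by simp only [Pi.smul_apply, hx f]

/-- The space `H_1(G) ⊕ k ^ Flag(G) ⊕ k ^ Vert(G)`. -/
abbrev Vec (G : RibbonGraph I) := G.H1 k × (G.Flag → k) × G.VertFun k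

/-- The orientation line `Det (H_1(G)) ⊗ Det (Flag(G)) ⊗ Det (Vert(G))`, which is, up to an even
shift of degrees, the line `Det (H_1(G)) ⊗ ⨂_v Det (Leg(v))[-3]`: the flags of `v` together with `v`
itself give the factor of `v`. -/
abbrev Orient (G : RibbonGraph I) := Det k (G.Vec k)

/-- The number of vertices. -/
def numVertices (G : RibbonGraph I) : ℕ := Nat.card (Quotient (Perm.SameCycle.setoid G.rot))

variable {k}

theorem mem_H1 {G : RibbonGraph I} {x : G.Flag → k} : x ∈ G.H1 k ↔ (∀ f, x (G.opp f) = - x f) ∧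
    ∀ u : G.Flag → k, (∀ f, u (G.rot f) = u f) → ∑ f, u f * x f = 0 := Iff.rfl

theorem mem_VertFun {G : RibbonGraph I} {u : G.Flag → k} :
    u ∈ G.VertFun k ↔ ∀ f, u (G.rot f) = u f := Iff.rfl

theorem opp_leg (G : RibbonGraph I) (i : I) : G.opp (G.leg i) = G.leg i :=
  (G.opp_eq_self_iff _).2 ⟨i, rfl⟩

theorem H1_leg [CharZero k] {G : RibbonGraph I} (x : G.H1 k) (i : I) : x.1 (G.leg i) = 0 := by
  have h := x.2.1 (G.leg i)
  rw [G.opp_leg] at h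
  exact self_eq_neg.1 h

theorem VertFun_sameCycle {K : Type*} {G : RibbonGraph I} {u : G.Flag → K} (hu : ∀ f, u (G.rot f) = u f)
    {x y : G.Flag} (h : G.rot.SameCycle x y) : u x = u y := by
  obtain ⟨n, rfl⟩ := h.exists_nat_pow_eq
  clear h
  induction n with
  | zero => rfl
  | succ n ih => rw [pow_succ', Perm.mul_apply, hu, ih]

variable (k)

/-! Isomorphisms of ribbon graphs. -/

/-- Isomorphisms of ribbon graphs with marked legs. -/
structure Iso (G G' : RibbonGraph I) where
  /-- the bijection of the sets of flags -/
  equiv : G.Flag ≃ G'.Flag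
  map_rot : ∀ x, equiv (G.rot x) = G'.rot (equiv x)
  map_opp : ∀ x, equiv (G.opp x) = G'.opp (equiv x)
  map_leg : ∀ i, equiv (G.leg i) = G'.leg i

variable {G G' : RibbonGraph I}

/-- The inverse isomorphism. -/
def Iso.symm (h : Iso G G') : Iso G' G where
  equiv := h.equiv.symm
  map_rot x := by rw [Equiv.symm_apply_eq, h.map_rot, Equiv.apply_symm_apply]
  map_opp x := by rw [Equiv.symm_apply_eq, h.map_opp, Equiv.apply_symm_apply]
  map_leg i := by rw [Equiv.symm_apply_eq, h.map_leg]

theorem Iso.comp_mem_H1 (h : Iso G G') {x : G'.Flag → k} (hx : x ∈ G'.H1 k) :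
    (fun f => x (h.equiv f)) ∈ G.H1 k := by
  refine ⟨fun f => ?_, fun u hu => ?_⟩
  · change x (h.equiv (G.opp f)) = - x (h.equiv f)
    rw [h.map_opp, hx.1]
  · rw [← Equiv.sum_comp h.equiv.symm]
    simp only [Equiv.apply_symm_apply]
    refine hx.2 (fun f => u (h.equiv.symm f)) fun f => ?_
    have := h.symm.map_rot f
    change h.equiv.symm _ = G.rot (h.equiv.symm f) at this
    rw [this, hu]

/-- The map induced by an isomorphism on the first homology. -/
def Iso.mapH1 (h : Iso G G') : G.H1 k ≃ₗ[k] G'.H1 k where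
  toFun x := ⟨fun f => x.1 (h.equiv.symm f), h.symm.comp_mem_H1 k x.2⟩
  invFun x := ⟨fun f => x.1 (h.equiv f), h.comp_mem_H1 k x.2⟩
  map_add' _ _ := rfl
  map_smul' _ _ := rfl
  left_inv x := by ext; simp
  right_inv x := by ext; simp

/-- The map induced by an isomorphism on functions on the set of vertices. -/
def Iso.mapVertFun (h : Iso G G') : G.VertFun k ≃ₗ[k] G'.VertFun k where
  toFun x := ⟨fun f => x.1 (h.equiv.symm f), fun f => by
    have := h.symm.map_rot f
    change h.equiv.symm _ = G.rot (h.equiv.symm f) at this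
    change x.1 (h.equiv.symm (G'.rot f)) = x.1 (h.equiv.symm f)
    rw [this, x.2]⟩
  invFun x := ⟨fun f => x.1 (h.equiv f), fun f => by
    change x.1 (h.equiv (G.rot f)) = x.1 (h.equiv f)
    rw [h.map_rot, x.2]⟩
  map_add' _ _ := rfl
  map_smul' _ _ := rfl
  left_inv x := by ext; simp
  right_inv x := by ext; simp

/-- The map induced by an isomorphism on `H_1(G) ⊕ k ^ Flag(G) ⊕ k ^ Vert(G)`. -/
def Iso.mapVec (h : Iso G G') : G.Vec k ≃ₗ[k] G'.Vec k :=
  (h.mapH1 k).prodCongr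
    ((LinearEquiv.funCongrLeft k k h.equiv.symm).prodCongr (h.mapVertFun k))

/-- The map induced by an isomorphism on orientation lines. -/
def Iso.mapOrient (h : Iso G G') : G.Orient k →ₗ[k] G'.Orient k :=
  detMap (h.mapVec k).toLinearMap 0 1 one_mem_power
    (by rw [zero_add]; exact (LinearEquiv.finrank_eq (h.mapVec k)).symm)

theorem Iso.coe_mapOrient (h : Iso G G') (x : G.Orient k) :
    (h.mapOrient k x).val = ExteriorAlgebra.map (h.mapVec k).toLinearMap x.val := by
  rw [Iso.mapOrient, coe_detMap, one_mul]

end RibbonGraph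

/-! ### The underlying space of the twisted Feynman transform -/

section Chains

variable (k : Type u) [Field k] (I : Type) (b : ℕ)

/-- Formal linear combinations of ribbon graphs with legs marked by `I` and with `b(G) = b`, with
coefficients in the orientation lines. -/
abbrev RawChain :=
  DirectSum {G : RibbonGraph I // G.betti k = b} fun G => G.1.Orient k

/-- The subspace generated by the identifications `(G, α) ~ (G', h α)`, for `h : G ≃ G'`. -/
def isoRel : Submodule k (RawChain k I b) :=
  Submodule.span k {x | ∃ (G G' : {G : RibbonGraph I // G.betti k = b})
    (h : RibbonGraph.Iso G.1 G'.1) (α : G.1.Orient k),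
      x = DirectSum.lof k _ (fun G : {G : RibbonGraph I // G.betti k = b} => G.1.Orient k) G α -
        DirectSum.lof k _ (fun G : {G : RibbonGraph I // G.betti k = b} => G.1.Orient k) G'
          (h.mapOrient k α)}

/-- The component `((I, b))` of the twisted Feynman transform: the direct sum over the isomorphism
classes of ribbon graphs of the coinvariants of the automorphism groups in the orientation lines. -/
abbrev Chain := RawChain k I b ⧸ isoRel k I b

variable {k I b}

/-- The class `(G, α)` of a ribbon graph with an element of its orientation line. -/
def Chain.mk (G : RibbonGraph I) (hG : G.betti k = b) : G.Orient k →ₗ[k] Chain k I b :=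
  (isoRel k I b).mkQ.comp
    (DirectSum.lof k _ (fun G : {G : RibbonGraph I // G.betti k = b} => G.1.Orient k) ⟨G, hG⟩)

theorem Chain.mk_mapOrient {G G' : RibbonGraph I} (hG : G.betti k = b) (hG' : G'.betti k = b)
    (h : RibbonGraph.Iso G G') (α : G.Orient k) :
    Chain.mk G' hG' (h.mapOrient k α) = Chain.mk G hG α := by
  symm
  rw [← sub_eq_zero]
  refine Eq.trans (map_sub (isoRel k I b).mkQ _ _).symm ?_
  rw [Submodule.mkQ_apply, Submodule.Quotient.mk_eq_zero]
  exact Submodule.subset_span ⟨⟨G, hG⟩, ⟨G', hG'⟩, h, α, rfl⟩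

/-- Linear maps out of the space of chains. -/
def Chain.lift {M : Type v} [AddCommGroup M] [Module k M]
    (F : ∀ G : RibbonGraph I, G.betti k = b → (G.Orient k →ₗ[k] M))
    (hF : ∀ G G' hG hG' (h : RibbonGraph.Iso G G') (α : G.Orient k),
      F G' hG' (h.mapOrient k α) = F G hG α) : Chain k I b →ₗ[k] M :=
  (isoRel k I b).liftQ (DirectSum.toModule k _ M fun G => F G.1 G.2) <| by
    refine Submodule.span_le.2 ?_
    rintro _ ⟨G, G', h, α, rfl⟩
    rw [SetLike.mem_coe, LinearMap.mem_ker, map_sub, DirectSum.toModule_lof,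
      DirectSum.toModule_lof, hF G.1 G'.1 G.2 G'.2 h α, sub_self]

theorem Chain.lift_mk {M : Type v} [AddCommGroup M] [Module k M]
    (F : ∀ G : RibbonGraph I, G.betti k = b → (G.Orient k →ₗ[k] M))
    (hF : ∀ G G' hG hG' (h : RibbonGraph.Iso G G') (α : G.Orient k),
      F G' hG' (h.mapOrient k α) = F G hG α) (G : RibbonGraph I) (hG : G.betti k = b)
    (α : G.Orient k) : Chain.lift F hF (Chain.mk G hG α) = F G hG α := by
  refine (Submodule.liftQ_apply _ _ _).trans ?_
  rw [DirectSum.toModule_lof]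

theorem Chain.hom_ext {M : Type v} [AddCommGroup M] [Module k M] {f g : Chain k I b →ₗ[k] M}
    (h : ∀ (G : RibbonGraph I) (hG : G.betti k = b) (α : G.Orient k),
      f (Chain.mk G hG α) = g (Chain.mk G hG α)) : f = g := by
  refine Submodule.linearMap_qext _ ?_
  refine DirectSum.linearMap_ext k fun G => ?_
  ext α
  exact h G.1 G.2 α

variable (k I b)

/-- The chains of degree `d`: the degree of `(G, α)` is `∑_v (n(v) - 3) - b(G)`. -/
def chainGrade (d : ℤ) : Submodule k (Chain k I b) :=
  Submodule.span k {x | ∃ (G : RibbonGraph I) (hG : G.betti k = b) (α : G.Orient k),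
    (Fintype.card G.Flag : ℤ) - 3 * G.numVertices - b = d ∧ x = Chain.mk G hG α}

end Chains

/-! ### Operations on ribbon graphs -/

namespace RibbonGraph

variable (k : Type u) [Field k] {I J : Type}

/-! Relabelling of the legs. -/

/-- The same graph with legs marked through the bijection `e`. -/
abbrev relabel (e : I ≃ J) (G : RibbonGraph I) : RibbonGraph J where
  Flag := G.Flag
  rot := G.rot
  opp := G.opp
  leg := e.symm.toEmbedding.trans G.leg
  opp_opp := G.opp_opp
  opp_eq_self_iff x := by
    rw [G.opp_eq_self_iff]
    constructor
    · rintro ⟨i, rfl⟩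
      exact ⟨e i, by simp⟩
    · rintro ⟨j, rfl⟩
      exact ⟨e.symm j, rfl⟩
  nonempty := G.nonempty
  connected := G.connected
  stable := G.stable

/-- The isomorphism of relabelled graphs given by an isomorphism. -/
def Iso.relabel {G G' : RibbonGraph I} (h : Iso G G') (e : I ≃ J) :
    Iso (G.relabel e) (G'.relabel e) where
  equiv := h.equiv
  map_rot := h.map_rot
  map_opp := h.map_opp
  map_leg j := h.map_leg (e.symm j)

/-- The identity map between the orientation lines of a graph and of the relabelled graph. -/
def relabelOrient (e : I ≃ J) (G : RibbonGraph I) : G.Orient k →ₗ[k] (G.relabel e).Orient k :=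
  LinearMap.id (M := G.Orient k)

/-! Gluing of two legs of one graph. -/

/-- The graph obtained by joining the legs `f = some none` and `f' = none` to an edge. -/
abbrev glue (G : RibbonGraph (Option (Option I))) : RibbonGraph I where
  Flag := G.Flag
  rot := G.rot
  opp := G.opp * swap (G.leg (some none)) (G.leg none)
  leg := (inclTwo I).trans G.leg
  opp_opp x := by
    simp only [Perm.mul_apply]
    by_cases h1 : x = G.leg (some none)
    · subst h1
      rw [swap_apply_left, G.opp_leg, swap_apply_right, G.opp_leg]
    by_cases h2 : x = G.leg none
    · subst h2
      rw [swap_apply_right, G.opp_leg, swap_apply_left, G.opp_leg]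
    rw [swap_apply_of_ne_of_ne h1 h2, swap_apply_of_ne_of_ne, G.opp_opp]
    · intro h
      rw [← G.opp_leg, G.opp.injective.eq_iff] at h
      exact h1 h
    · intro h
      rw [← G.opp_leg, G.opp.injective.eq_iff] at h
      exact h2 h
  opp_eq_self_iff x := by
    rw [Perm.mul_apply]
    constructor
    · intro h
      by_cases h1 : x = G.leg (some none)
      · subst h1
        rw [swap_apply_left, G.opp_leg, G.leg.injective.eq_iff] at h
        simp at h
      by_cases h2 : x = G.leg none
      · subst h2
        rw [swap_apply_right, G.opp_leg, G.leg.injective.eq_iff] at h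
        simp at h
      rw [swap_apply_of_ne_of_ne h1 h2, G.opp_eq_self_iff] at h
      obtain ⟨i, rfl⟩ := h
      match i with
      | none => exact absurd rfl h2
      | some none => exact absurd rfl h1
      | some (some i) => exact ⟨i, rfl⟩
    · rintro ⟨i, rfl⟩
      have hi : ((inclTwo I).trans G.leg) i = G.leg (some (some i)) := rfl
      rw [hi, swap_apply_of_ne_of_ne, G.opp_leg]
      · simp
      · simp
  nonempty := G.nonempty
  connected S hS h := by
    refine G.connected S hS fun x hx => ⟨(h x hx).1, ?_⟩
    have h3 := (h x hx).2
    rw [Perm.mul_apply] at h3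
    by_cases h1 : x = G.leg (some none)
    · rw [h1, G.opp_leg, ← h1]
      exact hx
    by_cases h2 : x = G.leg none
    · rw [h2, G.opp_leg, ← h2]
      exact hx
    rwa [swap_apply_of_ne_of_ne h1 h2] at h3
  stable := G.stable

variable {k}

section Glue

variable (G : RibbonGraph (Option (Option I)))

theorem glue_opp_some_none : G.glue.opp (G.leg (some none)) = G.leg none := by
  change G.opp (swap (G.leg (some none)) (G.leg none) (G.leg (some none))) = _
  rw [swap_apply_left, G.opp_leg]

theorem glue_opp_none : G.glue.opp (G.leg none) = G.leg (some none) := by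
  change G.opp (swap (G.leg (some none)) (G.leg none) (G.leg none)) = _
  rw [swap_apply_right, G.opp_leg]

theorem glue_opp_of_ne {x : G.Flag} (h1 : x ≠ G.leg (some none)) (h2 : x ≠ G.leg none) :
    G.glue.opp x = G.opp x := by
  change G.opp (swap (G.leg (some none)) (G.leg none) x) = _
  rw [swap_apply_of_ne_of_ne h1 h2]

theorem mem_H1_glue [CharZero k] {x : G.Flag → k} (hx : x ∈ G.H1 k) : x ∈ G.glue.H1 k := by
  refine ⟨fun f => ?_, hx.2⟩
  have e1 := H1_leg ⟨x, hx⟩ (some none)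
  have e2 := H1_leg ⟨x, hx⟩ none
  change x _ = 0 at e1 e2
  by_cases h1 : f = G.leg (some none)
  · subst h1
    refine (congrArg x G.glue_opp_some_none).trans ?_
    rw [e1, e2, neg_zero]
  by_cases h2 : f = G.leg none
  · subst h2
    refine (congrArg x G.glue_opp_none).trans ?_
    rw [e1, e2, neg_zero]
  rw [G.glue_opp_of_ne h1 h2]
  exact hx.1 f

theorem mem_H1_of_glue {x : G.Flag → k} (hx : x ∈ G.glue.H1 k) (h0 : x (G.leg (some none)) = 0) :
    x ∈ G.H1 k := by
  refine ⟨fun f => ?_, hx.2⟩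
  have h0' : x (G.leg none) = 0 := by
    have h := hx.1 (G.leg (some none))
    rw [h0, neg_zero] at h
    exact (congrArg x G.glue_opp_some_none).symm.trans h
  by_cases h1 : f = G.leg (some none)
  · subst h1
    rw [G.opp_leg, h0, neg_zero]
  by_cases h2 : f = G.leg none
  · subst h2
    rw [G.opp_leg, h0', neg_zero]
  rw [← G.glue_opp_of_ne h1 h2]
  exact hx.1 f

/-- There is a cycle in the glued graph that passes once through the new edge, in the direction
from `f` to `f'`. -/
theorem exists_loop (k : Type u) [Field k] [CharZero k] :
    ∃ x : G.glue.H1 k, x.1 (G.leg (some none)) = 1 := by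
  have hne : G.leg (some none) ≠ G.leg none := by simp
  let S : Set G.Flag := {g | ∃ x : G.Flag → k, (∀ f, x (G.opp f) = - x f) ∧
    ∀ u : G.Flag → k, (∀ f, u (G.rot f) = u f) → ∑ f, u f * x f = u g - u (G.leg (some none))}
  have hS : S = Set.univ := by
    refine G.connected S ⟨G.leg (some none), 0, by simp, by simp⟩ ?_
    rintro g ⟨x, hx1, hx2⟩
    refine ⟨⟨x, hx1, fun u hu => by rw [hx2 u hu, hu]⟩,
      ⟨x + (Pi.single (G.opp g) 1 - Pi.single g 1), fun f => ?_, fun u hu => ?_⟩⟩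
    · have e1 : G.opp f = G.opp g ↔ f = g := G.opp.injective.eq_iff
      have e2 : G.opp f = g ↔ f = G.opp g :=
        ⟨fun h => by rw [← h, G.opp_opp], fun h => by rw [h, G.opp_opp]⟩
      simp only [Pi.add_apply, Pi.sub_apply, Pi.single_apply, e1, e2, hx1]
      ring
    · simp [mul_add, mul_sub, Finset.sum_add_distrib, hx2 u hu, Pi.single_apply]
  obtain ⟨x, hx1, hx2⟩ : G.leg none ∈ S := hS ▸ Set.mem_univ _
  have h0 : ∀ i, x (G.leg i) = 0 := by
    intro i
    have h := hx1 (G.leg i)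
    rw [G.opp_leg] at h
    exact self_eq_neg.1 h
  refine ⟨⟨x + (Pi.single (G.leg (some none)) 1 - Pi.single (G.leg none) 1), fun f => ?_,
    fun u hu => ?_⟩, ?_⟩
  · by_cases h1 : f = G.leg (some none)
    · subst h1
      refine (congrArg _ G.glue_opp_some_none).trans ?_
      simp [h0]
    by_cases h2 : f = G.leg none
    · subst h2
      refine (congrArg _ G.glue_opp_none).trans ?_
      simp [h0]
    rw [G.glue_opp_of_ne h1 h2]
    have h3 : G.opp f ≠ G.leg (some none) := fun h => h1 (by rw [← G.opp_opp f, h, G.opp_leg])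
    have h4 : G.opp f ≠ G.leg none := fun h => h2 (by rw [← G.opp_opp f, h, G.opp_leg])
    simp [h1, h2, h3, h4, hx1]
  · simp [mul_add, mul_sub, Finset.sum_add_distrib, hx2 u hu, Pi.single_apply]
  · simp [h0]

/-- A cycle in the glued graph that passes once through the new edge, in the direction from `f` to
`f'`. -/
def loop (k : Type u) [Field k] [CharZero k] : G.glue.H1 k := Classical.choose (G.exists_loop k)

theorem loop_apply [CharZero k] : (G.loop k).1 (G.leg (some none)) = 1 :=
  Classical.choose_spec (G.exists_loop k)

/-- The inclusion of `H_1(G)` in the first homology of the glued graph. -/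
def glueH1 (k : Type u) [Field k] [CharZero k] : G.H1 k →ₗ[k] G.glue.H1 k where
  toFun x := ⟨x.1, G.mem_H1_glue x.2⟩
  map_add' _ _ := rfl
  map_smul' _ _ := rfl

/-- The splitting of the first homology of the glued graph. -/
def glueH1Equiv (k : Type u) [Field k] [CharZero k] : G.glue.H1 k ≃ₗ[k] k × G.H1 k where
  toFun x := (x.1 (G.leg (some none)), ⟨(x - x.1 (G.leg (some none)) • G.loop k).1, by
    refine G.mem_H1_of_glue (x - x.1 (G.leg (some none)) • G.loop k).2 ?_
    simp [G.loop_apply]⟩)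
  invFun y := y.1 • G.loop k + G.glueH1 k y.2
  map_add' x y := by
    refine Prod.ext rfl (Subtype.ext ?_)
    ext f
    simp [add_mul]
    ring
  map_smul' c x := by
    refine Prod.ext rfl (Subtype.ext ?_)
    ext f
    simp [mul_sub, mul_assoc]
  left_inv x := by
    refine Subtype.ext ?_
    ext f
    simp [glueH1]
  right_inv y := by
    have h : (y.1 • G.loop k + G.glueH1 k y.2).1 (G.leg (some none)) = y.1 := by
      have := H1_leg y.2 (some none)
      simp [glueH1, G.loop_apply, this]
    refine Prod.ext h (Subtype.ext ?_)
    ext f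
    simp only [h]
    simp [glueH1]

theorem betti_glue [CharZero k] : G.glue.betti k = G.betti k + 1 := by
  rw [betti, LinearEquiv.finrank_eq (G.glueH1Equiv k), finrank_prod, finrank_self, betti, add_comm]

/-- The inclusion of `H_1(G) ⊕ k ^ Flag(G) ⊕ k ^ Vert(G)` in the same space for the glued graph. -/
def glueVec (k : Type u) [Field k] [CharZero k] : G.Vec k →ₗ[k] G.glue.Vec k :=
  (G.glueH1 k).prodMap (LinearMap.id (M := (G.Flag → k) × G.VertFun k))

theorem finrank_vec_glue [CharZero k] :
    finrank k (G.glue.Vec k) = 1 + finrank k (G.Vec k) := by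
  have h1 : finrank k (G.glue.Vec k) = finrank k (G.glue.H1 k) +
    finrank k ((G.Flag → k) × G.VertFun k) := finrank_prod
  have h2 : finrank k (G.Vec k) = finrank k (G.H1 k) +
    finrank k ((G.Flag → k) × G.VertFun k) := finrank_prod
  have h3 := betti_glue (k := k) G
  rw [betti, betti] at h3
  omega

/-- The map `α ↦ e_{f f'} ∧ α` from the orientation line of a graph to the orientation line of the
glued graph, where `e_{f f'}` is the class of the new edge, oriented from `f` to `f'`. -/
def glueOrient (k : Type u) [Field k] [CharZero k] : G.Orient k →ₗ[k] G.glue.Orient k :=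
  detMap (G.glueVec k) 1 (ExteriorAlgebra.ι k (G.loop k, 0, 0)) (ι_mem_power _) G.finrank_vec_glue

/-- The map does not depend on the choice of the loop. -/
theorem glueOrient_eq [CharZero k] (y : G.glue.H1 k) (hy : y.1 (G.leg (some none)) = 1)
    (α : G.Orient k) : (G.glueOrient k α).val =
      ExteriorAlgebra.ι k ((y, 0, 0) : G.glue.Vec k) * ExteriorAlgebra.map (G.glueVec k) α.val := by
  rw [glueOrient, coe_detMap]
  have hmem : (G.loop k - y).1 ∈ G.H1 k := by
    refine G.mem_H1_of_glue (G.loop k - y).2 ?_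
    simp [hy, G.loop_apply]
  have h : ((G.loop k, 0, 0) : G.glue.Vec k) =
      (y, 0, 0) + G.glueVec k (⟨(G.loop k - y).1, hmem⟩, 0, 0) := by
    refine Prod.ext (Subtype.ext ?_) (Prod.ext ?_ ?_)
    · ext f
      change (G.loop k).1 f = y.1 f + ((G.loop k).1 f - y.1 f)
      ring
    · exact (add_zero (0 : G.Flag → k)).symm
    · exact (add_zero (0 : G.VertFun k)).symm
  rw [h, map_add, add_mul, ← ExteriorAlgebra.map_apply_ι, ← map_mul, ι_mul_det, map_zero, add_zero]

end Glue

/-- The isomorphism of glued graphs given by an isomorphism. -/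
def Iso.glue {G G' : RibbonGraph (Option (Option I))} (h : Iso G G') : Iso G.glue G'.glue where
  equiv := h.equiv
  map_rot := h.map_rot
  map_opp x := by
    change h.equiv (G.opp (swap (G.leg (some none)) (G.leg none) x)) =
      G'.opp (swap (G'.leg (some none)) (G'.leg none) (h.equiv x))
    rw [h.map_opp, ← h.map_leg, ← h.map_leg, h.equiv.injective.swap_apply]
  map_leg i := h.map_leg (some (some i))

theorem Iso.glueOrient [CharZero k] {G G' : RibbonGraph (Option (Option I))} (h : Iso G G')
    (α : G.Orient k) :
    G'.glueOrient k (h.mapOrient k α) = h.glue.mapOrient k (G.glueOrient k α) := by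
  apply Det.val_injective
  have hy : (h.glue.mapH1 k (G.loop k)).1 (G'.leg (some none)) = 1 := by
    change (G.loop k).1 (h.equiv.symm (G'.leg (some none))) = 1
    rw [← h.map_leg, Equiv.symm_apply_apply, G.loop_apply]
  rw [G'.glueOrient_eq (h.glue.mapH1 k (G.loop k)) hy, Iso.coe_mapOrient, Iso.coe_mapOrient,
    G.glueOrient_eq (G.loop k) G.loop_apply, map_mul, ExteriorAlgebra.map_apply_ι]
  refine congrArg₂ (· * ·) (congrArg _ ?_) ?_
  · refine Prod.ext rfl (Prod.ext ?_ ?_)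
    · exact (map_zero (LinearEquiv.funCongrLeft k k h.equiv.symm)).symm
    · exact (map_zero (h.glue.mapVertFun k)).symm
  · rw [← AlgHom.comp_apply, ← AlgHom.comp_apply, ExteriorAlgebra.map_comp_map,
      ExteriorAlgebra.map_comp_map]
    rfl

end RibbonGraph

namespace RibbonGraph

/-! Gluing of legs of two graphs. -/

section Comp

variable {k : Type u} [Field k] {I J : Type}

/-- The marking of the legs of the composition of two graphs. -/
abbrev compLeg (G : RibbonGraph (Option I)) (G' : RibbonGraph (Option J)) :
    I ⊕ J ↪ G.Flag ⊕ G'.Flag :=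
  ⟨Sum.map (fun i => G.leg (some i)) (fun j => G'.leg (some j)), Sum.map_injective.2
    ⟨G.leg.injective.comp (Option.some_injective _),
      G'.leg.injective.comp (Option.some_injective _)⟩⟩

/-- The graph obtained from two graphs by joining the leg `f = none` of the first one and the leg
`f' = none` of the second one to an edge. -/
abbrev comp (G : RibbonGraph (Option I)) (G' : RibbonGraph (Option J)) : RibbonGraph (I ⊕ J) where
  Flag := G.Flag ⊕ G'.Flag
  rot := Perm.sumCongr G.rot G'.rot
  opp := Perm.sumCongr G.opp G'.opp * swap (Sum.inl (G.leg none)) (Sum.inr (G'.leg none))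
  leg := compLeg G G'
  opp_opp x := by
    simp only [Perm.mul_apply]
    by_cases h1 : x = Sum.inl (G.leg none)
    · subst h1
      simp [G.opp_leg, G'.opp_leg]
    by_cases h2 : x = Sum.inr (G'.leg none)
    · subst h2
      simp [G.opp_leg, G'.opp_leg]
    rw [swap_apply_of_ne_of_ne h1 h2, swap_apply_of_ne_of_ne]
    · rcases x with x | x <;> simp [G.opp_opp, G'.opp_opp]
    · rcases x with x | x
      · intro h
        have h : G.opp x = G.leg none := by simpa using h
        exact h1 (by rw [← G.opp_opp x, h, G.opp_leg])
      · simp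
    · rcases x with x | x
      · simp
      · intro h
        have h : G'.opp x = G'.leg none := by simpa using h
        exact h2 (by rw [← G'.opp_opp x, h, G'.opp_leg])
  opp_eq_self_iff x := by
    rw [Perm.mul_apply]
    constructor
    · intro h
      by_cases h1 : x = Sum.inl (G.leg none)
      · subst h1
        simp at h
      by_cases h2 : x = Sum.inr (G'.leg none)
      · subst h2
        simp at h
      rw [swap_apply_of_ne_of_ne h1 h2] at h
      rcases x with x | x
      · have h : G.opp x = x := by simpa using h
        obtain ⟨i, rfl⟩ := (G.opp_eq_self_iff x).1 h
        cases i with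
        | none => exact absurd rfl h1
        | some i => exact ⟨Sum.inl i, rfl⟩
      · have h : G'.opp x = x := by simpa using h
        obtain ⟨i, rfl⟩ := (G'.opp_eq_self_iff x).1 h
        cases i with
        | none => exact absurd rfl h2
        | some i => exact ⟨Sum.inr i, rfl⟩
    · rintro ⟨i | i, rfl⟩
      · change Perm.sumCongr G.opp G'.opp (swap _ _ (Sum.inl (G.leg (some i)))) = _
        rw [swap_apply_of_ne_of_ne (by simp) (by simp)]
        simp [G.opp_leg]
      · change Perm.sumCongr G.opp G'.opp (swap _ _ (Sum.inr (G'.leg (some i)))) = _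
        rw [swap_apply_of_ne_of_ne (by simp) (by simp)]
        simp [G'.opp_leg]
  nonempty := ⟨Sum.inl (G.leg none)⟩
  connected S hS h := by
    have hl : ∀ x, Sum.inl x ∈ S → Sum.inl (G.rot x) ∈ S ∧ Sum.inl (G.opp x) ∈ S := by
      intro x hx
      refine ⟨(h _ hx).1, ?_⟩
      by_cases h1 : x = G.leg none
      · rwa [h1, G.opp_leg, ← h1]
      have h2 := (h _ hx).2
      rwa [Perm.mul_apply, swap_apply_of_ne_of_ne (by simpa using h1) (by simp)] at h2
    have hr : ∀ x, Sum.inr x ∈ S → Sum.inr (G'.rot x) ∈ S ∧ Sum.inr (G'.opp x) ∈ S := by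
      intro x hx
      refine ⟨(h _ hx).1, ?_⟩
      by_cases h1 : x = G'.leg none
      · rwa [h1, G'.opp_leg, ← h1]
      have h2 := (h _ hx).2
      rwa [Perm.mul_apply, swap_apply_of_ne_of_ne (by simp) (by simpa using h1)] at h2
    have hl' : (∃ x, Sum.inl x ∈ S) → ∀ x, Sum.inl x ∈ S := fun hx x =>
      Set.eq_univ_iff_forall.1 (G.connected {x | Sum.inl x ∈ S} hx hl) x
    have hr' : (∃ x, Sum.inr x ∈ S) → ∀ x, Sum.inr x ∈ S := fun hx x =>
      Set.eq_univ_iff_forall.1 (G'.connected {x | Sum.inr x ∈ S} hx hr) x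
    have hlr : Sum.inl (G.leg none) ∈ S → Sum.inr (G'.leg none) ∈ S := by
      intro hx
      have h2 := (h _ hx).2
      rw [Perm.mul_apply, swap_apply_left] at h2
      simpa [G'.opp_leg] using h2
    have hrl : Sum.inr (G'.leg none) ∈ S → Sum.inl (G.leg none) ∈ S := by
      intro hx
      have h2 := (h _ hx).2
      rw [Perm.mul_apply, swap_apply_right] at h2
      simpa [G.opp_leg] using h2
    refine Set.eq_univ_iff_forall.2 ?_
    obtain ⟨x | x, hx⟩ := hS
    · have h1 := hl' ⟨x, hx⟩
      have h2 := hr' ⟨_, hlr (h1 _)⟩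
      rintro (y | y)
      · exact h1 y
      · exact h2 y
    · have h2 := hr' ⟨x, hx⟩
      have h1 := hl' ⟨_, hrl (h2 _)⟩
      rintro (y | y)
      · exact h1 y
      · exact h2 y
  stable x := by
    rcases x with x | x
    · simpa using G.stable x
    · simpa using G'.stable x

variable (G : RibbonGraph (Option I)) (G' : RibbonGraph (Option J))

theorem comp_opp_inl (x : G.Flag) (h : x ≠ G.leg none) :
    (G.comp G').opp (Sum.inl x) = Sum.inl (G.opp x) := by
  rw [Perm.mul_apply, swap_apply_of_ne_of_ne (by simpa using h) (by simp)]
  rfl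

theorem comp_opp_inr (x : G'.Flag) (h : x ≠ G'.leg none) :
    (G.comp G').opp (Sum.inr x) = Sum.inr (G'.opp x) := by
  rw [Perm.mul_apply, swap_apply_of_ne_of_ne (by simp) (by simpa using h)]
  rfl

theorem comp_opp_inl_none : (G.comp G').opp (Sum.inl (G.leg none)) = Sum.inr (G'.leg none) := by
  rw [Perm.mul_apply, swap_apply_left, Perm.sumCongr_apply, Sum.map_inr, G'.opp_leg]

theorem comp_opp_inr_none : (G.comp G').opp (Sum.inr (G'.leg none)) = Sum.inl (G.leg none) := by
  rw [Perm.mul_apply, swap_apply_right, Perm.sumCongr_apply, Sum.map_inl, G.opp_leg]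

theorem elim_mem_H1 [CharZero k] {x : G.Flag → k} {y : G'.Flag → k} (hx : x ∈ G.H1 k)
    (hy : y ∈ G'.H1 k) : Sum.elim x y ∈ (G.comp G').H1 k := by
  have e1 := H1_leg ⟨x, hx⟩ none
  have e2 := H1_leg ⟨y, hy⟩ none
  change x _ = 0 at e1
  change y _ = 0 at e2
  refine ⟨?_, fun u hu => ?_⟩
  · rintro (f | f)
    · by_cases h : f = G.leg none
      · subst h
        rw [comp_opp_inl_none]
        simp [e1, e2]
      · rw [G.comp_opp_inl G' f h]
        exact hx.1 f
    · by_cases h : f = G'.leg none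
      · subst h
        rw [comp_opp_inr_none]
        simp [e1, e2]
      · rw [G.comp_opp_inr G' f h]
        exact hy.1 f
  · rw [Fintype.sum_sum_type]
    simp only [Sum.elim_inl, Sum.elim_inr]
    rw [hx.2 (fun f => u (Sum.inl f)) fun f => hu (Sum.inl f),
      hy.2 (fun f => u (Sum.inr f)) fun f => hu (Sum.inr f), add_zero]

/-- No cycle passes through a separating edge. -/
theorem H1_comp_none [CharZero k] {z : G.Flag ⊕ G'.Flag → k} (hz : z ∈ (G.comp G').H1 k) :
    z (Sum.inl (G.leg none)) = 0 := by
  have h1 : ∑ f, z (Sum.inl f) = 0 := by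
    have := hz.2 (Sum.elim 1 0) (by rintro (f | f) <;> rfl)
    simpa [Fintype.sum_sum_type] using this
  have h2 : ∑ f, (z (Sum.inl f) + z (Sum.inl (G.opp f))) = 2 * z (Sum.inl (G.leg none)) := by
    rw [Finset.sum_eq_single (G.leg none)]
    · rw [G.opp_leg]
      ring
    · intro f _ hf
      rw [← G.comp_opp_inl G' f hf, hz.1]
      ring
    · simp
  rw [Finset.sum_add_distrib, Equiv.sum_comp G.opp (fun f => z (Sum.inl f)), h1, add_zero] at h2
  simpa using h2.symm

theorem mem_H1_of_comp [CharZero k] {z : G.Flag ⊕ G'.Flag → k} (hz : z ∈ (G.comp G').H1 k) :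
    (fun f => z (Sum.inl f)) ∈ G.H1 k ∧ (fun f => z (Sum.inr f)) ∈ G'.H1 k := by
  have e1 := G.H1_comp_none G' hz
  have e2 : z (Sum.inr (G'.leg none)) = 0 := by
    rw [← G.comp_opp_inl_none G', hz.1, e1, neg_zero]
  refine ⟨⟨fun f => ?_, fun u hu => ?_⟩, ⟨fun f => ?_, fun u hu => ?_⟩⟩
  · by_cases h : f = G.leg none
    · subst h
      simp [G.opp_leg, e1]
    · change z (Sum.inl (G.opp f)) = - z (Sum.inl f)
      rw [← G.comp_opp_inl G' f h, hz.1]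
  · have := hz.2 (Sum.elim u 0) (by
      rintro (f | f)
      · exact hu f
      · rfl)
    simpa [Fintype.sum_sum_type] using this
  · by_cases h : f = G'.leg none
    · subst h
      simp [G'.opp_leg, e2]
    · change z (Sum.inr (G'.opp f)) = - z (Sum.inr f)
      rw [← G.comp_opp_inr G' f h, hz.1]
  · have := hz.2 (Sum.elim 0 u) (by
      rintro (f | f)
      · rfl
      · exact hu f)
    simpa [Fintype.sum_sum_type] using this

/-- The splitting of the first homology of the composition of two graphs. -/
def compH1Equiv (k : Type u) [Field k] [CharZero k] :
    (G.H1 k × G'.H1 k) ≃ₗ[k] (G.comp G').H1 k where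
  toFun x := ⟨Sum.elim x.1.1 x.2.1, G.elim_mem_H1 G' x.1.2 x.2.2⟩
  invFun z := (⟨_, (G.mem_H1_of_comp G' z.2).1⟩, ⟨_, (G.mem_H1_of_comp G' z.2).2⟩)
  map_add' x y := by
    refine Subtype.ext ?_
    ext (f | f) <;> rfl
  map_smul' c x := by
    refine Subtype.ext ?_
    ext (f | f) <;> rfl
  left_inv x := rfl
  right_inv z := by
    refine Subtype.ext ?_
    ext (f | f) <;> rfl

/-- The splitting of the space of functions on the set of flags of the composition. -/
def compFlagEquiv (k : Type u) [Field k] :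
    ((G.Flag → k) × (G'.Flag → k)) ≃ₗ[k] ((G.comp G').Flag → k) :=
  (LinearEquiv.sumArrowLequivProdArrow G.Flag G'.Flag k k).symm

/-- The splitting of the space of functions on the set of vertices of the composition. -/
def compVertFunEquiv (k : Type u) [Field k] :
    (G.VertFun k × G'.VertFun k) ≃ₗ[k] (G.comp G').VertFun k where
  toFun x := ⟨Sum.elim x.1.1 x.2.1, by
    rintro (f | f)
    · exact x.1.2 f
    · exact x.2.2 f⟩
  invFun z := (⟨fun f => z.1 (Sum.inl f), fun f => z.2 (Sum.inl f)⟩,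
    ⟨fun f => z.1 (Sum.inr f), fun f => z.2 (Sum.inr f)⟩)
  map_add' x y := by
    refine Subtype.ext ?_
    ext (f | f) <;> rfl
  map_smul' c x := by
    refine Subtype.ext ?_
    ext (f | f) <;> rfl
  left_inv x := rfl
  right_inv z := by
    refine Subtype.ext ?_
    ext (f | f) <;> rfl

theorem betti_comp [CharZero k] : (G.comp G').betti k = G.betti k + G'.betti k := by
  rw [betti, ← LinearEquiv.finrank_eq (G.compH1Equiv G' k), finrank_prod, betti, betti]

theorem finrank_vec (G : RibbonGraph I) : finrank k (G.Vec k) =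
    G.betti k + (Fintype.card G.Flag + finrank k (G.VertFun k)) := by
  have h : finrank k ((G.Flag → k) × G.VertFun k) =
    finrank k (G.Flag → k) + finrank k (G.VertFun k) := finrank_prod
  rw [Module.finrank_fintype_fun_eq_card] at h
  rw [← h]
  exact finrank_prod

theorem finrank_vec_comp [CharZero k] : finrank k ((G.comp G').Vec k) =
    finrank k (G.Vec k) + finrank k (G'.Vec k) := by
  have h1 := G.betti_comp (k := k) G'
  have h3 := LinearEquiv.finrank_eq (G.compVertFunEquiv G' k)
  rw [finrank_prod] at h3
  rw [finrank_vec, finrank_vec, finrank_vec, Fintype.card_sum]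
  omega

/-- The inclusion of `H_1(G) ⊕ k ^ Flag(G) ⊕ k ^ Vert(G)` for the first graph. -/
def compInl (k : Type u) [Field k] [CharZero k] : G.Vec k →ₗ[k] (G.comp G').Vec k :=
  ((G.compH1Equiv G' k).toLinearMap.comp (LinearMap.inl k _ _)).prodMap
    (((G.compFlagEquiv G' k).toLinearMap.comp (LinearMap.inl k _ _)).prodMap
      ((G.compVertFunEquiv G' k).toLinearMap.comp (LinearMap.inl k _ _)))

/-- The inclusion of `H_1(G) ⊕ k ^ Flag(G) ⊕ k ^ Vert(G)` for the second graph. -/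
def compInr (k : Type u) [Field k] [CharZero k] : G'.Vec k →ₗ[k] (G.comp G').Vec k :=
  ((G.compH1Equiv G' k).toLinearMap.comp (LinearMap.inr k _ _)).prodMap
    (((G.compFlagEquiv G' k).toLinearMap.comp (LinearMap.inr k _ _)).prodMap
      ((G.compVertFunEquiv G' k).toLinearMap.comp (LinearMap.inr k _ _)))

/-- The product of orientation lines, which belongs to the gluing of the legs of two graphs. -/
def compOrient (k : Type u) [Field k] [CharZero k] :
    G.Orient k →ₗ[k] G'.Orient k →ₗ[k] (G.comp G').Orient k :=
  detMul (G.compInl G' k) (G.compInr G' k) (G.finrank_vec_comp G')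

variable {G G'}

/-- The isomorphism of compositions given by isomorphisms. -/
def Iso.comp {K : RibbonGraph (Option I)} {K' : RibbonGraph (Option J)} (h : Iso G K)
    (h' : Iso G' K') : Iso (G.comp G') (K.comp K') where
  equiv := Equiv.sumCongr h.equiv h'.equiv
  map_rot := by
    rintro (x | x)
    · exact congrArg Sum.inl (h.map_rot x)
    · exact congrArg Sum.inr (h'.map_rot x)
  map_opp x := by
    have key : ∀ y, Equiv.sumCongr h.equiv h'.equiv (Perm.sumCongr G.opp G'.opp y) =
        Perm.sumCongr K.opp K'.opp (Equiv.sumCongr h.equiv h'.equiv y) := by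
      rintro (x | x)
      · exact congrArg Sum.inl (h.map_opp x)
      · exact congrArg Sum.inr (h'.map_opp x)
    rw [Perm.mul_apply, Perm.mul_apply, key, ← (Equiv.injective _).swap_apply]
    simp [h.map_leg, h'.map_leg]
  map_leg := by
    rintro (i | i)
    · exact congrArg Sum.inl (h.map_leg _)
    · exact congrArg Sum.inr (h'.map_leg _)

theorem Iso.compOrient [CharZero k] {K : RibbonGraph (Option I)} {K' : RibbonGraph (Option J)}
    (h : Iso G K) (h' : Iso G' K') (α : G.Orient k) (β : G'.Orient k) :
    K.compOrient K' k (h.mapOrient k α) (h'.mapOrient k β) =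
      (h.comp h').mapOrient k (G.compOrient G' k α β) := by
  apply Det.val_injective
  rw [Iso.coe_mapOrient, RibbonGraph.compOrient, RibbonGraph.compOrient, coe_detMul, coe_detMul,
    Iso.coe_mapOrient, Iso.coe_mapOrient, map_mul]
  simp only [← AlgHom.comp_apply, ExteriorAlgebra.map_comp_map]
  have e1 : (K.compInl K' k).comp (h.mapVec k).toLinearMap =
      ((h.comp h').mapVec k).toLinearMap.comp (G.compInl G' k) := by
    refine LinearMap.ext fun x => Prod.ext (Subtype.ext ?_) (Prod.ext ?_ (Subtype.ext ?_)) <;>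
    · ext (f | f) <;> rfl
  have e2 : (K.compInr K' k).comp (h'.mapVec k).toLinearMap =
      ((h.comp h').mapVec k).toLinearMap.comp (G.compInr G' k) := by
    refine LinearMap.ext fun x => Prod.ext (Subtype.ext ?_) (Prod.ext ?_ (Subtype.ext ?_)) <;>
    · ext (f | f) <;> rfl
  rw [e1, e2]

end Comp

end RibbonGraph

namespace RibbonGraph

/-! Expansion of a vertex to an edge. -/

theorem map_mul_map {k : Type u} [Field k] {V W V' W' : Type u} [AddCommGroup V] [AddCommGroup W]
    [AddCommGroup V'] [AddCommGroup W'] [Module k V] [Module k W] [Module k V'] [Module k W']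
    {f : V →ₗ[k] W} {f' : V' →ₗ[k] W'} {a : V →ₗ[k] V'} {b : W →ₗ[k] W'}
    (h : f'.comp a = b.comp f) {t : ExteriorAlgebra k W} {t' : ExteriorAlgebra k W'}
    (ht : ExteriorAlgebra.map b t = t') (x : ExteriorAlgebra k V) :
    t' * ExteriorAlgebra.map f' (ExteriorAlgebra.map a x) =
      ExteriorAlgebra.map b (t * ExteriorAlgebra.map f x) := by
  rw [map_mul, ht, ← AlgHom.comp_apply, ← AlgHom.comp_apply, ExteriorAlgebra.map_comp_map,
    ExteriorAlgebra.map_comp_map, h]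

theorem map_mul_three {k : Type u} [Field k] {W W' : Type u} [AddCommGroup W] [AddCommGroup W']
    [Module k W] [Module k W'] (b : W →ₗ[k] W') {x y z : W} {x' y' z' : W'} (hx : b x = x')
    (hy : b y = y') (hz : b z = z') : ExteriorAlgebra.map b
      (ExteriorAlgebra.ι k x * ExteriorAlgebra.ι k y * ExteriorAlgebra.ι k z) =
      ExteriorAlgebra.ι k x' * ExteriorAlgebra.ι k y' * ExteriorAlgebra.ι k z' := by
  rw [map_mul, map_mul, ExteriorAlgebra.map_apply_ι, ExteriorAlgebra.map_apply_ι,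
    ExteriorAlgebra.map_apply_ι, hx, hy, hz]

section Expand

variable {k : Type u} [Field k] {I : Type}

/-- A pair `(p, q)` of flags at the same vertex that cuts the set of flags of the vertex in two arcs
`p, …, rot⁻¹ q` and `q, …, rot⁻¹ p`, which have at least two elements. -/
abbrev Chord (G : RibbonGraph I) : Type := {c : G.Flag × G.Flag //
  G.rot.SameCycle c.1 c.2 ∧ c.1 ≠ c.2 ∧ G.rot c.1 ≠ c.2 ∧ G.rot c.2 ≠ c.1}

variable {G : RibbonGraph I}

/-- The rotation of the expanded graph, up to the exchange of the two new flags. -/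
def Chord.insert (c : G.Chord) : Perm (G.Flag ⊕ Bool) :=
  swap (Sum.inl c.1.2) (Sum.inr false) * swap (Sum.inl c.1.1) (Sum.inr true) *
    Perm.sumCongr G.rot 1

/-- The rotation of the expanded graph: the vertex is replaced by two vertices, with flags
`p, …, rot⁻¹ q, e'` and `q, …, rot⁻¹ p, e''` in this cyclic order, where `e' = inr false` and
`e'' = inr true`. -/
def Chord.rot (c : G.Chord) : Perm (G.Flag ⊕ Bool) :=
  c.insert * swap (Sum.inr false) (Sum.inr true)

theorem Chord.insert_inl (c : G.Chord) (y : G.Flag) : c.insert (Sum.inl y) =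
    if G.rot y = c.1.2 then Sum.inr false else if G.rot y = c.1.1 then Sum.inr true
    else Sum.inl (G.rot y) := by
  rw [Chord.insert, Perm.mul_apply, Perm.mul_apply, Perm.sumCongr_apply, Sum.map_inl]
  by_cases h1 : G.rot y = c.1.1
  · have h2 : ¬ G.rot y = c.1.2 := fun h => c.2.2.1 (h1.symm.trans h)
    rw [if_neg h2, if_pos h1, h1, swap_apply_left]
    exact swap_apply_of_ne_of_ne (by simp) (by simp)
  · have h3 : swap (Sum.inl c.1.1) (Sum.inr true) (Sum.inl (G.rot y) : G.Flag ⊕ Bool) =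
        Sum.inl (G.rot y) := swap_apply_of_ne_of_ne (by simpa using h1) (by simp)
    rw [h3, if_neg h1]
    split_ifs with h2
    · rw [h2, swap_apply_left]
    · exact swap_apply_of_ne_of_ne (by simpa using h2) (by simp)

theorem Chord.insert_false (c : G.Chord) : c.insert (Sum.inr false) = Sum.inl c.1.2 := by
  rw [Chord.insert, Perm.mul_apply, Perm.mul_apply, Perm.sumCongr_apply, Sum.map_inr]
  have h : swap (Sum.inl c.1.1) (Sum.inr true) (Sum.inr false : G.Flag ⊕ Bool) = Sum.inr false :=
    swap_apply_of_ne_of_ne (by simp) (by simp)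
  change swap _ _ (swap _ _ (Sum.inr false)) = _
  rw [h, swap_apply_right]

theorem Chord.insert_true (c : G.Chord) : c.insert (Sum.inr true) = Sum.inl c.1.1 := by
  rw [Chord.insert, Perm.mul_apply, Perm.mul_apply, Perm.sumCongr_apply, Sum.map_inr]
  change swap _ _ (swap _ _ (Sum.inr true)) = _
  rw [swap_apply_right, swap_apply_of_ne_of_ne (by simpa using c.2.2.1) (by simp)]

theorem Chord.rot_inl (c : G.Chord) (y : G.Flag) : c.rot (Sum.inl y) =
    if G.rot y = c.1.2 then Sum.inr false else if G.rot y = c.1.1 then Sum.inr true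
    else Sum.inl (G.rot y) := by
  rw [Chord.rot, Perm.mul_apply, swap_apply_of_ne_of_ne (by simp) (by simp), c.insert_inl]

theorem Chord.rot_false (c : G.Chord) : c.rot (Sum.inr false) = Sum.inl c.1.1 := by
  rw [Chord.rot, Perm.mul_apply, swap_apply_left, c.insert_true]

theorem Chord.rot_true (c : G.Chord) : c.rot (Sum.inr true) = Sum.inl c.1.2 := by
  rw [Chord.rot, Perm.mul_apply, swap_apply_right, c.insert_false]

theorem Chord.insert_sameCycle (c : G.Chord) :
    c.insert.SameCycle (Sum.inr false) (Sum.inr true) := by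
  have hstep : ∀ n : ℕ, c.insert.SameCycle (Sum.inr true) (Sum.inl ((G.rot ^ n) c.1.1)) := by
    intro n
    induction n with
    | zero =>
      rw [pow_zero, Perm.one_apply, ← c.insert_true]
      exact (Perm.SameCycle.refl _ _).apply_right
    | succ n ih =>
      rw [pow_succ', Perm.mul_apply]
      have h := ih.apply_right
      rw [c.insert_inl] at h
      split_ifs at h with h1 h2
      · have h := h.apply_right
        rwa [c.insert_false, ← h1] at h
      · rw [h2, ← c.insert_true]
        exact (Perm.SameCycle.refl _ _).apply_right
      · exact h
  obtain ⟨n, hn⟩ := c.2.1.exists_nat_pow_eq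
  have h := hstep n
  rw [hn, ← c.insert_false, Perm.sameCycle_apply_right] at h
  exact h.symm

/-- The two new flags are at different vertices. -/
theorem Chord.not_sameCycle (c : G.Chord) : ¬ c.rot.SameCycle (Sum.inr false) (Sum.inr true) :=
  not_sameCycle_mul_swap_of_sameCycle (by simp) c.insert_sameCycle

/-- The graph obtained from `G` by the expansion of a vertex to an edge with flags
`e' = inr false` and `e'' = inr true`. -/
abbrev expand (G : RibbonGraph I) (c : G.Chord) : RibbonGraph I where
  Flag := G.Flag ⊕ Bool
  rot := c.rot
  opp := Perm.sumCongr G.opp Equiv.boolNot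
  leg := G.leg.trans Function.Embedding.inl
  opp_opp := by
    rintro (x | x)
    · simp [G.opp_opp]
    · simp
  opp_eq_self_iff := by
    rintro (x | x)
    · simp [G.opp_eq_self_iff]
    · simp
  nonempty := ⟨Sum.inr false⟩
  connected S hS h := by
    have h1 : Sum.inr false ∈ S → Sum.inr true ∈ S := fun hx => by simpa using (h _ hx).2
    have h2 : Sum.inr true ∈ S → Sum.inr false ∈ S := fun hx => by simpa using (h _ hx).2
    have h3 : Sum.inr false ∈ S → Sum.inl c.1.1 ∈ S := fun hx => c.rot_false ▸ (h _ hx).1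
    have h4 : Sum.inr true ∈ S → Sum.inl c.1.2 ∈ S := fun hx => c.rot_true ▸ (h _ hx).1
    have hT : {x | Sum.inl x ∈ S} = Set.univ := by
      refine G.connected _ ?_ fun x hx => ⟨?_, ?_⟩
      · obtain ⟨x | x, hx⟩ := hS
        · exact ⟨x, hx⟩
        · cases x
          · exact ⟨_, h3 hx⟩
          · exact ⟨_, h4 hx⟩
      · have := (h _ hx).1
        rw [c.rot_inl] at this
        change Sum.inl (G.rot x) ∈ S
        split_ifs at this with e1 e2
        · rw [e1]
          exact h4 (h1 this)
        · rw [e2]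
          exact h3 (h2 this)
        · exact this
      · exact (h _ hx).2
    have hT' : ∀ x, Sum.inl x ∈ S := fun x => Set.eq_univ_iff_forall.1 hT x
    obtain ⟨y, hy⟩ := G.rot.surjective c.1.2
    have h5 : Sum.inr false ∈ S := by
      have := (h _ (hT' y)).1
      rwa [c.rot_inl, if_pos hy] at this
    refine Set.eq_univ_iff_forall.2 ?_
    rintro (x | x)
    · exact hT' x
    · cases x
      · exact h5
      · exact h1 h5
  stable := by
    rintro (x | x)
    · rw [c.rot_inl]
      split_ifs with h1 h2
      · refine ⟨by simp, ?_⟩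
        rw [c.rot_false]
        intro h
        exact c.2.2.2.1 (by rw [Sum.inl.inj h, h1])
      · refine ⟨by simp, ?_⟩
        rw [c.rot_true]
        intro h
        exact c.2.2.2.2 (by rw [Sum.inl.inj h, h2])
      · refine ⟨by simpa using (G.stable x).1, ?_⟩
        rw [c.rot_inl]
        split_ifs
        · simp
        · simp
        · simpa using (G.stable x).2
    · cases x
      · rw [c.rot_false, c.rot_inl, if_neg c.2.2.2.1, if_neg (G.stable _).1]
        simp
      · rw [c.rot_true, c.rot_inl, if_neg (G.stable _).1, if_neg c.2.2.2.2]
        simp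

variable (c : G.Chord)

variable (k) in
/-- The indicator function of the vertex of the expanded graph that contains the flag `e'`. -/
def Chord.newVertex : (G.expand c).VertFun k :=
  ⟨fun x => if c.rot.SameCycle (Sum.inr false) x then 1 else 0, fun x => by
    simp only [Perm.sameCycle_apply_right]⟩

theorem Chord.newVertex_false : (c.newVertex k).1 (Sum.inr false) = 1 :=
  if_pos (Perm.SameCycle.refl _ _)

theorem Chord.newVertex_true : (c.newVertex k).1 (Sum.inr true) = 0 :=
  if_neg c.not_sameCycle

variable (k) in
/-- The pullback of functions on the set of vertices along the contraction of the new edge. -/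
def Chord.vertFun : G.VertFun k →ₗ[k] (G.expand c).VertFun k where
  toFun u := ⟨Sum.elim u.1 fun b => if b then u.1 c.1.2 else u.1 c.1.1, by
    have h : u.1 c.1.1 = u.1 c.1.2 := VertFun_sameCycle u.2 c.2.1
    rintro (y | y)
    · rw [c.rot_inl]
      split_ifs with h1 h2
      · change u.1 c.1.1 = u.1 y
        rw [h, ← h1, u.2]
      · change u.1 c.1.2 = u.1 y
        rw [← h, ← h2, u.2]
      · exact u.2 y
    · cases y
      · rw [c.rot_false]
        rfl
      · rw [c.rot_true]
        rfl⟩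
  map_add' u v := by
    refine Subtype.ext ?_
    ext (y | y)
    · rfl
    · cases y <;> rfl
  map_smul' a u := by
    refine Subtype.ext ?_
    ext (y | y)
    · rfl
    · cases y <;> rfl

theorem Chord.restrict_mem {u : G.Flag ⊕ Bool → k} (hu : u ∈ (G.expand c).VertFun k)
    (h : u (Sum.inr false) = u (Sum.inr true)) : (fun x => u (Sum.inl x)) ∈ G.VertFun k := by
  intro y
  have h1 := hu (Sum.inl y)
  have h2 := hu (Sum.inr false)
  have h3 := hu (Sum.inr true)
  rw [c.rot_false] at h2
  rw [c.rot_true] at h3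
  rw [c.rot_inl] at h1
  change u (Sum.inl (G.rot y)) = u (Sum.inl y)
  split_ifs at h1 with e1 e2
  · rw [e1, h3, ← h, h1]
  · rw [e2, h2, h, h1]
  · exact h1

theorem Chord.restrict_sub_mem (u : (G.expand c).VertFun k) :
    (fun x => (u - (u.1 (Sum.inr false) - u.1 (Sum.inr true)) • c.newVertex k).1 (Sum.inl x)) ∈
      G.VertFun k := by
  refine c.restrict_mem (u - (u.1 (Sum.inr false) - u.1 (Sum.inr true)) • c.newVertex k).2 ?_
  change u.1 (Sum.inr false) - _ * (c.newVertex k).1 (Sum.inr false) =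
    u.1 (Sum.inr true) - _ * (c.newVertex k).1 (Sum.inr true)
  rw [c.newVertex_false, c.newVertex_true]
  ring

variable (k) in
/-- The splitting of the space of functions on the set of vertices of the expanded graph. -/
def Chord.vertFunEquiv : (k × G.VertFun k) ≃ₗ[k] (G.expand c).VertFun k :=
  LinearEquiv.ofBijective
    ((LinearMap.toSpanSingleton k _ (c.newVertex k)).coprod (c.vertFun k)) <| by
    have e (y : k × G.VertFun k) (x : G.Flag ⊕ Bool) :
      (((LinearMap.toSpanSingleton k _ (c.newVertex k)).coprod (c.vertFun k)) y).1 x =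
        y.1 * (c.newVertex k).1 x + (c.vertFun k y.2).1 x := rfl
    constructor
    · refine (injective_iff_map_eq_zero _).2 ?_
      rintro y hy
      have h0 : ∀ x, y.1 * (c.newVertex k).1 x + (c.vertFun k y.2).1 x = 0 := fun x => by
        rw [← e, hy]
        rfl
      have h1 := h0 (Sum.inr false)
      have h2 := h0 (Sum.inr true)
      rw [c.newVertex_false] at h1
      rw [c.newVertex_true] at h2
      change y.1 * 1 + y.2.1 c.1.1 = 0 at h1
      change y.1 * 0 + y.2.1 c.1.2 = 0 at h2
      have h3 : y.2.1 c.1.1 = y.2.1 c.1.2 := VertFun_sameCycle y.2.2 c.2.1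
      have h4 : y.1 = 0 := by linear_combination h1 - h2 - h3
      refine Prod.ext h4 (Subtype.ext (funext fun x => ?_))
      have h5 := h0 (Sum.inl x)
      rw [h4, zero_mul, zero_add] at h5
      exact h5
    · intro u
      refine ⟨(u.1 (Sum.inr false) - u.1 (Sum.inr true), ⟨_, c.restrict_sub_mem u⟩), ?_⟩
      refine Subtype.ext (funext fun x => ?_)
      rw [e]
      have h2 := u.2 (Sum.inr false)
      have h3 := u.2 (Sum.inr true)
      have h4 := (c.newVertex k).2 (Sum.inr false)
      have h5 := (c.newVertex k).2 (Sum.inr true)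
      rw [c.rot_false] at h2 h4
      rw [c.rot_true] at h3 h5
      rw [c.newVertex_false] at h4
      rw [c.newVertex_true] at h5
      rcases x with x | x
      · change _ + (u.1 (Sum.inl x) - _ * (c.newVertex k).1 (Sum.inl x)) = _
        ring
      · cases x
        · change _ + (u.1 (Sum.inl c.1.1) - _ * (c.newVertex k).1 (Sum.inl c.1.1)) = _
          rw [c.newVertex_false, h4, h2]
          ring
        · change _ + (u.1 (Sum.inl c.1.2) - _ * (c.newVertex k).1 (Sum.inl c.1.2)) = _
          rw [c.newVertex_true, h5, h3]
          ring

/-- The sum of the coefficients of `x` over the flags that belong to the vertex of `e'`. -/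
def Chord.flow (c : G.Chord) (x : G.Flag → k) : k :=
  ∑ g, (c.newVertex k).1 (Sum.inl g) * x g

theorem Chord.extend_mem {x : G.Flag → k} (hx : x ∈ G.H1 k) :
    (Sum.elim x fun b => if b then c.flow x else - c.flow x) ∈ (G.expand c).H1 k := by
  refine ⟨?_, fun u hu => ?_⟩
  · rintro (f | f)
    · exact hx.1 f
    · cases f
      · exact (neg_neg _).symm
      · rfl
  · obtain ⟨y, hy⟩ := (c.vertFunEquiv k).surjective ⟨u, hu⟩
    have e (z : G.Flag ⊕ Bool) :
        u z = y.1 * (c.newVertex k).1 z + (c.vertFun k y.2).1 z := by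
      have := congrArg (fun v : (G.expand c).VertFun k => v.1 z) hy
      exact this.symm
    have h1 := hx.2 y.2.1 y.2.2
    have h3 : y.2.1 c.1.1 = y.2.1 c.1.2 := VertFun_sameCycle y.2.2 c.2.1
    have e1 (f : G.Flag) : u (Sum.inl f) * x f =
        y.1 * ((c.newVertex k).1 (Sum.inl f) * x f) + y.2.1 f * x f := by
      rw [e]
      change (_ + y.2.1 f) * x f = _
      ring
    have e2 : u (Sum.inr false) = y.1 + y.2.1 c.1.1 := by
      rw [e, c.newVertex_false, mul_one]
      rfl
    have e3 : u (Sum.inr true) = y.2.1 c.1.2 := by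
      rw [e, c.newVertex_true, mul_zero, zero_add]
      rfl
    rw [Fintype.sum_sum_type]
    simp only [Sum.elim_inl, Sum.elim_inr, e1, Finset.sum_add_distrib, ← Finset.mul_sum, h1,
      Fintype.sum_bool, e2, e3, h3]
    change y.1 * c.flow x + 0 + (y.2.1 c.1.2 * c.flow x + _ * - c.flow x) = 0
    ring

theorem Chord.restrict_mem_H1 {z : G.Flag ⊕ Bool → k} (hz : z ∈ (G.expand c).H1 k) :
    (fun f => z (Sum.inl f)) ∈ G.H1 k := by
  refine ⟨fun f => hz.1 (Sum.inl f), fun u hu => ?_⟩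
  have h1 := hz.2 (c.vertFun k ⟨u, hu⟩).1 (c.vertFun k ⟨u, hu⟩).2
  have h2 : z (Sum.inr true) = - z (Sum.inr false) := hz.1 (Sum.inr false)
  have h3 : u c.1.1 = u c.1.2 := VertFun_sameCycle hu c.2.1
  rw [Fintype.sum_sum_type, Fintype.sum_bool, h2] at h1
  change ∑ f, u f * z (Sum.inl f) + (u c.1.2 * _ + u c.1.1 * _) = 0 at h1
  rw [h3] at h1
  linear_combination h1

theorem Chord.H1_false {z : G.Flag ⊕ Bool → k} (hz : z ∈ (G.expand c).H1 k) :
    z (Sum.inr false) = - c.flow fun f => z (Sum.inl f) := by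
  have h1 := hz.2 (c.newVertex k).1 (c.newVertex k).2
  rw [Fintype.sum_sum_type, Fintype.sum_bool, c.newVertex_false, c.newVertex_true] at h1
  change c.flow (fun f => z (Sum.inl f)) + _ = 0 at h1
  linear_combination h1

variable (k) in
/-- The isomorphism of the first homology induced by the contraction of the new edge, in the
opposite direction: the coefficient of the new edge is determined by the condition that the boundary
vanishes at the two new vertices. -/
def Chord.h1Equiv : G.H1 k ≃ₗ[k] (G.expand c).H1 k where
  toFun x := ⟨_, c.extend_mem x.2⟩
  invFun z := ⟨_, c.restrict_mem_H1 z.2⟩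
  map_add' x y := by
    have h : c.flow (x.1 + y.1) = c.flow x.1 + c.flow y.1 := by
      simp [Chord.flow, mul_add, Finset.sum_add_distrib]
    refine Subtype.ext (funext ?_)
    rintro (f | f)
    · rfl
    · cases f
      · change - c.flow (x.1 + y.1) = - c.flow x.1 + - c.flow y.1
        rw [h]
        ring
      · exact h
  map_smul' a x := by
    have h : c.flow (a • x.1) = a * c.flow x.1 := by
      simp only [Chord.flow, Finset.mul_sum, Pi.smul_apply, smul_eq_mul, mul_left_comm]
    refine Subtype.ext (funext ?_)
    rintro (f | f)
    · rfl
    · cases f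
      · change - c.flow (a • x.1) = a * - c.flow x.1
        rw [h]
        ring
      · exact h
  left_inv x := rfl
  right_inv z := by
    refine Subtype.ext (funext ?_)
    rintro (f | f)
    · rfl
    · cases f
      · exact (c.H1_false z.2).symm
      · refine Eq.trans ?_ (z.2.1 (Sum.inr false)).symm
        rw [c.H1_false z.2, neg_neg]
        rfl

theorem betti_expand : (G.expand c).betti k = G.betti k :=
  (LinearEquiv.finrank_eq (c.h1Equiv k)).symm

theorem finrank_vec_expand : finrank k ((G.expand c).Vec k) = 3 + finrank k (G.Vec k) := by
  have h1 := betti_expand (k := k) c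
  have h3 := LinearEquiv.finrank_eq (c.vertFunEquiv k)
  rw [finrank_prod, finrank_self] at h3
  rw [finrank_vec, finrank_vec, Fintype.card_sum, Fintype.card_bool]
  omega

variable (k) in
/-- The embedding of `H_1(G) ⊕ k ^ Flag(G) ⊕ k ^ Vert(G)` in the same space for the expanded
graph. -/
def Chord.vec : G.Vec k →ₗ[k] (G.expand c).Vec k :=
  (c.h1Equiv k).toLinearMap.prodMap
    (((LinearEquiv.sumArrowLequivProdArrow G.Flag Bool k k).symm.toLinearMap.comp
      (LinearMap.inl k _ _)).prodMap (c.vertFun k))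

variable (k) in
/-- The element `v' ∧ e' ∧ e''`, where `v'` is the vertex of `e'`. -/
def Chord.newElement : ExteriorAlgebra k ((G.expand c).Vec k) :=
  ExteriorAlgebra.ι k (0, 0, c.newVertex k) *
    ExteriorAlgebra.ι k (0, Pi.single (Sum.inr false) 1, 0) *
    ExteriorAlgebra.ι k (0, Pi.single (Sum.inr true) 1, 0)

theorem Chord.newElement_mem : c.newElement k ∈ ⋀[k]^3 ((G.expand c).Vec k) :=
  mul_mem_power (mul_mem_power (ι_mem_power _) (ι_mem_power _)) (ι_mem_power _)

variable (k) in
/-- The map `α ↦ v' ∧ e' ∧ e'' ∧ α` of orientation lines. -/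
def expandOrient : G.Orient k →ₗ[k] (G.expand c).Orient k :=
  detMap (c.vec k) 3 (c.newElement k) c.newElement_mem (finrank_vec_expand c)

/-! Isomorphisms. -/

variable {G' : RibbonGraph I}

theorem Iso.sameCycle (h : Iso G G') (x y : G.Flag) :
    G'.rot.SameCycle (h.equiv x) (h.equiv y) ↔ G.rot.SameCycle x y := by
  have e : h.equiv.permCongr G.rot = G'.rot := by
    ext z
    rw [Equiv.permCongr_apply, h.map_rot, Equiv.apply_symm_apply]
  rw [← e, sameCycle_permCongr]

/-- The bijection between chords given by an isomorphism. -/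
def Iso.chord (h : Iso G G') : G.Chord ≃ G'.Chord :=
  Equiv.subtypeEquiv (Equiv.prodCongr h.equiv h.equiv) fun c => by
    change _ ↔ G'.rot.SameCycle (h.equiv c.1) (h.equiv c.2) ∧ h.equiv c.1 ≠ h.equiv c.2 ∧
      G'.rot (h.equiv c.1) ≠ h.equiv c.2 ∧ G'.rot (h.equiv c.2) ≠ h.equiv c.1
    rw [h.sameCycle, ← h.map_rot, ← h.map_rot, h.equiv.injective.ne_iff, h.equiv.injective.ne_iff,
      h.equiv.injective.ne_iff]

/-- The isomorphism of expanded graphs given by an isomorphism. -/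
def Iso.expand (h : Iso G G') : Iso (G.expand c) (G'.expand (h.chord c)) where
  equiv := Equiv.sumCongr h.equiv (Equiv.refl Bool)
  map_rot := by
    rintro (x | x)
    · change _ = (h.chord c).rot (Sum.inl (h.equiv x))
      rw [c.rot_inl, (h.chord c).rot_inl]
      change _ = if G'.rot (h.equiv x) = h.equiv c.1.2 then _ else
        if G'.rot (h.equiv x) = h.equiv c.1.1 then _ else _
      rw [← h.map_rot]
      simp only [h.equiv.injective.eq_iff]
      split_ifs <;> rfl
    · cases x
      · change _ = (h.chord c).rot (Sum.inr false)
        rw [c.rot_false, (h.chord c).rot_false]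
        rfl
      · change _ = (h.chord c).rot (Sum.inr true)
        rw [c.rot_true, (h.chord c).rot_true]
        rfl
  map_opp := by
    rintro (x | x)
    · exact congrArg Sum.inl (h.map_opp x)
    · rfl
  map_leg i := congrArg Sum.inl (h.map_leg i)

theorem Iso.newVertex (h : Iso G G') :
    (h.expand c).mapVertFun k (c.newVertex k) = (h.chord c).newVertex k := by
  refine Subtype.ext (funext fun x => ?_)
  obtain ⟨x, rfl⟩ := (h.expand c).equiv.surjective x
  change (c.newVertex k).1 ((h.expand c).equiv.symm ((h.expand c).equiv x)) = _
  rw [Equiv.symm_apply_apply]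
  change (if _ then _ else _) = if (G'.expand (h.chord c)).rot.SameCycle
    ((h.expand c).equiv (Sum.inr false)) ((h.expand c).equiv x) then _ else _
  simp only [(h.expand c).sameCycle]

theorem Iso.vec_comp (h : Iso G G') : ((h.chord c).vec k).comp (h.mapVec k).toLinearMap =
    ((h.expand c).mapVec k).toLinearMap.comp (c.vec k) := by
  refine LinearMap.ext fun x => Prod.ext ?_ (Prod.ext ?_ (Subtype.ext ?_))
  · refine ((h.chord c).h1Equiv k).symm.injective ?_
    refine Eq.trans (LinearEquiv.symm_apply_apply _ _) ?_
    rfl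
  · ext (f | f) <;> rfl
  · ext (f | f)
    · rfl
    · cases f
      · exact congrArg x.2.2.1 (h.equiv.symm_apply_apply c.1.1)
      · exact congrArg x.2.2.1 (h.equiv.symm_apply_apply c.1.2)

theorem Iso.newElement (h : Iso G G') :
    ExteriorAlgebra.map ((h.expand c).mapVec k).toLinearMap (c.newElement k) =
      (h.chord c).newElement k := by
  have e1 (b : Bool) : LinearEquiv.funCongrLeft k k (h.expand c).equiv.symm
      (Pi.single (Sum.inr b) 1) = Pi.single (Sum.inr b) 1 := by
    funext x
    obtain ⟨x, rfl⟩ := (h.expand c).equiv.surjective x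
    change (Pi.single (Sum.inr b) 1 : G.Flag ⊕ Bool → k)
      ((h.expand c).equiv.symm ((h.expand c).equiv x)) = _
    rw [Equiv.symm_apply_apply]
    rcases x with x | x
    · rfl
    · change _ = (Pi.single (Sum.inr b) 1 : G'.Flag ⊕ Bool → k) (Sum.inr x)
      simp [Pi.single_apply]
  have e0 : (h.expand c).mapH1 k 0 = 0 := map_zero _
  have e2 : LinearEquiv.funCongrLeft k k (h.expand c).equiv.symm 0 = 0 := map_zero _
  have e3 : (h.expand c).mapVertFun k 0 = 0 := map_zero _
  exact map_mul_three _ (Prod.ext e0 (Prod.ext e2 (h.newVertex c)))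
    (Prod.ext e0 (Prod.ext (e1 false) e3)) (Prod.ext e0 (Prod.ext (e1 true) e3))

theorem Iso.expandOrient (h : Iso G G') (α : G.Orient k) :
    RibbonGraph.expandOrient k (h.chord c) (h.mapOrient k α) =
      (h.expand c).mapOrient k (RibbonGraph.expandOrient k c α) := by
  apply Det.val_injective
  rw [Iso.coe_mapOrient, RibbonGraph.expandOrient, RibbonGraph.expandOrient, coe_detMap,
    coe_detMap, Iso.coe_mapOrient]
  exact map_mul_map (h.vec_comp c) (h.newElement c) α.val

end Expand

end RibbonGraph

/-! ### The operations of the twisted Feynman transform -/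

/-- The identity isomorphism. -/
def RibbonGraph.Iso.refl {I : Type} (G : RibbonGraph I) : RibbonGraph.Iso G G where
  equiv := Equiv.refl _
  map_rot _ := rfl
  map_opp _ := rfl
  map_leg _ := rfl

section ChainOperations

variable (k : Type u) [Field k]

/-- The action of bijections: relabelling of the legs. -/
def chainMap {I J : Type} (e : I ≃ J) (b : ℕ) : Chain k I b →ₗ[k] Chain k J b :=
  Chain.lift (fun G hG => (Chain.mk (G.relabel e) hG).comp (G.relabelOrient k e))
    fun G G' hG hG' h α => by
      have hG1 : (G.relabel e).betti k = b := hG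
      have hG1' : (G'.relabel e).betti k = b := hG'
      exact Chain.mk_mapOrient hG1 hG1' (h.relabel e) (G.relabelOrient k e α)

theorem mapOrient_refl {I : Type} (G : RibbonGraph I) (α : G.Orient k) :
    (RibbonGraph.Iso.refl G).mapOrient k α = α := by
  apply Det.val_injective
  rw [RibbonGraph.Iso.coe_mapOrient]
  have h : ((RibbonGraph.Iso.refl G).mapVec k).toLinearMap = LinearMap.id := rfl
  rw [h, ExteriorAlgebra.map_id]
  rfl

variable [CharZero k]

/-- The loop composition `μ (e_{f f'} ⊗ -)`. -/
def chainLoop (I : Type) (b : ℕ) : Chain k (Option (Option I)) b →ₗ[k] Chain k I (b + 1) :=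
  Chain.lift (fun G hG => (Chain.mk G.glue (by rw [G.betti_glue, hG])).comp (G.glueOrient k))
    fun G G' hG hG' h α => by
      rw [LinearMap.comp_apply, LinearMap.comp_apply, h.glueOrient, Chain.mk_mapOrient]

theorem mk_comp {I J : Type} {b b' : ℕ} {G K : RibbonGraph (Option I)} {G' K' : RibbonGraph (Option J)}
    (hG : (G.comp G').betti k = b + b') (hK : (K.comp K').betti k = b + b')
    (h : RibbonGraph.Iso G K) (h' : RibbonGraph.Iso G' K') (α : G.Orient k) (β : G'.Orient k) :
    Chain.mk (K.comp K') hK (K.compOrient K' k (h.mapOrient k α) (h'.mapOrient k β)) =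
      Chain.mk (G.comp G') hG (G.compOrient G' k α β) := by
  rw [h.compOrient h', Chain.mk_mapOrient]

theorem betti_comp_eq {I J : Type} {b b' : ℕ} {G : RibbonGraph (Option I)} {G' : RibbonGraph (Option J)}
    (hG : G.betti k = b) (hG' : G'.betti k = b') : (G.comp G').betti k = b + b' := by
  rw [G.betti_comp, hG, hG']

/-- The composition of a given graph with all other graphs. -/
def compGraph {I J : Type} {b b' : ℕ} (G : RibbonGraph (Option I)) (hG : G.betti k = b)
    (α : G.Orient k) : Chain k (Option J) b' →ₗ[k] Chain k (I ⊕ J) (b + b') :=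
  Chain.lift
    (fun G' hG' => (Chain.mk (G.comp G') (betti_comp_eq k hG hG')).comp (G.compOrient G' k α))
    fun G' K' hG' hK' h' β => by
      have h := mk_comp k (betti_comp_eq k hG hG') (betti_comp_eq k hG hK')
        (RibbonGraph.Iso.refl G) h' α β
      rw [mapOrient_refl] at h
      exact h

theorem compGraph_mk {I J : Type} {b b' : ℕ} (G : RibbonGraph (Option I)) (hG : G.betti k = b)
    (α : G.Orient k) (G' : RibbonGraph (Option J)) (hG' : G'.betti k = b') (β : G'.Orient k) :
    compGraph k G hG α (Chain.mk G' hG' β) =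
      Chain.mk (G.comp G') (betti_comp_eq k hG hG') (G.compOrient G' k α β) :=
  Chain.lift_mk _ _ _ _ _

/-- The composition along a graph with two vertices and one edge. -/
def chainComp (I J : Type) (b b' : ℕ) :
    Chain k (Option I) b →ₗ[k] Chain k (Option J) b' →ₗ[k] Chain k (I ⊕ J) (b + b') :=
  Chain.lift
    (fun G hG =>
      { toFun := compGraph k G hG
        map_add' := fun α α' => Chain.hom_ext fun G' hG' β => by
          rw [LinearMap.add_apply]
          simp only [compGraph_mk, map_add, LinearMap.add_apply]
        map_smul' := fun c α => Chain.hom_ext fun G' hG' β => by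
          rw [LinearMap.smul_apply]
          simp only [compGraph_mk, map_smul, LinearMap.smul_apply, RingHom.id_apply] })
    fun G K hG hK h α => by
      refine Chain.hom_ext fun G' hG' β => ?_
      have h := mk_comp k (betti_comp_eq k hG hG') (betti_comp_eq k hK hG') h
        (RibbonGraph.Iso.refl G') α β
      rw [mapOrient_refl] at h
      change compGraph k K hK _ _ = compGraph k G hG _ _
      rw [compGraph_mk, compGraph_mk]
      exact h

theorem chainComp_mk {I J : Type} {b b' : ℕ} (G : RibbonGraph (Option I)) (hG : G.betti k = b)
    (α : G.Orient k) (G' : RibbonGraph (Option J)) (hG' : G'.betti k = b') (β : G'.Orient k) :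
    chainComp k I J b b' (Chain.mk G hG α) (Chain.mk G' hG' β) =
      Chain.mk (G.comp G') (betti_comp_eq k hG hG') (G.compOrient G' k α β) := by
  rw [chainComp, Chain.lift_mk]
  exact compGraph_mk k G hG α G' hG' β

/-- The differential: the sum over all the ways to expand a vertex to an edge, every one of which is
given by two chords, `(p, q)` and `(q, p)`. -/
def chainDiff (I : Type) (b : ℕ) : Chain k I b →ₗ[k] Chain k I b :=
  Chain.lift
    (fun G hG => (2 : k)⁻¹ • ∑ c : G.Chord,
      (Chain.mk (G.expand c) (by rw [RibbonGraph.betti_expand, hG])).comp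
        (RibbonGraph.expandOrient k c))
    fun G G' hG hG' h α => by
      simp only [LinearMap.smul_apply, LinearMap.sum_apply, LinearMap.comp_apply]
      rw [← Equiv.sum_comp h.chord]
      refine congrArg _ (Finset.sum_congr rfl fun c _ => ?_)
      rw [h.expandOrient, Chain.mk_mapOrient]

end ChainOperations

/-! ### Twisted modular `Det`-operads and their morphisms -/

/-- The collection of complexes `P((I, b))`, with the actions of bijections and with the compositions
along the graphs with one edge, that underlies a modular operad twisted by the cocycle
`Det(G) = Det(H_1(G))`. The compositions along the graphs with one edge, together with bijections,
generate all compositions. The axioms of an operad do not enter in the notion of a morphism, and are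
not a part of this structure, which serves only to organize the two operads constructed below.
* `comp` is the composition along the graph with two vertices and with one edge `f f'`, where
  `f = none` in `Option I = I ⊔ {f}` and `f' = none` in `Option J = J ⊔ {f'}`;
* `loop` is the value on `e_{f f'}`, the generator of `Det` of the graph with one vertex and one loop
  given by the orientation of the loop from `f` to `f'`, of the composition along this graph, where
  `f = some none` and `f' = none` in `Option (Option I) = I ⊔ {f, f'}`. -/
structure DetOperad (k : Type u) [Field k] where
  /-- the spaces `P((I, b))` -/
  obj : (I : Type) → [Finite I] → ℕ → Type v
  [addCommGroup : ∀ (I : Type) [Finite I] (b : ℕ), AddCommGroup (obj I b)]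
  [module : ∀ (I : Type) [Finite I] (b : ℕ), Module k (obj I b)]
  /-- the components of the grading -/
  grade : ∀ (I : Type) [Finite I] (b : ℕ), ℤ → Submodule k (obj I b)
  /-- the action of bijections -/
  map : ∀ {I J : Type} [Finite I] [Finite J], (I ≃ J) → ∀ b, obj I b →ₗ[k] obj J b
  /-- the composition along the graph with two vertices and one edge -/
  comp : ∀ (I J : Type) [Finite I] [Finite J] (b b' : ℕ),
    obj (Option I) b →ₗ[k] obj (Option J) b' →ₗ[k] obj (I ⊕ J) (b + b')
  /-- the composition along the graph with one vertex and one loop -/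
  loop : ∀ (I : Type) [Finite I] (b : ℕ), obj (Option (Option I)) b →ₗ[k] obj I (b + 1)
  /-- the differential -/
  diff : ∀ (I : Type) [Finite I] (b : ℕ), obj I b →ₗ[k] obj I b

attribute [instance] DetOperad.addCommGroup DetOperad.module

/-- A morphism of twisted modular `Det`-operads: a family of linear maps of degree zero that are
equivariant and commute with the compositions and with the differentials. -/
structure DetOperad.Hom {k : Type u} [Field k] (P : DetOperad.{u, v} k) (Q : DetOperad.{u, w} k) where
  /-- the components of the morphism -/
  app : ∀ (I : Type) [Finite I] (b : ℕ), P.obj I b →ₗ[k] Q.obj I b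
  app_grade : ∀ (I : Type) [Finite I] (b : ℕ) (d : ℤ), ∀ x ∈ P.grade I b d,
    app I b x ∈ Q.grade I b d
  app_map : ∀ (I J : Type) [Finite I] [Finite J] (e : I ≃ J) (b : ℕ) (x : P.obj I b),
    app J b (P.map e b x) = Q.map e b (app I b x)
  app_comp : ∀ (I J : Type) [Finite I] [Finite J] (b b' : ℕ) (x : P.obj (Option I) b)
    (y : P.obj (Option J) b'), app (I ⊕ J) (b + b') (P.comp I J b b' x y) =
      Q.comp I J b b' (app (Option I) b x) (app (Option J) b' y)
  app_loop : ∀ (I : Type) [Finite I] (b : ℕ) (x : P.obj (Option (Option I)) b),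
    app I (b + 1) (P.loop I b x) = Q.loop I b (app (Option (Option I)) b x)
  app_diff : ∀ (I : Type) [Finite I] (b : ℕ) (x : P.obj I b),
    app I b (P.diff I b x) = Q.diff I b (app I b x)

/-- The twisted modular `Det`-operad `S[t]`. The component `S[t]((I, b))` is concentrated in degree
`-b`. -/
abbrev symmetricOperad (k : Type u) [Field k] : DetOperad.{u, u} k where
  obj I _ b := SComp k I b
  grade _ _ b d := if d = -(b : ℤ) then ⊤ else ⊥
  map e b := sMap k e b
  comp I J _ _ b b' := sComp k I J b b'
  loop I _ b := sLoop k I b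
  diff _ _ _ := 0

/-- The twisted modular `Det`-operad `χ_0⁻¹ F Ass`, where `F Ass` is the Feynman transform of the
cyclic operad of associative algebras with scalar product. -/
abbrev feynmanAss (k : Type u) [Field k] [CharZero k] : DetOperad.{u, max 1 u} k where
  obj I _ b := Chain k I b
  grade I _ b d := chainGrade k I b d
  map e b := chainMap k e b
  comp I J _ _ b b' := chainComp k I J b b'
  loop I _ b := chainLoop k I b
  diff I _ b := chainDiff k I b

/-! ### Punctures and canonical orientations -/

namespace RibbonGraph

section Punctures

variable {I : Type} (G : RibbonGraph I)

/-- The permutation of flags whose cycles are the punctures of the surface of the graph: it goes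
along the boundary of the ribbon surface from a flag to the flag next to its opposite. -/
def face : Perm G.Flag := G.rot * G.opp

/-- All vertices have valence three. -/
def IsTrivalent : Prop := ∀ x, G.rot (G.rot (G.rot x)) = x

/-- For every puncture there is a leg adjacent to it. -/
def HasLegAtEveryPuncture : Prop := ∀ x, ∃ i, G.leg i ∈ cyc G.face x

/-- The permutation `σ_G` of the set of legs: the cyclic orders on the sets of legs adjacent to the
same puncture. -/
def legPerm : Perm I := erase G.leg G.face

variable (k : Type u) [Field k]

/-- The class in `H_1(G)` of the boundary of the ribbon surface at the puncture of the flag `x`. -/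
def faceClass (x : G.Flag) : G.H1 k :=
  ⟨fun f => (if f ∈ cyc G.face x then 1 else 0) - (if G.opp f ∈ cyc G.face x then 1 else 0), by
    refine ⟨fun f => ?_, fun u hu => ?_⟩
    · beta_reduce
      rw [G.opp_opp]
      ring
    · have h : ∀ f, G.opp f ∈ cyc G.face x ↔ G.rot f ∈ cyc G.face x := by
        intro f
        have e : G.rot f = G.face (G.opp f) := by rw [face, Perm.mul_apply, G.opp_opp]
        rw [e]
        exact (Perm.sameCycle_apply_right (f := G.face)).symm
      simp only [h, mul_sub, Finset.sum_sub_distrib]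
      rw [sub_eq_zero, ← Equiv.sum_comp G.rot]
      refine Finset.sum_congr rfl fun f _ => ?_
      rw [hu]⟩

/-- The valence of the vertex of the flag `x`. -/
def valence (x : G.Flag) : ℕ := Function.minimalPeriod G.rot x

/-- The contribution to the intersection index of two cycles of the vertex of `o`, which consists of
the flags `o, rot o, rot² o, …` in this cyclic order. -/
def localIntersection (x y : G.Flag → k) (o : G.Flag) : k :=
  ∑ j ∈ Finset.range (G.valence o), ∑ i ∈ Finset.range j,
    (x ((G.rot ^ i) o) * y ((G.rot ^ j) o) - x ((G.rot ^ j) o) * y ((G.rot ^ i) o))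

/-- The intersection index of two elements of `H_1(G)` on the surface of the graph. The contribution
of a vertex does not depend on the choice of the flag `Quotient.out v`. -/
def intersection (x y : G.H1 k) : k :=
  2⁻¹ * ∑ v : Quotient (Perm.SameCycle.setoid G.rot), G.localIntersection k x.1 y.1 v.out

/-- The indicator function of the vertex of the flag `x`. -/
def vertexFun (x : G.Flag) : G.VertFun k :=
  ⟨fun y => if G.rot.SameCycle x y then 1 else 0, fun y => by
    simp only [Perm.sameCycle_apply_right]⟩

/-- Auxiliary choices in the description of the canonical orientation, for a graph whose surface has
genus `γ`. -/
structure Framing (γ : ℕ) where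
  /-- a list of flags, one for every puncture -/
  punctures : List G.Flag
  isCycleList_face : IsCycleList G.face (punctures.map (cyc G.face))
  /-- a list of flags, one for every vertex -/
  vertices : List G.Flag
  isCycleList_rot : IsCycleList G.rot (vertices.map (cyc G.rot))
  genus_eq : 2 * γ + punctures.length = G.betti k + 1
  /-- the first half of a symplectic basis of the first homology of the closed surface -/
  a : Fin γ → G.H1 k
  /-- the second half of a symplectic basis of the first homology of the closed surface -/
  b : Fin γ → G.H1 k
  intersection_a_a : ∀ i j, G.intersection k (a i) (a j) = 0
  intersection_b_b : ∀ i j, G.intersection k (b i) (b j) = 0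
  intersection_a_b : ∀ i j, G.intersection k (a i) (b j) = if i = j then 1 else 0

variable {G k}

/-- The generator of the orientation line of a trivalent graph that is the product of the generator
of `Det (H_1(G))` and of the canonical elements of `Det (Leg(v))[-3]`.

The first factor corresponds, under the isomorphism of `Det (H_1(G))` with the determinant of the set
of punctures (shifted by `2 γ - 1`), to the wedge product `C_1 ∧ … ∧ C_ν` of the punctures in the
chosen order. The isomorphism comes from the exact sequence
`0 → H_2(Σ) → k ^ {C_1, …, C_ν} → H_1(G) → H_1(Σ) → 0` for the closed surface `Σ`, with the
fundamental class `C_1 + … + C_ν` as the generator of `H_2(Σ)`, and with the symplectic generator of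
`Det (H_1(Σ))`. -/
def Framing.element {γ : ℕ} (B : G.Framing k γ) : ExteriorAlgebra k (G.Vec k) :=
  (B.punctures.dropLast.map fun x => ExteriorAlgebra.ι k ((G.faceClass k x, 0, 0) : G.Vec k)).prod *
  (List.ofFn fun i => ExteriorAlgebra.ι k ((B.a i, 0, 0) : G.Vec k) *
    ExteriorAlgebra.ι k ((B.b i, 0, 0) : G.Vec k)).prod *
  (B.vertices.map fun x => ExteriorAlgebra.ι k ((0, 0, G.vertexFun k x) : G.Vec k) *
    ExteriorAlgebra.ι k ((0, Pi.single x 1, 0) : G.Vec k) *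
    ExteriorAlgebra.ι k ((0, Pi.single (G.rot x) 1, 0) : G.Vec k) *
    ExteriorAlgebra.ι k ((0, Pi.single (G.rot (G.rot x)) 1, 0) : G.Vec k)).prod

/-- The wedge product `C_1 ∧ … ∧ C_ν` of the cycles of `σ_G`, in the order of the punctures chosen
in the framing. -/
def Framing.legWedge {γ : ℕ} (B : G.Framing k γ) : Blocks k I :=
  wedge k (B.punctures.map fun x => G.leg ⁻¹' cyc G.face x)

end Punctures

end RibbonGraph

end RibbonOperad

end

/-! The orientation line of a ribbon graph is one-dimensional, so a linear map on it is determined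
by its value on one generator. The map `φ` is well defined if any change of the choices multiplies
the canonical orientation and the product of the cycles of `σ_G` by the same scalar
(`Framing.compare`). There are three kinds of choices. Punctures: the boundary classes have sum
zero, so the product of all of them but one, with the proper sign (`tailProd`), changes under
permutations as the product of all punctures does (`tailProd_perm`). Vertices: a trivalent vertex
contributes a product of four vectors, which is central and does not change when the three flags are
rotated. Symplectic bases: the boundary classes span the radical of the intersection form
(`ker_intersectionForm`), and the exponential of the contraction with the form provides a functional
that takes the value one on every product of a fixed basis of the radical with a symplectic family
(`exists_pfaffian`, `exists_functional_symplectic`).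

Compositions: gluing two legs multiplies the face permutation by a transposition of these legs, and
erasing the other flags commutes with this (`erase_mul_swap`, `erase_trans`), so the permutations of
legs compose as in `S[t]`. A puncture loses its last leg exactly when a cycle becomes empty. For the
orientations, the punctures of `f` and `f'` are listed first. When two graphs are joined, the merged
puncture is the omitted one and the products concatenate (`Framing.element_comp`). When a loop cuts
one puncture, the class of the new edge can be taken to be minus the boundary of the new puncture of
`f'` (`Framing.element_dissect`). When a loop joins two punctures, the class of the new edge and
minus the old boundary class of `f'` form a new symplectic pair (`Framing.element_sew`).

Differential: it is zero in `S[t]`, so `φ` has to annihilate boundaries. An expansion can be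
trivalent only if the expanded vertex has valence four, and then there are two ways to expand it,
exchanged by a rotation of the chord. The rotation matches the canonical orientations of the two
expansions, but it permutes the flags of the vertex by a 4-cycle, which is odd; so the two terms
cancel (`canonicalMap_expand_shift`).

Trivalent graphs have degree `-b`, and an Euler characteristic estimate places their values in the
stable range. Uniqueness holds because graphs with orientations span the chains. -/

noncomputable section

namespace RibbonOperad

open Equiv Module
open scoped Classical

universe u v w

set_option linter.unusedSectionVars false

/-! ### Products of vectors in exterior algebras -/

section ExteriorProducts

variable {k : Type u} [Field k] {V : Type v} {W : Type w} [AddCommGroup V] [Module k V]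
  [AddCommGroup W] [Module k W]

variable (k) in
/-- The product in the exterior algebra of a list of vectors. -/
def ιProd (L : List V) : ExteriorAlgebra k V := (L.map (ExteriorAlgebra.ι k)).prod

@[simp] theorem ιProd_nil : ιProd k ([] : List V) = 1 := rfl

@[simp] theorem ιProd_cons (v : V) (L : List V) :
    ιProd k (v :: L) = ExteriorAlgebra.ι k v * ιProd k L := by simp [ιProd]

theorem ιProd_append (L M : List V) : ιProd k (L ++ M) = ιProd k L * ιProd k M := by simp [ιProd]

theorem map_ιProd (f : V →ₗ[k] W) (L : List V) :
    ExteriorAlgebra.map f (ιProd k L) = ιProd k (L.map f) := by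
  induction L with
  | nil => simp
  | cons v L ih => rw [ιProd_cons, map_mul, ih, ExteriorAlgebra.map_apply_ι, List.map_cons, ιProd_cons]

theorem ι_mul_ι_eq_neg (v w : V) : ExteriorAlgebra.ι k v * ExteriorAlgebra.ι k w =
    - (ExteriorAlgebra.ι k w * ExteriorAlgebra.ι k v) :=
  eq_neg_of_add_eq_zero_left (ExteriorAlgebra.ι_add_mul_swap _ _)

theorem ιProd_mul_ι (L : List V) (v : V) : ιProd k L * ExteriorAlgebra.ι k v =
    (-1) ^ L.length * (ExteriorAlgebra.ι k v * ιProd k L) := by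
  induction L with
  | nil => simp
  | cons w L ih =>
    rw [ιProd_cons, mul_assoc, ih, List.length_cons, pow_succ, ← mul_assoc,
      ((Commute.neg_one_right (ExteriorAlgebra.ι k w)).pow_right _).eq, mul_assoc, ← mul_assoc
      (ExteriorAlgebra.ι k w), ι_mul_ι_eq_neg w v]
    simp [mul_assoc]

theorem ι_mul_ιProd (L : List V) (v : V) : ExteriorAlgebra.ι k v * ιProd k L =
    (-1) ^ L.length * (ιProd k L * ExteriorAlgebra.ι k v) := by
  rw [ιProd_mul_ι, ← mul_assoc, ← pow_add, Even.neg_one_pow ⟨_, rfl⟩, one_mul]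

theorem ι_mul_ιProd_of_mem {L : List V} {v : V} (h : v ∈ L) :
    ExteriorAlgebra.ι k v * ιProd k L = 0 := by
  induction L with
  | nil => simp at h
  | cons w L ih =>
    rw [ιProd_cons, ← mul_assoc]
    rcases List.mem_cons.1 h with rfl | h
    · rw [ExteriorAlgebra.ι_sq_zero, zero_mul]
    · rw [ι_mul_ι_eq_neg, neg_mul, mul_assoc, ih h, mul_zero, neg_zero]

theorem ι_mul_ιProd_of_mem_span {L : List V} {v : V} (h : v ∈ Submodule.span k {x | x ∈ L}) :
    ExteriorAlgebra.ι k v * ιProd k L = 0 := by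
  have : Submodule.span k {x | x ∈ L} ≤ LinearMap.ker
      ((LinearMap.mulRight k (ιProd k L)).comp (ExteriorAlgebra.ι k (M := V))) :=
    Submodule.span_le.2 fun x hx => ι_mul_ιProd_of_mem hx
  exact this h

theorem list_sum_mem_span (L : List V) : L.sum ∈ Submodule.span k {x | x ∈ L} :=
  list_sum_mem fun _ hx => Submodule.subset_span hx

/-- In a list of vectors with sum zero, omitting the last vector is the same up to a sign as omitting
the first one. -/
theorem ιProd_dropLast {v : V} {L : List V} (h : (v :: L).sum = 0) :
    ιProd k (v :: L).dropLast = (-1) ^ L.length * ιProd k L := by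
  rcases List.eq_nil_or_concat L with rfl | ⟨M, w, rfl⟩
  · simp
  · have e1 : (v :: M.concat w).dropLast = v :: M := by
      rw [List.concat_eq_append, ← List.cons_append, List.dropLast_concat]
    -- Modulo the span of `M` the first vector is minus the last one; moving `w` behind `M` gives
    -- the rest of the sign.
    have e2 : v = - M.sum - w := by
      rw [List.concat_eq_append] at h
      simp only [List.sum_cons, List.sum_append, List.sum_nil, add_zero] at h
      rw [← sub_eq_zero, ← h]
      abel
    rw [e1, ιProd_cons, e2, map_sub, map_neg, sub_mul, neg_mul,
      ι_mul_ιProd_of_mem_span (list_sum_mem_span M), List.concat_eq_append, ιProd_append, ιProd_cons,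
      ιProd_nil, mul_one, ι_mul_ιProd]
    simp [pow_succ]

/-- Products of two vectors are central. -/
theorem pair_commute (v w : V) (x : ExteriorAlgebra k V) :
    Commute (ExteriorAlgebra.ι k v * ExteriorAlgebra.ι k w) x := by
  induction x using ExteriorAlgebra.induction with
  | algebraMap r => exact (Algebra.commutes r _).symm
  | ι u =>
    change _ * _ = _ * _
    rw [mul_assoc, ι_mul_ι_eq_neg w u, mul_neg, ← mul_assoc, ι_mul_ι_eq_neg v u, neg_mul, neg_neg,
      mul_assoc]
  | mul a b ha hb => exact ha.mul_right hb
  | add a b ha hb => exact ha.add_right hb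

variable (k) in
/-- The product `a_1 ∧ b_1 ∧ … ∧ a_γ ∧ b_γ`. -/
def pairProd {γ : ℕ} (a b : Fin γ → V) : ExteriorAlgebra k V :=
  (List.ofFn fun i => ExteriorAlgebra.ι k (a i) * ExteriorAlgebra.ι k (b i)).prod

theorem pairProd_succ {γ : ℕ} (a b : Fin (γ + 1) → V) : pairProd k a b =
    ExteriorAlgebra.ι k (a 0) * ExteriorAlgebra.ι k (b 0) *
      pairProd k (fun i => a i.succ) (fun i => b i.succ) := by
  rw [pairProd, List.ofFn_succ, List.prod_cons]
  rfl

/-- The vectors of a family of pairs, in a list. -/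
def pairList {γ : ℕ} (a b : Fin γ → V) : List V := (List.ofFn fun i => [a i, b i]).flatten

theorem pairList_succ {γ : ℕ} (a b : Fin (γ + 1) → V) : pairList a b =
    a 0 :: b 0 :: pairList (fun i => a i.succ) (fun i => b i.succ) := by
  rw [pairList, List.ofFn_succ, List.flatten_cons]
  rfl

theorem ιProd_pairList {γ : ℕ} (a b : Fin γ → V) : ιProd k (pairList a b) = pairProd k a b := by
  induction γ with
  | zero => rfl
  | succ γ ih => rw [pairList_succ, ιProd_cons, ιProd_cons, ih, pairProd_succ, mul_assoc]

theorem length_pairList {γ : ℕ} (a b : Fin γ → V) : (pairList a b).length = 2 * γ := by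
  induction γ with
  | zero => rfl
  | succ γ ih =>
    rw [pairList_succ, List.length_cons, List.length_cons, ih]
    ring

theorem mem_pairList {γ : ℕ} {a b : Fin γ → V} {x : V} :
    x ∈ pairList a b ↔ (∃ i, x = a i) ∨ ∃ i, x = b i := by
  simp only [pairList, List.mem_flatten, List.mem_ofFn]
  constructor
  · rintro ⟨_, ⟨i, rfl⟩, h⟩
    rcases List.mem_pair.1 h with rfl | rfl
    · exact Or.inl ⟨i, rfl⟩
    · exact Or.inr ⟨i, rfl⟩
  · rintro (⟨i, rfl⟩ | ⟨i, rfl⟩)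
    · exact ⟨_, ⟨i, rfl⟩, by simp⟩
    · exact ⟨_, ⟨i, rfl⟩, by simp⟩

theorem pairProd_commute {γ : ℕ} (a b : Fin γ → V) (x : ExteriorAlgebra k V) :
    Commute (pairProd k a b) x := by
  induction γ with
  | zero => exact Commute.one_left x
  | succ γ ih =>
    rw [pairProd_succ]
    exact (pair_commute _ _ x).mul_left (ih _ _)

theorem map_pairProd (f : V →ₗ[k] W) {γ : ℕ} (a b : Fin γ → V) :
    ExteriorAlgebra.map f (pairProd k a b) = pairProd k (fun i => f (a i)) fun i => f (b i) := by
  induction γ with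
  | zero => exact map_one _
  | succ γ ih =>
    rw [pairProd_succ, pairProd_succ, map_mul, map_mul, ExteriorAlgebra.map_apply_ι,
      ExteriorAlgebra.map_apply_ι, ih]

variable (k) in
/-- A list of linearly independent vectors. -/
def IsFree (L : List V) : Prop := finrank k (Submodule.span k {x | x ∈ L}) = L.length

theorem finrank_span_list_le (L : List V) :
    finrank k (Submodule.span k {x | x ∈ L}) ≤ L.length := by
  have h : {x | x ∈ L} = (L.toFinset : Set V) := by
    ext x
    simp
  rw [h]
  exact (finrank_span_finset_le_card _).trans (List.toFinset_card_le L)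

instance finite_span_list (L : List V) : FiniteDimensional k (Submodule.span k {x | x ∈ L}) :=
  FiniteDimensional.span_of_finite k (List.finite_toSet L)

/-- One vector raises the dimension of a span by at most one, so the maximal dimension for `v :: L`
forces both conclusions. -/
theorem IsFree.cons {v : V} {L : List V} (h : IsFree k (v :: L)) :
    IsFree k L ∧ v ∉ Submodule.span k {x | x ∈ L} := by
  have h1 : Submodule.span k {x | x ∈ v :: L} =
      Submodule.span k {v} ⊔ Submodule.span k {x | x ∈ L} := by
    rw [← Submodule.span_union]
    congr 1
    ext x
    simp
  have h3 := finrank_span_list_le (k := k) L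
  have h2 := Submodule.finrank_add_le_finrank_add_finrank (Submodule.span k {v})
    (Submodule.span k {x | x ∈ L})
  have h4 : finrank k (Submodule.span k {v}) ≤ 1 := by
    rw [← Finset.coe_singleton]
    exact finrank_span_finset_le_card {v}
  rw [← h1, h, List.length_cons] at h2
  refine ⟨le_antisymm h3 (by omega), fun hv => ?_⟩
  rw [IsFree, h1, sup_eq_right.2 (by rwa [Submodule.span_singleton_le_iff_mem]),
    List.length_cons] at h
  omega

/-- The scalar part of an element of the exterior algebra. -/
def scalarPart : ExteriorAlgebra k V →ₗ[k] k := ExteriorAlgebra.algebraMapInv.toLinearMap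

theorem scalarPart_ι_mul (v : V) (x : ExteriorAlgebra k V) :
    scalarPart (ExteriorAlgebra.ι k v * x) = 0 := by
  simp [scalarPart, ExteriorAlgebra.algebraMapInv]

theorem scalarPart_one : scalarPart (1 : ExteriorAlgebra k V) = 1 := by
  simp [scalarPart]

/-- The contraction with a linear form. -/
def contraction (θ : Dual k V) : ExteriorAlgebra k V →ₗ[k] ExteriorAlgebra k V :=
  CliffordAlgebra.contractLeft (Q := (0 : QuadraticForm k V)) θ

theorem contraction_ι_mul (θ : Dual k V) (v : V) (x : ExteriorAlgebra k V) :
    contraction θ (ExteriorAlgebra.ι k v * x) =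
      θ v • x - ExteriorAlgebra.ι k v * contraction θ x :=
  CliffordAlgebra.contractLeft_ι_mul _ _ _

theorem contraction_one (θ : Dual k V) : contraction θ (1 : ExteriorAlgebra k V) = 0 :=
  CliffordAlgebra.contractLeft_one _ _

theorem contraction_ιProd_mul {θ : Dual k V} {L : List V} (h : ∀ v ∈ L, θ v = 0)
    (x : ExteriorAlgebra k V) :
    contraction θ (ιProd k L * x) = (-1) ^ L.length * (ιProd k L * contraction θ x) := by
  induction L with
  | nil => simp
  | cons v L ih =>
    rw [ιProd_cons, mul_assoc, contraction_ι_mul, h v (by simp), zero_smul, zero_sub,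
      ih fun w hw => h w (List.mem_cons_of_mem _ hw), List.length_cons, pow_succ, ← mul_assoc,
      ((Commute.neg_one_right (ExteriorAlgebra.ι k v)).pow_right _).eq]
    simp [mul_assoc]

theorem contraction_pairProd {θ : Dual k V} {γ : ℕ} {a b : Fin γ → V} (ha : ∀ i, θ (a i) = 0)
    (hb : ∀ i, θ (b i) = 0) : contraction θ (pairProd k a b) = 0 := by
  rw [← ιProd_pairList, ← mul_one (ιProd k _), contraction_ιProd_mul, contraction_one, mul_zero,
    mul_zero]
  intro v hv
  rcases mem_pairList.1 hv with ⟨i, rfl⟩ | ⟨i, rfl⟩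
  · exact ha i
  · exact hb i

theorem neg_one_pow_mul_eq_smul (n : ℕ) (x : ExteriorAlgebra k V) :
    (-1) ^ n * x = ((-1) ^ n : k) • x := by
  rw [Algebra.smul_def, map_pow, map_neg, map_one]

/-- The coefficient of the product of independent vectors. -/
theorem IsFree.exists_functional {L : List V} (h : IsFree k L) :
    ∃ Λ : ExteriorAlgebra k V →ₗ[k] k, ∀ x, Λ (ιProd k L * x) = scalarPart x := by
  induction L with
  | nil => exact ⟨scalarPart, fun x => by simp⟩
  | cons v L ih =>
    obtain ⟨h1, h2⟩ := h.cons
    obtain ⟨Λ, hΛ⟩ := ih h1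
    -- The contraction with a form that vanishes on `L` but not at `v` removes `v`. In the other
    -- term of the Leibniz rule a factor `v` remains, which can be moved behind `L`; its scalar part
    -- is zero.
    obtain ⟨θ, hθ, hL⟩ := Submodule.exists_le_ker_of_notMem h2
    refine ⟨(θ v)⁻¹ • Λ.comp (contraction θ), fun x => ?_⟩
    have hL' : ∀ w ∈ L, θ w = 0 := fun w hw => hL (Submodule.subset_span hw)
    rw [ιProd_cons, mul_assoc, LinearMap.smul_apply, LinearMap.comp_apply, contraction_ι_mul,
      contraction_ιProd_mul hL', map_sub, map_smul, hΛ, ← mul_assoc,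
      ((Commute.neg_one_right (ExteriorAlgebra.ι k v)).pow_right _).eq, mul_assoc, ← mul_assoc _ _
      (contraction θ x), ι_mul_ιProd, neg_one_pow_mul_eq_smul, neg_one_pow_mul_eq_smul, map_smul,
      smul_mul_assoc, map_smul, mul_assoc, hΛ, scalarPart_ι_mul, smul_zero, smul_zero, sub_zero,
      smul_smul, inv_mul_cancel₀ hθ, one_smul]

/-! Symplectic families. -/

/-- Two families of vectors that span together a hyperbolic space. -/
structure IsSymplectic (ω : V →ₗ[k] V →ₗ[k] k) {γ : ℕ} (a b : Fin γ → V) : Prop where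
  aa : ∀ i j, ω (a i) (a j) = 0
  bb : ∀ i j, ω (b i) (b j) = 0
  ab : ∀ i j, ω (a i) (b j) = if i = j then 1 else 0

theorem IsSymplectic.tail {ω : V →ₗ[k] V →ₗ[k] k} {γ : ℕ} {a b : Fin (γ + 1) → V}
    (h : IsSymplectic ω a b) : IsSymplectic ω (fun i => a i.succ) (fun i => b i.succ) where
  aa _ _ := h.aa _ _
  bb _ _ := h.bb _ _
  ab i j := by simp [h.ab]

/-- `F` is the exponential of the contraction with `ω`. It is available as a change of quadratic
form in Clifford algebras: the quadratic form of an alternating `ω` is zero, so both algebras are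
the exterior algebra. Vectors of the radical can be taken out of `F`, and the scalar part of `F` is
a Pfaffian. -/
theorem exists_pfaffian (ω : V →ₗ[k] V →ₗ[k] k) (hω : ∀ v, ω v v = 0) :
    ∃ F : ExteriorAlgebra k V →ₗ[k] ExteriorAlgebra k V,
      (∀ v x, (∀ w, ω v w = 0) → F (ExteriorAlgebra.ι k v * x) = ExteriorAlgebra.ι k v * F x) ∧
      ∀ (γ : ℕ) (a b : Fin γ → V), IsSymplectic ω a b → scalarPart (F (pairProd k a b)) = 1 := by
  have hq : LinearMap.BilinMap.toQuadraticMap (-ω) =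
      (0 : QuadraticForm k V) - (0 : QuadraticForm k V) := by
    ext v
    simp [hω]
  let F : ExteriorAlgebra k V →ₗ[k] ExteriorAlgebra k V := CliffordAlgebra.changeForm hq
  have hF : ∀ v x, F (ExteriorAlgebra.ι k v * x) =
      ExteriorAlgebra.ι k v * F x - contraction (-ω v) (F x) := fun v x =>
    CliffordAlgebra.changeForm_ι_mul hq v x
  have hc : ∀ θ x, F (contraction θ x) = contraction θ (F x) := fun θ x =>
    CliffordAlgebra.changeForm_contractLeft hq θ x
  refine ⟨F, fun v x hv => ?_, fun γ => ?_⟩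
  · have : -ω v = 0 := by
      ext w
      simp [hv]
    rw [hF, this, contraction, map_zero]
    exact sub_zero _
  · induction γ with
    | zero =>
      intro a b _
      have : F (pairProd k a b) = 1 := CliffordAlgebra.changeForm_one hq
      rw [this, scalarPart_one]
    | succ γ ih =>
      intro a b h
      set y := pairProd k (fun i => a i.succ) fun i => b i.succ
      -- The vector `a 0` is orthogonal to all later pairs, so in the scalar part it can be paired
      -- only with `b 0`.
      have hy : contraction (-ω (a 0)) (F y) = 0 := by
        rw [← hc, contraction_pairProd, map_zero]
        · intro i
          simp [h.aa]
        · intro i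
          simp [h.ab, (Fin.succ_ne_zero i).symm]
      have hθ : ∀ z, contraction (-ω (a 0)) (contraction (-ω (b 0)) z) =
        - contraction (-ω (b 0)) (contraction (-ω (a 0)) z) := fun z =>
          CliffordAlgebra.contractLeft_comm _ _ _
      rw [pairProd_succ, mul_assoc, hF, hF, map_sub, scalarPart_ι_mul, map_sub, contraction_ι_mul,
        hθ, hy]
      simp only [map_zero, mul_zero, sub_zero, neg_zero, LinearMap.neg_apply, h.ab, if_true,
        neg_smul, one_smul, map_neg, zero_sub, neg_neg]
      exact ih _ _ h.tail

/-- The product of independent vectors of the radical of an alternating form with the vectors of a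
symplectic family has an invariant meaning. -/
theorem exists_functional_symplectic {ω : V →ₗ[k] V →ₗ[k] k} (hω : ∀ v, ω v v = 0) {R : List V}
    (hR : ∀ v ∈ R, ∀ w, ω v w = 0) (hfree : IsFree k R) :
    ∃ Φ : ExteriorAlgebra k V →ₗ[k] k, ∀ (γ : ℕ) (a b : Fin γ → V), IsSymplectic ω a b →
      Φ (ιProd k R * pairProd k a b) = 1 := by
  obtain ⟨F, h1, h2⟩ := exists_pfaffian ω hω
  obtain ⟨Λ, hΛ⟩ := hfree.exists_functional
  have h3 : ∀ (L : List V), (∀ v ∈ L, ∀ w, ω v w = 0) → ∀ x, F (ιProd k L * x) = ιProd k L * F x := by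
    intro L hL x
    induction L with
    | nil => simp
    | cons v L ih =>
      rw [ιProd_cons, mul_assoc, h1 v _ (hL v (by simp)), ih fun w hw => hL w (by simp [hw]),
        mul_assoc]
  refine ⟨Λ.comp F, fun γ a b h => ?_⟩
  rw [LinearMap.comp_apply, h3 R hR, hΛ, h2 γ a b h]

/-- The existence of a symplectic basis modulo the radical. -/
theorem exists_symplectic [FiniteDimensional k V] {ω : V →ₗ[k] V →ₗ[k] k} (hω : ∀ v, ω v v = 0) :
    ∃ (γ : ℕ) (a b : Fin γ → V), IsSymplectic ω a b ∧
      finrank k V = 2 * γ + finrank k (LinearMap.ker ω) := by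
  have hs : ∀ v w, ω v w = - ω w v := by
    intro v w
    have := hω (v + w)
    simp only [map_add, LinearMap.add_apply, hω] at this
    linear_combination this
  -- Every vector is the sum of an element of the span of the family and of a vector orthogonal to
  -- the family.
  have hproj : ∀ (γ : ℕ) (a b : Fin γ → V), IsSymplectic ω a b → ∀ z : V, ∃ y,
      z - y ∈ Submodule.span k {x | x ∈ pairList a b} ∧ ∀ i, ω y (a i) = 0 ∧ ω y (b i) = 0 := by
    intro γ a b h z
    refine ⟨z - ∑ i, (ω z (b i) • a i - ω z (a i) • b i), ?_, fun j => ⟨?_, ?_⟩⟩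
    · rw [sub_sub_cancel]
      refine Submodule.sum_mem _ fun i _ => Submodule.sub_mem _ (Submodule.smul_mem _ _ ?_)
        (Submodule.smul_mem _ _ ?_)
      · exact Submodule.subset_span (mem_pairList.2 (Or.inl ⟨i, rfl⟩))
      · exact Submodule.subset_span (mem_pairList.2 (Or.inr ⟨i, rfl⟩))
    · simp [h.aa, hs (b _) (a _), h.ab, Finset.sum_ite_eq, LinearMap.sum_apply]
    · simp [h.bb, h.ab, LinearMap.sum_apply]
  have hindep : ∀ (γ : ℕ) (a b : Fin γ → V), IsSymplectic ω a b →
      2 * γ ≤ finrank k (Submodule.span k {x | x ∈ pairList a b}) ∧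
      Disjoint (Submodule.span k {x | x ∈ pairList a b}) (LinearMap.ker ω) := by
    intro γ a b h
    let f : Submodule.span k {x | x ∈ pairList a b} →ₗ[k] (Fin γ → k) × (Fin γ → k) :=
      (((LinearMap.pi fun i => ω.flip (b i)).prod (LinearMap.pi fun i => ω.flip (a i)))).comp
        (Submodule.subtype _)
    constructor
    -- The pairings with `b` and with `a` are coordinates on the span; they take all values, which
    -- bounds the dimension from below.
    · have hf : Function.Surjective f := by
        intro c
        refine ⟨⟨∑ i, (c.1 i • a i - c.2 i • b i), ?_⟩, ?_⟩
        · refine Submodule.sum_mem _ fun i _ => Submodule.sub_mem _ (Submodule.smul_mem _ _ ?_)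
            (Submodule.smul_mem _ _ ?_)
          · exact Submodule.subset_span (mem_pairList.2 (Or.inl ⟨i, rfl⟩))
          · exact Submodule.subset_span (mem_pairList.2 (Or.inr ⟨i, rfl⟩))
        · refine Prod.ext (funext fun j => ?_) (funext fun j => ?_)
          · simp [f, h.bb, h.ab]
          · simp [f, h.aa, hs (b _) (a _), h.ab]
      have := LinearMap.finrank_le_finrank_of_surjective hf
      rw [finrank_prod, finrank_fin_fun] at this
      omega
    · rw [Submodule.disjoint_def]
      intro x hx hx2
      have hx3 : ∀ w, ω x w = 0 := fun w => by rw [LinearMap.mem_ker.1 hx2]; rfl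
      have e : x = ∑ i, (ω x (b i) • a i - ω x (a i) • b i) := by
        have hle : Submodule.span k {x | x ∈ pairList a b} ≤ LinearMap.ker (LinearMap.id -
          ∑ i, ((ω.flip (b i)).smulRight (a i) - (ω.flip (a i)).smulRight (b i))) := by
          refine Submodule.span_le.2 fun y hy => ?_
          rcases mem_pairList.1 hy with ⟨i, rfl⟩ | ⟨i, rfl⟩
          · simp [h.aa, h.ab, LinearMap.sum_apply]
          · simp [h.bb, hs (b _) (a _), h.ab, LinearMap.sum_apply]
        have := hle hx
        simp only [LinearMap.mem_ker, LinearMap.sub_apply, LinearMap.id_apply, LinearMap.sum_apply,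
          sub_eq_zero] at this
        simpa using this
      rw [e]
      simp [hx3]
  have hbound : ∀ γ : ℕ, (∃ a b : Fin γ → V, IsSymplectic ω a b) → γ ≤ finrank k V := by
    rintro γ ⟨a, b, h⟩
    have := (hindep γ a b h).1.trans (Submodule.finrank_le _)
    omega
  have hzero : ∃ a b : Fin 0 → V, IsSymplectic ω a b :=
    ⟨0, 0, fun i => i.elim0, fun i => i.elim0, fun i => i.elim0⟩
  -- A family with the largest number of pairs: two vectors orthogonal to it and with non-zero
  -- pairing would provide one more pair.
  set γ := Nat.findGreatest (fun γ => ∃ a b : Fin γ → V, IsSymplectic ω a b) (finrank k V) with hγ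
  obtain ⟨a, b, h⟩ : ∃ a b : Fin γ → V, IsSymplectic ω a b :=
    Nat.findGreatest_spec (P := fun γ => ∃ a b : Fin γ → V, IsSymplectic ω a b) (Nat.zero_le _) hzero
  refine ⟨γ, a, b, h, ?_⟩
  have hmax : ¬ ∃ a b : Fin (γ + 1) → V, IsSymplectic ω a b := by
    intro h1
    have := Nat.le_findGreatest (P := fun γ => ∃ a b : Fin γ → V, IsSymplectic ω a b) (hbound _ h1) h1
    omega
  have hperp : ∀ y y' : V, (∀ i, ω y (a i) = 0 ∧ ω y (b i) = 0) →
      (∀ i, ω y' (a i) = 0 ∧ ω y' (b i) = 0) → ω y y' = 0 := by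
    intro y y' hy hy'
    by_contra hne
    refine hmax ⟨Fin.cons y a, Fin.cons ((ω y y')⁻¹ • y') b, ?_, ?_, ?_⟩
    · intro i j
      induction i using Fin.cases <;> induction j using Fin.cases <;>
        simp [hω, h.aa, hy, hs (a _) y]
    · intro i j
      induction i using Fin.cases <;> induction j using Fin.cases <;>
        simp [hω, h.bb, hy', hs (b _) y']
    · intro i j
      induction i using Fin.cases <;> induction j using Fin.cases <;>
        simp [hne, h.ab, hy, hy', hs (a _) y', (Fin.succ_ne_zero _).symm]
  -- What remains of `z` after the projection is orthogonal to the family and, by maximality, to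
  -- everything orthogonal to the family; so it is in the radical.
  have hcompl : Submodule.span k {x | x ∈ pairList a b} ⊔ LinearMap.ker ω = ⊤ := by
    refine eq_top_iff.2 fun z _ => ?_
    obtain ⟨y, hy1, hy2⟩ := hproj γ a b h z
    refine Submodule.mem_sup.2 ⟨_, hy1, y, ?_, sub_add_cancel z y⟩
    rw [LinearMap.mem_ker]
    ext w
    obtain ⟨y', hy1', hy2'⟩ := hproj γ a b h w
    have h1 : ω y (w - y') = 0 := by
      have : Submodule.span k {x | x ∈ pairList a b} ≤ LinearMap.ker (ω y) := by
        refine Submodule.span_le.2 fun x hx => ?_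
        rcases mem_pairList.1 hx with ⟨i, rfl⟩ | ⟨i, rfl⟩
        · exact (hy2 i).1
        · exact (hy2 i).2
      exact this hy1'
    rw [map_sub, hperp y y' hy2 hy2', sub_zero] at h1
    exact h1
  have h1 := Submodule.finrank_sup_add_finrank_inf_eq
    (Submodule.span k {x | x ∈ pairList a b}) (LinearMap.ker ω)
  rw [hcompl, (hindep γ a b h).2.eq_bot, finrank_top, finrank_bot, add_zero] at h1
  have h2 := finrank_span_list_le (k := k) (pairList a b)
  rw [length_pairList] at h2
  have h3 := (hindep γ a b h).1
  omega

end ExteriorProducts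

/-! ### The determinant as a line. -/

section DetLine

variable {k : Type u} [Field k] {V : Type u} [AddCommGroup V] [Module k V]

theorem ιProd_mem_power (L : List V) : ιProd k L ∈ ⋀[k]^L.length V := by
  induction L with
  | nil => exact one_mem_power
  | cons v L ih =>
    rw [ιProd_cons, List.length_cons, add_comm]
    exact mul_mem_power (ι_mem_power v) ih

/-- The determinant is one-dimensional. -/
theorem Det.exists_smul [FiniteDimensional k V] {t : Det k V} (ht : t ≠ 0) (x : Det k V) :
    ∃ c : k, x = c • t := by
  have h : finrank k (Det k V) = 1 := by
    have := exteriorPower.finrank_eq (R := k) (M := V) (n := finrank k V)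
    rw [Nat.choose_self] at this
    exact this
  obtain ⟨c, hc⟩ := (finrank_eq_one_iff_of_nonzero' t ht).1 h x
  exact ⟨c, hc.symm⟩

end DetLine

/-! ### Lists of cycles and invariant functions -/

section CycleLists

variable {X Y I J : Type}

theorem IsCycleList.unique {τ : Perm X} {L M : List (Set X)} (hL : IsCycleList τ L)
    (hM : IsCycleList τ M) : L.Perm M :=
  (List.perm_ext_iff_of_nodup hL.1 hM.1).2 fun C => by rw [hL.2, hM.2]

theorem exists_isCycleList [Finite X] (τ : Perm X) : ∃ L, IsCycleList τ L := by
  have : Fintype X := Fintype.ofFinite X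
  refine ⟨(Finset.univ.image (cyc τ)).toList, Finset.nodup_toList _, fun C => ?_⟩
  simp [eq_comm]

theorem IsCycleList.exists_map {τ : Perm X} {L : List (Set X)} (h : IsCycleList τ L) :
    ∃ P : List X, P.map (cyc τ) = L := by
  have : ∀ M : List (Set X), (∀ C ∈ M, ∃ x, C = cyc τ x) → ∃ P : List X, P.map (cyc τ) = M := by
    intro M hM
    induction M with
    | nil => exact ⟨[], rfl⟩
    | cons C M ih =>
      obtain ⟨P, rfl⟩ := ih fun D hD => hM D (List.mem_cons_of_mem _ hD)
      obtain ⟨x, rfl⟩ := hM C (by simp)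
      exact ⟨x :: P, rfl⟩
  exact this L fun C hC => (h.2 C).1 hC

/-- The cycle through a given element can be put at the beginning of a list of cycles. -/
theorem IsCycleList.exists_head {τ : Perm X} {P : List X} (h : IsCycleList τ (P.map (cyc τ)))
    (x : X) : ∃ P' : List X, IsCycleList τ ((x :: P').map (cyc τ)) := by
  obtain ⟨M, hM⟩ := exists_perm_cons ((h.2 _).2 ⟨x, rfl⟩)
  have h1 := h.perm hM
  obtain ⟨P', hP'⟩ := h1.exists_map
  cases P' with
  | nil => simp at hP'
  | cons y P' =>
    rw [List.map_cons, List.cons.injEq] at hP'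
    exact ⟨P', by rwa [List.map_cons, hP'.2]⟩

theorem IsCycleList.exists_two_heads {τ : Perm X} {P : List X} (h : IsCycleList τ (P.map (cyc τ)))
    {x y : X} (hxy : ¬ τ.SameCycle x y) :
    ∃ P' : List X, IsCycleList τ ((x :: y :: P').map (cyc τ)) := by
  obtain ⟨P, h⟩ := h.exists_head x
  have hy : cyc τ y ∈ P.map (cyc τ) := by
    rcases List.mem_cons.1 ((h.2 _).2 ⟨y, rfl⟩) with e | e
    · exact absurd (cyc_eq_iff.1 e.symm) hxy
    · exact e
  obtain ⟨M, hM⟩ := exists_perm_cons hy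
  have h1 := h.perm (hM.cons _)
  obtain ⟨P', hP'⟩ := h1.exists_map
  match P', hP' with
  | [], hP' => simp at hP'
  | [_], hP' => simp at hP'
  | _ :: _ :: P', hP' =>
    simp only [List.map_cons, List.cons.injEq] at hP'
    exact ⟨P', by rwa [List.map_cons, List.map_cons, hP'.2.2]⟩

theorem exists_representatives [Finite X] (τ : Perm X) :
    ∃ P : List X, IsCycleList τ (P.map (cyc τ)) := by
  obtain ⟨L, hL⟩ := exists_isCycleList τ
  obtain ⟨P, rfl⟩ := hL.exists_map
  exact ⟨P, hL⟩

theorem IsCycleList.exists_sameCycle {τ : Perm X} {P : List X} (h : IsCycleList τ (P.map (cyc τ)))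
    (x : X) : ∃ y ∈ P, τ.SameCycle y x := by
  obtain ⟨y, hy, e⟩ := List.mem_map.1 ((h.2 _).2 ⟨x, rfl⟩)
  exact ⟨y, hy, cyc_eq_iff.1 e⟩

theorem IsCycleList.not_sameCycle {τ : Perm X} {P : List X} {x y : X}
    (h : IsCycleList τ ((x :: P).map (cyc τ))) (hy : y ∈ P) : ¬ τ.SameCycle y x := by
  intro hs
  rw [List.map_cons] at h
  exact (List.nodup_cons.1 h.1).1 (cyc_eq_iff.2 hs ▸ List.mem_map_of_mem hy)

theorem cyc_conj (e : X ≃ Y) {τ : Perm X} {ρ : Perm Y} (h : ∀ x, e (τ x) = ρ (e x)) (x : X) :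
    cyc ρ (e x) = e '' cyc τ x := by
  have : e.permCongr τ = ρ := by
    ext y
    rw [permCongr_apply, h, apply_symm_apply]
  rw [← this, cyc_permCongr]

theorem sameCycle_conj (e : X ≃ Y) {τ : Perm X} {ρ : Perm Y} (h : ∀ x, e (τ x) = ρ (e x))
    (x y : X) : ρ.SameCycle (e x) (e y) ↔ τ.SameCycle x y := by
  have : e.permCongr τ = ρ := by
    ext y
    rw [permCongr_apply, h, apply_symm_apply]
  rw [← this, sameCycle_permCongr]

theorem IsCycleList.conj (e : X ≃ Y) {τ : Perm X} {ρ : Perm Y} (h : ∀ x, e (τ x) = ρ (e x))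
    {P : List X} (hP : IsCycleList τ (P.map (cyc τ))) :
    IsCycleList ρ ((P.map e).map (cyc ρ)) := by
  have h1 : e.permCongr τ = ρ := by
    ext y
    rw [permCongr_apply, h, apply_symm_apply]
  have h2 := hP.permCongr e
  rw [h1, List.map_map] at h2
  rw [List.map_map]
  convert h2 using 2
  ext1 x
  exact cyc_conj e h x

variable (k : Type u) [Field k]

/-- The functions that are invariant under a permutation. -/
def invariants (τ : Perm X) : Submodule k (X → k) where
  carrier := {u | ∀ x, u (τ x) = u x}
  zero_mem' := by simp
  add_mem' {x y} hx hy := fun f => by simp only [Pi.add_apply, hx f, hy f]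
  smul_mem' c x hx := fun f => by simp only [Pi.smul_apply, hx f]

theorem eq_of_sameCycle [Finite X] {K : Type*} {τ : Perm X} {u : X → K} (hu : ∀ x, u (τ x) = u x) {x y : X}
    (h : τ.SameCycle x y) : u x = u y := by
  obtain ⟨n, rfl⟩ := h.exists_nat_pow_eq
  clear h
  induction n with
  | zero => rfl
  | succ n ih => rw [pow_succ', Perm.mul_apply, hu, ih]

/-- The indicator function of a cycle. -/
def cycFun (τ : Perm X) (x : X) : invariants k τ :=
  ⟨fun y => if τ.SameCycle x y then 1 else 0, fun y => by simp only [Perm.sameCycle_apply_right]⟩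

theorem cycFun_of_sameCycle {τ : Perm X} {x y : X} (h : τ.SameCycle x y) :
    (cycFun k τ x).1 y = 1 := if_pos h

theorem cycFun_of_not_sameCycle {τ : Perm X} {x y : X} (h : ¬ τ.SameCycle x y) :
    (cycFun k τ x).1 y = 0 := if_neg h

/-- The indicator functions of the cycles span the invariant functions. -/
theorem span_cycFun [Finite X] {τ : Perm X} {P : List X} (h : IsCycleList τ (P.map (cyc τ))) :
    Submodule.span k {u | u ∈ P.map (cycFun k τ)} = ⊤ := by
  refine eq_top_iff.2 fun u _ => ?_
  -- At a given `y` exactly one of the indicator functions is non-zero, that of the representative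
  -- of the cycle of `y`.
  have e : u = (P.map fun x => u.1 x • cycFun k τ x).sum := by
    refine Subtype.ext (funext fun y => ?_)
    have h1 : ∀ Q : List X, ((Q.map fun x => u.1 x • cycFun k τ x).sum).1 y =
        (Q.map fun x => if τ.SameCycle x y then u.1 x else 0).sum := by
      intro Q
      induction Q with
      | nil => rfl
      | cons x Q ih =>
        rw [List.map_cons, List.sum_cons, List.map_cons, List.sum_cons, ← ih]
        change u.1 x * (if τ.SameCycle x y then 1 else 0) + _ = _
        rw [mul_ite, mul_one, mul_zero]
    have h2 : ∀ Q : List X, (Q.map (cyc τ)).Nodup → (Q.map fun x => if τ.SameCycle x y then u.1 x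
        else 0).sum = if ∃ x ∈ Q, τ.SameCycle x y then u.1 y else 0 := by
      intro Q hQ
      induction Q with
      | nil => simp
      | cons x Q ih =>
        rw [List.map_cons] at hQ
        have hQ := List.nodup_cons.1 hQ
        rw [List.map_cons, List.sum_cons, ih hQ.2]
        by_cases hx : τ.SameCycle x y
        · have : ¬ ∃ z ∈ Q, τ.SameCycle z y := by
            rintro ⟨z, hz, hzy⟩
            exact hQ.1 (cyc_eq_iff.2 (hzy.trans hx.symm) ▸ List.mem_map_of_mem hz)
          rw [if_pos hx, if_neg this, if_pos ⟨x, by simp, hx⟩, add_zero,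
            eq_of_sameCycle u.2 hx]
        · rw [if_neg hx, zero_add]
          congr 1
          simp [hx]
    rw [h1, h2 P h.1, if_pos (h.exists_sameCycle y)]
  rw [e]
  refine list_sum_mem fun z hz => ?_
  obtain ⟨x, hx, rfl⟩ := List.mem_map.1 hz
  exact Submodule.smul_mem _ _ (Submodule.subset_span (List.mem_map_of_mem hx))

theorem finrank_invariants [Finite X] {τ : Perm X} {P : List X} (h : IsCycleList τ (P.map (cyc τ))) :
    finrank k (invariants k τ) = P.length := by
  refine le_antisymm ?_ ?_
  · have := finrank_span_list_le (k := k) (P.map (cycFun k τ))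
    rwa [span_cycFun k h, finrank_top, List.length_map] at this
  -- Evaluation at the representatives sends the indicator functions to the standard basis, so the
  -- dimension is not smaller than their number.
  · let f : invariants k τ →ₗ[k] Fin P.length → k :=
      (LinearMap.funLeft k k P.get).comp (Submodule.subtype _)
    have hf : Function.Surjective f := by
      rw [← LinearMap.range_eq_top, eq_top_iff, ← (Pi.basisFun k (Fin P.length)).span_eq]
      refine Submodule.span_le.2 ?_
      rintro _ ⟨i, rfl⟩
      refine ⟨cycFun k τ (P.get i), funext fun j => ?_⟩
      have hinj := List.nodup_iff_injective_get.1 h.1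
      have e : τ.SameCycle (P.get i) (P.get j) ↔ j = i := by
        rw [← cyc_eq_iff]
        constructor
        · intro hij
          have := @hinj ⟨i, by simp⟩ ⟨j, by simp⟩ (by simpa using hij)
          exact Fin.ext (by simpa using this.symm)
        · rintro rfl
          rfl
      change (if τ.SameCycle (P.get i) (P.get j) then (1 : k) else 0) = _
      rw [Pi.basisFun_apply, Pi.single_apply]
      simp only [e]
    have := LinearMap.finrank_le_finrank_of_surjective hf
    simpa using this

/-- The number of elements, as the sum of the lengths of the cycles, for a permutation all of whose
cycles have length three. -/
theorem card_eq_three_mul [Fintype X] {τ : Perm X} (h3 : ∀ x, τ (τ (τ x)) = x) (h1 : ∀ x, τ x ≠ x)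
    {P : List X} (h : IsCycleList τ (P.map (cyc τ))) : Fintype.card X = 3 * P.length := by
  have hnd : P.Nodup := List.Nodup.of_map _ h.1
  -- Every element is `τ ^ i` of a representative, with a unique `i < 3`: a cycle cannot be shorter,
  -- since neither `τ` nor `τ ^ 2` has fixed points.
  have key : Function.Bijective (fun z : {x // x ∈ P} × Fin 3 => (τ ^ (z.2 : ℕ)) z.1.1) := by
    constructor
    · rintro ⟨⟨x, hx⟩, i⟩ ⟨⟨y, hy⟩, j⟩ e
      have e : (τ ^ (i : ℕ)) x = (τ ^ (j : ℕ)) y := e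
      have hs : τ.SameCycle x y := by
        have hxi : τ.SameCycle x ((τ ^ (i : ℕ)) x) := (Perm.SameCycle.refl _ _).pow_right
        have hyj : τ.SameCycle y ((τ ^ (j : ℕ)) y) := (Perm.SameCycle.refl _ _).pow_right
        rw [e] at hxi
        exact hxi.trans hyj.symm
      have hxy : x = y := List.inj_on_of_nodup_map h.1 hx hy (cyc_eq_iff.2 hs)
      subst hxy
      have h2 : τ (τ x) ≠ x := fun hh => h1 x (by
        have := h3 x
        rwa [hh] at this)
      have hij : i = j := by
        have h1' := h1 x
        have h1'' := h1 (τ x)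
        fin_cases i <;> fin_cases j <;> first | rfl | (simp [pow_succ, h1', h2, h1'.symm, h2.symm] at e)
      rw [hij]
    · intro y
      obtain ⟨x, hx, hs⟩ := h.exists_sameCycle y
      obtain ⟨n, rfl⟩ := hs.exists_nat_pow_eq
      refine ⟨(⟨x, hx⟩, ⟨n % 3, Nat.mod_lt _ (by norm_num)⟩), ?_⟩
      have h33 : τ ^ 3 = 1 := by
        ext x
        simp [pow_succ, h3]
      change (τ ^ (n % 3)) x = (τ ^ n) x
      conv_rhs => rw [← Nat.mod_add_div n 3, pow_add, pow_mul, h33, one_pow, mul_one]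
  have := Fintype.card_of_bijective key
  rw [← this, Fintype.card_prod, Fintype.card_fin]
  have : Fintype.card {x // x ∈ P} = P.length := by
    rw [Fintype.card_of_subtype P.toFinset (by simp), List.toFinset_card_of_nodup hnd]
  rw [this, mul_comm]

end CycleLists

/-! ### Erasing elements from cycles -/

section FirstReturns

variable {X Y I J : Type}

/-- The element `i` is the first element of `I` met by the `τ`-orbit of `x` after `x`. -/
inductive FirstReturn (l : I ↪ X) (τ : Perm X) : X → I → Prop
  | hit {x i} : τ x = l i → FirstReturn l τ x i
  | skip {x i} : τ x ∉ Set.range l → FirstReturn l τ (τ x) i → FirstReturn l τ x i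

theorem FirstReturn.unique {l : I ↪ X} {τ : Perm X} {x : X} {i j : I} (hi : FirstReturn l τ x i)
    (hj : FirstReturn l τ x j) : i = j := by
  induction hi with
  | hit h =>
    cases hj with
    | hit h' => exact l.injective (h.symm.trans h')
    | skip h' _ => exact absurd ⟨_, h.symm⟩ h'
  | skip h _ ih =>
    cases hj with
    | hit h' => exact absurd ⟨_, h'.symm⟩ h
    | skip _ h' => exact ih h'

theorem firstReturn_erase [Finite X] (l : I ↪ X) (τ : Perm X) (i : I) :
    FirstReturn l τ (l i) (erase l τ i) := by
  have key : ∀ n x j, (τ ^ (n + 1)) x = l j → (∀ m < n, (τ ^ (m + 1)) x ∉ Set.range l) →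
      FirstReturn l τ x j := by
    intro n
    induction n with
    | zero =>
      intro x j h _
      exact FirstReturn.hit (by simpa using h)
    | succ n ih =>
      intro x j h hm
      refine FirstReturn.skip (by simpa using hm 0 (by omega)) (ih _ _ ?_ fun m hmn => ?_)
      · rw [← h, pow_succ τ (n + 1), Perm.mul_apply]
      · have := hm (m + 1) (by omega)
        rwa [pow_succ τ (m + 1), Perm.mul_apply] at this
  refine key _ _ _ (apply_erase l τ i) fun m hm => ?_
  rintro ⟨j, hj⟩
  exact absurd (returnTime_le hj.symm) (by omega)

theorem erase_eq [Finite X] {l : I ↪ X} {τ : Perm X} {ρ : Perm I}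
    (h : ∀ i, FirstReturn l τ (l i) (ρ i)) : erase l τ = ρ :=
  Equiv.ext fun i => (firstReturn_erase l τ i).unique (h i)

/-- For erasing in two stages: the case when the first return to `I` survives the second stage. -/
theorem FirstReturn.lift {l : I ↪ X} {l' : J ↪ I} {τ : Perm X} {x : X} {i : I} {j : J}
    (h : FirstReturn l τ x i) (hi : i = l' j) : FirstReturn (l'.trans l) τ x j := by
  induction h with
  | hit h => exact FirstReturn.hit (by rw [h, hi]; rfl)
  | skip h _ ih =>
    refine FirstReturn.skip (fun hr => h ?_) (ih hi)
    obtain ⟨m, hm⟩ := hr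
    exact ⟨l' m, hm⟩

/-- The other case of erasing in two stages: the first return to `I` disappears at the second stage,
and the search for `J` goes on from it. -/
theorem FirstReturn.append {l : I ↪ X} {l' : J ↪ I} {τ : Perm X} {x : X} {i : I} {j : J}
    (h : FirstReturn l τ x i) (hi : i ∉ Set.range l') (hj : FirstReturn (l'.trans l) τ (l i) j) :
    FirstReturn (l'.trans l) τ x j := by
  induction h with
  | hit h =>
    refine FirstReturn.skip ?_ (h ▸ hj)
    rintro ⟨m, hm⟩
    exact hi ⟨m, l.injective (hm.trans h)⟩
  | skip h _ ih =>
    refine FirstReturn.skip (fun hr => h ?_) (ih hi hj)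
    obtain ⟨m, hm⟩ := hr
    exact ⟨l' m, hm⟩

theorem erase_trans [Finite X] [Finite I] (l : I ↪ X) (l' : J ↪ I) (τ : Perm X) :
    erase (l'.trans l) τ = erase l' (erase l τ) := by
  refine erase_eq fun j => ?_
  have key : ∀ i j, FirstReturn l' (erase l τ) i j → FirstReturn (l'.trans l) τ (l i) j := by
    intro i j h
    induction h with
    | @hit x _ h => exact (firstReturn_erase l τ x).lift h
    | @skip x _ h _ ih => exact (firstReturn_erase l τ x).append h ih
  exact key _ _ (firstReturn_erase l' (erase l τ) j)

/-- Before its return the orbit meets only erased elements, which are not moved by a transposition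
of two elements that are kept. So only the first step can differ, and `hx` takes care of it. -/
theorem FirstReturn.mul_swap {l : I ↪ X} {τ : Perm X} {a b : I} {x x' : X} {j : I}
    (h : FirstReturn l τ x j) (hx : (τ * swap (l a) (l b)) x' = τ x) :
    FirstReturn l (τ * swap (l a) (l b)) x' j := by
  induction h generalizing x' with
  | hit h => exact FirstReturn.hit (hx.trans h)
  | skip h _ ih =>
    refine FirstReturn.skip (by rwa [hx]) ?_
    rw [hx]
    refine ih ?_
    rw [Perm.mul_apply, swap_apply_of_ne_of_ne]
    · exact fun e => h ⟨a, e.symm⟩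
    · exact fun e => h ⟨b, e.symm⟩

/-- This reduces the gluing of legs to the compositions of `S[t]`: when the face permutation is
multiplied by the transposition of two legs, so is the permutation of the legs. -/
theorem erase_mul_swap [Finite X] (l : I ↪ X) (τ : Perm X) (a b : I) :
    erase l (τ * swap (l a) (l b)) = erase l τ * swap a b := by
  refine erase_eq fun i => (firstReturn_erase l τ (swap a b i)).mul_swap ?_
  rw [Perm.mul_apply, l.injective.swap_apply]

theorem FirstReturn.conj (e : X ≃ Y) {l : I ↪ X} {l' : I ↪ Y} {τ : Perm X} {ρ : Perm Y}
    (h : ∀ x, e (τ x) = ρ (e x)) (hl : ∀ i, e (l i) = l' i) {x : X} {i : I}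
    (hx : FirstReturn l τ x i) : FirstReturn l' ρ (e x) i := by
  induction hx with
  | hit hx => exact FirstReturn.hit (by rw [← h, hx, hl])
  | skip hx _ ih =>
    refine FirstReturn.skip (fun hr => hx ?_) (h _ ▸ ih)
    obtain ⟨j, hj⟩ := hr
    exact ⟨j, e.injective (by rw [hl, h, hj])⟩

theorem erase_conj [Finite X] [Finite Y] (e : X ≃ Y) {l : I ↪ X} {l' : I ↪ Y} {τ : Perm X}
    {ρ : Perm Y} (h : ∀ x, e (τ x) = ρ (e x)) (hl : ∀ i, e (l i) = l' i) :
    erase l' ρ = erase l τ := by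
  refine erase_eq fun i => ?_
  rw [← hl]
  exact (firstReturn_erase l τ i).conj e h hl

theorem erase_relabel [Finite X] (e : I ≃ J) (l : I ↪ X) (τ : Perm X) :
    erase (e.symm.toEmbedding.trans l) τ = e.permCongr (erase l τ) := by
  have : Finite I := Finite.of_injective l l.injective
  rw [erase_trans]
  refine erase_eq fun j => FirstReturn.hit ?_
  simp

theorem FirstReturn.inl {l : I ↪ X} {l' : J ↪ Y} {τ : Perm X} {ρ : Perm Y} {x : X} {i : I}
    (h : FirstReturn l τ x i) :
    FirstReturn (l.sumMap l') (Perm.sumCongr τ ρ) (Sum.inl x) (Sum.inl i) := by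
  induction h with
  | hit h => exact FirstReturn.hit (by simp [h])
  | skip h _ ih =>
    refine FirstReturn.skip ?_ ih
    rintro ⟨i | i, hi⟩
    · exact h ⟨i, by simpa using hi⟩
    · simp at hi

theorem FirstReturn.inr {l : I ↪ X} {l' : J ↪ Y} {τ : Perm X} {ρ : Perm Y} {x : Y} {i : J}
    (h : FirstReturn l' ρ x i) :
    FirstReturn (l.sumMap l') (Perm.sumCongr τ ρ) (Sum.inr x) (Sum.inr i) := by
  induction h with
  | hit h => exact FirstReturn.hit (by simp [h])
  | skip h _ ih =>
    refine FirstReturn.skip ?_ ih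
    rintro ⟨i | i, hi⟩
    · simp at hi
    · exact h ⟨i, by simpa using hi⟩

theorem erase_sumCongr [Finite X] [Finite Y] (l : I ↪ X) (l' : J ↪ Y) (τ : Perm X) (ρ : Perm Y) :
    erase (l.sumMap l') (Perm.sumCongr τ ρ) = Perm.sumCongr (erase l τ) (erase l' ρ) := by
  refine erase_eq ?_
  rintro (i | i)
  · exact (firstReturn_erase l τ i).inl
  · exact (firstReturn_erase l' ρ i).inr

end FirstReturns

/-! ### Potentials -/

section Potentials

variable {k : Type u} [Field k] [CharZero k] {X : Type} [Fintype X]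

/-- A function with zero sums over the cycles of a permutation is a difference. -/
theorem exists_potential (τ : Perm X) {y : X → k}
    (hy : ∀ u : X → k, (∀ x, u (τ x) = u x) → ∑ x, u x * y x = 0) :
    ∃ Y : X → k, ∀ x, Y (τ x) - Y x = y x := by
  set N := orderOf τ with hN
  have hN0 : (N : k) ≠ 0 := Nat.cast_ne_zero.2 (orderOf_pos τ).ne'
  have hinv : ∀ x, ∑ m ∈ Finset.range N, y ((τ ^ m) (τ x)) = ∑ m ∈ Finset.range N, y ((τ ^ m) x) := by
    intro x
    have h1 := Finset.sum_range_succ (fun m => y ((τ ^ m) x)) N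
    have h2 := Finset.sum_range_succ' (fun m => y ((τ ^ m) x)) N
    have h3 : y ((τ ^ N) x) = y x := by rw [hN, pow_orderOf_eq_one]; rfl
    simp only [pow_succ, Perm.mul_apply, pow_zero, Perm.one_apply] at h1 h2
    rw [h3] at h1
    exact add_right_cancel (h2.symm.trans h1)
  -- The sum of `y` over `N` steps is constant on cycles. Paired with the indicator function of a
  -- cycle, it becomes a sum of `N` copies of the pairing of `y` with this function, which vanishes
  -- by hypothesis.
  have hzero : ∀ x, ∑ m ∈ Finset.range N, y ((τ ^ m) x) = 0 := by
    intro x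
    have h1 : ∑ z, (cycFun k τ x).1 z * ∑ m ∈ Finset.range N, y ((τ ^ m) z) = 0 := by
      simp only [Finset.mul_sum]
      rw [Finset.sum_comm]
      refine Finset.sum_eq_zero fun m _ => ?_
      have e : ∀ z, (cycFun k τ x).1 z = (cycFun k τ x).1 ((τ ^ m) z) := fun z =>
        eq_of_sameCycle (cycFun k τ x).2 (Perm.SameCycle.refl τ z).pow_right
      rw [Finset.sum_congr rfl fun z _ => by rw [e z],
        Equiv.sum_comp (τ ^ m) fun z => (cycFun k τ x).1 z * y z]
      exact hy _ (cycFun k τ x).2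
    have h2 : ∀ z, (cycFun k τ x).1 z * ∑ m ∈ Finset.range N, y ((τ ^ m) z) =
        (cycFun k τ x).1 z * ∑ m ∈ Finset.range N, y ((τ ^ m) x) := by
      intro z
      by_cases hz : τ.SameCycle x z
      · rw [← eq_of_sameCycle (u := fun z => ∑ m ∈ Finset.range N, y ((τ ^ m) z)) hinv hz]
      · rw [cycFun_of_not_sameCycle k hz, zero_mul, zero_mul]
    rw [Finset.sum_congr rfl fun z _ => h2 z, ← Finset.sum_mul] at h1
    refine (mul_eq_zero.1 h1).resolve_left ?_
    have h3 : ∀ z, (cycFun k τ x).1 z = if τ.SameCycle x z then 1 else 0 := by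
      intro z
      split_ifs with hz
      · exact cycFun_of_sameCycle k hz
      · exact cycFun_of_not_sameCycle k hz
    simp only [h3]
    rw [Finset.sum_boole, Nat.cast_eq_zero]
    exact Finset.card_ne_zero.2 ⟨x, by simpa using Perm.SameCycle.refl τ x⟩
  -- The partial sums of `y` along the orbit are averaged over a full period, so that no base point
  -- has to be chosen on the cycles. The difference of the sum of length `m` under `τ` is `y (τ ^ m
  -- x) - y x`, and the first terms add up to zero.
  refine ⟨fun x => -(N : k)⁻¹ * ∑ m ∈ Finset.range N, ∑ j ∈ Finset.range m, y ((τ ^ j) x),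
    fun x => ?_⟩
  have h1 : ∑ m ∈ Finset.range N, ∑ j ∈ Finset.range m, y ((τ ^ j) (τ x)) -
      ∑ m ∈ Finset.range N, ∑ j ∈ Finset.range m, y ((τ ^ j) x) = - (N * y x) := by
    rw [← Finset.sum_sub_distrib]
    have : ∀ m ∈ Finset.range N, ∑ j ∈ Finset.range m, y ((τ ^ j) (τ x)) -
        ∑ j ∈ Finset.range m, y ((τ ^ j) x) = y ((τ ^ m) x) - y x := by
      intro m _
      have h1 := Finset.sum_range_succ (fun m => y ((τ ^ m) x)) m
      have h2 := Finset.sum_range_succ' (fun m => y ((τ ^ m) x)) m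
      simp only [pow_succ, Perm.mul_apply, pow_zero, Perm.one_apply] at h1 h2
      linear_combination h1 - h2
    rw [Finset.sum_congr rfl this, Finset.sum_sub_distrib, hzero]
    simp
  beta_reduce
  rw [← mul_sub, h1]
  field_simp

/-- The intersection form is a sum over vertices, with the flags of a vertex listed from
`Quotient.out`; this brings a sum over all flags to the same shape. -/
theorem sum_cycles (τ : Perm X) (F : X → k) :
    ∑ x, F x = ∑ v : Quotient (Perm.SameCycle.setoid τ),
      ∑ i ∈ Finset.range (Function.minimalPeriod τ v.out), F ((τ ^ i) v.out) := by
  rw [← Finset.sum_fiberwise (s := Finset.univ) (g := fun x : X => (Quotient.mk (Perm.SameCycle.setoid τ) x))]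
  refine Finset.sum_congr rfl fun v _ => ?_
  symm
  refine Finset.sum_bij (fun i _ => (τ ^ i) v.out) ?_ ?_ ?_ fun _ _ => rfl
  · intro i _
    rw [Finset.mem_filter]
    refine ⟨Finset.mem_univ _, ?_⟩
    conv_rhs => rw [← Quotient.out_eq v]
    exact Quotient.sound ((Perm.SameCycle.refl τ v.out).pow_right.symm)
  · intro i hi j hj e
    rw [Perm.coe_pow, Perm.coe_pow] at e
    exact (Function.iterate_injOn_Iio_minimalPeriod) (by simpa using hi) (by simpa using hj) e
  · intro x hx
    rw [Finset.mem_filter] at hx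
    have hs : τ.SameCycle v.out x := by
      have h := hx.2
      rw [← Quotient.out_eq v] at h
      exact (Quotient.exact h).symm
    obtain ⟨n, hn⟩ := hs.exists_nat_pow_eq
    refine ⟨n % Function.minimalPeriod τ v.out, ?_, ?_⟩
    · rw [Finset.mem_range]
      exact Nat.mod_lt _ (Function.minimalPeriod_pos_of_mem_periodicPts
        (Function.mem_periodicPts.2 ⟨orderOf τ, orderOf_pos τ, by
          rw [Function.IsPeriodicPt, Function.IsFixedPt, ← Perm.coe_pow, pow_orderOf_eq_one]; rfl⟩))
    · rw [Perm.coe_pow, Function.iterate_mod_minimalPeriod_eq, ← Perm.coe_pow, hn]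

/-- The subspace orthogonal to the orthogonal of `P` is `P`. -/
theorem mem_of_orthogonal (P : Submodule k (X → k)) {w : X → k}
    (h : ∀ y : X → k, (∀ p ∈ P, ∑ x, p x * y x = 0) → ∑ x, w x * y x = 0) : w ∈ P := by
  by_contra hw
  obtain ⟨θ, hθ, hP⟩ := Submodule.exists_le_ker_of_notMem hw
  -- A linear form on functions is the sum against the function of its values at the indicators of
  -- points; this function is the `y` to which the hypothesis is applied.
  have e : ∀ z : X → k, θ z = ∑ x, z x * θ (Pi.single x 1) := by
    intro z
    conv_lhs => rw [← Finset.univ_sum_single z, map_sum]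
    refine Finset.sum_congr rfl fun x _ => ?_
    rw [← smul_eq_mul, ← map_smul]
    congr 1
    ext j
    simp [Pi.single_apply]
  refine hθ ?_
  rw [e]
  refine h _ fun p hp => ?_
  rw [← e]
  exact hP hp

end Potentials

namespace RibbonGraph

/-! ### The intersection form -/

section Form

variable {k : Type u} [Field k] {I : Type} (G : RibbonGraph I)

variable (k) in
/-- The intersection form on the first homology. -/
def intersectionForm : G.H1 k →ₗ[k] G.H1 k →ₗ[k] k :=
  LinearMap.mk₂ k (G.intersection k)
    (fun x x' y => by
      simp only [intersection, localIntersection, Submodule.coe_add, Pi.add_apply, ← mul_add,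
        ← Finset.sum_add_distrib]
      refine congrArg _ (Finset.sum_congr rfl fun v _ => Finset.sum_congr rfl fun j _ =>
        Finset.sum_congr rfl fun i _ => ?_)
      ring)
    (fun c x y => by
      simp only [intersection, localIntersection, Submodule.coe_smul, Pi.smul_apply, smul_eq_mul,
        mul_left_comm c, Finset.mul_sum]
      refine Finset.sum_congr rfl fun v _ => Finset.sum_congr rfl fun j _ =>
        Finset.sum_congr rfl fun i _ => ?_
      ring)
    (fun x y y' => by
      simp only [intersection, localIntersection, Submodule.coe_add, Pi.add_apply, ← mul_add,
        ← Finset.sum_add_distrib]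
      refine congrArg _ (Finset.sum_congr rfl fun v _ => Finset.sum_congr rfl fun j _ =>
        Finset.sum_congr rfl fun i _ => ?_)
      ring)
    (fun c x y => by
      simp only [intersection, localIntersection, Submodule.coe_smul, Pi.smul_apply, smul_eq_mul,
        mul_left_comm c, Finset.mul_sum]
      refine Finset.sum_congr rfl fun v _ => Finset.sum_congr rfl fun j _ =>
        Finset.sum_congr rfl fun i _ => ?_
      ring)

theorem intersectionForm_apply (x y : G.H1 k) :
    G.intersectionForm k x y = G.intersection k x y := rfl

theorem intersectionForm_self (x : G.H1 k) : G.intersectionForm k x x = 0 := by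
  simp [intersectionForm_apply, intersection, localIntersection, mul_comm]

theorem intersectionForm_swap (x y : G.H1 k) :
    G.intersectionForm k x y = - G.intersectionForm k y x := by
  have := G.intersectionForm_self (x + y)
  simp only [map_add, LinearMap.add_apply, intersectionForm_self] at this
  linear_combination this

/-- Summation by parts: when one sequence consists of the differences of `Y`, the inner sums
telescope. -/
theorem sum_pairs_potential (x : ℕ → k) (Y : ℕ → k) (n : ℕ) :
    ∑ j ∈ Finset.range n, ∑ i ∈ Finset.range j,
      (x i * (Y (j + 1) - Y j) - x j * (Y (i + 1) - Y i)) =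
    (∑ i ∈ Finset.range n, x i) * (Y n + Y 0) - ∑ j ∈ Finset.range n, x j * (Y j + Y (j + 1)) := by
  induction n with
  | zero => simp
  | succ n ih =>
    have h1 : ∑ i ∈ Finset.range n, (x i * (Y (n + 1) - Y n) - x n * (Y (i + 1) - Y i)) =
        (∑ i ∈ Finset.range n, x i) * (Y (n + 1) - Y n) - x n * (Y n - Y 0) := by
      rw [Finset.sum_sub_distrib, ← Finset.sum_mul, ← Finset.mul_sum, Finset.sum_range_sub]
    rw [Finset.sum_range_succ, ih, h1, Finset.sum_range_succ, Finset.sum_range_succ]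
    ring

/-- The vanishing of the boundary of `x`, paired with the indicator function of one vertex. -/
theorem sum_vertex_eq_zero (x : G.H1 k) (o : G.Flag) :
    ∑ i ∈ Finset.range (G.valence o), x.1 ((G.rot ^ i) o) = 0 := by
  have h1 := x.2.2 (cycFun k G.rot o).1 (cycFun k G.rot o).2
  have e : ∀ z : G.Flag, (cycFun k G.rot o).1 z * x.1 z =
      if z ∈ Finset.univ.filter (G.rot.SameCycle o) then x.1 z else 0 := by
    intro z
    by_cases hz : G.rot.SameCycle o z
    · simp [cycFun_of_sameCycle k hz, hz]
    · simp [cycFun_of_not_sameCycle k hz, hz]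
  simp only [e] at h1
  rw [Finset.sum_ite_mem, Finset.univ_inter] at h1
  rw [← h1]
  refine Finset.sum_bij (fun i _ => (G.rot ^ i) o) ?_ ?_ ?_ fun _ _ => rfl
  · intro i _
    rw [Finset.mem_filter]
    exact ⟨Finset.mem_univ _, (Perm.SameCycle.refl G.rot o).pow_right⟩
  · intro i hi j hj e
    rw [Perm.coe_pow, Perm.coe_pow] at e
    exact (Function.iterate_injOn_Iio_minimalPeriod) (by simpa [valence] using hi)
      (by simpa [valence] using hj) e
  · intro z hz
    rw [Finset.mem_filter] at hz
    obtain ⟨n, hn⟩ := hz.2.exists_nat_pow_eq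
    refine ⟨n % Function.minimalPeriod G.rot o, ?_, ?_⟩
    · rw [Finset.mem_range]
      exact Nat.mod_lt _ (Function.minimalPeriod_pos_of_mem_periodicPts
        (Function.mem_periodicPts.2 ⟨orderOf G.rot, orderOf_pos G.rot, by
          rw [Function.IsPeriodicPt, Function.IsFixedPt, ← Perm.coe_pow, pow_orderOf_eq_one]; rfl⟩))
    · rw [Perm.coe_pow, Function.iterate_mod_minimalPeriod_eq, ← Perm.coe_pow, hn]

/-- The intersection index in terms of a potential of the second cycle. -/
theorem intersectionForm_eq [CharZero k] (x y : G.H1 k) {Y : G.Flag → k}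
    (hY : ∀ f, Y (G.rot f) - Y f = y.1 f) :
    G.intersectionForm k x y = - (2⁻¹ * ∑ f, x.1 f * (Y f + Y (G.rot f))) := by
  rw [intersectionForm_apply, intersection, sum_cycles G.rot, ← mul_neg, ← Finset.sum_neg_distrib]
  refine congrArg _ (Finset.sum_congr rfl fun v _ => ?_)
  have h := sum_pairs_potential (fun i => x.1 ((G.rot ^ i) v.out)) (fun i => Y ((G.rot ^ i) v.out))
    (G.valence v.out)
  rw [G.sum_vertex_eq_zero x, zero_mul, zero_sub] at h
  simp only [pow_succ', Perm.mul_apply, hY] at h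
  exact h

end Form

section Faces

variable {k : Type u} [Field k] {I : Type} (G : RibbonGraph I)

theorem face_opp (f : G.Flag) : G.face (G.opp f) = G.rot f := by
  rw [face, Perm.mul_apply, G.opp_opp]

theorem invariant_opp {X : G.Flag → k} (hX : ∀ f, X (G.face f) = X f) (f : G.Flag) :
    X (G.opp f) = X (G.rot f) := by
  rw [← G.face_opp, hX]

variable (k) in
/-- The boundary of a linear combination of punctures. -/
def boundary : invariants k G.face →ₗ[k] G.H1 k where
  toFun X := ⟨fun f => X.1 f - X.1 (G.opp f), by
    refine ⟨fun f => ?_, fun u hu => ?_⟩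
    · beta_reduce
      rw [G.opp_opp]
      ring
    · simp only [G.invariant_opp X.2, mul_sub, Finset.sum_sub_distrib]
      rw [sub_eq_zero, ← Equiv.sum_comp G.rot]
      exact Finset.sum_congr rfl fun f _ => by rw [hu]⟩
  map_add' X Y := Subtype.ext (funext fun f => by
    change (X.1 f + Y.1 f) - (X.1 _ + Y.1 _) = (X.1 f - X.1 _) + (Y.1 f - Y.1 _)
    ring)
  map_smul' c X := Subtype.ext (funext fun f => by
    change c * X.1 f - c * X.1 _ = c * (X.1 f - X.1 _)
    ring)

theorem faceClass_eq (x : G.Flag) : G.faceClass k x = G.boundary k (cycFun k G.face x) := rfl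

theorem faceClass_congr {x y : G.Flag} (h : cyc G.face x = cyc G.face y) :
    G.faceClass k x = G.faceClass k y := by
  refine Subtype.ext (funext fun f => ?_)
  simp only [faceClass, h]

variable [CharZero k]

/-- For a function `X` that is constant on punctures, `-X` is a potential of its boundary. The
resulting sum pairs `y`, which is odd under `opp`, with `X + X ∘ opp`, which is even. -/
theorem intersectionForm_boundary (y : G.H1 k) (X : invariants k G.face) :
    G.intersectionForm k y (G.boundary k X) = 0 := by
  rw [G.intersectionForm_eq (Y := fun f => - X.1 f)]
  · have h : ∑ f, y.1 f * (- X.1 f + - X.1 (G.rot f)) = 0 := by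
      have e : ∑ f, y.1 f * X.1 (G.opp f) = - ∑ f, y.1 f * X.1 f := by
        rw [← Equiv.sum_comp G.opp, ← Finset.sum_neg_distrib]
        exact Finset.sum_congr rfl fun f _ => by rw [y.2.1, G.opp_opp, neg_mul]
      simp only [← G.invariant_opp X.2, mul_add, mul_neg, Finset.sum_add_distrib,
        Finset.sum_neg_distrib, e]
      ring
    rw [h, mul_zero, neg_zero]
  · intro f
    rw [← G.invariant_opp X.2]
    change _ = X.1 f - X.1 (G.opp f)
    ring

theorem boundary_intersectionForm (X : invariants k G.face) (y : G.H1 k) :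
    G.intersectionForm k (G.boundary k X) y = 0 := by
  rw [intersectionForm_swap, intersectionForm_boundary, neg_zero]

/-- The radical of the intersection form consists of the boundaries. -/
theorem ker_intersectionForm :
    LinearMap.ker (G.intersectionForm k) = LinearMap.range (G.boundary k) := by
  refine le_antisymm (fun x hx => ?_) ?_
  · obtain ⟨X, hX⟩ := exists_potential G.rot x.2.2
    let S : Submodule k (G.Flag → k) := invariants k G.opp
    -- By `intersectionForm_eq` the function `X + X ∘ rot` is orthogonal to `H1`, and `H1` is by
    -- definition the orthogonal of the sum of the functions invariant under `opp` and of those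
    -- invariant under `rot`.
    have hW : (fun f => X f + X (G.rot f)) ∈ S ⊔ invariants k G.rot := by
      refine mem_of_orthogonal _ fun y hy => ?_
      have hy1 : ∀ f, y (G.opp f) = - y f := by
        intro f
        have h := hy (Pi.single f 1 + Pi.single (G.opp f) 1) (Submodule.mem_sup_left fun g => by
          have e1 : G.opp g = G.opp f ↔ g = f := G.opp.injective.eq_iff
          have e2 : G.opp g = f ↔ g = G.opp f :=
            ⟨fun h => by rw [← h, G.opp_opp], fun h => by rw [h, G.opp_opp]⟩
          simp only [Pi.add_apply, Pi.single_apply, e1, e2]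
          ring)
        simp only [Pi.add_apply, Pi.single_apply, add_mul, ite_mul, one_mul, zero_mul,
          Finset.sum_add_distrib, Finset.sum_ite_eq', Finset.mem_univ, if_true] at h
        exact eq_neg_of_add_eq_zero_right h
      have hy2 : y ∈ G.H1 k := ⟨hy1, fun u hu => hy u (Submodule.mem_sup_right hu)⟩
      have h := G.intersectionForm_eq ⟨y, hy2⟩ x hX
      rw [intersectionForm_swap, LinearMap.mem_ker.1 hx] at h
      have h' : ∑ f, y f * (X f + X (G.rot f)) = 0 := by simpa using h
      rw [← h']
      exact Finset.sum_congr rfl fun f _ => mul_comm _ _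
    obtain ⟨s, hs, u, hu, hsu⟩ := Submodule.mem_sup.1 hW
    have hsu : ∀ f, s f + u f = X f + X (G.rot f) := fun f => congrFun hsu f
    -- A potential may be changed by a function of the vertex. After this correction `Z + Z ∘ rot`
    -- is even under `opp`, while `Z ∘ rot - Z = x` is odd; together this gives `Z ∘ rot = Z ∘ opp`,
    -- so `Z` is constant on punctures.
    set Z : G.Flag → k := fun f => X f - 2⁻¹ * u f with hZ
    have h1 : ∀ f, Z f + Z (G.rot f) = s f := by
      intro f
      have h2 : u (G.rot f) = u f := hu f
      simp only [hZ, h2]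
      linear_combination - hsu f
    have h2 : ∀ f, Z (G.rot f) - Z f = x.1 f := by
      intro f
      have h2 : u (G.rot f) = u f := hu f
      simp only [hZ, h2, ← hX]
      ring
    have h3 : ∀ f, Z (G.rot f) = Z (G.opp f) := by
      intro f
      have e1 := h1 f
      have e2 := h1 (G.opp f)
      have e3 : s (G.opp f) = s f := hs f
      have e4 := h2 f
      have e5 := h2 (G.opp f)
      rw [x.2.1] at e5
      linear_combination 2⁻¹ * (e1 - e2 - e3 + e4 + e5)
    have h4 : ∀ f, Z (G.face f) = Z f := by
      intro f
      have := h3 (G.opp f)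
      rw [G.opp_opp] at this
      exact this
    refine ⟨-⟨Z, h4⟩, Subtype.ext (funext fun f => ?_)⟩
    change - Z f - - Z (G.opp f) = x.1 f
    rw [← h2, h3]
    ring
  · rintro _ ⟨X, rfl⟩
    rw [LinearMap.mem_ker]
    ext y
    exact G.boundary_intersectionForm X y

/-- The kernel is spanned by the fundamental class of the closed surface: a function constant on
punctures and with zero boundary is invariant under `opp`, hence under `rot`, hence constant by
connectedness. -/
theorem finrank_ker_boundary : finrank k (LinearMap.ker (G.boundary k)) = 1 := by
  obtain ⟨o⟩ := G.nonempty
  refine finrank_eq_one (⟨⟨fun _ => 1, fun _ => rfl⟩, ?_⟩ : LinearMap.ker (G.boundary k)) ?_ ?_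
  · refine Subtype.ext (funext fun f => ?_)
    exact sub_self (1 : k)
  · intro h
    have := congrFun (congrArg (fun z : LinearMap.ker (G.boundary k) => z.1.1) h) o
    exact one_ne_zero this
  · rintro ⟨X, hX⟩
    have h1 : ∀ f, X.1 (G.opp f) = X.1 f := fun f => by
      have := congrFun (congrArg Subtype.val (LinearMap.mem_ker.1 hX)) f
      exact (sub_eq_zero.1 this).symm
    have h2 : {f | X.1 f = X.1 o} = Set.univ := by
      refine G.connected _ ⟨o, rfl⟩ fun f hf => ⟨?_, ?_⟩
      · change X.1 (G.rot f) = _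
        rw [← G.invariant_opp X.2, h1]
        exact hf
      · change X.1 (G.opp f) = _
        rw [h1]
        exact hf
    refine ⟨X.1 o, Subtype.ext (Subtype.ext (funext fun f => ?_))⟩
    have : f ∈ {f | X.1 f = X.1 o} := h2 ▸ Set.mem_univ f
    change X.1 o * 1 = X.1 f
    rw [mul_one]
    exact this.symm

theorem boundary_one : G.boundary k ⟨fun _ => 1, fun _ => rfl⟩ = 0 :=
  Subtype.ext (funext fun _ => sub_self (1 : k))

theorem sum_cycFun {X : Type} [Finite X] {τ : Perm X} {P : List X}
    (h : IsCycleList τ (P.map (cyc τ))) :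
    (P.map (cycFun k τ)).sum = ⟨fun _ => 1, fun _ => rfl⟩ := by
  refine Subtype.ext (funext fun y => ?_)
  have key : ∀ Q : List X, (Q.map (cyc τ)).Nodup →
      ((Q.map (cycFun k τ)).sum).1 y = if ∃ x ∈ Q, τ.SameCycle x y then 1 else 0 := by
    intro Q hQ
    induction Q with
    | nil => simp
    | cons x Q ih =>
      rw [List.map_cons] at hQ
      have hQ := List.nodup_cons.1 hQ
      rw [List.map_cons, List.sum_cons]
      change (if τ.SameCycle x y then (1 : k) else 0) + ((Q.map (cycFun k τ)).sum).1 y = _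
      rw [ih hQ.2]
      by_cases hx : τ.SameCycle x y
      · have : ¬ ∃ z ∈ Q, τ.SameCycle z y := by
          rintro ⟨z, hz, hzy⟩
          exact hQ.1 (cyc_eq_iff.2 (hzy.trans hx.symm) ▸ List.mem_map_of_mem hz)
        rw [if_pos hx, if_neg this, if_pos ⟨x, by simp, hx⟩, add_zero]
      · rw [if_neg hx, zero_add]
        congr 1
        simp [hx]
  rw [key P h.1, if_pos (h.exists_sameCycle y)]

/-- The sum of the boundary classes of all punctures is zero. -/
theorem sum_faceClass {P : List G.Flag} (h : IsCycleList G.face (P.map (cyc G.face))) :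
    (P.map (G.faceClass k)).sum = 0 := by
  have := congrArg (G.boundary k) (sum_cycFun (k := k) h)
  rw [boundary_one, map_list_sum, List.map_map] at this
  exact this

theorem span_faceClass {P : List G.Flag} (h : IsCycleList G.face (P.map (cyc G.face))) :
    Submodule.span k {x | x ∈ P.map (G.faceClass k)} = LinearMap.ker (G.intersectionForm k) := by
  rw [ker_intersectionForm, LinearMap.range_eq_map, ← span_cycFun k h, Submodule.map_span]
  congr 1
  ext x
  simp [faceClass_eq]

/-- The radical is the image of `k ^ ν` modulo the constants. This is why the number `γ` of
hyperbolic pairs is the genus: `b = 2 γ + (ν - 1)`. -/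
theorem finrank_ker_intersectionForm {P : List G.Flag}
    (h : IsCycleList G.face (P.map (cyc G.face))) :
    finrank k (LinearMap.ker (G.intersectionForm k)) + 1 = P.length := by
  have h1 := LinearMap.finrank_range_add_finrank_ker (G.boundary k)
  rw [finrank_ker_boundary, finrank_invariants k h] at h1
  rw [ker_intersectionForm]
  exact h1

variable (k) in
/-- The auxiliary choices that concern the punctures and the closed surface. -/
structure SurfaceFraming (γ : ℕ) where
  /-- a list of flags, one for every puncture -/
  punctures : List G.Flag
  isCycleList_face : IsCycleList G.face (punctures.map (cyc G.face))
  genus_eq : 2 * γ + punctures.length = G.betti k + 1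
  /-- the first half of a symplectic basis of the first homology of the closed surface -/
  a : Fin γ → G.H1 k
  /-- the second half of a symplectic basis of the first homology of the closed surface -/
  b : Fin γ → G.H1 k
  isSymplectic : IsSymplectic (G.intersectionForm k) a b

variable (k) in
theorem exists_surfaceFraming : ∃ γ, Nonempty (G.SurfaceFraming k γ) := by
  obtain ⟨γ, a, b, h1, h2⟩ := exists_symplectic (G.intersectionForm_self (k := k))
  obtain ⟨P, hP⟩ := exists_representatives G.face
  refine ⟨γ, ⟨⟨P, hP, ?_, a, b, h1⟩⟩⟩
  have h3 := G.finrank_ker_intersectionForm (k := k) hP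
  rw [betti, h2]
  omega

end Faces

/-! ### The Euler characteristic -/

section Euler

variable {k : Type u} [Field k] [CharZero k] {I : Type} (G : RibbonGraph I)

variable (k) in
/-- The functions that change sign under the exchange of the flags of an edge. -/
def edgeFun : Submodule k (G.Flag → k) where
  carrier := {x | ∀ f, x (G.opp f) = - x f}
  zero_mem' := by simp
  add_mem' {x y} hx hy := fun f => by
    simp only [Pi.add_apply, hx f, hy f]
    ring
  smul_mem' c x hx := fun f => by
    simp only [Pi.smul_apply, hx f, smul_neg]

/-- The dimension of `edgeFun` plays the role of the number of edges. A function on flags is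
recovered from its odd part, its even part and its values at the legs; the odd sign `ε`, which
orients every edge by an arbitrary enumeration of the flags and vanishes at the legs, turns the even
part into an odd function. -/
theorem card_flag_le [Finite I] :
    Fintype.card G.Flag ≤ 2 * finrank k (G.edgeFun k) + Nat.card I := by
  have : Fintype I := Fintype.ofFinite I
  let e := Fintype.equivFin G.Flag
  let ε : G.Flag → k := fun f => if e f < e (G.opp f) then 1 else if e (G.opp f) < e f then -1 else 0
  have hε : ∀ f, ε (G.opp f) = - ε f := by
    intro f
    simp only [ε, G.opp_opp]
    rcases lt_trichotomy (e f) (e (G.opp f)) with h | h | h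
    · simp [h, h.not_gt]
    · simp [h]
    · simp [h, h.not_gt]
  have hε0 : ∀ f, ε f = 0 → f ∈ Set.range G.leg := by
    intro f hf
    rw [← G.opp_eq_self_iff]
    simp only [ε] at hf
    rcases lt_trichotomy (e f) (e (G.opp f)) with h | h | h
    · simp [h] at hf
    · exact (e.injective h).symm
    · simp [h, h.not_gt] at hf
  let φ : (G.Flag → k) →ₗ[k] G.edgeFun k × G.edgeFun k × (I → k) :=
    { toFun := fun x => (⟨fun f => x f - x (G.opp f), fun f => by simp only [G.opp_opp]; ring⟩,
        ⟨fun f => ε f * (x f + x (G.opp f)), fun f => by simp only [G.opp_opp, hε]; ring⟩,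
        fun i => x (G.leg i))
      map_add' := fun x y => by
        refine Prod.ext (Subtype.ext (funext fun f => ?_)) (Prod.ext (Subtype.ext
          (funext fun f => ?_)) rfl)
        · change (x f + y f) - (x _ + y _) = (x f - x _) + (y f - y _)
          ring
        · change ε f * ((x f + y f) + (x _ + y _)) = ε f * (x f + x _) + ε f * (y f + y _)
          ring
      map_smul' := fun c x => by
        refine Prod.ext (Subtype.ext (funext fun f => ?_)) (Prod.ext (Subtype.ext
          (funext fun f => ?_)) rfl)
        · change c * x f - c * x _ = c * (x f - x _)
          ring
        · change ε f * (c * x f + c * x _) = c * (ε f * (x f + x _))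
          ring }
  have hφ : Function.Injective φ := by
    refine (injective_iff_map_eq_zero _).2 fun x hx => funext fun f => ?_
    have h1 : x f - x (G.opp f) = 0 := congrFun (congrArg (fun z => z.1.1) hx) f
    have h2 : ε f * (x f + x (G.opp f)) = 0 := congrFun (congrArg (fun z => z.2.1.1) hx) f
    have h3 : ∀ i, x (G.leg i) = 0 := fun i => congrFun (congrArg (fun z => z.2.2) hx) i
    rcases mul_eq_zero.1 h2 with h | h
    · obtain ⟨i, rfl⟩ := hε0 f h
      exact h3 i
    · have : 2 * x f = 0 := by linear_combination h1 + h
      simpa using this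
  have := LinearMap.finrank_le_finrank_of_injective hφ
  rw [finrank_prod, finrank_prod, Module.finrank_fintype_fun_eq_card,
    Module.finrank_fintype_fun_eq_card] at this
  rw [Nat.card_eq_fintype_card]
  omega

/-- The boundary map from edges to vertices has the kernel `H_1(G)`, and it is not onto, because the
total boundary of an edge is zero while a point has total one. This half of the Euler formula
suffices for the stable range. -/
theorem finrank_edgeFun_lt :
    finrank k (G.edgeFun k) < G.betti k + finrank k (G.VertFun k) := by
  let φ : G.edgeFun k →ₗ[k] Dual k (G.VertFun k) :=
    LinearMap.mk₂ k (fun x u => ∑ f, u.1 f * x.1 f)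
      (fun x y u => by simp [mul_add, Finset.sum_add_distrib])
      (fun c x u => by simp [Finset.mul_sum, mul_left_comm])
      (fun x u v => by simp [add_mul, Finset.sum_add_distrib])
      (fun c x u => by simp [Finset.mul_sum, mul_assoc])
  have hφ : ∀ x u, φ x u = ∑ f, u.1 f * x.1 f := fun _ _ => rfl
  have h1 := LinearMap.finrank_range_add_finrank_ker φ
  have h2 : finrank k (LinearMap.ker φ) = G.betti k := by
    refine LinearEquiv.finrank_eq (LinearEquiv.ofBijective
      ({ toFun := fun x => ⟨x.1.1, x.1.2, fun u hu => ?_⟩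
         map_add' := fun _ _ => rfl
         map_smul' := fun _ _ => rfl } : LinearMap.ker φ →ₗ[k] G.H1 k) ⟨fun x y h => ?_, fun x => ?_⟩)
    · exact LinearMap.congr_fun (LinearMap.mem_ker.1 x.2) ⟨u, hu⟩
    · exact Subtype.ext (Subtype.ext (congrArg (fun z : G.H1 k => z.1) h))
    · exact ⟨⟨⟨x.1, x.2.1⟩, LinearMap.ext fun u => x.2.2 u.1 u.2⟩, rfl⟩
  have h3 : LinearMap.range φ < ⊤ := by
    refine lt_top_iff_ne_top.2 fun htop => ?_
    obtain ⟨o⟩ := G.nonempty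
    have : (LinearMap.proj o).comp (G.VertFun k).subtype ∈ LinearMap.range φ := htop ▸ Submodule.mem_top
    obtain ⟨x, hx⟩ := this
    have h := LinearMap.congr_fun hx ⟨fun _ => 1, fun _ => rfl⟩
    rw [hφ] at h
    have h0 : ∑ f, x.1 f = 0 := by
      have e : ∑ f, x.1 f = - ∑ f, x.1 f := by
        conv_lhs => rw [← Equiv.sum_comp G.opp]
        rw [← Finset.sum_neg_distrib]
        exact Finset.sum_congr rfl fun f _ => x.2 f
      exact self_eq_neg.1 e
    simp only [one_mul, h0] at h
    exact zero_ne_one h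
  have h4 := Submodule.finrank_lt h3.ne
  rw [Subspace.dual_finrank_eq] at h4
  omega

theorem finrank_vertFun {P : List G.Flag} (h : IsCycleList G.rot (P.map (cyc G.rot))) :
    finrank k (G.VertFun k) = P.length := finrank_invariants k h

theorem IsTrivalent.card_flag {G : RibbonGraph I} (hG : G.IsTrivalent) {P : List G.Flag}
    (h : IsCycleList G.rot (P.map (cyc G.rot))) : Fintype.card G.Flag = 3 * P.length :=
  card_eq_three_mul hG (fun x => (G.stable x).1) h

/-- The component of `S[t]` of the number of legs and of the Betti number of a trivalent graph is
in the stable range. -/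
theorem IsTrivalent.stable_range [Finite I] {G : RibbonGraph I} (hG : G.IsTrivalent) :
    2 < 2 * G.betti k + Nat.card I := by
  obtain ⟨P, hP⟩ := exists_representatives G.rot
  have h1 := hG.card_flag hP
  have h2 := G.card_flag_le (k := k)
  have h3 := G.finrank_edgeFun_lt (k := k)
  rw [G.finrank_vertFun hP] at h3
  have h4 : 0 < P.length := by
    obtain ⟨o⟩ := G.nonempty
    obtain ⟨y, hy, -⟩ := hP.exists_sameCycle o
    exact List.length_pos_of_mem hy
  -- With `V` vertices, `E = dim edgeFun` and `n` legs, `3 V ≤ 2 E + n` and `E < b + V` give `V + 2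
  -- ≤ 2 b + n`, and `V` is positive.
  omega

/-- Needed for the grading: the term `∑_v (n(v) - 3)` of the degree vanishes. -/
theorem IsTrivalent.card_flag_eq {G : RibbonGraph I} (hG : G.IsTrivalent) :
    Fintype.card G.Flag = 3 * G.numVertices := by
  obtain ⟨P, hP⟩ := exists_representatives G.rot
  rw [hG.card_flag hP, numVertices]
  congr 1
  let f : {C // C ∈ P.map (cyc G.rot)} → Quotient (Perm.SameCycle.setoid G.rot) := fun C =>
    Quotient.mk _ (Classical.choose ((hP.2 C.1).1 C.2))
  have hf : Function.Bijective f := by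
    have hspec : ∀ C : {C // C ∈ P.map (cyc G.rot)},
        C.1 = cyc G.rot (Classical.choose ((hP.2 C.1).1 C.2)) := fun C =>
      Classical.choose_spec ((hP.2 C.1).1 C.2)
    constructor
    · intro C D h
      refine Subtype.ext ?_
      rw [hspec C, hspec D]
      exact cyc_eq_iff.2 (Quotient.exact h)
    · intro q
      obtain ⟨x, rfl⟩ := Quotient.exists_rep q
      refine ⟨⟨cyc G.rot x, (hP.2 _).2 ⟨x, rfl⟩⟩, Quotient.sound ?_⟩
      exact (cyc_eq_iff.1 (hspec ⟨cyc G.rot x, (hP.2 _).2 ⟨x, rfl⟩⟩)).symm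
  rw [← Nat.card_congr (Equiv.ofBijective f hf), Nat.card_eq_fintype_card,
    Fintype.card_of_subtype (P.map (cyc G.rot)).toFinset (by simp),
    List.toFinset_card_of_nodup hP.1, List.length_map]

end Euler

end RibbonGraph

/-! ### Signs of permutations of punctures -/

section Signs

variable {k : Type u} [Field k] {X : Type} {V : Type v} [AddCommGroup V] [Module k V]

variable (k) in
/-- The product of all vectors of a list but the first one, with the sign that makes it equal to the
product of all vectors but the last one if the sum of the vectors is zero. -/
def tailProd : List V → ExteriorAlgebra k V
  | [] => 0
  | _ :: L => (-1) ^ L.length * ιProd k L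

theorem tailProd_cons (v : V) (L : List V) : tailProd k (v :: L) = (-1) ^ L.length * ιProd k L := rfl

/-- The canonical orientation omits the last puncture. Omitting the first one is more convenient,
because the punctures affected by a gluing can be put in front. For the empty list the left side
would be one and `tailProd` is zero. -/
theorem ιProd_dropLast_eq_tailProd {L : List V} (hL : L ≠ []) (h : L.sum = 0) :
    ιProd k L.dropLast = tailProd k L := by
  cases L with
  | nil => exact absurd rfl hL
  | cons v L => exact ιProd_dropLast h

/-- Transports signs: a relation between wedge products of cycles gives the same relation between
the products of the vectors assigned to them. -/
theorem ιProd_map_eq (f : Set X → V) (L : List (Set X)) : ιProd k (L.map f) =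
    ExteriorAlgebra.map (Finsupp.linearCombination k f) (wedge k L) := by
  have : wedge k L = ιProd k (L.map fun C => (Finsupp.single C 1 : Set X →₀ k)) := by
    simp only [wedge, ιProd, List.map_map]
    rfl
  rw [this, map_ιProd, List.map_map]
  congr 2
  ext C
  simp

/-- The isomorphism of `Det (k ^ ν)` with the determinant of the quotient by the sum of the basis
vectors, in terms of lists. Only the exchange of the first two entries uses that the sum is zero;
behind the head, permutations act on `tailProd` as they do on `wedge`. -/
theorem tailProd_perm (f : Set X → V) {L M : List (Set X)} (h : L.Perm M) (h0 : (L.map f).sum = 0) :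
    ∃ ε : k, wedge k M = ε • wedge k L ∧ tailProd k (M.map f) = ε • tailProd k (L.map f) := by
  induction h with
  | nil => exact ⟨1, by simp, by simp⟩
  | @cons C L M h ih =>
    obtain ⟨ε, hε⟩ : ∃ ε : k, wedge k M = ε • wedge k L := by
      rcases wedge_perm (k := k) h with e | e
      · exact ⟨1, by rw [e, one_smul]⟩
      · exact ⟨-1, by rw [e, neg_smul, one_smul, neg_neg]⟩
    refine ⟨ε, ?_, ?_⟩
    · rw [wedge_cons, wedge_cons, hε, mul_smul_comm]
    · rw [List.map_cons, List.map_cons, tailProd_cons, tailProd_cons, ιProd_map_eq, ιProd_map_eq, hε,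
        map_smul, mul_smul_comm, List.length_map, List.length_map, h.length_eq]
  | swap C D L =>
    refine ⟨-1, ?_, ?_⟩
    · rw [wedge_cons, wedge_cons, wedge_cons, wedge_cons, ← mul_assoc, ← mul_assoc, neg_smul, one_smul,
        ← neg_mul]
      congr 1
      exact eq_neg_of_add_eq_zero_left (ExteriorAlgebra.ι_add_mul_swap _ _)
    · simp only [List.map_cons, tailProd_cons, List.sum_cons, List.length_cons, ιProd_cons] at h0 ⊢
      -- Modulo the other vectors `f D` is `- f C`, so a change of the omitted vector from one to
      -- the other changes the sign.
      have e : f D = - f C - (L.map f).sum := by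
        rw [← sub_eq_zero, ← h0]
        abel
      rw [e, map_sub, map_neg, sub_mul, ι_mul_ιProd_of_mem_span (list_sum_mem_span _), sub_zero, neg_mul,
        mul_neg, neg_smul, one_smul]
  | trans h1 h2 ih1 ih2 =>
    obtain ⟨ε, e1, e2⟩ := ih1 h0
    obtain ⟨ε', e1', e2'⟩ := ih2 (by rw [← (h1.map f).sum_eq, h0])
    exact ⟨ε' * ε, by rw [e1', e1, smul_smul], by rw [e2', e2, smul_smul]⟩

end Signs

namespace RibbonGraph

section Canonical

variable {k : Type u} [Field k] {I : Type} (G : RibbonGraph I)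

/-! ### The factors of the canonical orientation -/

variable (k) in
/-- The boundary class of a puncture, as an element of the space of which `G.Orient k` is the
determinant. -/
def faceVec (x : G.Flag) : G.Vec k := (G.faceClass k x, 0, 0)

variable (k) in
/-- The vectors of a vertex of valence three: the vertex and its flags. -/
def vertexVecs (x : G.Flag) : List (G.Vec k) :=
  [(0, 0, G.vertexFun k x), (0, Pi.single x 1, 0), (0, Pi.single (G.rot x) 1, 0),
    (0, Pi.single (G.rot (G.rot x)) 1, 0)]

variable (k) in
/-- The canonical orientation of the vertices with given flags. -/
def vertexProd (L : List G.Flag) : ExteriorAlgebra k (G.Vec k) :=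
  (L.map fun x => ιProd k (G.vertexVecs k x)).prod

theorem vertexProd_eq_ιProd (L : List G.Flag) :
    G.vertexProd k L = ιProd k (L.flatMap (G.vertexVecs k)) := by
  induction L with
  | nil => rfl
  | cons x L ih =>
    rw [List.flatMap_cons, ιProd_append, ← ih]
    rfl

/-- A product of an even number of vectors is central; therefore the order of the vertices and the
place of their factors do not matter. -/
theorem vertexVecs_commute (x : G.Flag) (y : ExteriorAlgebra k (G.Vec k)) :
    Commute (ιProd k (G.vertexVecs k x)) y := by
  simp only [vertexVecs, ιProd_cons, ιProd_nil, mul_one]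
  rw [← mul_assoc]
  exact (pair_commute _ _ y).mul_left (pair_commute _ _ y)

theorem vertexProd_commute (L : List G.Flag) (y : ExteriorAlgebra k (G.Vec k)) :
    Commute (G.vertexProd k L) y := by
  induction L with
  | nil => exact Commute.one_left y
  | cons x L ih =>
    rw [vertexProd, List.map_cons, List.prod_cons]
    exact (G.vertexVecs_commute x y).mul_left ih

theorem vertexFun_congr {x y : G.Flag} (h : G.rot.SameCycle x y) :
    G.vertexFun k x = G.vertexFun k y := by
  refine Subtype.ext (funext fun z => ?_)
  simp only [vertexFun]
  congr 1
  exact propext ⟨fun hz => h.symm.trans hz, fun hz => h.trans hz⟩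

variable {G}

/-- A cyclic permutation of three flags is even: the remaining flag is moved past the central
product of the other two. -/
theorem IsTrivalent.vertexVecs_rot (hG : G.IsTrivalent) (x : G.Flag) :
    ιProd k (G.vertexVecs k (G.rot x)) = ιProd k (G.vertexVecs k x) := by
  have h : G.vertexFun k (G.rot x) = G.vertexFun k x :=
    G.vertexFun_congr (Perm.sameCycle_apply_left.2 (Perm.SameCycle.refl _ _))
  simp only [vertexVecs, ιProd_cons, ιProd_nil, mul_one]
  rw [h, hG x, ← mul_assoc (ExteriorAlgebra.ι k (0, Pi.single (G.rot x) 1, 0))]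
  rw [(pair_commute _ _ _).eq]

theorem IsTrivalent.vertexVecs_congr (hG : G.IsTrivalent) {x y : G.Flag}
    (h : G.rot.SameCycle x y) : ιProd k (G.vertexVecs k x) = ιProd k (G.vertexVecs k y) :=
  eq_of_sameCycle (u := fun z => ιProd k (G.vertexVecs k z)) hG.vertexVecs_rot h

theorem IsTrivalent.vertexProd_unique (hG : G.IsTrivalent) {L M : List G.Flag}
    (hL : IsCycleList G.rot (L.map (cyc G.rot))) (hM : IsCycleList G.rot (M.map (cyc G.rot))) :
    G.vertexProd k L = G.vertexProd k M := by
  -- The factor of a vertex as a function of the cycle, not of a flag in it. The value on sets that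
  -- are not cycles is irrelevant.
  let E : Set G.Flag → ExteriorAlgebra k (G.Vec k) := fun C =>
    if h : ∃ x, C = cyc G.rot x then ιProd k (G.vertexVecs k (Classical.choose h)) else 1
  have hE : ∀ x, E (cyc G.rot x) = ιProd k (G.vertexVecs k x) := by
    intro x
    have h : ∃ y, cyc G.rot x = cyc G.rot y := ⟨x, rfl⟩
    simp only [E]
    rw [dif_pos h]
    exact hG.vertexVecs_congr (cyc_eq_iff.1 (Classical.choose_spec h)).symm
  have key : ∀ N : List G.Flag, G.vertexProd k N = ((N.map (cyc G.rot)).map E).prod := by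
    intro N
    rw [vertexProd, List.map_map]
    congr 2
    ext1 x
    exact (hE x).symm
  rw [key, key]
  refine ((hL.unique hM).map E).prod_eq' ?_
  refine List.pairwise_of_forall_mem_list ?_
  intro a ha b _
  rw [List.map_map] at ha
  obtain ⟨x, _, rfl⟩ := List.mem_map.1 ha
  rw [Function.comp_apply, hE]
  exact G.vertexVecs_commute x _

variable (G) in
variable (k) in
/-- The space of which `G.Orient k` is the determinant carries the intersection form. -/
def vecForm : G.Vec k →ₗ[k] G.Vec k →ₗ[k] k :=
  (G.intersectionForm k).compl₁₂ (LinearMap.fst k _ _) (LinearMap.fst k _ _)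

/-! ### Framings -/

variable (G) in
variable (k) in
/-- The inclusion of the first homology. -/
abbrev inH1 : G.H1 k →ₗ[k] G.Vec k := LinearMap.inl k _ _

variable {γ : ℕ}

theorem Framing.isSymplectic (B : G.Framing k γ) : IsSymplectic (G.intersectionForm k) B.a B.b :=
  ⟨B.intersection_a_a, B.intersection_b_b, B.intersection_a_b⟩

variable [CharZero k]

theorem punctures_ne_nil {P : List G.Flag} (h : IsCycleList G.face (P.map (cyc G.face))) :
    P ≠ [] := by
  rintro rfl
  obtain ⟨o⟩ := G.nonempty
  obtain ⟨y, hy, -⟩ := h.exists_sameCycle o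
  simp at hy

/-- This form separates the three kinds of choices, and the omitted puncture is now the first one.
-/
theorem Framing.element_eq (B : G.Framing k γ) : B.element =
    tailProd k (B.punctures.map (G.faceVec k)) *
      pairProd k (fun i => G.inH1 k (B.a i)) (fun i => G.inH1 k (B.b i)) *
      G.vertexProd k B.vertices := by
  have h0 : (B.punctures.map (G.faceVec k)).sum = 0 := by
    have h := congrArg (G.inH1 k) (G.sum_faceClass (k := k) B.isCycleList_face)
    rw [map_list_sum, List.map_map, map_zero] at h
    exact h
  have h1 : B.punctures.map (G.faceVec k) ≠ [] := by
    simpa using punctures_ne_nil B.isCycleList_face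
  rw [← ιProd_dropLast_eq_tailProd h1 h0, Framing.element]
  congr 1
  · congr 1
    rw [← List.map_dropLast, ιProd, List.map_map]
    rfl
  · rw [vertexProd]
    congr 2
    ext1 x
    simp only [vertexVecs, ιProd_cons, ιProd_nil, mul_one, mul_assoc]

theorem Framing.legWedge_eq (B : G.Framing k γ) : B.legWedge =
    mapBlocks k (G.leg ⁻¹' ·) (wedge k (B.punctures.map (cyc G.face))) := by
  rw [mapBlocks_wedge, List.map_map]
  rfl

/-- The vectors in the radical of the intersection form whose product is a factor of the canonical
orientation. -/
def Framing.radicalVecs (B : G.Framing k γ) : List (G.Vec k) :=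
  B.punctures.tail.map (G.faceVec k) ++ B.vertices.flatMap (G.vertexVecs k)

theorem Framing.element_eq_radicalVecs (B : G.Framing k γ) : B.element =
    (-1) ^ B.punctures.tail.length * (ιProd k B.radicalVecs *
      pairProd k (fun i => G.inH1 k (B.a i)) (fun i => G.inH1 k (B.b i))) := by
  rw [B.element_eq, radicalVecs, ιProd_append, ← vertexProd_eq_ιProd]
  cases h : B.punctures with
  | nil => exact absurd h (punctures_ne_nil B.isCycleList_face)
  | cons x P =>
    rw [List.map_cons, tailProd_cons, List.tail_cons, List.length_map, mul_assoc, mul_assoc,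
      ← (G.vertexProd_commute B.vertices _).eq, mul_assoc]

theorem mem_radicalVecs (B : G.Framing k γ) : ∀ v ∈ B.radicalVecs, ∀ w, G.vecForm k v w = 0 := by
  intro v hv w
  rw [Framing.radicalVecs, List.mem_append] at hv
  rcases hv with hv | hv
  · obtain ⟨x, -, rfl⟩ := List.mem_map.1 hv
    exact G.boundary_intersectionForm (cycFun k G.face x) w.1
  · obtain ⟨x, -, hx⟩ := List.mem_flatMap.1 hv
    have : v.1 = 0 := by
      simp only [vertexVecs, List.mem_cons, List.not_mem_nil, or_false] at hx
      rcases hx with rfl | rfl | rfl | rfl <;> rfl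
    change G.intersectionForm k v.1 w.1 = 0
    rw [this, map_zero]
    rfl

theorem IsTrivalent.exists_flag (hG : G.IsTrivalent) {P : List G.Flag}
    (hP : IsCycleList G.rot (P.map (cyc G.rot))) (f : G.Flag) :
    ∃ x ∈ P, f = x ∨ f = G.rot x ∨ f = G.rot (G.rot x) := by
  obtain ⟨x, hx, hs⟩ := hP.exists_sameCycle f
  refine ⟨x, hx, ?_⟩
  obtain ⟨n, rfl⟩ := hs.exists_nat_pow_eq
  clear hs
  induction n with
  | zero => exact Or.inl rfl
  | succ n ih =>
    rw [pow_succ', Perm.mul_apply]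
    rcases ih with e | e | e <;> rw [e]
    · exact Or.inr (Or.inl rfl)
    · exact Or.inr (Or.inr rfl)
    · exact Or.inl (hG x)

theorem vertexFun_eq (x : G.Flag) : G.vertexFun k x = cycFun k G.rot x := by
  refine Subtype.ext (funext fun y => ?_)
  by_cases h : G.rot.SameCycle x y
  · rw [cycFun_of_sameCycle k h]
    exact if_pos h
  · rw [cycFun_of_not_sameCycle k h]
    exact if_neg h

theorem length_flatMap_vertexVecs (L : List G.Flag) :
    (L.flatMap (G.vertexVecs k)).length = 4 * L.length := by
  induction L with
  | nil => rfl
  | cons x L ih =>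
    rw [List.flatMap_cons, List.length_append, ih, List.length_cons]
    simp only [vertexVecs, List.length_cons, List.length_nil]
    ring

theorem Framing.length_radicalVecs (B : G.Framing k γ) :
    B.radicalVecs.length + 1 = B.punctures.length + 4 * B.vertices.length := by
  rw [radicalVecs, List.length_append, length_flatMap_vertexVecs, List.length_map, List.length_tail]
  have := List.length_pos_of_ne_nil (punctures_ne_nil B.isCycleList_face)
  omega

/-- A count of dimensions. The span contains the radical of the intersection form, because the
omitted boundary class is minus the sum of the others, and all functions of flags and of vertices.
The dimension `(ν - 1) + 3 V + V` of the sum of these spaces is the length of the list. -/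
theorem Framing.isFree_radicalVecs (hG : G.IsTrivalent) (B : G.Framing k γ) :
    IsFree k B.radicalVecs := by
  refine le_antisymm (finrank_span_list_le _) ?_
  set S := Submodule.span k {x | x ∈ B.radicalVecs} with hS
  have hF : ∀ x ∈ LinearMap.ker (G.intersectionForm k), G.inH1 k x ∈ S := by
    have h0 := G.sum_faceClass (k := k) B.isCycleList_face
    rw [← G.span_faceClass B.isCycleList_face]
    cases h : B.punctures with
    | nil => exact absurd h (punctures_ne_nil B.isCycleList_face)
    | cons y P =>
      have hP : ∀ x ∈ P, G.inH1 k (G.faceClass k x) ∈ S := fun x hx => by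
        refine Submodule.subset_span ?_
        change _ ∈ B.radicalVecs
        rw [radicalVecs, h, List.mem_append]
        exact Or.inl (List.mem_map_of_mem hx)
      intro x hx
      have : Submodule.span k {x | x ∈ (y :: P).map (G.faceClass k)} ≤ S.comap (G.inH1 k) := by
        refine Submodule.span_le.2 fun z hz => ?_
        obtain ⟨w, hw, rfl⟩ := List.mem_map.1 hz
        rcases List.mem_cons.1 hw with rfl | hw
        · rw [h, List.map_cons, List.sum_cons] at h0
          rw [SetLike.mem_coe, Submodule.mem_comap, eq_neg_of_add_eq_zero_left h0, map_neg, map_list_sum]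
          refine Submodule.neg_mem _ (list_sum_mem fun v hv => ?_)
          rw [List.map_map] at hv
          obtain ⟨u, hu, rfl⟩ := List.mem_map.1 hv
          exact hP u hu
        · exact hP w hw
      exact this hx
  have hV : ∀ x ∈ B.vertices, ∀ v ∈ G.vertexVecs k x, v ∈ S := fun x hx v hv => by
    refine Submodule.subset_span ?_
    change _ ∈ B.radicalVecs
    rw [radicalVecs, List.mem_append]
    exact Or.inr (List.mem_flatMap.2 ⟨x, hx, hv⟩)
  have hfl : ∀ f : G.Flag → k, ((0, f, 0) : G.Vec k) ∈ S := by
    have : (⊤ : Submodule k (G.Flag → k)) ≤ S.comap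
        ((LinearMap.inr k (G.H1 k) _).comp (LinearMap.inl k (G.Flag → k) (G.VertFun k))) := by
      rw [← (Pi.basisFun k G.Flag).span_eq]
      refine Submodule.span_le.2 ?_
      rintro _ ⟨f, rfl⟩
      rw [Pi.basisFun_apply]
      obtain ⟨x, hx, hf⟩ := hG.exists_flag B.isCycleList_rot f
      refine hV x hx _ ?_
      rcases hf with rfl | rfl | rfl <;> simp [vertexVecs]
    exact fun f => this Submodule.mem_top
  have hve : ∀ v : G.VertFun k, ((0, 0, v) : G.Vec k) ∈ S := by
    have : (⊤ : Submodule k (G.VertFun k)) ≤ S.comap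
        ((LinearMap.inr k (G.H1 k) _).comp (LinearMap.inr k (G.Flag → k) (G.VertFun k))) := by
      have h := span_cycFun k B.isCycleList_rot
      change Submodule.span k ({u | u ∈ B.vertices.map (cycFun k G.rot)} : Set (G.VertFun k)) = ⊤ at h
      rw [← h]
      refine Submodule.span_le.2 ?_
      intro z hz
      obtain ⟨x, hx, rfl⟩ := List.mem_map.1 hz
      refine hV x hx _ ?_
      have e := vertexFun_eq (k := k) (G := G) x
      exact List.mem_cons.2 (Or.inl (congrArg (fun v => ((0, 0, v) : G.Vec k)) e.symm))
    exact fun f => this Submodule.mem_top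
  let φ : LinearMap.ker (G.intersectionForm k) × (G.Flag → k) × G.VertFun k →ₗ[k] S :=
    LinearMap.codRestrict S ((LinearMap.ker (G.intersectionForm k)).subtype.prodMap LinearMap.id)
      fun y => by
        have e : ((LinearMap.ker (G.intersectionForm k)).subtype.prodMap LinearMap.id) y =
          G.inH1 k y.1.1 + (((0, y.2.1, 0) : G.Vec k) + ((0, 0, y.2.2) : G.Vec k)) := by
          refine Prod.ext ?_ (Prod.ext ?_ ?_)
          · change y.1.1 = y.1.1 + (0 + 0)
            rw [add_zero, add_zero]
          · change y.2.1 = 0 + (y.2.1 + 0)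
            rw [add_zero, zero_add]
          · change y.2.2 = 0 + (0 + y.2.2)
            rw [zero_add, zero_add]
        rw [e]
        exact Submodule.add_mem _ (hF _ y.1.2) (Submodule.add_mem _ (hfl _) (hve _))
  have hφ : Function.Injective φ := by
    intro y z hyz
    have h := congrArg Subtype.val hyz
    refine Prod.ext (Subtype.ext ?_) ?_
    · exact congrArg (fun z : G.Vec k => z.1) h
    · exact congrArg (fun z : G.Vec k => z.2) h
  have h1 := LinearMap.finrank_le_finrank_of_injective hφ
  have : Module.Free k (LinearMap.ker (G.intersectionForm k)) := Module.Free.of_divisionRing k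
    (LinearMap.ker (G.intersectionForm k))
  rw [finrank_prod, finrank_prod, Module.finrank_fintype_fun_eq_card,
    G.finrank_vertFun B.isCycleList_rot, hG.card_flag B.isCycleList_rot] at h1
  have h2 := G.finrank_ker_intersectionForm (k := k) B.isCycleList_face
  have h3 := B.length_radicalVecs
  omega

theorem isSymplectic_inH1 {a b : Fin γ → G.H1 k} (h : IsSymplectic (G.intersectionForm k) a b) :
    IsSymplectic (G.vecForm k) (fun i => G.inH1 k (a i)) (fun i => G.inH1 k (b i)) :=
  ⟨h.aa, h.bb, h.ab⟩

/-- A linear functional that equals one on the canonical element, no matter which symplectic family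
is used; it makes the orientation independent of `a` and `b`. The sign in front is absorbed in `Φ`,
as its square is one. -/
theorem Framing.exists_functional (hG : G.IsTrivalent) (B : G.Framing k γ) :
    ∃ Φ : ExteriorAlgebra k (G.Vec k) →ₗ[k] k,
      ∀ (γ' : ℕ) (a b : Fin γ' → G.H1 k), IsSymplectic (G.intersectionForm k) a b →
        Φ ((-1) ^ B.punctures.tail.length * (ιProd k B.radicalVecs *
          pairProd k (fun i => G.inH1 k (a i)) (fun i => G.inH1 k (b i)))) = 1 := by
  obtain ⟨Φ, hΦ⟩ := exists_functional_symplectic (ω := G.vecForm k)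
    (fun v => G.intersectionForm_self v.1) (mem_radicalVecs B) (B.isFree_radicalVecs hG)
  refine ⟨((-1) ^ B.punctures.tail.length : k) • Φ, fun γ' a b h => ?_⟩
  rw [neg_one_pow_mul_eq_smul, LinearMap.smul_apply, map_smul, hΦ _ _ _ (isSymplectic_inH1 h), smul_smul, ← pow_add,
    Even.neg_one_pow ⟨_, rfl⟩, one_smul]

/-- The number of factors is `(ν - 1) + 4 V + 2 γ`, which by the genus formula is the dimension `b +
3 V + V`. -/
theorem Framing.element_mem_power (hG : G.IsTrivalent) (B : G.Framing k γ) :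
    B.element ∈ ⋀[k]^(finrank k (G.Vec k)) (G.Vec k) := by
  rw [B.element_eq_radicalVecs, ← ιProd_pairList, ← ιProd_append, neg_one_pow_mul_eq_smul]
  refine Submodule.smul_mem _ _ ?_
  have h : finrank k (G.Vec k) = (B.radicalVecs ++ pairList (fun i => G.inH1 k (B.a i))
      fun i => G.inH1 k (B.b i)).length := by
    have h1 := finrank_vec (k := k) G
    rw [hG.card_flag B.isCycleList_rot, G.finrank_vertFun B.isCycleList_rot] at h1
    have h2 := B.length_radicalVecs
    have h3 := B.genus_eq
    rw [h1, List.length_append, length_pairList]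
    omega
  rw [h]
  exact ιProd_mem_power _

/-- The canonical orientation defined by a framing, as an element of the orientation line. -/
def Framing.orient (hG : G.IsTrivalent) (B : G.Framing k γ) : G.Orient k :=
  (⟨B.element, B.element_mem_power hG⟩ : ⋀[k]^(finrank k (G.Vec k)) (G.Vec k))

theorem Framing.val_orient (hG : G.IsTrivalent) (B : G.Framing k γ) :
    (B.orient hG).val = B.element := rfl

theorem Framing.element_ne_zero (hG : G.IsTrivalent) (B : G.Framing k γ) : B.element ≠ 0 := by
  intro h
  obtain ⟨Φ, hΦ⟩ := B.exists_functional hG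
  have := hΦ γ B.a B.b B.isSymplectic
  rw [← B.element_eq_radicalVecs, h, map_zero] at this
  exact zero_ne_one this

theorem Framing.exists_smul (hG : G.IsTrivalent) (B : G.Framing k γ) (α : G.Orient k) :
    ∃ c : k, α = c • B.orient hG :=
  Det.exists_smul (fun h => B.element_ne_zero hG (congrArg Det.val h)) α

theorem Framing.genus_unique (B : G.Framing k γ) {γ' : ℕ} (B' : G.Framing k γ') : γ = γ' := by
  have h1 := B.genus_eq
  have h2 := B'.genus_eq
  have h3 := (B.isCycleList_face.unique B'.isCycleList_face).length_eq
  rw [List.length_map, List.length_map] at h3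
  omega

/-- The dependence of the canonical orientation on the choices. -/
theorem Framing.compare (hG : G.IsTrivalent) (B : G.Framing k γ) {γ' : ℕ} (B' : G.Framing k γ') :
    ∃ ε : k, B'.legWedge = ε • B.legWedge ∧ B'.element = ε • B.element := by
  -- The boundary class depends only on the cycle, so it can be written as a function of sets, as
  -- `tailProd_perm` requires.
  let f : Set G.Flag → G.Vec k := fun C =>
    if h : ∃ x, C = cyc G.face x then G.faceVec k (Classical.choose h) else 0
  have hf : ∀ x, f (cyc G.face x) = G.faceVec k x := by
    intro x
    have h : ∃ y, cyc G.face x = cyc G.face y := ⟨x, rfl⟩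
    simp only [f]
    rw [dif_pos h, faceVec, ← G.faceClass_congr (Classical.choose_spec h)]
    rfl
  have key : ∀ P : List G.Flag, P.map (G.faceVec k) = (P.map (cyc G.face)).map f := by
    intro P
    rw [List.map_map]
    exact List.map_congr_left fun x _ => (hf x).symm
  have h0 : ((B.punctures.map (cyc G.face)).map f).sum = 0 := by
    have h := congrArg (G.inH1 k) (G.sum_faceClass (k := k) B.isCycleList_face)
    rw [map_list_sum, List.map_map, map_zero] at h
    rw [← key]
    exact h
  obtain ⟨ε, h1, h2⟩ := tailProd_perm (k := k) f (B.isCycleList_face.unique B'.isCycleList_face) h0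
  refine ⟨ε, ?_, ?_⟩
  · rw [B.legWedge_eq, B'.legWedge_eq, h1, map_smul]
  · rw [← key, ← key] at h2
    rw [B'.element_eq, h2, smul_mul_assoc, smul_mul_assoc,
      hG.vertexProd_unique B'.isCycleList_rot B.isCycleList_rot]
    congr 1
    -- It remains to compare the two symplectic bases over the same punctures and vertices. The two
    -- elements lie on one line, and the functional of `B` is one on both.
    let B'' : G.Framing k γ' :=
      { B' with
        punctures := B.punctures
        isCycleList_face := B.isCycleList_face
        vertices := B.vertices
        isCycleList_rot := B.isCycleList_rot
        genus_eq := by rw [← B.genus_unique B', B.genus_eq] }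
    have hB : B''.element = tailProd k (B.punctures.map (G.faceVec k)) *
      pairProd k (fun i => G.inH1 k (B'.a i)) (fun i => G.inH1 k (B'.b i)) *
      G.vertexProd k B.vertices := B''.element_eq
    obtain ⟨c, hc⟩ := B.exists_smul hG (B''.orient hG)
    have hc : B''.element = c • B.element := congrArg Det.val hc
    obtain ⟨Φ, hΦ⟩ := B.exists_functional hG
    have e1 := hΦ γ B.a B.b B.isSymplectic
    have e2 := hΦ γ' B''.a B''.b B''.isSymplectic
    have hr : B''.radicalVecs = B.radicalVecs := rfl
    rw [← B.element_eq_radicalVecs] at e1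
    rw [← hr] at e2
    change Φ ((-1) ^ B''.punctures.tail.length * _) = 1 at e2
    rw [← B''.element_eq_radicalVecs, hc, map_smul, e1, smul_eq_mul, mul_one] at e2
    rw [← hB, hc, e2, one_smul]

/-- A framing of the surface can be completed to a framing. -/
def SurfaceFraming.framing (S : G.SurfaceFraming k γ) (L : List G.Flag)
    (hL : IsCycleList G.rot (L.map (cyc G.rot))) : G.Framing k γ where
  punctures := S.punctures
  isCycleList_face := S.isCycleList_face
  vertices := L
  isCycleList_rot := hL
  genus_eq := S.genus_eq
  a := S.a
  b := S.b
  intersection_a_a := S.isSymplectic.aa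
  intersection_b_b := S.isSymplectic.bb
  intersection_a_b := S.isSymplectic.ab

variable (G) in
variable (k) in
theorem exists_framing : ∃ γ, Nonempty (G.Framing k γ) := by
  obtain ⟨γ, ⟨S⟩⟩ := G.exists_surfaceFraming k
  obtain ⟨L, hL⟩ := exists_representatives G.rot
  exact ⟨γ, ⟨S.framing L hL⟩⟩

/-- A framing with another list of punctures. -/
def Framing.withPunctures (B : G.Framing k γ) (P : List G.Flag)
    (hP : IsCycleList G.face (P.map (cyc G.face))) : G.Framing k γ :=
  { B with
    punctures := P
    isCycleList_face := hP
    genus_eq := by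
      have h3 := (B.isCycleList_face.unique hP).length_eq
      rw [List.length_map, List.length_map] at h3
      rw [← h3, B.genus_eq] }

variable (G) in
variable (k) in
/-- The value of the morphism on a ribbon graph. -/
theorem exists_canonicalMap : ∃ T : G.Orient k →ₗ[k] Ambient k I,
    (G.IsTrivalent → G.HasLegAtEveryPuncture → ∀ (γ : ℕ) (B : G.Framing k γ) (α : G.Orient k),
      α.val = B.element → T α = Finsupp.single (G.legPerm, γ) B.legWedge) ∧
    (¬ (G.IsTrivalent ∧ G.HasLegAtEveryPuncture) → T = 0) := by
  by_cases h : G.IsTrivalent ∧ G.HasLegAtEveryPuncture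
  · obtain ⟨hG, hl⟩ := h
    obtain ⟨γ, ⟨B⟩⟩ := G.exists_framing k
    obtain ⟨Φ, hΦ⟩ := B.exists_functional hG
    have e1 := hΦ γ B.a B.b B.isSymplectic
    rw [← B.element_eq_radicalVecs] at e1
    -- On the orientation line `Φ` is the coordinate that equals one at `B.element`. For another
    -- framing the orientation and the product of cycles acquire the same factor `ε`.
    refine ⟨(LinearMap.toSpanSingleton k _ (Finsupp.single (G.legPerm, γ) B.legWedge)).comp
      (Φ.comp Det.val), fun _ _ γ' B' α hα => ?_, fun hn => absurd ⟨hG, hl⟩ hn⟩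
    obtain ⟨ε, h1, h2⟩ := B.compare hG B'
    obtain rfl := B.genus_unique B'
    rw [LinearMap.comp_apply, LinearMap.comp_apply, hα, h2, map_smul, e1, h1,
      LinearMap.toSpanSingleton_apply, smul_eq_mul, mul_one, Finsupp.smul_single]
  · exact ⟨0, fun h1 h2 => absurd ⟨h1, h2⟩ h, fun _ => rfl⟩

variable (G) in
variable (k) in
/-- The value of the morphism on a ribbon graph. -/
def canonicalMap : G.Orient k →ₗ[k] Ambient k I := Classical.choose (G.exists_canonicalMap k)

theorem canonicalMap_apply (hG : G.IsTrivalent) (hl : G.HasLegAtEveryPuncture) (B : G.Framing k γ)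
    {α : G.Orient k} (hα : α.val = B.element) :
    G.canonicalMap k α = Finsupp.single (G.legPerm, γ) B.legWedge :=
  (Classical.choose_spec (G.exists_canonicalMap k)).1 hG hl γ B α hα

theorem canonicalMap_eq_zero (h : ¬ (G.IsTrivalent ∧ G.HasLegAtEveryPuncture)) :
    G.canonicalMap k = 0 :=
  (Classical.choose_spec (G.exists_canonicalMap k)).2 h

/-- With a leg at every puncture no cycle gets empty when the other flags are erased, so the
punctures correspond to the cycles of `σ_G`. -/
theorem Framing.isCycleList_legPerm (B : G.Framing k γ) (hl : G.HasLegAtEveryPuncture) :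
    IsCycleList G.legPerm (B.punctures.map fun x => G.leg ⁻¹' cyc G.face x) := by
  have := B.isCycleList_face.erase (l := G.leg) ?_
  · rw [List.map_map] at this
    exact this
  · intro C hC
    obtain ⟨x, -, rfl⟩ := List.mem_map.1 hC
    exact hl x

theorem canonicalMap_mem [Finite I] {b : ℕ} (hb : G.betti k = b) (α : G.Orient k) :
    G.canonicalMap k α ∈ SComp k I b := by
  by_cases h : G.IsTrivalent ∧ G.HasLegAtEveryPuncture
  · obtain ⟨hG, hl⟩ := h
    obtain ⟨γ, ⟨B⟩⟩ := G.exists_framing k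
    obtain ⟨c, rfl⟩ := B.exists_smul hG α
    rw [map_smul, canonicalMap_apply hG hl B (B.val_orient hG)]
    refine Submodule.smul_mem _ _ (single_mem_SComp (B.isCycleList_legPerm hl) ?_ ?_)
    · rw [List.length_map, B.genus_eq, hb]
    · rw [← hb]
      exact hG.stable_range
  · rw [canonicalMap_eq_zero h]
    exact Submodule.zero_mem _

end Canonical

end RibbonGraph

/-! ### Images of the canonical factors under linear maps. -/

section MapProducts

variable {k : Type u} [Field k] {V : Type v} {W : Type w} [AddCommGroup V] [Module k V]
  [AddCommGroup W] [Module k W]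

theorem map_tailProd (f : V →ₗ[k] W) (L : List V) :
    ExteriorAlgebra.map f (tailProd k L) = tailProd k (L.map f) := by
  cases L with
  | nil => exact map_zero _
  | cons v L =>
    rw [tailProd_cons, List.map_cons, tailProd_cons, map_mul, map_ιProd, map_pow, map_neg, map_one,
      List.length_map]

end MapProducts

namespace RibbonGraph

section Transport

variable {k : Type u} [Field k] {I J : Type} {G : RibbonGraph I} {G' : RibbonGraph J}

theorem map_vertexProd (f : G.Vec k →ₗ[k] G'.Vec k) (g : G.Flag → G'.Flag) {L : List G.Flag}
    (h : ∀ x ∈ L, (G.vertexVecs k x).map f = G'.vertexVecs k (g x)) :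
    ExteriorAlgebra.map f (G.vertexProd k L) = G'.vertexProd k (L.map g) := by
  induction L with
  | nil => exact map_one _
  | cons x L ih =>
    have e1 : G.vertexProd k (x :: L) = ιProd k (G.vertexVecs k x) * G.vertexProd k L := by
      rw [vertexProd, List.map_cons, List.prod_cons]
      rfl
    have e2 : G'.vertexProd k ((x :: L).map g) =
        ιProd k (G'.vertexVecs k (g x)) * G'.vertexProd k (L.map g) := by
      rw [List.map_cons, vertexProd, List.map_cons, List.prod_cons]
      rfl
    rw [e1, e2, map_mul, map_ιProd, h x (by simp), ih fun y hy => h y (by simp [hy])]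

theorem vertexProd_append (L M : List G.Flag) :
    G.vertexProd k (L ++ M) = G.vertexProd k L * G.vertexProd k M := by
  rw [vertexProd, List.map_append, List.prod_append]
  rfl

end Transport

/-! ### Invariance under isomorphisms of graphs. -/

section Isomorphisms

variable {k : Type u} [Field k] [CharZero k] {I : Type} {G G' : RibbonGraph I} (h : Iso G G')

theorem Iso.map_face (x : G.Flag) : h.equiv (G.face x) = G'.face (h.equiv x) := by
  rw [face, face, Perm.mul_apply, Perm.mul_apply, h.map_rot, h.map_opp]

theorem Iso.mapH1_faceClass (x : G.Flag) :
    h.mapH1 k (G.faceClass k x) = G'.faceClass k (h.equiv x) := by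
  have key : ∀ f, h.equiv.symm f ∈ cyc G.face x ↔ f ∈ cyc G'.face (h.equiv x) := by
    intro f
    have := sameCycle_conj h.equiv h.map_face x (h.equiv.symm f)
    rw [Equiv.apply_symm_apply] at this
    exact this.symm
  refine Subtype.ext (funext fun f => ?_)
  have e : G.opp (h.equiv.symm f) = h.equiv.symm (G'.opp f) := (h.symm.map_opp f).symm
  change (if h.equiv.symm f ∈ cyc G.face x then (1 : k) else 0) -
    (if G.opp (h.equiv.symm f) ∈ cyc G.face x then (1 : k) else 0) = _
  rw [e]
  simp only [key]
  rfl

/-- The definition lists the flags of a vertex from `Quotient.out`, which an isomorphism need not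
respect; the formula with a potential involves no such choice. -/
theorem Iso.intersectionForm (x y : G.H1 k) :
    G'.intersectionForm k (h.mapH1 k x) (h.mapH1 k y) = G.intersectionForm k x y := by
  obtain ⟨Y, hY⟩ := exists_potential G.rot y.2.2
  have hr : ∀ f, h.equiv.symm (G'.rot f) = G.rot (h.equiv.symm f) := h.symm.map_rot
  rw [G.intersectionForm_eq x y hY, G'.intersectionForm_eq (Y := fun f => Y (h.equiv.symm f))]
  · rw [← Equiv.sum_comp h.equiv]
    congr 2
    refine Finset.sum_congr rfl fun f _ => ?_
    change x.1 (h.equiv.symm (h.equiv f)) * _ = _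
    rw [hr, Equiv.symm_apply_apply]
  · intro f
    rw [hr, hY]
    rfl

/-- The framing transported by an isomorphism. -/
def Framing.ofIso {γ : ℕ} (B : G.Framing k γ) : G'.Framing k γ where
  punctures := B.punctures.map h.equiv
  isCycleList_face := B.isCycleList_face.conj h.equiv h.map_face
  vertices := B.vertices.map h.equiv
  isCycleList_rot := B.isCycleList_rot.conj h.equiv h.map_rot
  genus_eq := by
    have : G.betti k = G'.betti k := LinearEquiv.finrank_eq (h.mapH1 k)
    rw [List.length_map, B.genus_eq, this]
  a i := h.mapH1 k (B.a i)
  b i := h.mapH1 k (B.b i)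
  intersection_a_a i j := (h.intersectionForm _ _).trans (B.intersection_a_a i j)
  intersection_b_b i j := (h.intersectionForm _ _).trans (B.intersection_b_b i j)
  intersection_a_b i j := (h.intersectionForm _ _).trans (B.intersection_a_b i j)

theorem Iso.mapVec_apply (x : G.H1 k) (y : G.Flag → k) (z : G.VertFun k) :
    h.mapVec k (x, y, z) = (h.mapH1 k x, fun f => y (h.equiv.symm f), h.mapVertFun k z) := rfl

theorem Iso.mapVec_single (x : G.Flag) :
    h.mapVec k (0, Pi.single x 1, 0) = (0, Pi.single (h.equiv x) 1, 0) := by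
  rw [h.mapVec_apply, map_zero, map_zero]
  congr 2
  ext f
  simp only [Pi.single_apply, Equiv.symm_apply_eq]

theorem Iso.mapVertFun_vertexFun (x : G.Flag) :
    h.mapVertFun k (G.vertexFun k x) = G'.vertexFun k (h.equiv x) := by
  refine Subtype.ext (funext fun f => ?_)
  have := sameCycle_conj h.equiv h.map_rot x (h.equiv.symm f)
  rw [Equiv.apply_symm_apply] at this
  change (if G.rot.SameCycle x (h.equiv.symm f) then (1 : k) else 0) =
    if G'.rot.SameCycle (h.equiv x) f then 1 else 0
  simp only [this]

theorem Framing.element_ofIso {γ : ℕ} (B : G.Framing k γ) :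
    (B.ofIso h).element = ExteriorAlgebra.map (h.mapVec k).toLinearMap B.element := by
  rw [element_eq, element_eq, map_mul, map_mul, map_tailProd, map_pairProd,
    map_vertexProd (h.mapVec k).toLinearMap h.equiv]
  · refine congrArg₂ (· * ·) (congrArg₂ (· * ·) (congrArg _ ?_) ?_) rfl
    · rw [List.map_map]
      change (B.punctures.map h.equiv).map _ = _
      rw [List.map_map]
      refine List.map_congr_left fun x _ => ?_
      change (G'.faceClass k (h.equiv x), 0, 0) = h.mapVec k (G.faceClass k x, 0, 0)
      rw [h.mapVec_apply, h.mapH1_faceClass, map_zero]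
      rfl
    · congr 1
  · intro x _
    simp only [vertexVecs, List.map_cons, List.map_nil, LinearEquiv.coe_coe, h.mapVec_single, h.map_rot]
    congr 1
    rw [h.mapVec_apply, map_zero, h.mapVertFun_vertexFun]
    rfl

theorem Iso.legPerm (h : Iso G G') : G'.legPerm = G.legPerm := erase_conj h.equiv h.map_face h.map_leg

theorem Iso.preimage_leg (x : G.Flag) :
    G'.leg ⁻¹' cyc G'.face (h.equiv x) = G.leg ⁻¹' cyc G.face x := by
  ext i
  change G'.face.SameCycle _ _ ↔ G.face.SameCycle _ _
  rw [← h.map_leg, sameCycle_conj h.equiv h.map_face]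

theorem Framing.legWedge_ofIso {γ : ℕ} (B : G.Framing k γ) :
    (B.ofIso h).legWedge = B.legWedge := by
  change wedge k ((B.punctures.map h.equiv).map _) = wedge k (B.punctures.map _)
  rw [List.map_map]
  congr 1
  exact List.map_congr_left fun x _ => h.preimage_leg x

theorem Iso.isTrivalent (h : Iso G G') : G.IsTrivalent → G'.IsTrivalent := by
  intro hG x
  have := hG (h.equiv.symm x)
  have hr : ∀ f, h.equiv.symm (G'.rot f) = G.rot (h.equiv.symm f) := h.symm.map_rot
  rw [← hr, ← hr, ← hr, h.equiv.symm.injective.eq_iff] at this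
  exact this

theorem Iso.hasLeg (h : Iso G G') : G.HasLegAtEveryPuncture → G'.HasLegAtEveryPuncture := by
  intro hl x
  obtain ⟨i, hi⟩ := hl (h.equiv.symm x)
  have : i ∈ G'.leg ⁻¹' cyc G'.face (h.equiv (h.equiv.symm x)) := by
    rw [h.preimage_leg]
    exact hi
  rw [Equiv.apply_symm_apply] at this
  exact ⟨i, this⟩

theorem Iso.canonicalMap (α : G.Orient k) :
    G'.canonicalMap k (h.mapOrient k α) = G.canonicalMap k α := by
  by_cases hc : G.IsTrivalent ∧ G.HasLegAtEveryPuncture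
  · obtain ⟨hG, hl⟩ := hc
    obtain ⟨γ, ⟨B⟩⟩ := G.exists_framing k
    obtain ⟨c, rfl⟩ := B.exists_smul hG α
    rw [map_smul, map_smul, map_smul, canonicalMap_apply hG hl B (B.val_orient hG),
      canonicalMap_apply (h.isTrivalent hG) (h.hasLeg hl) (B.ofIso h), h.legPerm, B.legWedge_ofIso h]
    rw [Iso.coe_mapOrient, B.element_ofIso, B.val_orient]
  · rw [canonicalMap_eq_zero hc, canonicalMap_eq_zero fun hc' =>
      hc ⟨h.symm.isTrivalent hc'.1, h.symm.hasLeg hc'.2⟩]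
    rfl

end Isomorphisms

/-! ### Equivariance under bijections of the legs. -/

section Relabelling

variable {k : Type u} [Field k] [CharZero k] {I J : Type} {G : RibbonGraph I} (e : I ≃ J)

theorem hasLeg_relabel : (G.relabel e).HasLegAtEveryPuncture ↔ G.HasLegAtEveryPuncture := by
  refine forall_congr' fun x => ⟨?_, ?_⟩
  · rintro ⟨j, hj⟩
    exact ⟨e.symm j, hj⟩
  · rintro ⟨i, hi⟩
    refine ⟨e i, ?_⟩
    change G.leg (e.symm (e i)) ∈ _
    rw [Equiv.symm_apply_apply]
    exact hi

/-- The same framing, for the graph with other marks of the legs. -/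
def Framing.relabel {γ : ℕ} (B : G.Framing k γ) : (G.relabel e).Framing k γ where
  punctures := B.punctures
  isCycleList_face := B.isCycleList_face
  vertices := B.vertices
  isCycleList_rot := B.isCycleList_rot
  genus_eq := B.genus_eq
  a := B.a
  b := B.b
  intersection_a_a := B.intersection_a_a
  intersection_b_b := B.intersection_b_b
  intersection_a_b := B.intersection_a_b

theorem canonicalMap_relabel (α : G.Orient k) :
    (G.relabel e).canonicalMap k (G.relabelOrient k e α) = sMapAux k e (G.canonicalMap k α) := by
  by_cases hc : G.IsTrivalent ∧ G.HasLegAtEveryPuncture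
  · obtain ⟨hG, hl⟩ := hc
    have hG' : (G.relabel e).IsTrivalent := hG
    obtain ⟨γ, ⟨B⟩⟩ := G.exists_framing k
    obtain ⟨c, rfl⟩ := B.exists_smul hG α
    rw [map_smul, map_smul, map_smul, map_smul, canonicalMap_apply hG hl B (B.val_orient hG),
      canonicalMap_apply hG' ((hasLeg_relabel e).2 hl) (B.relabel e) (α := G.relabelOrient k e
        (B.orient hG)) rfl]
    have hw : B.legWedge = wedge k (B.punctures.map fun x => G.leg ⁻¹' cyc G.face x) := rfl
    rw [hw, sMapAux_single, List.map_map]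
    congr 2
    · exact congrArg (·, γ) (erase_relabel e G.leg G.face)
    · change wedge k (B.punctures.map _) = wedge k _
      congr 1
      refine List.map_congr_left fun x _ => ?_
      ext j
      change _ ↔ j ∈ e '' _
      rw [Set.mem_image_equiv]
      rfl
  · have hc' : ¬ ((G.relabel e).IsTrivalent ∧ (G.relabel e).HasLegAtEveryPuncture) := fun hc' =>
      hc ⟨hc'.1, (hasLeg_relabel e).1 hc'.2⟩
    rw [canonicalMap_eq_zero hc, canonicalMap_eq_zero hc']
    exact (map_zero (sMapAux k e)).symm

end Relabelling

end RibbonGraph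

/-! ### The map on chains, its degree, and its uniqueness. -/

section Morphism

variable (k : Type u) [Field k] [CharZero k]

/-- The components of the morphism. -/
def canonicalHom (I : Type) [Finite I] (b : ℕ) : Chain k I b →ₗ[k] SComp k I b :=
  Chain.lift (M := SComp k I b) (fun G hG => LinearMap.codRestrict (SComp k I b) (G.canonicalMap k)
    (RibbonGraph.canonicalMap_mem hG)) fun _ _ _ _ h α => Subtype.ext (h.canonicalMap α)

theorem canonicalHom_mk {I : Type} [Finite I] {b : ℕ} (G : RibbonGraph I) (hG : G.betti k = b)
    (α : G.Orient k) : (canonicalHom k I b (Chain.mk G hG α)).1 = G.canonicalMap k α := by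
  rw [canonicalHom, Chain.lift_mk]
  rfl

/-- Only trivalent graphs have non-zero values, and there the number of flags is three times the
number of vertices, so the degree is `-b`. -/
theorem canonicalHom_grade (I : Type) [Finite I] (b : ℕ) (d : ℤ) (x : Chain k I b)
    (hx : x ∈ chainGrade k I b d) : canonicalHom k I b x ∈
      (if d = -(b : ℤ) then ⊤ else ⊥ : Submodule k (SComp k I b)) := by
  split_ifs with hd
  · exact Submodule.mem_top
  · refine Submodule.span_le (p := (⊥ : Submodule k (SComp k I b)).comap (canonicalHom k I b)).2 ?_ hx
    rintro _ ⟨G, hG, α, h, rfl⟩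
    rw [SetLike.mem_coe, Submodule.mem_comap, Submodule.mem_bot]
    refine Subtype.ext ?_
    rw [canonicalHom_mk, RibbonGraph.canonicalMap_eq_zero]
    · rfl
    · rintro ⟨h1, -⟩
      have := h1.card_flag_eq
      refine hd ?_
      rw [← h, this]
      push_cast
      ring

theorem canonicalHom_map (I J : Type) [Finite I] [Finite J] (e : I ≃ J) (b : ℕ) (x : Chain k I b) :
    canonicalHom k J b (chainMap k e b x) = sMap k e b (canonicalHom k I b x) := by
  have : (canonicalHom k J b).comp (chainMap k e b) = (sMap k e b).comp (canonicalHom k I b) := by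
    refine Chain.hom_ext (M := SComp k J b) fun G hG α => Subtype.ext ?_
    have hG' : (G.relabel e).betti k = b := hG
    have h1 : chainMap k e b (Chain.mk G hG α) =
        Chain.mk (G.relabel e) hG' (G.relabelOrient k e α) := Chain.lift_mk _ _ _ _ _
    rw [LinearMap.comp_apply, LinearMap.comp_apply, h1, canonicalHom_mk,
      RibbonGraph.canonicalMap_relabel]
    change _ = sMapAux k e (canonicalHom k I b (Chain.mk G hG α)).1
    rw [canonicalHom_mk]
  exact LinearMap.congr_fun this x

/-- The values on all graphs determine the morphism. -/
theorem hom_unique {φ ψ : DetOperad.Hom (feynmanAss.{u} k) (symmetricOperad.{u} k)}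
    (h : ∀ (I : Type) [Finite I] (b : ℕ) (G : RibbonGraph I) (hG : G.betti k = b) (α : G.Orient k),
      φ.app I b (Chain.mk G hG α) = ψ.app I b (Chain.mk G hG α)) : φ = ψ := by
  have e : @DetOperad.Hom.app _ _ _ _ φ = @DetOperad.Hom.app _ _ _ _ ψ := by
    funext I _ b
    exact Chain.hom_ext (M := SComp k I b) fun G hG α => h I b G hG α
  -- All fields of a morphism other than `app` are propositions.
  cases φ
  cases ψ
  cases e
  rfl

end Morphism

/-- Meant for the composition of two graphs, whose first homology is an orthogonal sum. -/
theorem IsSymplectic.append {k : Type u} [Field k] {U V W : Type*} [AddCommGroup U] [AddCommGroup V]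
    [AddCommGroup W] [Module k U] [Module k V] [Module k W] {ω : U →ₗ[k] U →ₗ[k] k}
    {ω' : V →ₗ[k] V →ₗ[k] k} {η : W →ₗ[k] W →ₗ[k] k} {m n : ℕ} {a b : Fin m → U} {a' b' : Fin n → V}
    (h : IsSymplectic ω a b) (h' : IsSymplectic ω' a' b') (f : U × V →ₗ[k] W)
    (hf : ∀ x y, η (f x) (f y) = ω x.1 y.1 + ω' x.2 y.2) :
    IsSymplectic η (Fin.append (fun i => f (a i, 0)) fun i => f (0, a' i))
      (Fin.append (fun i => f (b i, 0)) fun i => f (0, b' i)) := by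
  have h1 := h.aa
  have h2 := h.bb
  have h3 := h.ab
  have h1' := h'.aa
  have h2' := h'.bb
  have h3' := h'.ab
  constructor <;>
  refine Fin.addCases (fun i => Fin.addCases (fun j => ?_) fun j => ?_)
    fun i => Fin.addCases (fun j => ?_) fun j => ?_ <;>
  simp only [Fin.append_left, Fin.append_right, hf, h1, h2, h3, h1', h2', h3', map_zero,
    LinearMap.zero_apply, add_zero, zero_add, Fin.ext_iff, Fin.val_castAdd, Fin.val_natAdd,
    add_right_inj]
  -- The mixed pairings of an `a` of one family with a `b` of the other: their indices in `Fin (m +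
  -- n)` are different.
  · rw [if_neg (by omega)]
  · rw [if_neg (by omega)]

namespace RibbonGraph

theorem faceClass_apply {k : Type u} [Field k] {I : Type} (G : RibbonGraph I) (x f : G.Flag) :
    (G.faceClass k x).1 f = (if f ∈ cyc G.face x then 1 else 0) -
      (if G.opp f ∈ cyc G.face x then 1 else 0) := rfl

/-- The vector of a flag. -/
def flagVec (k : Type u) [Field k] {I : Type} (G : RibbonGraph I) (x : G.Flag) : G.Vec k :=
  (0, Pi.single x 1, 0)

theorem vertexVecs_eq {k : Type u} [Field k] {I : Type} (G : RibbonGraph I) (x : G.Flag) :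
    G.vertexVecs k x = [(0, 0, G.vertexFun k x), G.flagVec k x, G.flagVec k (G.rot x),
      G.flagVec k (G.rot (G.rot x))] := rfl

theorem vertexFun_apply {k : Type u} [Field k] {I : Type} (G : RibbonGraph I) (x f : G.Flag) :
    (G.vertexFun k x).1 f = if G.rot.SameCycle x f then 1 else 0 := rfl

/-! ### Compatibility with the joining of two graphs. -/

section Composition

variable {k : Type u} [Field k] {I J : Type} (G : RibbonGraph (Option I)) (G' : RibbonGraph (Option J))

/-- The source of the composition rule of `S[t]`: the new edge changes `opp`, hence `rot * opp`, by
a transposition on the right, which merges the punctures of the two legs. -/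
theorem face_comp : (G.comp G').face =
    Perm.sumCongr G.face G'.face * swap (Sum.inl (G.leg none)) (Sum.inr (G'.leg none)) := by
  change Perm.sumCongr G.rot G'.rot * (Perm.sumCongr G.opp G'.opp * swap _ _) = _
  rw [← mul_assoc, Perm.sumCongr_mul]
  rfl

theorem isTrivalent_comp : (G.comp G').IsTrivalent ↔ G.IsTrivalent ∧ G'.IsTrivalent := by
  refine ⟨fun h => ⟨fun x => Sum.inl_injective (h (Sum.inl x)),
    fun x => Sum.inr_injective (h (Sum.inr x))⟩, ?_⟩
  rintro ⟨h, h'⟩ (x | x)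
  · exact congrArg Sum.inl (h x)
  · exact congrArg Sum.inr (h' x)

theorem compLeg_eq : (G.comp G').leg = (inclSum I J).trans (G.leg.sumMap G'.leg) := by
  ext (i | j) <;> rfl

theorem erase_face_comp : erase (G.leg.sumMap G'.leg) (G.comp G').face =
    Perm.sumCongr G.legPerm G'.legPerm * swap (Sum.inl none) (Sum.inr none) := by
  have h := erase_mul_swap (G.leg.sumMap G'.leg) (Perm.sumCongr G.face G'.face) (Sum.inl none)
    (Sum.inr none)
  rw [erase_sumCongr] at h
  rw [face_comp]
  convert h <;> rfl

theorem legPerm_comp [Finite I] [Finite J] : (G.comp G').legPerm =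
    erase (inclSum I J) (Perm.sumCongr G.legPerm G'.legPerm * swap (Sum.inl none) (Sum.inr none)) := by
  rw [legPerm, compLeg_eq, erase_trans, erase_face_comp]

theorem preimage_comp_none [Finite I] [Finite J] :
    (G.comp G').leg ⁻¹' cyc (G.comp G').face (Sum.inl (G.leg none)) =
      inclSum I J ⁻¹' cyc (Perm.sumCongr G.legPerm G'.legPerm *
        swap (Sum.inl none) (Sum.inr none)) (Sum.inl none) := by
  rw [← erase_face_comp, cyc_erase, compLeg_eq]
  rfl

theorem cyc_face_comp_inl {x : G.Flag} (h : ¬ G.face.SameCycle x (G.leg none)) :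
    cyc (G.comp G').face (Sum.inl x) = Sum.inl '' cyc G.face x := by
  rw [face_comp, cyc_mul_swap_of_not, cyc_sumCongr_inl]
  · rw [sameCycle_sumCongr_inl]
    rintro ⟨y, hy, e⟩
    exact h (Sum.inl_injective e ▸ hy)
  · rw [sameCycle_sumCongr_inl]
    rintro ⟨y, -, e⟩
    exact Sum.inr_ne_inl e

theorem cyc_face_comp_inr {x : G'.Flag} (h : ¬ G'.face.SameCycle x (G'.leg none)) :
    cyc (G.comp G').face (Sum.inr x) = Sum.inr '' cyc G'.face x := by
  rw [face_comp, cyc_mul_swap_of_not, cyc_sumCongr_inr]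
  · rw [sameCycle_sumCongr_inr]
    rintro ⟨y, -, e⟩
    exact Sum.inl_ne_inr e
  · rw [sameCycle_sumCongr_inr]
    rintro ⟨y, hy, e⟩
    exact h (Sum.inr_injective e ▸ hy)

theorem preimage_comp_inl {x : G.Flag} (h : ¬ G.face.SameCycle x (G.leg none)) :
    (G.comp G').leg ⁻¹' cyc (G.comp G').face (Sum.inl x) =
      inclSum I J ⁻¹' (Sum.inl '' (G.leg ⁻¹' cyc G.face x)) := by
  rw [cyc_face_comp_inl G G' h]
  ext (i | j)
  · constructor
    · rintro ⟨y, hy, e⟩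
      obtain rfl := Sum.inl_injective e
      exact ⟨some i, hy, rfl⟩
    · rintro ⟨y, hy, e⟩
      exact ⟨_, hy, congrArg (Sum.inl ∘ G.leg) (Sum.inl_injective e)⟩
  · constructor
    · rintro ⟨y, hy, e⟩
      exact absurd e Sum.inl_ne_inr
    · rintro ⟨y, hy, e⟩
      exact absurd e Sum.inl_ne_inr

theorem preimage_comp_inr {x : G'.Flag} (h : ¬ G'.face.SameCycle x (G'.leg none)) :
    (G.comp G').leg ⁻¹' cyc (G.comp G').face (Sum.inr x) =
      inclSum I J ⁻¹' (Sum.inr '' (G'.leg ⁻¹' cyc G'.face x)) := by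
  rw [cyc_face_comp_inr G G' h]
  ext (i | j)
  · constructor
    · rintro ⟨y, hy, e⟩
      exact absurd e Sum.inr_ne_inl
    · rintro ⟨y, hy, e⟩
      exact absurd e Sum.inr_ne_inl
  · constructor
    · rintro ⟨y, hy, e⟩
      obtain rfl := Sum.inr_injective e
      exact ⟨some j, hy, rfl⟩
    · rintro ⟨y, hy, e⟩
      exact ⟨_, hy, congrArg (Sum.inr ∘ G'.leg) (Sum.inr_injective e)⟩

theorem sameCycle_face_comp : (G.comp G').face.SameCycle (Sum.inl (G.leg none))
    (Sum.inr (G'.leg none)) := by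
  rw [face_comp]
  refine sameCycle_mul_swap_of_not_sameCycle ?_
  rw [sameCycle_sumCongr_inl]
  rintro ⟨y, -, e⟩
  exact Sum.inr_ne_inl e

theorem sameCycle_face_comp_inl {x : G.Flag} (h : G.face.SameCycle x (G.leg none)) :
    (G.comp G').face.SameCycle (Sum.inl x) (Sum.inl (G.leg none)) := by
  have hs := sameCycle_face_comp G G'
  have h1 : (Perm.sumCongr G.face G'.face).SameCycle (Sum.inl x) (Sum.inl (G.leg none)) :=
    (sameCycle_sumCongr_inl _ _ _ _).2 ⟨_, h, rfl⟩
  rw [face_comp] at hs ⊢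
  rcases sameCycle_mul_swap_or (b := Sum.inr (G'.leg none)) (Or.inl h1) with h2 | h2
  · exact h2
  · exact h2.trans hs.symm

theorem sameCycle_face_comp_inr {x : G'.Flag} (h : G'.face.SameCycle x (G'.leg none)) :
    (G.comp G').face.SameCycle (Sum.inr x) (Sum.inl (G.leg none)) := by
  have hs := sameCycle_face_comp G G'
  have h1 : (Perm.sumCongr G.face G'.face).SameCycle (Sum.inr x) (Sum.inr (G'.leg none)) :=
    (sameCycle_sumCongr_inr _ _ _ _).2 ⟨_, h, rfl⟩
  rw [face_comp] at hs ⊢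
  rcases sameCycle_mul_swap_or (a := Sum.inl (G.leg none)) (Or.inr h1) with h2 | h2
  · exact h2
  · exact h2.trans hs.symm

/-- Only the merged puncture can lose its legs: punctures away from the glued legs keep theirs, and
before the gluing the other two had at least the glued legs. The first condition is the rule of
`S[t]` about empty cycles. -/
theorem hasLeg_comp : (G.comp G').HasLegAtEveryPuncture ↔
    ((G.comp G').leg ⁻¹' cyc (G.comp G').face (Sum.inl (G.leg none))).Nonempty ∧
      G.HasLegAtEveryPuncture ∧ G'.HasLegAtEveryPuncture := by
  constructor
  · intro h
    refine ⟨h _, fun x => ?_, fun x => ?_⟩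
    · by_cases hx : G.face.SameCycle x (G.leg none)
      · exact ⟨none, hx⟩
      · have h1 : ((G.comp G').leg ⁻¹' cyc (G.comp G').face (Sum.inl x)).Nonempty := h _
        rw [preimage_comp_inl G G' hx] at h1
        obtain ⟨i, j, hj, -⟩ := h1
        exact ⟨j, hj⟩
    · by_cases hx : G'.face.SameCycle x (G'.leg none)
      · exact ⟨none, hx⟩
      · have h1 : ((G.comp G').leg ⁻¹' cyc (G.comp G').face (Sum.inr x)).Nonempty := h _
        rw [preimage_comp_inr G G' hx] at h1
        obtain ⟨i, j, hj, -⟩ := h1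
        exact ⟨j, hj⟩
  · rintro ⟨h, h1, h2⟩ (x | x)
    · by_cases hx : G.face.SameCycle x (G.leg none)
      · rw [cyc_eq_iff.2 (sameCycle_face_comp_inl G G' hx)]
        exact h
      · change ((G.comp G').leg ⁻¹' cyc (G.comp G').face (Sum.inl x)).Nonempty
        rw [preimage_comp_inl G G' hx]
        obtain ⟨i, hi⟩ := h1 x
        cases i with
        | none => exact absurd hi hx
        | some i => exact ⟨Sum.inl i, some i, hi, rfl⟩
    · by_cases hx : G'.face.SameCycle x (G'.leg none)
      · rw [cyc_eq_iff.2 (sameCycle_face_comp_inr G G' hx)]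
        exact h
      · change ((G.comp G').leg ⁻¹' cyc (G.comp G').face (Sum.inr x)).Nonempty
        rw [preimage_comp_inr G G' hx]
        obtain ⟨i, hi⟩ := h2 x
        cases i with
        | none => exact absurd hi hx
        | some i => exact ⟨Sum.inr i, some i, hi, rfl⟩

variable [CharZero k]

/-- The two graphs have no vertex in common, so potentials of the two parts form together a
potential. -/
theorem intersectionForm_comp (x y : G.H1 k × G'.H1 k) :
    (G.comp G').intersectionForm k (G.compH1Equiv G' k x) (G.compH1Equiv G' k y) =
      G.intersectionForm k x.1 y.1 + G'.intersectionForm k x.2 y.2 := by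
  obtain ⟨Y, hY⟩ := exists_potential G.rot y.1.2.2
  obtain ⟨Y', hY'⟩ := exists_potential G'.rot y.2.2.2
  rw [G.intersectionForm_eq _ _ hY, G'.intersectionForm_eq _ _ hY',
    (G.comp G').intersectionForm_eq _ _ (Y := Sum.elim Y Y'), Fintype.sum_sum_type, mul_add, neg_add]
  · rfl
  · rintro (f | f)
    · exact hY f
    · exact hY' f

variable {G G'}

theorem isCycleList_face_comp {P : List G.Flag} {P' : List G'.Flag}
    (hP : IsCycleList G.face ((G.leg none :: P).map (cyc G.face)))
    (hP' : IsCycleList G'.face ((G'.leg none :: P').map (cyc G'.face))) :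
    IsCycleList (G.comp G').face
      ((Sum.inl (G.leg none) :: (P.map Sum.inl ++ P'.map Sum.inr)).map (cyc (G.comp G').face)) := by
  have h1 := hP.sumCongr hP'
  have h2 : IsCycleList (Perm.sumCongr G.face G'.face)
      (cyc (Perm.sumCongr G.face G'.face) (Sum.inl (G.leg none)) ::
        cyc (Perm.sumCongr G.face G'.face) (Sum.inr (G'.leg none)) ::
        ((P.map (cyc G.face)).map (Sum.inl '' ·) ++ (P'.map (cyc G'.face)).map (Sum.inr '' ·))) := by
    refine h1.perm ?_
    rw [cyc_sumCongr_inl, cyc_sumCongr_inr]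
    simp only [List.map_cons, List.cons_append]
    exact List.Perm.cons _ List.perm_middle
  have hn : ¬ (Perm.sumCongr G.face G'.face).SameCycle (Sum.inl (G.leg none))
      (Sum.inr (G'.leg none)) := by
    rw [sameCycle_sumCongr_inl]
    rintro ⟨y, -, e⟩
    exact Sum.inr_ne_inl e
  have h3 := h2.sew hn
  rw [← face_comp] at h3
  rw [List.map_cons, List.map_append]
  convert h3 using 3
  · rw [List.map_map, List.map_map]
    exact List.map_congr_left fun x hx => cyc_face_comp_inl G G' (hP.not_sameCycle hx)
  · rw [List.map_map, List.map_map]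
    exact List.map_congr_left fun x hx => cyc_face_comp_inr G G' (hP'.not_sameCycle hx)

theorem isSymplectic_comp {γ γ' : ℕ} (B : G.Framing k γ) (B' : G'.Framing k γ') :
    IsSymplectic ((G.comp G').intersectionForm k)
      (Fin.append (fun i => G.compH1Equiv G' k (B.a i, 0)) fun i => G.compH1Equiv G' k (0, B'.a i))
      (Fin.append (fun i => G.compH1Equiv G' k (B.b i, 0)) fun i => G.compH1Equiv G' k (0, B'.b i)) :=
  B.isSymplectic.append B'.isSymplectic (G.compH1Equiv G' k).toLinearMap (intersectionForm_comp G G')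

/-- The framing of the composition of two graphs. -/
def Framing.comp {γ γ' : ℕ} (B : G.Framing k γ) (B' : G'.Framing k γ') {P : List G.Flag}
    {P' : List G'.Flag} (hP : B.punctures = G.leg none :: P) (hP' : B'.punctures = G'.leg none :: P') :
    (G.comp G').Framing k (γ + γ') where
  punctures := Sum.inl (G.leg none) :: (P.map Sum.inl ++ P'.map Sum.inr)
  isCycleList_face := isCycleList_face_comp (hP ▸ B.isCycleList_face) (hP' ▸ B'.isCycleList_face)
  vertices := B.vertices.map Sum.inl ++ B'.vertices.map Sum.inr
  isCycleList_rot := by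
    have h := B.isCycleList_rot.sumCongr B'.isCycleList_rot
    rw [List.map_append]
    convert h using 2
    · rw [List.map_map, List.map_map]
      exact List.map_congr_left fun x _ => cyc_sumCongr_inl _ _ x
    · rw [List.map_map, List.map_map]
      exact List.map_congr_left fun x _ => cyc_sumCongr_inr _ _ x
  genus_eq := by
    have h := B.genus_eq
    have h' := B'.genus_eq
    rw [hP, List.length_cons] at h
    rw [hP', List.length_cons] at h'
    rw [betti_comp, List.length_cons, List.length_append, List.length_map, List.length_map]
    omega
  a := Fin.append (fun i => G.compH1Equiv G' k (B.a i, 0)) fun i => G.compH1Equiv G' k (0, B'.a i)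
  b := Fin.append (fun i => G.compH1Equiv G' k (B.b i, 0)) fun i => G.compH1Equiv G' k (0, B'.b i)
  intersection_a_a := (isSymplectic_comp B B').aa
  intersection_b_b := (isSymplectic_comp B B').bb
  intersection_a_b := (isSymplectic_comp B B').ab

theorem compInl_apply (x : G.H1 k) (y : G.Flag → k) (z : G.VertFun k) :
    G.compInl G' k (x, y, z) =
      (G.compH1Equiv G' k (x, 0), Sum.elim y (0 : G'.Flag → k), G.compVertFunEquiv G' k (z, 0)) := rfl

theorem compInr_apply (x : G'.H1 k) (y : G'.Flag → k) (z : G'.VertFun k) :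
    G.compInr G' k (x, y, z) =
      (G.compH1Equiv G' k (0, x), Sum.elim (0 : G.Flag → k) y, G.compVertFunEquiv G' k (0, z)) := rfl

theorem compInl_inH1 (x : G.H1 k) :
    G.compInl G' k (G.inH1 k x) = (G.comp G').inH1 k (G.compH1Equiv G' k (x, 0)) :=
  Prod.ext rfl (Prod.ext (funext (Sum.rec (fun _ => rfl) fun _ => rfl))
    (map_zero (G.compVertFunEquiv G' k)))

theorem compInr_inH1 (x : G'.H1 k) :
    G.compInr G' k (G'.inH1 k x) = (G.comp G').inH1 k (G.compH1Equiv G' k (0, x)) :=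
  Prod.ext rfl (Prod.ext (funext (Sum.rec (fun _ => rfl) fun _ => rfl))
    (map_zero (G.compVertFunEquiv G' k)))

/-- A puncture that avoids the glued legs does not run along the new edge, so its boundary class is
the old one extended by zero. -/
theorem faceVec_comp_inl {x : G.Flag} (h : ¬ G.face.SameCycle x (G.leg none)) :
    (G.comp G').faceVec k (Sum.inl x) = G.compInl G' k (G.faceVec k x) := by
  have e := G.cyc_face_comp_inl G' h
  have hl : ∀ f : G.Flag, Sum.inl f ∈ cyc (G.comp G').face (Sum.inl x) ↔ f ∈ cyc G.face x := fun f => by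
    rw [e, Sum.inl_injective.mem_set_image]
  have hr : ∀ f : G'.Flag, Sum.inr f ∉ cyc (G.comp G').face (Sum.inl x) := fun f => by
    rw [e]
    rintro ⟨y, -, hy⟩
    exact Sum.inl_ne_inr hy
  have hn : G.leg none ∉ cyc G.face x := h
  rw [faceVec, faceVec, compInl_apply]
  refine Prod.ext (Subtype.ext (funext ?_)) (Prod.ext ?_ ?_)
  · rintro (f | f)
    · change _ = (G.faceClass k x).1 f
      rw [faceClass_apply, faceClass_apply]
      by_cases hf : f = G.leg none
      · subst hf
        rw [comp_opp_inl_none, if_neg (hr _), G.opp_leg, if_neg hn, if_neg ((hl _).not.2 hn)]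
      · rw [comp_opp_inl G G' f hf]
        simp only [hl]
    · change _ = (0 : k)
      rw [faceClass_apply, if_neg (hr _), zero_sub, neg_eq_zero]
      by_cases hf : f = G'.leg none
      · subst hf
        rw [comp_opp_inr_none, if_neg ((hl _).not.2 hn)]
      · rw [comp_opp_inr G G' f hf, if_neg (hr _)]
  · exact funext (Sum.rec (fun _ => rfl) fun _ => rfl)
  · exact (map_zero (G.compVertFunEquiv G' k)).symm

theorem faceVec_comp_inr {x : G'.Flag} (h : ¬ G'.face.SameCycle x (G'.leg none)) :
    (G.comp G').faceVec k (Sum.inr x) = G.compInr G' k (G'.faceVec k x) := by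
  have e := G.cyc_face_comp_inr G' h
  have hr : ∀ f : G'.Flag, Sum.inr f ∈ cyc (G.comp G').face (Sum.inr x) ↔ f ∈ cyc G'.face x := fun f => by
    rw [e, Sum.inr_injective.mem_set_image]
  have hl : ∀ f : G.Flag, Sum.inl f ∉ cyc (G.comp G').face (Sum.inr x) := fun f => by
    rw [e]
    rintro ⟨y, -, hy⟩
    exact Sum.inr_ne_inl hy
  have hn : G'.leg none ∉ cyc G'.face x := h
  rw [faceVec, faceVec, compInr_apply]
  refine Prod.ext (Subtype.ext (funext ?_)) (Prod.ext ?_ ?_)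
  · rintro (f | f)
    · change _ = (0 : k)
      rw [faceClass_apply, if_neg (hl _), zero_sub, neg_eq_zero]
      by_cases hf : f = G.leg none
      · subst hf
        rw [comp_opp_inl_none, if_neg ((hr _).not.2 hn)]
      · rw [comp_opp_inl G G' f hf, if_neg (hl _)]
    · change _ = (G'.faceClass k x).1 f
      rw [faceClass_apply, faceClass_apply]
      by_cases hf : f = G'.leg none
      · subst hf
        rw [comp_opp_inr_none, if_neg (hl _), G'.opp_leg, if_neg hn, if_neg ((hr _).not.2 hn)]
      · rw [comp_opp_inr G G' f hf]
        simp only [hr]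
  · exact funext (Sum.rec (fun _ => rfl) fun _ => rfl)
  · exact (map_zero (G.compVertFunEquiv G' k)).symm

theorem vertexVecs_comp_inl (x : G.Flag) :
    (G.vertexVecs k x).map (G.compInl G' k) = (G.comp G').vertexVecs k (Sum.inl x) := by
  have hs : ∀ y : G.Flag, G.compInl G' k (G.flagVec k y) = (G.comp G').flagVec k (Sum.inl y) := by
    intro y
    rw [flagVec, flagVec, compInl_apply]
    refine Prod.ext (map_zero (G.compH1Equiv G' k)) (Prod.ext ?_ (map_zero (G.compVertFunEquiv G' k)))
    ext (f | f) <;> simp [Pi.single_apply]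
  simp only [vertexVecs_eq, List.map_cons, List.map_nil, hs]
  refine congrArg₂ List.cons ?_ rfl
  rw [compInl_apply]
  refine Prod.ext (map_zero (G.compH1Equiv G' k)) (Prod.ext ?_ (Subtype.ext (funext ?_)))
  · ext (f | f) <;> rfl
  · rintro (f | f)
    · have h : (Perm.sumCongr G.rot G'.rot).SameCycle (Sum.inl x) (Sum.inl f) ↔
          G.rot.SameCycle x f := by simp [sameCycle_sumCongr_inl]
      change (G.vertexFun k x).1 f = ((G.comp G').vertexFun k (Sum.inl x)).1 (Sum.inl f)
      rw [vertexFun_apply, vertexFun_apply]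
      simp only [h]
    · exact (if_neg (by simp [sameCycle_sumCongr_inl])).symm

theorem vertexVecs_comp_inr (x : G'.Flag) :
    (G'.vertexVecs k x).map (G.compInr G' k) = (G.comp G').vertexVecs k (Sum.inr x) := by
  have hs : ∀ y : G'.Flag, G.compInr G' k (G'.flagVec k y) = (G.comp G').flagVec k (Sum.inr y) := by
    intro y
    rw [flagVec, flagVec, compInr_apply]
    refine Prod.ext (map_zero (G.compH1Equiv G' k)) (Prod.ext ?_ (map_zero (G.compVertFunEquiv G' k)))
    ext (f | f) <;> simp [Pi.single_apply]
  simp only [vertexVecs_eq, List.map_cons, List.map_nil, hs]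
  refine congrArg₂ List.cons ?_ rfl
  rw [compInr_apply]
  refine Prod.ext (map_zero (G.compH1Equiv G' k)) (Prod.ext ?_ (Subtype.ext (funext ?_)))
  · ext (f | f) <;> rfl
  · rintro (f | f)
    · exact (if_neg (by simp [sameCycle_sumCongr_inr])).symm
    · have h : (Perm.sumCongr G.rot G'.rot).SameCycle (Sum.inr x) (Sum.inr f) ↔
          G'.rot.SameCycle x f := by simp [sameCycle_sumCongr_inr]
      change (G'.vertexFun k x).1 f = ((G.comp G').vertexFun k (Sum.inr x)).1 (Sum.inr f)
      rw [vertexFun_apply, vertexFun_apply]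
      simp only [h]

theorem pairProd_append {V : Type v} [AddCommGroup V] [Module k V] {m n : ℕ} (a b : Fin m → V)
    (a' b' : Fin n → V) :
    pairProd k (Fin.append a a') (Fin.append b b') = pairProd k a b * pairProd k a' b' := by
  have e : (fun i => ExteriorAlgebra.ι k (Fin.append a a' i) * ExteriorAlgebra.ι k (Fin.append b b' i)) =
      Fin.append (fun i => ExteriorAlgebra.ι k (a i) * ExteriorAlgebra.ι k (b i))
        fun i => ExteriorAlgebra.ι k (a' i) * ExteriorAlgebra.ι k (b' i) := by
    funext i
    refine Fin.addCases (fun i => ?_) (fun i => ?_) i <;> simp only [Fin.append_left, Fin.append_right]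
  rw [pairProd, e, List.ofFn_fin_append, List.prod_append]
  rfl

/-- With the punctures of the glued legs in front, the merged puncture is the omitted one. The
remaining boundary classes are those of `G` followed by those of `G'`, and the signs given by the
lengths of `P` and `P'` multiply. All other factors are central and can be collected. -/
theorem Framing.element_comp {γ γ' : ℕ} (B : G.Framing k γ) (B' : G'.Framing k γ') {P : List G.Flag}
    {P' : List G'.Flag} (hP : B.punctures = G.leg none :: P) (hP' : B'.punctures = G'.leg none :: P') :
    (B.comp B' hP hP').element = ExteriorAlgebra.map (G.compInl G' k) B.element *
      ExteriorAlgebra.map (G.compInr G' k) B'.element := by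
  have hn := (hP ▸ B.isCycleList_face : IsCycleList G.face ((G.leg none :: P).map (cyc G.face)))
  have hn' := (hP' ▸ B'.isCycleList_face :
    IsCycleList G'.face ((G'.leg none :: P').map (cyc G'.face)))
  have h1 : tailProd k ((B.comp B' hP hP').punctures.map ((G.comp G').faceVec k)) =
      ExteriorAlgebra.map (G.compInl G' k) (tailProd k (B.punctures.map (G.faceVec k))) *
        ExteriorAlgebra.map (G.compInr G' k) (tailProd k (B'.punctures.map (G'.faceVec k))) := by
    rw [hP, hP', map_tailProd, map_tailProd]
    simp only [List.map_cons, tailProd_cons, comp, List.map_append, ιProd_append, List.length_append,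
      List.length_map, pow_add, List.map_map]
    have e1 : P.map ((G.comp G').faceVec k ∘ Sum.inl) = P.map (G.compInl G' k ∘ G.faceVec k) :=
      List.map_congr_left fun x hx => faceVec_comp_inl (hn.not_sameCycle hx)
    have e2 : P'.map ((G.comp G').faceVec k ∘ Sum.inr) = P'.map (G.compInr G' k ∘ G'.faceVec k) :=
      List.map_congr_left fun x hx => faceVec_comp_inr (hn'.not_sameCycle hx)
    rw [e1, e2]
    simp only [neg_one_pow_mul_eq_smul, smul_mul_assoc, mul_smul_comm]
    exact smul_comm _ _ _
  have h2 : (G.comp G').vertexProd k (B.comp B' hP hP').vertices =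
      ExteriorAlgebra.map (G.compInl G' k) (G.vertexProd k B.vertices) *
        ExteriorAlgebra.map (G.compInr G' k) (G'.vertexProd k B'.vertices) := by
    rw [map_vertexProd _ Sum.inl fun x _ => vertexVecs_comp_inl x,
      map_vertexProd _ Sum.inr fun x _ => vertexVecs_comp_inr x, ← vertexProd_append]
    rfl
  have h3 : pairProd k (fun i => (G.comp G').inH1 k ((B.comp B' hP hP').a i))
        (fun i => (G.comp G').inH1 k ((B.comp B' hP hP').b i)) =
      ExteriorAlgebra.map (G.compInl G' k)
          (pairProd k (fun i => G.inH1 k (B.a i)) fun i => G.inH1 k (B.b i)) *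
        ExteriorAlgebra.map (G.compInr G' k)
          (pairProd k (fun i => G'.inH1 k (B'.a i)) fun i => G'.inH1 k (B'.b i)) := by
    rw [map_pairProd, map_pairProd, ← pairProd_append]
    congr 1 <;> funext i <;> refine Fin.addCases (fun i => ?_) (fun i => ?_) i
    all_goals
      simp only [Fin.append_left, Fin.append_right, comp, compInl_inH1, compInr_inH1]
  rw [element_eq, element_eq, element_eq, h1, h2, h3, map_mul, map_mul, map_mul, map_mul]
  have c1 : Commute (ExteriorAlgebra.map (G.compInl G' k)
      (pairProd k (fun i => G.inH1 k (B.a i)) fun i => G.inH1 k (B.b i)))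
      (ExteriorAlgebra.map (G.compInr G' k) (tailProd k (B'.punctures.map (G'.faceVec k)))) := by
    rw [map_pairProd]
    exact pairProd_commute _ _ _
  have c2 : ∀ z, Commute (ExteriorAlgebra.map (G.compInl G' k) (G.vertexProd k B.vertices)) z := by
    rw [map_vertexProd _ Sum.inl fun x _ => vertexVecs_comp_inl x]
    exact vertexProd_commute _ _
  generalize ExteriorAlgebra.map (G.compInl G' k) (tailProd k (B.punctures.map (G.faceVec k))) = t at *
  generalize ExteriorAlgebra.map (G.compInr G' k) (tailProd k (B'.punctures.map (G'.faceVec k))) = t'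
    at *
  generalize ExteriorAlgebra.map (G.compInl G' k)
    (pairProd k (fun i => G.inH1 k (B.a i)) fun i => G.inH1 k (B.b i)) = p at *
  generalize ExteriorAlgebra.map (G.compInr G' k)
    (pairProd k (fun i => G'.inH1 k (B'.a i)) fun i => G'.inH1 k (B'.b i)) = p' at *
  generalize ExteriorAlgebra.map (G.compInl G' k) (G.vertexProd k B.vertices) = w at *
  generalize ExteriorAlgebra.map (G.compInr G' k) (G'.vertexProd k B'.vertices) = w'
  calc t * t' * (p * p') * (w * w') = t * (t' * p) * p' * (w * w') := by simp only [mul_assoc]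
    _ = t * (p * t') * p' * (w * w') := by rw [c1.eq]
    _ = t * p * ((t' * p') * w) * w' := by simp only [mul_assoc]
    _ = t * p * (w * (t' * p')) * w' := by rw [(c2 _).eq]
    _ = t * p * w * (t' * p' * w') := by simp only [mul_assoc]

theorem sCompTerm_wedge [Finite I] [Finite J] {σ : Perm (Option I)} {ρ : Perm (Option J)} (g g' : ℕ)
    {L : List (Set (Option I))} {M : List (Set (Option J))} (hL : cyc σ none ∉ L) (hM : cyc ρ none ∉ M)
    (hA : (inclSum I J ⁻¹' cyc (Perm.sumCongr σ ρ * swap (Sum.inl none) (Sum.inr none))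
      (Sum.inl none)).Nonempty) :
    sCompTerm k σ g ρ g' (wedge k (cyc σ none :: L)) (wedge k (cyc ρ none :: M)) =
      Finsupp.single (erase (inclSum I J) (Perm.sumCongr σ ρ * swap (Sum.inl none) (Sum.inr none)), g + g')
        (wedge k ((inclSum I J ⁻¹' cyc (Perm.sumCongr σ ρ * swap (Sum.inl none) (Sum.inr none))
          (Sum.inl none)) :: (L.map (fun C => inclSum I J ⁻¹' (Sum.inl '' C)) ++
            M.map fun C => inclSum I J ⁻¹' (Sum.inr '' C)))) := by
  rw [sCompTerm]
  simp only [if_pos hA, LinearMap.compr₂_apply, LinearMap.compl₁₂_apply, LinearMap.comp_apply,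
    contr_wedge_cons hL, contr_wedge_cons hM, mapBlocks_wedge, LinearMap.mul_apply',
    LinearMap.mulLeft_apply, Finsupp.lsingle_apply, ← wedge_append, ← wedge_cons]

/-- If one of the graphs has the value zero, or if the merged puncture has no leg, both sides
vanish. Otherwise framings that begin with the punctures of the glued legs match the rule of `S[t]`,
which contracts with the cycles of these legs. -/
theorem canonicalMap_comp [Finite I] [Finite J] (α : G.Orient k) (β : G'.Orient k) :
    (G.comp G').canonicalMap k (G.compOrient G' k α β) =
      sCompAux k I J (G.canonicalMap k α) (G'.canonicalMap k β) := by
  by_cases hc : G.IsTrivalent ∧ G.HasLegAtEveryPuncture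
  swap
  · rw [canonicalMap_eq_zero hc, canonicalMap_eq_zero, LinearMap.zero_apply, LinearMap.zero_apply,
      map_zero, LinearMap.zero_apply]
    rw [isTrivalent_comp, hasLeg_comp]
    exact fun h => hc ⟨h.1.1, h.2.2.1⟩
  by_cases hc' : G'.IsTrivalent ∧ G'.HasLegAtEveryPuncture
  swap
  · rw [canonicalMap_eq_zero hc', canonicalMap_eq_zero, LinearMap.zero_apply, LinearMap.zero_apply,
      map_zero]
    rw [isTrivalent_comp, hasLeg_comp]
    exact fun h => hc' ⟨h.1.2, h.2.2.2⟩
  obtain ⟨hG, hl⟩ := hc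
  obtain ⟨hG', hl'⟩ := hc'
  obtain ⟨γ, ⟨B₀⟩⟩ := G.exists_framing k
  obtain ⟨γ', ⟨B₀'⟩⟩ := G'.exists_framing k
  obtain ⟨P, hP⟩ := B₀.isCycleList_face.exists_head (G.leg none)
  obtain ⟨P', hP'⟩ := B₀'.isCycleList_face.exists_head (G'.leg none)
  obtain ⟨B, hB⟩ : ∃ B : G.Framing k γ, B.punctures = G.leg none :: P :=
    ⟨B₀.withPunctures _ hP, rfl⟩
  obtain ⟨B', hB'⟩ : ∃ B : G'.Framing k γ', B.punctures = G'.leg none :: P' :=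
    ⟨B₀'.withPunctures _ hP', rfl⟩
  obtain ⟨c, rfl⟩ := B.exists_smul hG α
  obtain ⟨c', rfl⟩ := B'.exists_smul hG' β
  have hw := B.isCycleList_legPerm hl
  have hw' := B'.isCycleList_legPerm hl'
  have hcyc : G.leg ⁻¹' cyc G.face (G.leg none) = cyc G.legPerm none := (cyc_erase _ _ _).symm
  have hcyc' : G'.leg ⁻¹' cyc G'.face (G'.leg none) = cyc G'.legPerm none := (cyc_erase _ _ _).symm
  rw [hB, List.map_cons, hcyc] at hw
  rw [hB', List.map_cons, hcyc'] at hw'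
  have e : B.legWedge = wedge k (cyc G.legPerm none :: P.map fun x => G.leg ⁻¹' cyc G.face x) := by
    rw [Framing.legWedge, hB, List.map_cons, hcyc]
  have e' : B'.legWedge =
      wedge k (cyc G'.legPerm none :: P'.map fun x => G'.leg ⁻¹' cyc G'.face x) := by
    rw [Framing.legWedge, hB', List.map_cons, hcyc']
  simp only [map_smul, LinearMap.smul_apply]
  congr 2
  rw [canonicalMap_apply hG hl B (B.val_orient hG), canonicalMap_apply hG' hl' B' (B'.val_orient hG'),
    sCompAux_single]
  by_cases hA : ((G.comp G').leg ⁻¹' cyc (G.comp G').face (Sum.inl (G.leg none))).Nonempty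
  · rw [canonicalMap_apply ((isTrivalent_comp G G').2 ⟨hG, hG'⟩) ((hasLeg_comp G G').2 ⟨hA, hl, hl'⟩)
      (B.comp B' hB hB'), legPerm_comp]
    · rw [preimage_comp_none] at hA
      rw [e, e', sCompTerm_wedge γ γ' (List.nodup_cons.1 hw.1).1 (List.nodup_cons.1 hw'.1).1 hA]
      congr 1
      change wedge k ((Sum.inl (G.leg none) :: (P.map Sum.inl ++ P'.map Sum.inr)).map _) = _
      rw [List.map_cons, preimage_comp_none, List.map_append, List.map_map, List.map_map, List.map_map,
        List.map_map]
      congr 3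
      · exact List.map_congr_left fun x hx => preimage_comp_inl G G' (hP.not_sameCycle hx)
      · exact List.map_congr_left fun x hx => preimage_comp_inr G G' (hP'.not_sameCycle hx)
    · rw [B.element_comp B', compOrient, coe_detMul, B.val_orient, B'.val_orient]
  · rw [canonicalMap_eq_zero fun h => hA ((hasLeg_comp G G').1 h.2).1]
    rw [preimage_comp_none] at hA
    rw [sCompTerm]
    simp only [if_neg hA]
    rfl

end Composition

end RibbonGraph

section Morphism

variable (k : Type u) [Field k] [CharZero k]

theorem canonicalHom_comp (I J : Type) [Finite I] [Finite J] (b b' : ℕ) (x : Chain k (Option I) b)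
    (y : Chain k (Option J) b') : canonicalHom k (I ⊕ J) (b + b') (chainComp k I J b b' x y) =
      sComp k I J b b' (canonicalHom k (Option I) b x) (canonicalHom k (Option J) b' y) := by
  have h1 : ∀ (G : RibbonGraph (Option I)) (hG : G.betti k = b) (α : G.Orient k),
      (canonicalHom k (I ⊕ J) (b + b')).comp (chainComp k I J b b' (Chain.mk G hG α)) =
        (sComp k I J b b' (canonicalHom k (Option I) b (Chain.mk G hG α))).comp
          (canonicalHom k (Option J) b') := by
    intro G hG α
    refine Chain.hom_ext (M := SComp k (I ⊕ J) (b + b')) fun G' hG' β => Subtype.ext ?_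
    rw [LinearMap.comp_apply, LinearMap.comp_apply, chainComp_mk, canonicalHom_mk,
      RibbonGraph.canonicalMap_comp]
    change _ = sCompAux k I J (canonicalHom k (Option I) b (Chain.mk G hG α)).1
      (canonicalHom k (Option J) b' (Chain.mk G' hG' β)).1
    rw [canonicalHom_mk, canonicalHom_mk]
  have h2 : ((canonicalHom k (I ⊕ J) (b + b')).comp ((chainComp k I J b b').flip y)) =
      ((sComp k I J b b').flip (canonicalHom k (Option J) b' y)).comp (canonicalHom k (Option I) b) :=
    Chain.hom_ext (M := SComp k (I ⊕ J) (b + b')) fun G hG α => LinearMap.congr_fun (h1 G hG α) y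
  exact LinearMap.congr_fun h2 x

end Morphism

/-! ### Dual vectors and one more pair for a symplectic family. -/

section Symplectic

variable {k : Type u} [Field k] {V : Type v} [AddCommGroup V] [Module k V]

/-- Serves to make a loop through the new edge orthogonal to a given symplectic family. -/
theorem IsSymplectic.exists_dual {ω : V →ₗ[k] V →ₗ[k] k} {γ : ℕ} {a b : Fin γ → V}
    (h : IsSymplectic ω a b) (hω : ∀ x y, ω x y = - ω y x) (c d : Fin γ → k) :
    ∃ z, ∀ i, ω z (a i) = c i ∧ ω z (b i) = d i := by
  refine ⟨∑ j, (d j • a j - c j • b j), fun i => ⟨?_, ?_⟩⟩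
  · simp only [map_sum, map_sub, map_smul, LinearMap.sum_apply, LinearMap.sub_apply,
      LinearMap.smul_apply, h.aa, hω (b _) (a i), h.ab, smul_eq_mul]
    simp
  · simp only [map_sum, map_sub, map_smul, LinearMap.sum_apply, LinearMap.sub_apply,
      LinearMap.smul_apply, h.bb, h.ab, smul_eq_mul]
    simp

/-- Adds the handle that appears when a loop joins two different punctures. -/
theorem IsSymplectic.cons {U : Type w} [AddCommGroup U] [Module k U] {ω : V →ₗ[k] V →ₗ[k] k}
    {η : U →ₗ[k] U →ₗ[k] k} {γ : ℕ} {a b : Fin γ → V} (h : IsSymplectic ω a b) (f : V →ₗ[k] U)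
    (hf : ∀ x y, η (f x) (f y) = ω x y) (hη : ∀ x y, η x y = - η y x) (h0 : ∀ x, η x x = 0) {x y : U}
    (hxy : η x y = 1) (hx : ∀ i, η x (f (a i)) = 0 ∧ η x (f (b i)) = 0)
    (hy : ∀ i, η y (f (a i)) = 0 ∧ η y (f (b i)) = 0) :
    IsSymplectic η (Fin.cons x fun i => f (a i)) (Fin.cons y fun i => f (b i)) := by
  have h1 : ∀ i, η (f (a i)) x = 0 := fun i => by rw [hη, (hx i).1, neg_zero]
  have h2 : ∀ i, η (f (b i)) y = 0 := fun i => by rw [hη, (hy i).2, neg_zero]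
  have h3 : ∀ i, η (f (a i)) y = 0 := fun i => by rw [hη, (hy i).1, neg_zero]
  constructor <;> refine Fin.cases (Fin.cases ?_ fun j => ?_) fun i => Fin.cases ?_ fun j => ?_ <;>
  simp only [Fin.cons_zero, Fin.cons_succ, h0, hxy, (hx _).1, (hx _).2, (hy _).2, h1, h2, h3, hf,
    h.aa, h.bb, h.ab, Fin.succ_inj, if_true, (Fin.succ_ne_zero _), (Fin.succ_ne_zero _).symm, if_false]

end Symplectic

namespace RibbonGraph

/-! ### Compatibility with the gluing of two legs of one graph. -/

section Gluing

variable {k : Type u} [Field k] {I : Type} (G : RibbonGraph (Option (Option I)))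

theorem face_glue : G.glue.face = G.face * swap (G.leg (some none)) (G.leg none) := by
  change G.rot * (G.opp * swap _ _) = _
  rw [← mul_assoc]
  rfl

theorem erase_face_glue :
    erase G.leg G.glue.face = G.legPerm * swap (some none) none := by
  rw [face_glue]
  convert erase_mul_swap G.leg G.face (some none) none
  rfl

theorem legPerm_glue [Finite I] :
    G.glue.legPerm = erase (inclTwo I) (G.legPerm * swap (some none) none) := by
  rw [← erase_face_glue, ← erase_trans]
  rfl

theorem preimage_glue [Finite I] (x : Option (Option I)) :
    G.glue.leg ⁻¹' cyc G.glue.face (G.leg x) =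
      inclTwo I ⁻¹' cyc (G.legPerm * swap (some none) none) x := by
  rw [← erase_face_glue, cyc_erase]
  rfl

theorem sameCycle_legPerm : G.legPerm.SameCycle (some none) none ↔
    G.face.SameCycle (G.leg (some none)) (G.leg none) := sameCycle_erase _ _ _ _

theorem cyc_face_glue {x : G.Flag} (h : ¬ G.face.SameCycle x (G.leg (some none)))
    (h' : ¬ G.face.SameCycle x (G.leg none)) : cyc G.glue.face x = cyc G.face x := by
  rw [face_glue, cyc_mul_swap_of_not h h']

theorem preimage_glue_of_not {x : G.Flag} (h : ¬ G.face.SameCycle x (G.leg (some none)))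
    (h' : ¬ G.face.SameCycle x (G.leg none)) : G.glue.leg ⁻¹' cyc G.glue.face x =
      inclTwo I ⁻¹' (G.leg ⁻¹' cyc G.face x) := by
  rw [cyc_face_glue G h h']
  rfl

/-- The punctures of the two glued legs are cut or merged, and only the resulting punctures can lose
their legs. In the case of merging the last two conditions coincide. -/
theorem hasLeg_glue : G.glue.HasLegAtEveryPuncture ↔ G.HasLegAtEveryPuncture ∧
    (G.glue.leg ⁻¹' cyc G.glue.face (G.leg (some none))).Nonempty ∧
    (G.glue.leg ⁻¹' cyc G.glue.face (G.leg none)).Nonempty := by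
  constructor
  · refine fun h => ⟨fun x => ?_, h _, h _⟩
    by_cases h1 : G.face.SameCycle x (G.leg (some none))
    · exact ⟨_, h1⟩
    by_cases h2 : G.face.SameCycle x (G.leg none)
    · exact ⟨_, h2⟩
    have h3 : (G.glue.leg ⁻¹' cyc G.glue.face x).Nonempty := h x
    rw [preimage_glue_of_not G h1 h2] at h3
    obtain ⟨i, hi⟩ := h3
    exact ⟨_, hi⟩
  · rintro ⟨h, hA, hA'⟩ x
    change (G.glue.leg ⁻¹' cyc G.glue.face x).Nonempty
    by_cases h1 : G.face.SameCycle x (G.leg (some none)) ∨ G.face.SameCycle x (G.leg none)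
    · have h2 := sameCycle_mul_swap_or h1
      rw [← face_glue] at h2
      rcases h2 with h2 | h2
      · rw [cyc_eq_iff.2 h2]
        exact hA
      · rw [cyc_eq_iff.2 h2]
        exact hA'
    · rw [not_or] at h1
      rw [preimage_glue_of_not G h1.1 h1.2]
      obtain ⟨i, hi⟩ := h x
      match i with
      | none => exact absurd hi h1.2
      | some none => exact absurd hi h1.1
      | some (some i) => exact ⟨i, hi⟩

variable [CharZero k]

/-- The form involves only `rot` and the coefficients at flags, and gluing changes neither. -/
theorem intersectionForm_glueH1 (x y : G.H1 k) :
    G.glue.intersectionForm k (G.glueH1 k x) (G.glueH1 k y) = G.intersectionForm k x y := rfl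

/-- The intersection index of a loop through the new edge with a boundary class. -/
theorem intersectionForm_glue_boundary (x : G.glue.H1 k) (X : invariants k G.face) :
    G.glue.intersectionForm k x (G.glueH1 k (G.boundary k X)) =
      x.1 (G.leg (some none)) * (X.1 (G.leg (some none)) - X.1 (G.leg none)) := by
  have hX := G.invariant_opp X.2
  have hne : G.leg (some none) ≠ G.leg none := by simp
  have hx' : x.1 (G.leg none) = - x.1 (G.leg (some none)) := by
    rw [← x.2.1, G.glue_opp_some_none]
  -- Gluing keeps `rot`, so the potential of a boundary in `G` is still a potential.
  have hY : ∀ f, -X.1 (G.glue.rot f) - -X.1 f = (G.glueH1 k (G.boundary k X)).1 f := fun f => by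
    change - X.1 (G.rot f) - - X.1 f = X.1 f - X.1 (G.opp f)
    rw [hX]
    ring
  rw [G.glue.intersectionForm_eq x _ (Y := fun f => - X.1 f) hY]
  have h1 : ∑ f, x.1 f * (-X.1 f + -X.1 (G.glue.rot f)) = - ∑ f, (x.1 f + x.1 (G.opp f)) * X.1 f := by
    have h2 : ∑ f, x.1 f * X.1 (G.rot f) = ∑ f, x.1 (G.opp f) * X.1 f := by
      rw [← Equiv.sum_comp G.opp fun f => x.1 (G.opp f) * X.1 f]
      refine Finset.sum_congr rfl fun f _ => ?_
      rw [G.opp_opp, hX]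
    simp only [add_mul, mul_add, Finset.sum_add_distrib, mul_neg, Finset.sum_neg_distrib, neg_add]
    rw [← h2]
  -- The cycle `x` is odd under the involution of the glued graph, which differs from `G.opp` only
  -- at the two glued flags; all other terms vanish.
  have h3 : ∑ f, (x.1 f + x.1 (G.opp f)) * X.1 f =
      2 * (x.1 (G.leg (some none)) * (X.1 (G.leg (some none)) - X.1 (G.leg none))) := by
    rw [← Finset.sum_subset (Finset.subset_univ {G.leg (some none), G.leg none}),
      Finset.sum_pair hne, G.opp_leg, G.opp_leg, hx']
    · ring
    · intro f _ hf
      simp only [Finset.mem_insert, Finset.mem_singleton, not_or] at hf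
      rw [← G.glue_opp_of_ne hf.1 hf.2, x.2.1, add_neg_cancel, zero_mul]
  rw [h1, h3]
  ring

variable {G}

theorem faceVec_glue {x : G.Flag} (h : ¬ G.face.SameCycle x (G.leg (some none)))
    (h' : ¬ G.face.SameCycle x (G.leg none)) :
    G.glue.faceVec k x = G.glueVec k (G.faceVec k x) := by
  refine Prod.ext (Subtype.ext (funext fun f => ?_)) rfl
  change (G.glue.faceClass k x).1 f = (G.faceClass k x).1 f
  have hn : G.leg (some none) ∉ cyc G.face x := h
  have hn' : G.leg none ∉ cyc G.face x := h'
  rw [faceClass_apply, faceClass_apply, cyc_face_glue G h h']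
  by_cases h1 : f = G.leg (some none)
  · subst h1
    rw [glue_opp_some_none, G.opp_leg, if_neg hn, if_neg hn']
  by_cases h2 : f = G.leg none
  · subst h2
    rw [glue_opp_none, G.opp_leg, if_neg hn, if_neg hn']
  rw [G.glue_opp_of_ne h1 h2]

theorem map_glueVec_vertexProd (L : List G.Flag) :
    ExteriorAlgebra.map (G.glueVec k) (G.vertexProd k L) = G.glue.vertexProd k L := by
  rw [map_vertexProd (G' := G.glue) (G.glueVec k) id fun x _ => ?_, List.map_id]
  rw [vertexVecs_eq, vertexVecs_eq, List.map_cons, List.map_cons, List.map_cons, List.map_cons,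
    List.map_nil]
  have h0 : G.glueH1 k 0 = 0 := map_zero _
  exact congrArg₂ List.cons (Prod.ext h0 rfl) (congrArg₂ List.cons (Prod.ext h0 rfl)
    (congrArg₂ List.cons (Prod.ext h0 rfl) (congrArg₂ List.cons (Prod.ext h0 rfl) rfl)))

/-- The framing of the glued graph, for two legs adjacent to one puncture. -/
def Framing.dissect {γ : ℕ} (B : G.Framing k γ) {P : List G.Flag}
    (hP : B.punctures = G.leg (some none) :: P)
    (hs : G.face.SameCycle (G.leg (some none)) (G.leg none)) : G.glue.Framing k γ where
  punctures := G.leg (some none) :: G.leg none :: P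
  isCycleList_face := by
    have h := (hP ▸ B.isCycleList_face :
      IsCycleList G.face ((G.leg (some none) :: P).map (cyc G.face)))
    have hd := IsCycleList.dissect (by simp) hs h
    rw [← face_glue] at hd
    have e : P.map (cyc G.glue.face) = P.map (cyc G.face) := List.map_congr_left fun x hx =>
      cyc_face_glue G (h.not_sameCycle hx) fun hx' => h.not_sameCycle hx (hx'.trans hs.symm)
    rw [List.map_cons, List.map_cons, e]
    exact hd
  vertices := B.vertices
  isCycleList_rot := B.isCycleList_rot
  genus_eq := by
    have h := B.genus_eq
    rw [hP, List.length_cons] at h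
    rw [betti_glue, List.length_cons, List.length_cons]
    omega
  a i := G.glueH1 k (B.a i)
  b i := G.glueH1 k (B.b i)
  intersection_a_a := B.intersection_a_a
  intersection_b_b := B.intersection_b_b
  intersection_a_b := B.intersection_a_b

/-- A cycle of `G` has zero coefficients at legs, so adding it to a loop does not change the
coefficient of the new edge; it can be chosen to cancel all pairings with the symplectic family. -/
theorem exists_dual_loop {γ : ℕ} (B : G.Framing k γ) : ∃ y : G.glue.H1 k, y.1 (G.leg (some none)) = 1 ∧
    ∀ i, G.glue.intersectionForm k y (G.glueH1 k (B.a i)) = 0 ∧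
      G.glue.intersectionForm k y (G.glueH1 k (B.b i)) = 0 := by
  obtain ⟨z, hz⟩ := B.isSymplectic.exists_dual G.intersectionForm_swap
    (fun i => - G.glue.intersectionForm k (G.loop k) (G.glueH1 k (B.a i)))
    (fun i => - G.glue.intersectionForm k (G.loop k) (G.glueH1 k (B.b i)))
  refine ⟨G.loop k + G.glueH1 k z, ?_, fun i => ⟨?_, ?_⟩⟩
  · change (G.loop k).1 _ + z.1 _ = 1
    rw [loop_apply, H1_leg, add_zero]
  · rw [map_add, LinearMap.add_apply, intersectionForm_glueH1, (hz i).1, add_neg_cancel]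
  · rw [map_add, LinearMap.add_apply, intersectionForm_glueH1, (hz i).2, add_neg_cancel]

/-- A loop through the new edge that does not intersect the symplectic basis. -/
def Framing.dualLoop {γ : ℕ} (B : G.Framing k γ) : G.glue.H1 k := Classical.choose (exists_dual_loop B)

theorem Framing.dualLoop_apply {γ : ℕ} (B : G.Framing k γ) : B.dualLoop.1 (G.leg (some none)) = 1 :=
  (Classical.choose_spec (exists_dual_loop B)).1

/-- The loop crosses once the boundary of the old puncture of `none`. This boundary is in the
radical of the form of `G`, so it does not meet the old pairs. The sign makes the index one: the
indicator function of this puncture is zero at `some none` and one at `none`. -/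
theorem Framing.isSymplectic_sew {γ : ℕ} (B : G.Framing k γ)
    (hs : ¬ G.face.SameCycle (G.leg (some none)) (G.leg none)) :
    IsSymplectic (G.glue.intersectionForm k) (Fin.cons B.dualLoop fun i => G.glueH1 k (B.a i))
      (Fin.cons (G.glueH1 k (-G.faceClass k (G.leg none))) fun i => G.glueH1 k (B.b i)) := by
  refine B.isSymplectic.cons (G.glueH1 k) G.intersectionForm_glueH1 G.glue.intersectionForm_swap
    G.glue.intersectionForm_self ?_ (Classical.choose_spec (exists_dual_loop B)).2 fun i => ⟨?_, ?_⟩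
  · rw [map_neg, map_neg, faceClass_eq, intersectionForm_glue_boundary, B.dualLoop_apply,
      cycFun_of_sameCycle k (Perm.SameCycle.refl _ _), cycFun_of_not_sameCycle k fun h => hs h.symm]
    ring
  · rw [intersectionForm_glueH1, map_neg, LinearMap.neg_apply, faceClass_eq, boundary_intersectionForm,
      neg_zero]
  · rw [intersectionForm_glueH1, map_neg, LinearMap.neg_apply, faceClass_eq, boundary_intersectionForm,
      neg_zero]

/-- The framing of the glued graph, for two legs adjacent to different punctures. -/
def Framing.sew {γ : ℕ} (B : G.Framing k γ) {P : List G.Flag}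
    (hP : B.punctures = G.leg (some none) :: G.leg none :: P)
    (hs : ¬ G.face.SameCycle (G.leg (some none)) (G.leg none)) : G.glue.Framing k (γ + 1) where
  punctures := G.leg (some none) :: P
  isCycleList_face := by
    have h := (hP ▸ B.isCycleList_face :
      IsCycleList G.face ((G.leg (some none) :: G.leg none :: P).map (cyc G.face)))
    have hd := IsCycleList.sew hs h
    rw [← face_glue] at hd
    have h' := h.perm (L' := (G.leg none :: G.leg (some none) :: P).map (cyc G.face))
      (List.Perm.swap _ _ _)
    have e : P.map (cyc G.glue.face) = P.map (cyc G.face) := List.map_congr_left fun x hx =>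
      cyc_face_glue G (h.not_sameCycle (List.mem_cons_of_mem _ hx))
        (h'.not_sameCycle (List.mem_cons_of_mem _ hx))
    rw [List.map_cons, e]
    exact hd
  vertices := B.vertices
  isCycleList_rot := B.isCycleList_rot
  genus_eq := by
    have h := B.genus_eq
    rw [hP, List.length_cons, List.length_cons] at h
    rw [betti_glue, List.length_cons]
    omega
  a := Fin.cons B.dualLoop fun i => G.glueH1 k (B.a i)
  b := Fin.cons (G.glueH1 k (-G.faceClass k (G.leg none))) fun i => G.glueH1 k (B.b i)
  intersection_a_a := (B.isSymplectic_sew hs).aa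
  intersection_b_b := (B.isSymplectic_sew hs).bb
  intersection_a_b := (B.isSymplectic_sew hs).ab

theorem Framing.map_element {γ : ℕ} (B : G.Framing k γ) :
    ExteriorAlgebra.map (G.glueVec k) B.element =
      tailProd k (B.punctures.map fun x => G.glueVec k (G.faceVec k x)) *
        pairProd k (fun i => G.glue.inH1 k (G.glueH1 k (B.a i)))
          (fun i => G.glue.inH1 k (G.glueH1 k (B.b i))) * G.glue.vertexProd k B.vertices := by
  rw [element_eq, map_mul, map_mul, map_tailProd, map_pairProd, map_glueVec_vertexProd, List.map_map]
  rfl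

/-- After the cut, the boundary of the puncture of `none` runs once along the new edge, in the
direction from `none` to `some none`; so minus its class may serve as the class of the loop. It
stands in front of the classes of `P`, as in the new list of punctures, and the minus sign accounts
for one more element behind the omitted one. -/
theorem Framing.element_dissect {γ : ℕ} (B : G.Framing k γ) {P : List G.Flag}
    (hP : B.punctures = G.leg (some none) :: P)
    (hs : G.face.SameCycle (G.leg (some none)) (G.leg none)) {α : G.Orient k}
    (hα : α.val = B.element) : (G.glueOrient k α).val = (B.dissect hP hs).element := by
  have h := (hP ▸ B.isCycleList_face :
    IsCycleList G.face ((G.leg (some none) :: P).map (cyc G.face)))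
  have hn : ¬ G.glue.face.SameCycle (G.leg (some none)) (G.leg none) := by
    rw [face_glue]
    exact not_sameCycle_mul_swap_of_sameCycle (by simp) hs
  have h1 : (-G.glue.faceClass k (G.leg none)).1 (G.leg (some none)) = 1 := by
    change - (G.glue.faceClass k (G.leg none)).1 (G.leg (some none)) = 1
    rw [faceClass_apply, glue_opp_some_none, if_neg fun h => hn h.symm,
      if_pos (mem_cyc_self _ _), zero_sub, neg_neg]
  have e : P.map (fun x => G.glueVec k (G.faceVec k x)) = P.map (G.glue.faceVec k) :=
    List.map_congr_left fun x hx => (faceVec_glue (h.not_sameCycle hx) fun hx' =>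
      h.not_sameCycle hx (hx'.trans hs.symm)).symm
  have h2 : ((-G.glue.faceClass k (G.leg none), 0, 0) : G.glue.Vec k) =
      - G.glue.faceVec k (G.leg none) :=
    Prod.ext rfl (Prod.ext neg_zero.symm neg_zero.symm)
  rw [G.glueOrient_eq _ h1, hα, B.map_element, element_eq, hP, List.map_cons, tailProd_cons, e, h2]
  change _ = tailProd k ((G.leg (some none) :: G.leg none :: P).map (G.glue.faceVec k)) *
    pairProd k (fun i => G.glue.inH1 k (G.glueH1 k (B.a i)))
      (fun i => G.glue.inH1 k (G.glueH1 k (B.b i))) * G.glue.vertexProd k B.vertices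
  rw [List.map_cons, List.map_cons, tailProd_cons, ιProd_cons, List.length_cons, ← mul_assoc,
    ← mul_assoc, map_neg, pow_succ]
  simp only [neg_one_pow_mul_eq_smul, mul_smul_comm, smul_mul_assoc, neg_mul, mul_neg, mul_one, smul_neg]

/-- The loop and minus the class of the old puncture of `none` are the new symplectic pair. This
pair is central and moves behind the classes of `P`; the minus sign accounts for one puncture less
in the list. -/
theorem Framing.element_sew {γ : ℕ} (B : G.Framing k γ) {P : List G.Flag}
    (hP : B.punctures = G.leg (some none) :: G.leg none :: P)
    (hs : ¬ G.face.SameCycle (G.leg (some none)) (G.leg none)) {α : G.Orient k}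
    (hα : α.val = B.element) : (G.glueOrient k α).val = (B.sew hP hs).element := by
  have h := (hP ▸ B.isCycleList_face :
    IsCycleList G.face ((G.leg (some none) :: G.leg none :: P).map (cyc G.face)))
  have h' := h.perm (L' := (G.leg none :: G.leg (some none) :: P).map (cyc G.face))
    (List.Perm.swap _ _ _)
  have e : P.map (fun x => G.glueVec k (G.faceVec k x)) = P.map (G.glue.faceVec k) :=
    List.map_congr_left fun x hx => (faceVec_glue (h.not_sameCycle (List.mem_cons_of_mem _ hx))
        (h'.not_sameCycle (List.mem_cons_of_mem _ hx))).symm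
  have h2 : G.glue.inH1 k (G.glueH1 k (-G.faceClass k (G.leg none))) =
      - G.glueVec k (G.faceVec k (G.leg none)) :=
    Prod.ext rfl (Prod.ext neg_zero.symm neg_zero.symm)
  rw [G.glueOrient_eq _ B.dualLoop_apply, hα, B.map_element, element_eq, hP, List.map_cons,
    List.map_cons, tailProd_cons, e]
  change _ = tailProd k ((G.leg (some none) :: P).map (G.glue.faceVec k)) *
    pairProd k (fun i => G.glue.inH1 k ((Fin.cons B.dualLoop fun i => G.glueH1 k (B.a i) :
        Fin (γ + 1) → G.glue.H1 k) i))
      (fun i => G.glue.inH1 k ((Fin.cons (G.glueH1 k (-G.faceClass k (G.leg none)))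
        fun i => G.glueH1 k (B.b i) : Fin (γ + 1) → G.glue.H1 k) i)) * G.glue.vertexProd k B.vertices
  rw [List.map_cons, tailProd_cons, ιProd_cons, List.length_cons, pairProd_succ]
  simp only [Fin.cons_zero, Fin.cons_succ, List.length_map]
  have c := pair_commute (k := k) (G.glue.inH1 k B.dualLoop)
    (G.glue.inH1 k (G.glueH1 k (-G.faceClass k (G.leg none)))) (ιProd k (P.map (G.glue.faceVec k)))
  rw [← mul_assoc (_ * ιProd k _), mul_assoc ((-1) ^ P.length) (ιProd k _), ← c.eq, h2, map_neg]
  simp only [neg_one_pow_mul_eq_smul, mul_smul_comm, smul_mul_assoc, neg_mul, mul_neg, mul_one,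
    pow_succ, mul_assoc]
  rfl

theorem sLoopTerm_dissect [Finite I] {σ : Perm (Option (Option I))} (g : ℕ)
    {L : List (Set (Option (Option I)))} (hL : cyc σ (some none) ∉ L) (hs : σ.SameCycle (some none) none)
    (hA : (inclTwo I ⁻¹' cyc (σ * swap (some none) none) (some none)).Nonempty)
    (hA' : (inclTwo I ⁻¹' cyc (σ * swap (some none) none) none).Nonempty) :
    sLoopTerm k σ g (wedge k (cyc σ (some none) :: L)) =
      Finsupp.single (erase (inclTwo I) (σ * swap (some none) none), g)
        (wedge k ((inclTwo I ⁻¹' cyc (σ * swap (some none) none) (some none)) ::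
          (inclTwo I ⁻¹' cyc (σ * swap (some none) none) none) :: L.map (inclTwo I ⁻¹' ·))) := by
  rw [sLoopTerm]
  simp only [if_pos hs, if_pos (And.intro hA hA'), LinearMap.comp_apply, contr_wedge_cons hL,
    mapBlocks_wedge, LinearMap.mulLeft_apply, Finsupp.lsingle_apply, mul_assoc, ← wedge_cons]

theorem sLoopTerm_sew [Finite I] {σ : Perm (Option (Option I))} (g : ℕ)
    {L : List (Set (Option (Option I)))} (hL : cyc σ (some none) ∉ cyc σ none :: L) (hL' : cyc σ none ∉ L)
    (hs : ¬ σ.SameCycle (some none) none)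
    (hA : (inclTwo I ⁻¹' cyc (σ * swap (some none) none) (some none)).Nonempty) :
    sLoopTerm k σ g (wedge k (cyc σ (some none) :: cyc σ none :: L)) =
      Finsupp.single (erase (inclTwo I) (σ * swap (some none) none), g + 1)
        (wedge k ((inclTwo I ⁻¹' cyc (σ * swap (some none) none) (some none)) ::
          L.map (inclTwo I ⁻¹' ·))) := by
  rw [sLoopTerm]
  simp only [if_neg hs, if_pos hA, LinearMap.comp_apply, contr_wedge_cons hL, contr_wedge_cons hL',
    mapBlocks_wedge, LinearMap.mulLeft_apply, Finsupp.lsingle_apply, ← wedge_cons]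

/-- The two cases are the cutting of one cycle and the merging of two. In both, the class of the new
edge is represented by the loop that suits the framing, which `glueOrient_eq` permits. -/
theorem canonicalMap_glue [Finite I] (α : G.Orient k) :
    G.glue.canonicalMap k (G.glueOrient k α) = sLoopAux k I (G.canonicalMap k α) := by
  by_cases hc : G.IsTrivalent ∧ G.HasLegAtEveryPuncture
  swap
  · rw [canonicalMap_eq_zero hc, canonicalMap_eq_zero, LinearMap.zero_apply, LinearMap.zero_apply,
      map_zero]
    rw [hasLeg_glue]
    exact fun h => hc ⟨h.1, h.2.1⟩
  obtain ⟨hG, hl⟩ := hc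
  have hG' : G.glue.IsTrivalent := hG
  have ht : ∀ σ g a, sLoopAux k I (Finsupp.single (σ, g) a) = sLoopTerm k σ g a := by
    intro σ g a
    simp [sLoopAux]
  have hcyc : ∀ i, G.leg ⁻¹' cyc G.face (G.leg i) = cyc G.legPerm i := fun i => (cyc_erase _ _ _).symm
  obtain ⟨γ, ⟨B₀⟩⟩ := G.exists_framing k
  by_cases hs : G.face.SameCycle (G.leg (some none)) (G.leg none)
  · have hs' := (G.sameCycle_legPerm).2 hs
    obtain ⟨P, hP⟩ := B₀.isCycleList_face.exists_head (G.leg (some none))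
    obtain ⟨B, hB⟩ : ∃ B : G.Framing k γ, B.punctures = G.leg (some none) :: P :=
      ⟨B₀.withPunctures _ hP, rfl⟩
    obtain ⟨c, rfl⟩ := B.exists_smul hG α
    simp only [map_smul]
    congr 1
    have hw := B.isCycleList_legPerm hl
    rw [hB, List.map_cons, hcyc] at hw
    have e : B.legWedge = wedge k (cyc G.legPerm (some none) ::
        P.map fun x => G.leg ⁻¹' cyc G.face x) := by
      rw [Framing.legWedge, hB, List.map_cons, hcyc]
    rw [canonicalMap_apply hG hl B (B.val_orient hG), ht]
    by_cases hA : (G.glue.leg ⁻¹' cyc G.glue.face (G.leg (some none))).Nonempty ∧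
        (G.glue.leg ⁻¹' cyc G.glue.face (G.leg none)).Nonempty
    · rw [canonicalMap_apply hG' ((hasLeg_glue G).2 ⟨hl, hA⟩) (B.dissect hB hs)
        (B.element_dissect hB hs (B.val_orient hG)), legPerm_glue]
      rw [preimage_glue, preimage_glue] at hA
      rw [e, sLoopTerm_dissect γ (List.nodup_cons.1 hw.1).1 hs' hA.1 hA.2]
      congr 1
      change wedge k ((G.leg (some none) :: G.leg none :: P).map _) = _
      rw [List.map_cons, List.map_cons, preimage_glue, preimage_glue, List.map_map]
      congr 3
      exact List.map_congr_left fun x hx => preimage_glue_of_not G (hP.not_sameCycle hx) fun hx' =>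
        hP.not_sameCycle hx (hx'.trans hs.symm)
    · rw [canonicalMap_eq_zero fun h => hA ((hasLeg_glue G).1 h.2).2]
      rw [preimage_glue, preimage_glue] at hA
      rw [sLoopTerm]
      simp only [if_neg hA, if_pos hs']
      rfl
  · have hs' : ¬ G.legPerm.SameCycle (some none) none := fun h => hs ((G.sameCycle_legPerm).1 h)
    obtain ⟨P, hP⟩ := B₀.isCycleList_face.exists_two_heads hs
    obtain ⟨B, hB⟩ : ∃ B : G.Framing k γ, B.punctures = G.leg (some none) :: G.leg none :: P :=
      ⟨B₀.withPunctures _ hP, rfl⟩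
    have hP' := hP.perm (L' := (G.leg none :: G.leg (some none) :: P).map (cyc G.face))
      (List.Perm.swap _ _ _)
    obtain ⟨c, rfl⟩ := B.exists_smul hG α
    simp only [map_smul]
    congr 1
    have hw := B.isCycleList_legPerm hl
    rw [hB, List.map_cons, List.map_cons, hcyc, hcyc] at hw
    have e : B.legWedge = wedge k (cyc G.legPerm (some none) :: cyc G.legPerm none ::
        P.map fun x => G.leg ⁻¹' cyc G.face x) := by
      rw [Framing.legWedge, hB, List.map_cons, List.map_cons, hcyc, hcyc]
    -- Both glued legs lie now on one puncture, so the single condition in the sewing rule covers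
    -- both conditions of `hasLeg_glue`.
    have hAA : G.glue.leg ⁻¹' cyc G.glue.face (G.leg none) =
        G.glue.leg ⁻¹' cyc G.glue.face (G.leg (some none)) := by
      have := sameCycle_mul_swap_of_not_sameCycle hs
      rw [← face_glue] at this
      rw [cyc_eq_iff.2 this]
    rw [canonicalMap_apply hG hl B (B.val_orient hG), ht]
    by_cases hA : (G.glue.leg ⁻¹' cyc G.glue.face (G.leg (some none))).Nonempty
    · rw [canonicalMap_apply hG' ((hasLeg_glue G).2 ⟨hl, hA, hAA ▸ hA⟩) (B.sew hB hs)
        (B.element_sew hB hs (B.val_orient hG)), legPerm_glue]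
      rw [preimage_glue] at hA
      have hnd := List.nodup_cons.1 hw.1
      rw [e, sLoopTerm_sew γ hnd.1 (List.nodup_cons.1 hnd.2).1 hs' hA]
      congr 1
      change wedge k ((G.leg (some none) :: P).map _) = _
      rw [List.map_cons, preimage_glue, List.map_map]
      congr 2
      exact List.map_congr_left fun x hx => preimage_glue_of_not G
        (hP.not_sameCycle (List.mem_cons_of_mem _ hx)) (hP'.not_sameCycle (List.mem_cons_of_mem _ hx))
    · rw [canonicalMap_eq_zero fun h => hA ((hasLeg_glue G).1 h.2).2.1]
      rw [preimage_glue] at hA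
      rw [sLoopTerm]
      simp only [if_neg hA, if_neg hs']
      rfl

end Gluing

end RibbonGraph

section Morphism

variable (k : Type u) [Field k] [CharZero k]

theorem canonicalHom_loop (I : Type) [Finite I] (b : ℕ) (x : Chain k (Option (Option I)) b) :
    canonicalHom k I (b + 1) (chainLoop k I b x) =
      sLoop k I b (canonicalHom k (Option (Option I)) b x) := by
  have : (canonicalHom k I (b + 1)).comp (chainLoop k I b) =
      (sLoop k I b).comp (canonicalHom k (Option (Option I)) b) := by
    refine Chain.hom_ext (M := SComp k I (b + 1)) fun G hG α => Subtype.ext ?_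
    have hG' : G.glue.betti k = b + 1 := by rw [G.betti_glue, hG]
    have h1 : chainLoop k I b (Chain.mk G hG α) = Chain.mk G.glue hG' (G.glueOrient k α) :=
      Chain.lift_mk _ _ _ _ _
    rw [LinearMap.comp_apply, LinearMap.comp_apply, h1, canonicalHom_mk,
      RibbonGraph.canonicalMap_glue]
    change _ = sLoopAux k I (canonicalHom k (Option (Option I)) b (Chain.mk G hG α)).1
    rw [canonicalHom_mk]
  exact LinearMap.congr_fun this x

end Morphism

/-! ### Operators of rank one and the determinant line. -/

section Reflections

variable {k : Type u} [Field k] {V : Type u} [AddCommGroup V] [Module k V]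

/-- By induction on products; the terms of second order in `w` drop out since `w ∧ w = 0`. -/
theorem map_id_sub_smulRight (θ : Dual k V) (w : V) (x : ExteriorAlgebra k V) :
    ExteriorAlgebra.map (LinearMap.id - θ.smulRight w) x =
      x - ExteriorAlgebra.ι k w * contraction θ x := by
  refine CliffordAlgebra.left_induction (0 : QuadraticForm k V) (P := fun x : ExteriorAlgebra k V =>
    ExteriorAlgebra.map (LinearMap.id - θ.smulRight w) x = x - ExteriorAlgebra.ι k w * contraction θ x)
    (fun r => ?_) (fun x y hx hy => ?_) (fun x m hx => ?_) x
  · have h1 : contraction θ (algebraMap k (ExteriorAlgebra k V) r) = 0 := by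
      rw [Algebra.algebraMap_eq_smul_one, map_smul, contraction_one, smul_zero]
    change ExteriorAlgebra.map _ (algebraMap k (ExteriorAlgebra k V) r) =
      algebraMap k (ExteriorAlgebra k V) r - _ * contraction θ (algebraMap k (ExteriorAlgebra k V) r)
    rw [h1, mul_zero, sub_zero, AlgHom.commutes]
  · change ExteriorAlgebra.map _ (x + y : ExteriorAlgebra k V) = (x + y : ExteriorAlgebra k V) -
      ExteriorAlgebra.ι k w * contraction θ (x + y : ExteriorAlgebra k V)
    rw [map_add, hx, hy, map_add, mul_add]
    abel
  · change ExteriorAlgebra.map _ (ExteriorAlgebra.ι k m * x : ExteriorAlgebra k V) =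
      (ExteriorAlgebra.ι k m * x : ExteriorAlgebra k V) -
        ExteriorAlgebra.ι k w * contraction θ (ExteriorAlgebra.ι k m * x : ExteriorAlgebra k V)
    have h0 : ∀ z, ExteriorAlgebra.ι k w * (ExteriorAlgebra.ι k w * z) = 0 := fun z => by
      rw [← mul_assoc, ExteriorAlgebra.ι_sq_zero, zero_mul]
    have h1 : ∀ z, ExteriorAlgebra.ι k w * (ExteriorAlgebra.ι k m * z) =
        - (ExteriorAlgebra.ι k m * (ExteriorAlgebra.ι k w * z)) := fun z => by
      rw [← mul_assoc, ι_mul_ι_eq_neg, neg_mul, mul_assoc]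
    rw [map_mul, ExteriorAlgebra.map_apply_ι, hx, contraction_ι_mul, LinearMap.sub_apply,
      LinearMap.smulRight_apply, LinearMap.id_apply, map_sub, map_smul]
    simp only [sub_mul, mul_sub, smul_mul_assoc, mul_smul_comm, h0, h1, smul_zero]
    abel

/-- A map that differs from the identity by an operator of rank one acts on the determinant line as
the multiplication by its determinant. -/
theorem map_id_sub_smulRight_det [FiniteDimensional k V] (θ : Dual k V) (w : V) (α : Det k V) :
    ExteriorAlgebra.map (LinearMap.id - θ.smulRight w) α.val = (1 - θ w) • α.val := by
  -- In top degree `w ∧ α = 0`; the contraction of this equality expresses the product of `w` with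
  -- the contraction of `α` as `θ w • α`.
  have h := contraction_ι_mul θ w α.val
  rw [ι_mul_det, map_zero] at h
  rw [map_id_sub_smulRight, sub_smul, one_smul, sub_eq_zero.1 h.symm]

end Reflections

/-! ### Cycles that survive erasing. -/

section Erasing

variable {X I : Type}

/-- The cycles of a permutation, none of which disappears when elements are erased. -/
theorem IsCycleList.of_erase [Finite X] {l : I ↪ X} {τ : Perm X} {ρ : Perm I} (h : RibbonOperad.erase l τ = ρ)
    (hl : ∀ x, ∃ i, τ.SameCycle x (l i)) {P : List I} (hP : IsCycleList ρ (P.map (cyc ρ))) :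
    IsCycleList τ ((P.map l).map (cyc τ)) := by
  subst h
  refine ⟨?_, fun C => ?_⟩
  · rw [List.map_map]
    have h1 := hP.1
    refine List.Nodup.map_on (fun x hx y hy e => ?_) (List.Nodup.of_map _ h1)
    have h2 := (sameCycle_erase l τ x y).2 (cyc_eq_iff.1 e)
    exact List.inj_on_of_nodup_map h1 hx hy (cyc_eq_iff.2 h2)
  · constructor
    · intro hC
      obtain ⟨x, -, rfl⟩ := List.mem_map.1 hC
      exact ⟨x, rfl⟩
    · rintro ⟨x, rfl⟩
      obtain ⟨i, hi⟩ := hl x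
      obtain ⟨j, hj, hs⟩ := hP.exists_sameCycle i
      rw [sameCycle_erase] at hs
      exact List.mem_map.2 ⟨l j, List.mem_map_of_mem hj, cyc_eq_iff.2 (hs.trans hi.symm)⟩

end Erasing

namespace RibbonGraph

/-! ### The expansion of a vertex does not change the surface. -/

section Expansion

variable {k : Type u} [Field k] {I : Type} {G : RibbonGraph I} (c : G.Chord)

/-! The punctures of the expanded graph. -/

theorem face_expand_inl (y : G.Flag) : (G.expand c).face (Sum.inl y) =
    if G.face y = c.1.2 then Sum.inr false else if G.face y = c.1.1 then Sum.inr true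
    else Sum.inl (G.face y) := c.rot_inl (G.opp y)

theorem face_expand_false : (G.expand c).face (Sum.inr false) = Sum.inl c.1.2 := c.rot_true

theorem face_expand_true : (G.expand c).face (Sum.inr true) = Sum.inl c.1.1 := c.rot_false

/-- Where a puncture of `G` arrives at `q`, it now passes through `e'` before `q`, and likewise
through `e''` before `p`. So the new flags are only inserted in the old punctures. -/
theorem erase_face_expand : erase Function.Embedding.inl (G.expand c).face = G.face := by
  refine erase_eq fun y => ?_
  have h := face_expand_inl c y
  split_ifs at h with h1 h2
  · refine FirstReturn.skip ?_ ?_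
    · change (G.expand c).face (Sum.inl y) ∉ _
      rw [h]
      rintro ⟨z, hz⟩
      exact Sum.inl_ne_inr hz
    · change FirstReturn _ _ ((G.expand c).face (Sum.inl y)) _
      rw [h, h1]
      exact FirstReturn.hit (face_expand_false c)
  · refine FirstReturn.skip ?_ ?_
    · change (G.expand c).face (Sum.inl y) ∉ _
      rw [h]
      rintro ⟨z, hz⟩
      exact Sum.inl_ne_inr hz
    · change FirstReturn _ _ ((G.expand c).face (Sum.inl y)) _
      rw [h, h2]
      exact FirstReturn.hit (face_expand_true c)
  · exact FirstReturn.hit h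

theorem sameCycle_face_expand (x y : G.Flag) :
    (G.expand c).face.SameCycle (Sum.inl x) (Sum.inl y) ↔ G.face.SameCycle x y := by
  conv_rhs => rw [← erase_face_expand c]
  exact (sameCycle_erase (X := (G.expand c).Flag) Function.Embedding.inl _ x y).symm

theorem exists_inl_face_expand (x : (G.expand c).Flag) :
    ∃ y : G.Flag, (G.expand c).face.SameCycle x (Sum.inl y) := by
  rcases x with y | b
  · exact ⟨y, Perm.SameCycle.refl _ _⟩
  · cases b
    · exact ⟨c.1.2, face_expand_false c ▸ (Perm.SameCycle.refl _ _).apply_right⟩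
    · exact ⟨c.1.1, face_expand_true c ▸ (Perm.SameCycle.refl _ _).apply_right⟩

theorem isCycleList_face_expand {P : List G.Flag} (hP : IsCycleList G.face (P.map (cyc G.face))) :
    IsCycleList (G.expand c).face ((P.map Sum.inl).map (cyc (G.expand c).face)) :=
  IsCycleList.of_erase (erase_face_expand c) (exists_inl_face_expand c) hP

theorem legPerm_expand [Finite I] : (G.expand c).legPerm = G.legPerm := by
  have h := erase_trans (X := (G.expand c).Flag) Function.Embedding.inl G.leg (G.expand c).face
  rw [erase_face_expand] at h
  exact h

theorem preimage_expand (x : G.Flag) :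
    (G.expand c).leg ⁻¹' cyc (G.expand c).face (Sum.inl x) = G.leg ⁻¹' cyc G.face x :=
  Set.ext fun i => sameCycle_face_expand c x (G.leg i)

theorem hasLeg_expand : (G.expand c).HasLegAtEveryPuncture ↔ G.HasLegAtEveryPuncture := by
  have h : ∀ x : G.Flag, (∃ i, (G.expand c).leg i ∈ cyc (G.expand c).face (Sum.inl x)) ↔
      ∃ i, G.leg i ∈ cyc G.face x := fun x =>
    exists_congr fun i => sameCycle_face_expand c x (G.leg i)
  refine ⟨fun hl x => (h x).1 (hl _), fun hl x => ?_⟩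
  obtain ⟨y, hy⟩ := exists_inl_face_expand c x
  rw [cyc_eq_iff.2 hy]
  exact (h y).2 (hl y)

/-! The first homology of the expanded graph. -/

/-- A class in the expanded graph is determined by its coefficients at the old flags, where the two
sides are compared. -/
theorem faceClass_expand (x : G.Flag) :
    (G.expand c).faceClass k (Sum.inl x) = c.h1Equiv k (G.faceClass k x) := by
  rw [← LinearEquiv.symm_apply_eq]
  refine Subtype.ext (funext fun f => ?_)
  change ((G.expand c).faceClass k (Sum.inl x)).1 (Sum.inl f) = (G.faceClass k x).1 f
  have h1 : (Sum.inl f ∈ cyc (G.expand c).face (Sum.inl x)) ↔ f ∈ cyc G.face x :=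
    sameCycle_face_expand c x f
  have h2 : ((G.expand c).opp (Sum.inl f) ∈ cyc (G.expand c).face (Sum.inl x)) ↔
      G.opp f ∈ cyc G.face x := sameCycle_face_expand c x (G.opp f)
  rw [faceClass_apply, faceClass_apply]
  simp only [h1, h2]

variable [CharZero k]

/-- A potential of a cycle in the graph extends to the expanded graph. -/
theorem exists_potential_expand (y : G.H1 k) : ∃ Z : (G.expand c).Flag → k,
    (∀ z, Z (c.rot z) - Z z = (c.h1Equiv k y).1 z) ∧ Z (Sum.inr false) = Z (Sum.inl c.1.2) ∧
      Z (Sum.inr true) = Z (Sum.inl c.1.1) := by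
  obtain ⟨Z, hZ⟩ := exists_potential c.rot (c.h1Equiv k y).2.2
  have h1 := hZ (Sum.inr false)
  have h2 := hZ (Sum.inr true)
  have h3 := (c.h1Equiv k y).2.1 (Sum.inr false)
  have h4 := (c.newVertex k).2 (Sum.inr false)
  have h5 := (c.newVertex k).2 (Sum.inr true)
  change _ = (c.h1Equiv k y).1 (Sum.inr false) at h1
  change _ = (c.h1Equiv k y).1 (Sum.inr true) at h2
  change (c.h1Equiv k y).1 (Sum.inr true) = - (c.h1Equiv k y).1 (Sum.inr false) at h3
  rw [c.rot_false] at h1 h4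
  rw [c.rot_true] at h2 h5
  rw [c.newVertex_false] at h4
  rw [c.newVertex_true] at h5
  -- A potential may be changed by a constant at the vertex of `e'`. The constant is chosen for the
  -- first condition; the second one then holds because the coefficients of `e'` and `e''` are
  -- opposite.
  refine ⟨fun z => Z z + (Z (Sum.inl c.1.2) - Z (Sum.inr false)) * (c.newVertex k).1 z,
    fun z => ?_, ?_, ?_⟩
  · have h6 := (c.newVertex k).2 z
    change (c.newVertex k).1 (c.rot z) = _ at h6
    beta_reduce
    rw [h6, ← hZ z]
    ring
  · beta_reduce
    rw [c.newVertex_false, h5]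
    ring
  · beta_reduce
    rw [c.newVertex_true, h4]
    linear_combination -h1 - h2 - h3

/-- The normalized potential restricts to a potential in `G`. The terms of `e'` and `e''` cancel:
the potential takes the same two values around both flags, and the coefficients are opposite. -/
theorem intersectionForm_expand (x y : G.H1 k) :
    (G.expand c).intersectionForm k (c.h1Equiv k x) (c.h1Equiv k y) = G.intersectionForm k x y := by
  obtain ⟨Z, hZ, h1, h2⟩ := exists_potential_expand c y
  have h3 : ∀ f, Z (c.rot (Sum.inl f)) = Z (Sum.inl (G.rot f)) := fun f => by
    rw [c.rot_inl]
    split_ifs with e1 e2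
    · rw [e1, h1]
    · rw [e2, h2]
    · rfl
  have h4 := (c.h1Equiv k x).2.1 (Sum.inr false)
  change (c.h1Equiv k x).1 (Sum.inr true) = - (c.h1Equiv k x).1 (Sum.inr false) at h4
  rw [(G.expand c).intersectionForm_eq _ _ hZ, G.intersectionForm_eq x y (Y := fun f => Z (Sum.inl f)),
    Fintype.sum_sum_type, Fintype.sum_bool, h4]
  · change -(2⁻¹ * (∑ f, x.1 f * (Z (Sum.inl f) + Z (c.rot (Sum.inl f))) +
      (_ * (_ + Z (c.rot (Sum.inr true))) + _ * (_ + Z (c.rot (Sum.inr false)))))) = _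
    simp only [h3, c.rot_false, c.rot_true, h1, h2]
    ring
  · intro f
    rw [← h3, hZ]
    rfl

/-- The surface framing of the expanded graph. -/
def SurfaceFraming.expand {γ : ℕ} (S : G.SurfaceFraming k γ) : (G.expand c).SurfaceFraming k γ where
  punctures := S.punctures.map Sum.inl
  isCycleList_face := isCycleList_face_expand c S.isCycleList_face
  genus_eq := by
    rw [List.length_map, betti_expand, S.genus_eq]
  a i := c.h1Equiv k (S.a i)
  b i := c.h1Equiv k (S.b i)
  isSymplectic := by
    constructor
    · intro i j
      rw [intersectionForm_expand, S.isSymplectic.aa]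
    · intro i j
      rw [intersectionForm_expand, S.isSymplectic.bb]
    · intro i j
      rw [intersectionForm_expand, S.isSymplectic.ab]

end Expansion

/-! ### The two expansions of a vertex of valence four. -/

section Shift

variable {k : Type u} [Field k] {I : Type} {G : RibbonGraph I} (c : G.Chord)

/-- The chord shifted by one step in the cyclic order. -/
def Chord.shift : G.Chord := ⟨(G.rot c.1.1, G.rot c.1.2), by
  refine ⟨?_, fun h => c.2.2.1 (G.rot.injective h), fun h => c.2.2.2.1 (G.rot.injective h),
    fun h => c.2.2.2.2 (G.rot.injective h)⟩
  exact c.2.1.apply_left.apply_right⟩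

theorem Chord.shift_bijective : Function.Bijective (Chord.shift (G := G)) := by
  rw [← Finite.injective_iff_bijective]
  intro c d h
  have h1 := congrArg Subtype.val h
  exact Subtype.ext (Prod.ext (G.rot.injective (congrArg Prod.fst h1))
    (G.rot.injective (congrArg Prod.snd h1)))

/-- The rotation of the flags of the vertex of the chord. -/
def Chord.turn : Perm G.Flag := G.rot.cycleOf c.1.1

theorem Chord.turn_of_sameCycle {y : G.Flag} (h : G.rot.SameCycle c.1.1 y) : c.turn y = G.rot y :=
  h.cycleOf_apply

theorem Chord.turn_of_not_sameCycle {y : G.Flag} (h : ¬ G.rot.SameCycle c.1.1 y) : c.turn y = y :=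
  Perm.cycleOf_apply_of_not_sameCycle h

/-- The rotation of the flags of the vertex, as a permutation of flags of the expanded graph. -/
def Chord.turnExpand : (G.expand c).Flag ≃ (G.expand c.shift).Flag := Perm.sumCongr c.turn 1

theorem Chord.turnExpand_inl (y : G.Flag) : c.turnExpand (Sum.inl y) = Sum.inl (c.turn y) := rfl

theorem Chord.turnExpand_inr (b : Bool) : c.turnExpand (Sum.inr b) = Sum.inr b := rfl

/-- Only the cyclic orders are respected. The bijection need not commute with `opp`, so it is not in
general an isomorphism of ribbon graphs; it serves to match the factors of flags and vertices, while
the homology is matched through that of `G`. -/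
theorem Chord.turnExpand_rot (z : (G.expand c).Flag) :
    c.turnExpand (c.rot z) = c.shift.rot (c.turnExpand z) := by
  rcases z with y | b
  · rw [c.rot_inl, c.turnExpand_inl, c.shift.rot_inl]
    change _ = if G.rot (c.turn y) = G.rot c.1.2 then _ else if G.rot (c.turn y) = G.rot c.1.1 then _
      else _
    rw [G.rot.injective.eq_iff, G.rot.injective.eq_iff]
    by_cases hy : G.rot.SameCycle c.1.1 y
    · rw [c.turn_of_sameCycle hy]
      split_ifs
      · rfl
      · rfl
      · rw [c.turnExpand_inl, c.turn_of_sameCycle hy.apply_right]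
    · have h1 : G.rot y ≠ c.1.2 := fun h => hy (Perm.sameCycle_apply_right.1 (h ▸ c.2.1))
      have h2 : G.rot y ≠ c.1.1 := fun h =>
        hy (Perm.sameCycle_apply_right.1 (h ▸ Perm.SameCycle.refl _ _))
      have h3 : y ≠ c.1.2 := fun h => hy (h ▸ c.2.1)
      have h4 : y ≠ c.1.1 := fun h => hy (h ▸ Perm.SameCycle.refl _ _)
      rw [if_neg h1, if_neg h2, c.turn_of_not_sameCycle hy, if_neg h3, if_neg h4, c.turnExpand_inl,
        c.turn_of_not_sameCycle fun h => hy (Perm.sameCycle_apply_right.1 h)]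
  · cases b
    · rw [c.rot_false, c.turnExpand_inr, c.shift.rot_false, c.turnExpand_inl,
        c.turn_of_sameCycle (Perm.SameCycle.refl _ _)]
      rfl
    · rw [c.rot_true, c.turnExpand_inr, c.shift.rot_true, c.turnExpand_inl,
        c.turn_of_sameCycle c.2.1]
      rfl

theorem Chord.turnExpand_symm_rot (z : (G.expand c.shift).Flag) :
    c.turnExpand.symm (c.shift.rot z) = c.rot (c.turnExpand.symm z) := by
  rw [Equiv.symm_apply_eq, c.turnExpand_rot, Equiv.apply_symm_apply]

theorem isTrivalent_expand_shift :
    (G.expand c.shift).IsTrivalent ↔ (G.expand c).IsTrivalent := by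
  have h : ∀ z, c.turnExpand (c.rot (c.rot (c.rot z))) =
      c.shift.rot (c.shift.rot (c.shift.rot (c.turnExpand z))) := fun z => by
    rw [c.turnExpand_rot, c.turnExpand_rot, c.turnExpand_rot]
  constructor
  · intro ht z
    exact c.turnExpand.injective ((h z).trans (ht _))
  · intro ht z
    obtain ⟨z, rfl⟩ := c.turnExpand.surjective z
    exact (h z).symm.trans (congrArg _ (ht z))

/-- Each of the two new vertices has exactly two old flags, so the expanded vertex has valence four
and the chord is a diagonal. -/
theorem rot_rot_of_isTrivalent (h : (G.expand c).IsTrivalent) :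
    G.rot (G.rot c.1.1) = c.1.2 ∧ G.rot (G.rot c.1.2) = c.1.1 := by
  have h1 : c.rot (c.rot (c.rot (Sum.inr false))) = Sum.inr false := h (Sum.inr false)
  have h2 : c.rot (c.rot (c.rot (Sum.inr true))) = Sum.inr true := h (Sum.inr true)
  rw [c.rot_false, c.rot_inl, if_neg c.2.2.2.1, if_neg (G.stable _).1, c.rot_inl] at h1
  rw [c.rot_true, c.rot_inl, if_neg (G.stable _).1, if_neg c.2.2.2.2, c.rot_inl] at h2
  constructor
  · split_ifs at h1 with e1 e2
    · exact e1
    · exact absurd (Sum.inr_injective h1) (by simp)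
  · split_ifs at h2 with e1 e2
    · exact absurd (Sum.inr_injective h2) (by simp)
    · exact e2

/-- On a vertex of valence four the rotation is a 4-cycle. Its length is found as its order, which
divides four but not two. -/
theorem sign_turn (h : (G.expand c).IsTrivalent) : Perm.sign c.turn = -1 := by
  obtain ⟨h1, h2⟩ := rot_rot_of_isTrivalent c h
  have hc : c.turn.IsCycle := Perm.isCycle_cycleOf _ (G.stable _).1
  have ho : orderOf c.turn = 2 ^ (1 + 1) := by
    refine orderOf_eq_prime_pow (fun h3 => ?_) ?_
    · have h4 := congrArg (fun g : Perm G.Flag => g c.1.1) h3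
      change (G.rot.cycleOf c.1.1 ^ (2 ^ 1)) c.1.1 = c.1.1 at h4
      rw [Perm.cycleOf_pow_apply_self, pow_one, pow_two, Perm.mul_apply, h1] at h4
      exact c.2.2.1 h4.symm
    · have h5 : (G.rot ^ 4) c.1.1 = c.1.1 := by
        change G.rot (G.rot (G.rot (G.rot c.1.1))) = c.1.1
        rw [h1, h2]
      refine Equiv.ext fun y => ?_
      by_cases hy : G.rot.SameCycle c.1.1 y
      · obtain ⟨n, rfl⟩ := hy.exists_nat_pow_eq
        have h6 : ∀ m : ℕ, (c.turn ^ m) ((G.rot ^ n) c.1.1) = (G.rot ^ m) ((G.rot ^ n) c.1.1) := by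
          intro m
          induction m with
          | zero => rfl
          | succ m ih =>
            rw [pow_succ', pow_succ', Perm.mul_apply, Perm.mul_apply, ih, c.turn_of_sameCycle]
            exact (Perm.SameCycle.refl _ _).pow_right.pow_right
        rw [h6, ← Perm.mul_apply, ← pow_add, add_comm, pow_add, Perm.mul_apply]
        exact congrArg _ h5
      · have h6 : ∀ m : ℕ, (c.turn ^ m) y = y := by
          intro m
          induction m with
          | zero => rfl
          | succ m ih => rw [pow_succ', Perm.mul_apply, ih, c.turn_of_not_sameCycle hy]
        exact h6 _
  rw [hc.sign, ← hc.orderOf, ho]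
  rfl

/-- The action of a permutation of flags on the factor `k ^ Flag(G)`. -/
def permVec (k : Type u) [Field k] (g : Perm G.Flag) : G.Vec k →ₗ[k] G.Vec k :=
  (LinearMap.id (M := G.H1 k)).prodMap
    ((LinearEquiv.funCongrLeft k k g.symm).toLinearMap.prodMap (LinearMap.id (M := G.VertFun k)))

theorem permVec_apply (g : Perm G.Flag) (x : G.H1 k) (y : G.Flag → k) (z : G.VertFun k) :
    permVec k g (x, y, z) = (x, fun f => y (g.symm f), z) := rfl

/-- A transposition of flags is a reflection along the difference of their vectors, so
`map_id_sub_smulRight_det` gives its action on the orientation line. -/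
theorem permVec_swap {x y : G.Flag} (hxy : x ≠ y) : permVec k (swap x y) =
    LinearMap.id - ((LinearMap.proj (R := k) (φ := fun _ : G.Flag => k) x -
      LinearMap.proj (R := k) (φ := fun _ : G.Flag => k) y : (G.Flag → k) →ₗ[k] k).comp
      ((LinearMap.fst k (G.Flag → k) (G.VertFun k)).comp (LinearMap.snd k (G.H1 k) _))).smulRight
        (G.flagVec k x - G.flagVec k y) := by
  refine LinearMap.ext fun u => ?_
  obtain ⟨u1, u2, u3⟩ := u
  rw [permVec_apply, LinearMap.sub_apply, LinearMap.smulRight_apply]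
  change _ = (u1, u2, u3) - (u2 x - u2 y) • (G.flagVec k x - G.flagVec k y)
  refine Prod.ext ?_ (Prod.ext (funext fun f => ?_) ?_)
  · change u1 = u1 - (u2 x - u2 y) • (0 - 0)
    rw [sub_zero, smul_zero, sub_zero]
  · change u2 ((swap x y).symm f) = u2 f - (u2 x - u2 y) *
      ((Pi.single x 1 : G.Flag → k) f - (Pi.single y 1 : G.Flag → k) f)
    rw [symm_swap]
    by_cases h1 : f = x
    · subst h1
      rw [swap_apply_left, Pi.single_eq_same, Pi.single_eq_of_ne hxy]
      ring
    by_cases h2 : f = y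
    · subst h2
      rw [swap_apply_right, Pi.single_eq_same, Pi.single_eq_of_ne hxy.symm]
      ring
    rw [swap_apply_of_ne_of_ne h1 h2, Pi.single_eq_of_ne h1, Pi.single_eq_of_ne h2]
    ring
  · change u3 = u3 - (u2 x - u2 y) • (0 - 0)
    rw [sub_zero, smul_zero, sub_zero]

theorem map_permVec (g : Perm G.Flag) (α : G.Orient k) :
    ExteriorAlgebra.map (permVec k g) α.val = ((Perm.sign g : ℤ) : k) • α.val := by
  refine Perm.swap_induction_on g ?_ fun g x y hxy ih => ?_
  · have h : permVec k (1 : Perm G.Flag) = LinearMap.id := rfl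
    rw [h, ExteriorAlgebra.map_id, Perm.sign_one]
    simp
  · have h : permVec k (swap x y * g) = (permVec k (swap x y)).comp (permVec k g) := rfl
    rw [h, ← ExteriorAlgebra.map_comp_map, AlgHom.comp_apply, ih, map_smul, permVec_swap hxy,
      map_id_sub_smulRight_det, Perm.sign_mul, Perm.sign_swap hxy, smul_smul]
    congr 1
    -- The form of the reflection takes the value two at its vector, so the determinant is `1 - 2`.
    have h1 : (Pi.single x 1 - Pi.single y 1 : G.Flag → k) x -
        (Pi.single x 1 - Pi.single y 1 : G.Flag → k) y = 2 := by
      rw [Pi.sub_apply, Pi.sub_apply, Pi.single_eq_same, Pi.single_eq_same, Pi.single_eq_of_ne hxy,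
        Pi.single_eq_of_ne hxy.symm]
      ring
    change _ * (1 - ((Pi.single x 1 - Pi.single y 1 : G.Flag → k) x -
        (Pi.single x 1 - Pi.single y 1 : G.Flag → k) y)) = _
    rw [h1]
    push_cast
    ring

variable (k) in
/-- The identification of functions on the sets of vertices of the expansions by a chord and by the
shifted chord. -/
def Chord.turnVertFun : (G.expand c).VertFun k →ₗ[k] (G.expand c.shift).VertFun k where
  toFun u := ⟨fun z => u.1 (c.turnExpand.symm z), fun z => by
    have h := c.turnExpand_symm_rot z
    exact (congrArg u.1 h).trans (u.2 _)⟩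
  map_add' _ _ := rfl
  map_smul' _ _ := rfl

variable (k) in
/-- The identification of the spaces that define the orientations of the expansions by a chord and by
the shifted chord. -/
def Chord.turnVec : (G.expand c).Vec k →ₗ[k] (G.expand c.shift).Vec k :=
  ((c.shift.h1Equiv k).toLinearMap.comp (c.h1Equiv k).symm.toLinearMap).prodMap
    ((LinearEquiv.funCongrLeft k k c.turnExpand.symm).toLinearMap.prodMap (c.turnVertFun k))

theorem Chord.turnVec_apply (x : (G.expand c).H1 k) (y : (G.expand c).Flag → k)
    (z : (G.expand c).VertFun k) : c.turnVec k (x, y, z) =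
      (c.shift.h1Equiv k ((c.h1Equiv k).symm x), fun f => y (c.turnExpand.symm f),
        c.turnVertFun k z) := rfl

theorem Chord.turnVec_inH1 (x : G.H1 k) : c.turnVec k ((G.expand c).inH1 k (c.h1Equiv k x)) =
    (G.expand c.shift).inH1 k (c.shift.h1Equiv k x) := by
  refine Prod.ext ?_ (Prod.ext rfl (map_zero (c.turnVertFun k)))
  change c.shift.h1Equiv k ((c.h1Equiv k).symm (c.h1Equiv k x)) = c.shift.h1Equiv k x
  rw [LinearEquiv.symm_apply_apply]

theorem Chord.turnVec_flagVec (x : (G.expand c).Flag) : c.turnVec k ((G.expand c).flagVec k x) =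
    (G.expand c.shift).flagVec k (c.turnExpand x) := by
  rw [flagVec, flagVec, c.turnVec_apply, map_zero, map_zero, map_zero]
  congr 2
  ext f
  simp only [Pi.single_apply, Equiv.symm_apply_eq]
  split_ifs <;> rfl

theorem Chord.turnVertFun_vertexFun (x : (G.expand c).Flag) :
    c.turnVertFun k ((G.expand c).vertexFun k x) = (G.expand c.shift).vertexFun k (c.turnExpand x) := by
  refine Subtype.ext (funext fun f => ?_)
  have h := sameCycle_conj c.turnExpand c.turnExpand_rot x (c.turnExpand.symm f)
  rw [Equiv.apply_symm_apply] at h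
  have h' : (G.expand c).rot.SameCycle x (c.turnExpand.symm f) ↔
      (G.expand c.shift).rot.SameCycle (c.turnExpand x) f := h.symm
  change ((G.expand c).vertexFun k x).1 (c.turnExpand.symm f) = _
  rw [vertexFun_apply, vertexFun_apply]
  by_cases hx : (G.expand c).rot.SameCycle x (c.turnExpand.symm f)
  · rw [if_pos hx, if_pos (h'.1 hx)]
  · rw [if_neg hx, if_neg (mt h'.2 hx)]

theorem Chord.turnVec_vertexFun (x : (G.expand c).Flag) :
    c.turnVec k (0, 0, (G.expand c).vertexFun k x) =
      (0, 0, (G.expand c.shift).vertexFun k (c.turnExpand x)) := by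
  rw [c.turnVec_apply, c.turnVertFun_vertexFun, map_zero, map_zero]
  rfl

theorem Chord.newElement_eq : c.newElement k =
    ExteriorAlgebra.ι k (0, 0, (G.expand c).vertexFun k (Sum.inr false)) *
      ExteriorAlgebra.ι k ((G.expand c).flagVec k (Sum.inr false)) *
      ExteriorAlgebra.ι k ((G.expand c).flagVec k (Sum.inr true)) := by
  have h : c.newVertex k = (G.expand c).vertexFun k (Sum.inr false) := by
    refine Subtype.ext (funext fun f => ?_)
    by_cases hf : c.rot.SameCycle (Sum.inr false) f
    · exact (if_pos hf).trans (if_pos hf).symm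
    · exact (if_neg hf).trans (if_neg hf).symm
  rw [newElement, h, flagVec, flagVec]
  -- What remains is the decidability of equality of flags inside `Pi.single`, which is a
  -- subsingleton.
  congr 4 <;>
  · congr
    exact Subsingleton.elim _ _

theorem Chord.map_newElement :
    ExteriorAlgebra.map (c.turnVec k) (c.newElement k) = c.shift.newElement k := by
  rw [c.newElement_eq, c.shift.newElement_eq, map_mul, map_mul, ExteriorAlgebra.map_apply_ι,
    ExteriorAlgebra.map_apply_ι, ExteriorAlgebra.map_apply_ι, c.turnVec_vertexFun, c.turnVec_flagVec,
    c.turnVec_flagVec, c.turnExpand_inr, c.turnExpand_inr]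

theorem Chord.sameCycle_turn_symm (f : G.Flag) : G.rot.SameCycle (c.turn.symm f) f := by
  obtain ⟨y, rfl⟩ := c.turn.surjective f
  rw [Equiv.symm_apply_apply]
  by_cases hy : G.rot.SameCycle c.1.1 y
  · rw [c.turn_of_sameCycle hy]
    exact (Perm.SameCycle.refl _ _).apply_right
  · rw [c.turn_of_not_sameCycle hy]

/-- On the vectors that come from `G` the identification of the two expansions is the rotation of
the flags at the expanded vertex. It is trivial on homology, and on functions of vertices because
`turn` keeps every flag at its vertex. -/
theorem Chord.turnVec_comp_vec : (c.turnVec k).comp (c.vec k) =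
    (c.shift.vec k).comp (permVec k c.turn) := by
  refine LinearMap.ext fun u => ?_
  obtain ⟨x, y, z⟩ := u
  refine Prod.ext ?_ (Prod.ext (funext ?_) (Subtype.ext (funext ?_)))
  · change c.shift.h1Equiv k ((c.h1Equiv k).symm (c.h1Equiv k x)) = c.shift.h1Equiv k x
    rw [LinearEquiv.symm_apply_apply]
  · rintro (f | f) <;> rfl
  · rintro (f | b)
    · change z.1 (c.turn.symm f) = z.1 f
      exact VertFun_sameCycle z.2 (c.sameCycle_turn_symm f)
    · cases b
      · exact (z.2 c.1.1).symm
      · exact (z.2 c.1.2).symm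

/-- The factor `v' ∧ e' ∧ e''` is preserved, and on `α` the rotation acts by the sign of a 4-cycle.
-/
theorem Chord.map_expandOrient (h : (G.expand c).IsTrivalent) (α : G.Orient k) :
    ExteriorAlgebra.map (c.turnVec k) (expandOrient k c α).val =
      - (expandOrient k c.shift α).val := by
  rw [expandOrient, coe_detMap, expandOrient, coe_detMap, map_mul, c.map_newElement,
    ← AlgHom.comp_apply, ExteriorAlgebra.map_comp_map, c.turnVec_comp_vec,
    ← ExteriorAlgebra.map_comp_map, AlgHom.comp_apply, map_permVec, sign_turn c h]
  simp

variable [CharZero k]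

/-- Both expansions inherit the surface framing of `G`; the other factors of the canonical element
depend only on the cyclic orders at the vertices. -/
theorem element_expand_shift {γ : ℕ} (S : G.SurfaceFraming k γ) {L : List (G.expand c).Flag}
    (hL : IsCycleList (G.expand c).rot (L.map (cyc (G.expand c).rot)))
    (hL' : IsCycleList (G.expand c.shift).rot ((L.map c.turnExpand).map (cyc (G.expand c.shift).rot))) :
    ExteriorAlgebra.map (c.turnVec k) ((S.expand c).framing L hL).element =
      ((S.expand c.shift).framing (L.map c.turnExpand) hL').element := by
  rw [Framing.element_eq, Framing.element_eq, map_mul, map_mul, map_tailProd, map_pairProd,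
    map_vertexProd (c.turnVec k) c.turnExpand]
  · refine congrArg₂ (· * ·) (congrArg₂ (· * ·) (congrArg _ ?_) ?_) rfl
    · change ((S.punctures.map Sum.inl).map _).map _ = (S.punctures.map Sum.inl).map _
      rw [List.map_map, List.map_map, List.map_map]
      refine List.map_congr_left fun x _ => ?_
      change c.turnVec k ((G.expand c).inH1 k ((G.expand c).faceClass k (Sum.inl x))) =
        (G.expand c.shift).inH1 k ((G.expand c.shift).faceClass k (Sum.inl x))
      rw [faceClass_expand, faceClass_expand, c.turnVec_inH1]
    · change pairProd k (fun i => c.turnVec k ((G.expand c).inH1 k (c.h1Equiv k (S.a i))))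
        (fun i => c.turnVec k ((G.expand c).inH1 k (c.h1Equiv k (S.b i)))) =
        pairProd k (fun i => (G.expand c.shift).inH1 k (c.shift.h1Equiv k (S.a i)))
          (fun i => (G.expand c.shift).inH1 k (c.shift.h1Equiv k (S.b i)))
      simp only [c.turnVec_inH1]
  · intro x _
    rw [vertexVecs_eq, vertexVecs_eq]
    simp only [List.map_cons, List.map_nil, c.turnVec_flagVec, c.turnVec_vertexFun]
    refine congrArg₂ List.cons rfl (congrArg₂ List.cons rfl ?_)
    have h := c.turnExpand_rot
    refine congrArg₂ List.cons (congrArg _ (h x)) (congrArg₂ List.cons (congrArg _ ?_) rfl)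
    exact (h _).trans (congrArg _ (h x))

/-- The expansions by a chord and by the shifted chord cancel. -/
theorem canonicalMap_expand_shift [Finite I] (α : G.Orient k) :
    (G.expand c.shift).canonicalMap k (expandOrient k c.shift α) =
      - (G.expand c).canonicalMap k (expandOrient k c α) := by
  by_cases hc : (G.expand c).IsTrivalent ∧ (G.expand c).HasLegAtEveryPuncture
  · obtain ⟨ht, hl⟩ := hc
    have ht' := (isTrivalent_expand_shift c).2 ht
    have hl' := (hasLeg_expand c.shift).2 ((hasLeg_expand c).1 hl)
    obtain ⟨γ, ⟨S⟩⟩ := G.exists_surfaceFraming k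
    obtain ⟨L, hL⟩ := exists_representatives (G.expand c).rot
    have hL' : IsCycleList (G.expand c.shift).rot
      ((L.map c.turnExpand).map (cyc (G.expand c.shift).rot)) := hL.conj c.turnExpand c.turnExpand_rot
    set B := (S.expand c).framing L hL with hB
    set B' := (S.expand c.shift).framing (L.map c.turnExpand) hL' with hB'
    obtain ⟨r, hr⟩ := B.exists_smul ht (expandOrient k c α)
    -- The identification takes the canonical element to the canonical element, but the expanded
    -- orientation to minus the expanded one; so their ratios are `r` and `-r`.
    have hr' : expandOrient k c.shift α = - (r • B'.orient ht') := by
      apply Det.val_injective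
      have h := c.map_expandOrient ht α
      rw [hr, map_smul, map_smul, B.val_orient, hB, element_expand_shift c S hL hL', ← hB',
        ← B'.val_orient ht'] at h
      rw [map_neg, map_smul, h, neg_neg]
    rw [hr', hr, map_neg, map_smul, map_smul, canonicalMap_apply ht hl B (B.val_orient ht),
      canonicalMap_apply ht' hl' B' (B'.val_orient ht'), legPerm_expand, legPerm_expand]
    congr 3
    change wedge k ((S.punctures.map Sum.inl).map _) = wedge k ((S.punctures.map Sum.inl).map _)
    rw [List.map_map, List.map_map]
    congr 1
    exact List.map_congr_left fun x _ => (preimage_expand c.shift x).trans (preimage_expand c x).symm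
  · rw [canonicalMap_eq_zero hc, canonicalMap_eq_zero]
    · simp
    · rw [isTrivalent_expand_shift, hasLeg_expand, ← hasLeg_expand c]
      exact hc

end Shift

end RibbonGraph

/-! ### Compatibility with the differentials. -/

section Morphism

variable (k : Type u) [Field k] [CharZero k]

/-- The shift permutes all chords and changes the sign of every term, so the sum equals its
negative. Terms that are not trivalent are zero already. -/
theorem canonicalHom_diff (I : Type) [Finite I] (b : ℕ) (x : Chain k I b) :
    canonicalHom k I b (chainDiff k I b x) = 0 := by
  have : (canonicalHom k I b).comp (chainDiff k I b) = 0 := by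
    refine Chain.hom_ext (M := SComp k I b) fun G hG α => ?_
    have hG' : ∀ c : G.Chord, (G.expand c).betti k = b := fun c => by
      rw [RibbonGraph.betti_expand, hG]
    have h1 : chainDiff k I b (Chain.mk G hG α) = (2 : k)⁻¹ • ∑ c : G.Chord,
        Chain.mk (G.expand c) (hG' c) (RibbonGraph.expandOrient k c α) := by
      refine (Chain.lift_mk _ _ _ _ _).trans ?_
      rw [LinearMap.smul_apply, LinearMap.sum_apply]
      rfl
    rw [LinearMap.comp_apply, h1, map_smul, map_sum]
    set F : G.Chord → SComp k I b := fun c => canonicalHom k I b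
      (Chain.mk (G.expand c) (hG' c) (RibbonGraph.expandOrient k c α)) with hF
    have h2 : ∀ c, F c.shift + F c = 0 := fun c => by
      refine Subtype.ext ?_
      change (canonicalHom k I b _).1 + (canonicalHom k I b _).1 = 0
      rw [canonicalHom_mk, canonicalHom_mk, RibbonGraph.canonicalMap_expand_shift, neg_add_cancel]
    have h4 : ∑ c, F c = 0 := by
      have h5 : (2 : k) • ∑ c, F c = 0 := by
        rw [two_smul]
        nth_rewrite 1 [← RibbonGraph.Chord.shift_bijective.sum_comp F]
        rw [← Finset.sum_add_distrib]
        exact Finset.sum_eq_zero fun c _ => h2 c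
      exact (smul_eq_zero.1 h5).resolve_left two_ne_zero
    rw [h4, smul_zero]
    rfl
  exact LinearMap.congr_fun this x

end Morphism

/-! ### The morphism and the final statement. -/

section Existence

variable (k : Type u) [Field k] [CharZero k]

/-- The morphism that is given on ribbon graphs by the canonical orientations. -/
def canonicalMorphism : DetOperad.Hom (feynmanAss.{u} k) (symmetricOperad.{u} k) where
  app I _ b := canonicalHom k I b
  app_grade I _ b d x hx := canonicalHom_grade k I b d x hx
  app_map I J _ _ e b x := canonicalHom_map k I J e b x
  app_comp I J _ _ b b' x y := canonicalHom_comp k I J b b' x y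
  app_loop I _ b x := canonicalHom_loop k I b x
  app_diff I _ b x := canonicalHom_diff k I b x

end Existence

end RibbonOperad

end

/-- The map `φ` is well defined and it is a morphism of twisted modular `Det`-operads. -/
theorem mainTheorem6 (k : Type*) [Field k] [CharZero k] :
    ∃! φ : RibbonOperad.DetOperad.Hom (RibbonOperad.feynmanAss k) (RibbonOperad.symmetricOperad k),
      (∀ (I : Type) [Finite I] (b : ℕ) (G : RibbonOperad.RibbonGraph I) (hG : G.betti k = b),
        G.IsTrivalent → G.HasLegAtEveryPuncture →
        ∀ (γ : ℕ) (B : G.Framing k γ) (α : G.Orient k), α.val = B.element →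
          (φ.app I b (RibbonOperad.Chain.mk G hG α) : RibbonOperad.SComp k I b).1 =
            Finsupp.single (G.legPerm, γ) B.legWedge) ∧
      (∀ (I : Type) [Finite I] (b : ℕ) (G : RibbonOperad.RibbonGraph I) (hG : G.betti k = b),
        ¬ (G.IsTrivalent ∧ G.HasLegAtEveryPuncture) →
        ∀ α : G.Orient k, φ.app I b (RibbonOperad.Chain.mk G hG α) = 0) := by
  refine ⟨RibbonOperad.canonicalMorphism k, ⟨fun I _ b G hG ht hl γ B α hα => ?_,
    fun I _ b G hG h α => ?_⟩, fun ψ hψ => ?_⟩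
  · exact (RibbonOperad.canonicalHom_mk k G hG α).trans
      (RibbonOperad.RibbonGraph.canonicalMap_apply ht hl B hα)
  · refine Subtype.ext ((RibbonOperad.canonicalHom_mk k G hG α).trans ?_)
    rw [RibbonOperad.RibbonGraph.canonicalMap_eq_zero h]
    rfl
  · refine RibbonOperad.hom_unique k fun I _ b G hG α => ?_
    by_cases h : G.IsTrivalent ∧ G.HasLegAtEveryPuncture
    · obtain ⟨ht, hl⟩ := h
      obtain ⟨γ, ⟨B⟩⟩ := RibbonOperad.RibbonGraph.exists_framing (G := G) k
      -- The orientation line is spanned by the canonical element, at which the value of `ψ` is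
      -- prescribed.
      obtain ⟨c, rfl⟩ := B.exists_smul ht α
      have h1 := hψ.1 I b G hG ht hl γ B (B.orient ht) (B.val_orient ht)
      have h2 := (RibbonOperad.canonicalHom_mk k G hG (B.orient ht)).trans
        (RibbonOperad.RibbonGraph.canonicalMap_apply ht hl B (B.val_orient ht))
      have h3 : ψ.app I b (RibbonOperad.Chain.mk G hG (B.orient ht)) =
          (RibbonOperad.canonicalMorphism k).app I b (RibbonOperad.Chain.mk G hG (B.orient ht)) :=
        Subtype.ext (h1.trans h2.symm)
      rw [map_smul, map_smul, map_smul, h3]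
    · refine (hψ.2 I b G hG h α).trans (Subtype.ext ?_)
      refine Eq.trans ?_ (RibbonOperad.canonicalHom_mk k G hG α).symm
      rw [RibbonOperad.RibbonGraph.canonicalMap_eq_zero h]
      rfl
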